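/- Let $M$ be the Euclidean plane, the unit sphere or the hyperbolic plane (curvature $\chi=0,1,-1$). Let $P\subset M$ be a geodesic polygon, not necessarily convex or simple: a compact region that is the closure of its interior and whose boundary is a finite union of geodesic segments (sides) that meet only at common endpoints (corners). If $\chi=1$, assume that $P$ is admissible: for every side $a$ the union of $P$ and its reflection $s_a(P)$ about $a$ lies in an open hemisphere. A chord $x$ of $P$ is a directed nondegenerate geodesic segment inside $P$ with beginning $b(x)$ and end $e(x)$ on $\partial P$; an endpoint interior to a side is not allowed if the chord lies along that side there. Chords are topologized by $(b(x),e(x))\in\partial P\times\partial P$. Let $\Delta_+$, $\Delta_-$, $\Delta_0$ be the sets of chords whose end, respectively beginning, is a corner, respectively which have a corner in their interior, and $\Delta=\Delta_+\cup\Delta_-\cup\Delta_0$. If $e(x)$ is interior to a side $a$, then $T_b(x)$ is the longest chord that begins at $e(x)$ and is contained in the reflection about $a$ of the oriented line $l(x)$ of $x$. Put $\Gamma=\Delta\cup T_b^{-1}(\Delta\setminus\Delta_-)$. In the projective model, oriented lines form part of the sphere that double covers the dual projective plane; its geodesics (arcs of great circles) are the pencils of rays. The phase space $X=X(P)$ is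 the surface obtained from the closed faces of $\Delta$ (the closures, in this sphere, of the sets of oriented lines $l(x)$ of the chords $x$ in one connected component of the complement of $\Delta$) by gluing them along the arcs of their common boundary chords. It carries the geodesic structure induced by $x\mapsto l(x)$. Besides chords it contains the rays supporting $P$ at a corner that are limits of chords shrinking to that corner; they count as chords that begin and end at that corner, hence as points of $\Delta$ and $\Gamma$. Then: 1. $T_b$ is well defined off $\Delta_+$. $X$ is a compact geodesic surface, in the following sense: $X$ is compact and Hausdorff; $l$ is continuous and finite-to-one; off a finite set of points $l$ is a local chart onto an open piece of the sphere or, at the boundary, of a half-sphere; and every point has arbitrarily small neighbourhoods that remain connected when the point is removed. The chords outside $\Delta$ form an open dense subspace of $X$. 2. $\Gamma$ is a convex geodesic graph in $X$: it is a finite graph whose edges are geodesic arcs; every cone point of $X$ (point near which $l$ is not injective) is a vertex; no other vertex has exactly two adjacent edges that together form one geodesic; there are finitely many open faces (components of $X\setminus\Gamma$), and the closed faces cover $X$ and are geodesically convex, i.e. any two distinct points of a closed face are joined by exactly one geodesic arc in it. 3. $T_b$ is continuous on the open faces of $\Gamma$ and extends uniquely by continuity from each open face $F$ to a map $T_F:\overline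 F\to X$. 4. These maps $T$, with the partition $\mathcal P$ of $X$ into the closed faces of $\Gamma$, form a piecewise convex transformation $(X,T,\mathcal P)$: every $T_F$ is a diffeomorphism onto its image which sends geodesics to geodesics, the images $T_F(\overline F)$ cover $X$ and have pairwise disjoint interiors, and they are the closed faces of a convex geodesic graph in $X$. 5. $T$ coincides with the billiard map $T_b$ on $X\setminus\Gamma$. -/

import Mathlib

open Set Topology
open scoped ContDiff

noncomputable section

/-! ### The three model planes

All three geometries are realised in `ℝ³`, so that geodesics are the sections of the surface by
planes through the origin; central projection gives the usual projective (straight-line) models. -/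

/-- Vectors and covectors of `ℝ³`. -/
abbrev V3 : Type := Fin 3 → ℝ

/-- The complete simply connected surface of curvature `χ ∈ {0, 1, -1}`, with the metric
`dx² + dy² + χ dz²`: the plane `z = 1`, the unit sphere, or the upper sheet of the hyperboloid
`z² - x² - y² = 1`. -/
def modelPlane (χ : ℝ) : Set V3 :=
  {v | χ * (v 0 ^ 2 + v 1 ^ 2) + v 2 ^ 2 = 1 ∧ (χ ≤ 0 → 0 < v 2)}

/-- The geodesic segment with (non-antipodal) endpoints `p` and `q`. -/
def geoSegment {χ : ℝ} (p q : modelPlane χ) : Set (modelPlane χ) :=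
  {v | ∃ s t : ℝ, 0 ≤ s ∧ 0 ≤ t ∧ (v : V3) = s • (p : V3) + t • (q : V3)}

/-- The geodesic reflection about the geodesic `{v | f ⬝ v = 0}`, as a linear map of `ℝ³`. -/
def geoReflection (χ : ℝ) (f v : V3) : V3 :=
  v - (2 * (f ⬝ᵥ v) / (f 0 ^ 2 + f 1 ^ 2 + χ * f 2 ^ 2)) • ![f 0, f 1, χ * f 2]

/-- The reflection is the identity on the geodesic. -/
theorem geoReflection_fix (χ : ℝ) (f v : V3) (h : f ⬝ᵥ v = 0) : geoReflection χ f v = v := by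
  simp [geoReflection, h]

/-- The reflection preserves the metric form `dx² + dy² + χ dz²` on tangent vectors (which are
horizontal if `χ = 0`). -/
theorem geoReflection_isometry (χ : ℝ) (hχ : χ = 0 ∨ χ = 1 ∨ χ = -1) (f v : V3)
    (hf : f 0 ^ 2 + f 1 ^ 2 + χ * f 2 ^ 2 ≠ 0) (hv : χ = 0 → v 2 = 0) :
    geoReflection χ f v 0 ^ 2 + geoReflection χ f v 1 ^ 2 + χ * geoReflection χ f v 2 ^ 2 =
      v 0 ^ 2 + v 1 ^ 2 + χ * v 2 ^ 2 := by
  have hc : (2 * (f ⬝ᵥ v) / (f 0 ^ 2 + f 1 ^ 2 + χ * f 2 ^ 2)) *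
      (f 0 ^ 2 + f 1 ^ 2 + χ * f 2 ^ 2) = 2 * (f 0 * v 0 + f 1 * v 1 + f 2 * v 2) := by
    rw [div_mul_cancel₀ _ hf]; simp [dotProduct, Fin.sum_univ_three]
  simp only [geoReflection, Pi.sub_apply, Pi.smul_apply, smul_eq_mul, Matrix.cons_val_zero,
    Matrix.cons_val_one, Matrix.cons_val]
  generalize 2 * (f ⬝ᵥ v) / (f 0 ^ 2 + f 1 ^ 2 + χ * f 2 ^ 2) = c at hc ⊢
  rcases hχ with rfl | rfl | rfl
  · rw [hv rfl] at hc ⊢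
    linear_combination c * hc
  · linear_combination c * hc
  · linear_combination c * hc

/-- The reflection preserves the quadric that contains the surface. -/
theorem geoReflection_quadric (χ : ℝ) (hχ : χ = 0 ∨ χ = 1 ∨ χ = -1) (f v : V3)
    (hf : f 0 ^ 2 + f 1 ^ 2 + χ * f 2 ^ 2 ≠ 0) :
    χ * (geoReflection χ f v 0 ^ 2 + geoReflection χ f v 1 ^ 2) + geoReflection χ f v 2 ^ 2 =
      χ * (v 0 ^ 2 + v 1 ^ 2) + v 2 ^ 2 := by
  rcases eq_or_ne χ 0 with rfl | h0
  · simp [geoReflection]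
  · have h := geoReflection_isometry χ hχ f v hf fun h => absurd h h0
    have h2 : χ * χ = 1 := by rcases hχ with rfl | rfl | rfl <;> simp_all
    linear_combination χ * h + (v 2 ^ 2 - geoReflection χ f v 2 ^ 2) * h2

/-! ### Geodesic polygons -/

/-- A geodesic polygon, convex or not, simple or not: a compact region which is the closure of its
interior and whose boundary is a finite union of geodesic segments (the sides) meeting only at
common endpoints (the corners). -/
structure GeoPolygon (χ : ℝ) where
  /-- The region. -/
  region : Set (modelPlane χ)
  /-- The number of sides. -/
  n : ℕ
  /-- First endpoint of a side. -/
  A : Fin n → modelPlane χ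
  /-- Second endpoint of a side. -/
  B : Fin n → modelPlane χ
  n_pos : 0 < n
  compact : IsCompact region
  regular : closure (interior region) = region
  ne : ∀ i, A i ≠ B i
  not_antipodal : ∀ i, (A i : V3) ≠ -(B i : V3)
  boundary : frontier region = ⋃ i, geoSegment (A i) (B i)
  meet : ∀ i j, i ≠ j →
    geoSegment (A i) (B i) ∩ geoSegment (A j) (B j) ⊆ {A i, B i} ∩ {A j, B j}

/-- The set of corners. -/
def GeoPolygon.corners {χ : ℝ} (P : GeoPolygon χ) : Set (modelPlane χ) :=
  range P.A ∪ range P.B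

/-- The (closed) `i`-th side. -/
def GeoPolygon.side {χ : ℝ} (P : GeoPolygon χ) (i : Fin P.n) : Set (modelPlane χ) :=
  geoSegment (P.A i) (P.B i)

/-- The geodesic reflection about the `i`-th side. -/
def GeoPolygon.sideReflection {χ : ℝ} (P : GeoPolygon χ) (i : Fin P.n) (v : V3) : V3 :=
  geoReflection χ (crossProduct (P.A i : V3) (P.B i : V3)) v

/-- For every side, the union of `P` and its reflection about that side lies in an open
hemisphere. -/
def GeoPolygon.Admissible {χ : ℝ} (P : GeoPolygon χ) : Prop :=
  ∀ i, ∃ c : V3, (∀ p ∈ P.region, 0 < c ⬝ᵥ (p : V3)) ∧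
    ∀ p ∈ P.region, 0 < c ⬝ᵥ P.sideReflection i (p : V3)

/-! ### Chords and the billiard map -/

/-- A chord: a directed geodesic segment inside `P` both of whose endpoints are on the boundary.
An endpoint which is interior to a side is not allowed to be an endpoint along that side (so
that a geodesic carries only finitely many chords). -/
def GeoPolygon.IsChord {χ : ℝ} (P : GeoPolygon χ) (x : modelPlane χ × modelPlane χ) : Prop :=
  x.1 ∈ frontier P.region ∧ x.2 ∈ frontier P.region ∧ x.1 ≠ x.2 ∧
    geoSegment x.1 x.2 ⊆ P.region ∧
    ∀ i, ∀ z ∈ ({x.1, x.2} : Set (modelPlane χ)), z ∈ P.side i → z ∉ P.corners →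
      crossProduct (x.1 : V3) (x.2 : V3) ⬝ᵥ (P.A i : V3) ≠ 0

/-- The space of chords, with the topology of `∂P × ∂P`. -/
def Chord {χ : ℝ} (P : GeoPolygon χ) : Type := {x : modelPlane χ × modelPlane χ // P.IsChord x}

instance {χ : ℝ} (P : GeoPolygon χ) : TopologicalSpace (Chord P) :=
  inferInstanceAs (TopologicalSpace {x : modelPlane χ × modelPlane χ // P.IsChord x})

namespace Chord

/-- The beginning of a chord. -/
def b {χ : ℝ} {P : GeoPolygon χ} (x : Chord P) : modelPlane χ := x.1.1

/-- The end of a chord. -/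
def e {χ : ℝ} {P : GeoPolygon χ} (x : Chord P) : modelPlane χ := x.1.2

/-- The points of a chord. -/
def carrier {χ : ℝ} {P : GeoPolygon χ} (x : Chord P) : Set (modelPlane χ) := geoSegment x.b x.e

/-- The oriented line (ray) containing a chord. An oriented geodesic `{v | f ⬝ v = 0}` is recorded
by its unit covector `f`; unoriented lines are then the points `±f` of the dual projective plane. -/
def ray {χ : ℝ} {P : GeoPolygon χ} (x : Chord P) : V3 :=
  (Real.sqrt (crossProduct (x.b : V3) (x.e : V3) ⬝ᵥ crossProduct (x.b : V3) (x.e : V3)))⁻¹ •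
    crossProduct (x.b : V3) (x.e : V3)

/-- `y` begins at the end of `x`, and follows the reflection about the side `i` of the oriented
line of `x`: the points `s_i(b(x)), e(x) = b(y), e(y)` are in this order on one geodesic. -/
def Follows {χ : ℝ} {P : GeoPolygon χ} (i : Fin P.n) (x y : Chord P) : Prop :=
  y.b = x.e ∧ ∃ c : ℝ, 0 < c ∧
    crossProduct (y.b : V3) (y.e : V3) = c • crossProduct (P.sideReflection i x.b) (x.e : V3)

/-- The graph of the billiard map `y = T_b(x)`: it is defined when `e(x)` is not a corner, and `y`
is the longest chord that follows the reflected ray. -/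
def IsNext {χ : ℝ} {P : GeoPolygon χ} (x y : Chord P) : Prop :=
  x.e ∉ P.corners ∧ ∃ i, x.e ∈ P.side i ∧ Follows i x y ∧
    ∀ y' : Chord P, Follows i x y' → y'.carrier ⊆ y.carrier

/-- `Δ₊`: the end is a corner. -/
def DeltaPlus {χ : ℝ} (P : GeoPolygon χ) : Set (Chord P) := {x | x.e ∈ P.corners}

/-- `Δ₋`: the beginning is a corner. -/
def DeltaMinus {χ : ℝ} (P : GeoPolygon χ) : Set (Chord P) := {x | x.b ∈ P.corners}

/-- `Δ₀`: there is a corner in the interior of the chord. -/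
def DeltaZero {χ : ℝ} (P : GeoPolygon χ) : Set (Chord P) :=
  {x | ∃ v ∈ P.corners, v ∈ x.carrier ∧ v ≠ x.b ∧ v ≠ x.e}

/-- `Δ = Δ₊ ∪ Δ₋ ∪ Δ₀`. -/
def Delta {χ : ℝ} (P : GeoPolygon χ) : Set (Chord P) :=
  DeltaPlus P ∪ DeltaMinus P ∪ DeltaZero P

/-- `Γ = Δ ∪ T_b⁻¹(Δ \ Δ₋)`, as a set of chords. -/
def Gamma {χ : ℝ} (P : GeoPolygon χ) : Set (Chord P) :=
  Delta P ∪ {x | ∃ y, IsNext x y ∧ y ∈ Delta P \ DeltaMinus P}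

end Chord

/-! ### Geodesic surfaces

The geodesic structure of a surface `X` is induced from the sphere of oriented lines by a map
`dev : X → S²`: the geodesics of `S²` are the arcs of great circles, i.e. the pencils of rays. -/

/-- The open faces of a graph with support `G`: the connected components of the complement. -/
def openFaces {X : Type} [TopologicalSpace X] (G : Set X) : Set (Set X) :=
  {F | ∃ x ∈ Gᶜ, F = connectedComponentIn Gᶜ x}

/-- `a` is a geodesic arc of `X` with endpoints `x`, `y`: it is a simple arc which `dev` develops
monotonically along a great circle. -/
def IsGeodesicArc {X : Type} [TopologicalSpace X] (dev : X → V3) (a : Set X) (x y : X) : Prop :=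
  ∃ (γ : unitInterval → X) (u w : V3) (θ : unitInterval → ℝ),
    Continuous γ ∧ Function.Injective γ ∧ range γ = a ∧ γ 0 = x ∧ γ 1 = y ∧
    u ⬝ᵥ u = 1 ∧ w ⬝ᵥ w = 1 ∧ u ⬝ᵥ w = 0 ∧ Continuous θ ∧ StrictMono θ ∧
    ∀ t, dev (γ t) = Real.cos (θ t) • u + Real.sin (θ t) • w

/-- Any two points of `Y` are joined by exactly one geodesic in `Y`. -/
def IsGeodesicallyConvex {X : Type} [TopologicalSpace X] (dev : X → V3) (Y : Set X) : Prop :=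
  ∀ x ∈ Y, ∀ y ∈ Y, x ≠ y → ∃! a : Set X, a ⊆ Y ∧ IsGeodesicArc dev a x y

/-- A (compact) geodesic surface: outside a finite set of points (cone points and corners of the
boundary) `dev` is a chart with values in the sphere or, at boundary points, in a half-sphere;
and no point is a pinching point. -/
structure IsGeodesicSurface {X : Type} [TopologicalSpace X] (dev : X → V3) : Prop where
  compact : CompactSpace X
  hausdorff : T2Space X
  continuous_dev : Continuous dev
  dev_unit : ∀ x, dev x ⬝ᵥ dev x = 1
  finite_fibres : ∀ v, (dev ⁻¹' {v}).Finite
  charts : ∃ K : Set X, K.Finite ∧ ∀ x, x ∉ K → ∃ U : Set X, IsOpen U ∧ x ∈ U ∧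
    IsEmbedding (U.domRestrict dev) ∧ ∃ O : Set V3, IsOpen O ∧
      (dev '' U = O ∩ {v | v ⬝ᵥ v = 1} ∨
        ∃ ν : V3, ν ≠ 0 ∧ dev '' U = O ∩ {v | v ⬝ᵥ v = 1 ∧ 0 ≤ ν ⬝ᵥ v})
  not_pinched : ∀ x : X, ∀ U ∈ 𝓝 x, ∃ N : Set X, N ∈ 𝓝 x ∧ N ⊆ U ∧ IsConnected (N \ {x})

/-- The geodesic structure is flat at `x`: `x` is not a cone point. -/
def IsFlatAt {X : Type} [TopologicalSpace X] (dev : X → V3) (x : X) : Prop :=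
  ∃ U ∈ 𝓝 x, InjOn dev U

/-- `G` is the support of a finite geodesic graph: the edges are geodesic arcs, meeting each other
and the set of vertices only at their endpoints; cone points are vertices; no other vertex is
degenerate, i.e. has exactly two adjacent edges which together form one geodesic. -/
def IsGeodesicGraph {X : Type} [TopologicalSpace X] (dev : X → V3) (G : Set X) : Prop :=
  ∃ (W : Set X) (E : Set (Set X)), W.Finite ∧ E.Finite ∧ G = W ∪ ⋃₀ E ∧
    (∀ a ∈ E, ∃ x y, IsGeodesicArc dev a x y ∧ a ∩ W = {x, y}) ∧
    (∀ a ∈ E, ∀ a' ∈ E, a ≠ a' → a ∩ a' ⊆ W) ∧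
    (∀ x, ¬ IsFlatAt dev x → x ∈ W) ∧
    ∀ v ∈ W, IsFlatAt dev v → ¬ ∃ a ∈ E, ∃ a' ∈ E, a ≠ a' ∧ v ∈ a ∩ a' ∧
      (∀ a'' ∈ E, v ∈ a'' → a'' = a ∨ a'' = a') ∧
      ∃ x y, IsGeodesicArc dev (a ∪ a') x y ∧ v ≠ x ∧ v ≠ y

/-- `G` is the support of a convex geodesic graph: its closed faces are geodesically convex and
form a finite partition of `X`. -/
structure IsConvexGeodesicGraph {X : Type} [TopologicalSpace X] (dev : X → V3) (G : Set X) :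
    Prop where
  graph : IsGeodesicGraph dev G
  finite_faces : (openFaces G).Finite
  cover : ⋃ F ∈ openFaces G, closure F = univ
  convex : ∀ F ∈ openFaces G, IsGeodesicallyConvex dev (closure F)

/-- `φ : Y → X` is a geodesically convex transformation: a diffeomorphism onto its image (in the
coordinates given by `dev`) which sends geodesics to geodesics. -/
structure IsConvexTransformation {X : Type} [TopologicalSpace X] (dev : X → V3) (Y : Set X)
    (φ : Y → X) : Prop where
  embedding : IsEmbedding φ
  smooth : ∀ x : Y, ∃ f : V3 → V3, ContDiffAt ℝ ∞ f (dev x) ∧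
    ∀ᶠ y : Y in 𝓝 x, dev (φ y) = f (dev y)
  smooth_inv : ∀ x : Y, ∃ f : V3 → V3, ContDiffAt ℝ ∞ f (dev (φ x)) ∧
    ∀ᶠ y : Y in 𝓝 x, dev y = f (dev (φ y))
  geodesics : ∀ (x y : Y) (a : Set X), a ⊆ Y → IsGeodesicArc dev a x y →
    IsGeodesicArc dev (φ '' (Subtype.val ⁻¹' a)) (φ x) (φ y)

/-- The maps `T F`, defined on the closed faces of the graph with support `G`, form a piecewise
convex transformation of `X` with the defining partition into the closed faces of `G`. -/
structure IsPiecewiseConvexTransformation {X : Type} [TopologicalSpace X] (dev : X → V3)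
    (G : Set X) (T : (F : openFaces G) → closure (F : Set X) → X) : Prop where
  surface : IsGeodesicSurface dev
  source : IsConvexGeodesicGraph dev G
  convex : ∀ F : openFaces G, IsConvexTransformation dev (closure (F : Set X)) (T F)
  cover : ⋃ F : openFaces G, range (T F) = univ
  disjoint : ∀ F F' : openFaces G, F ≠ F' → Disjoint (interior (range (T F))) (interior (range (T F')))
  target : ∃ G' : Set X, IsConvexGeodesicGraph dev G' ∧
    closure '' openFaces G' = range fun F : openFaces G => range (T F)

/-! ### The phase space of the billiard map as a geodesic surface

Every face `F` of `Δ` in the space of chords is developed by `ray` into the sphere of oriented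
lines, and the closed faces are the closures of these regions. `X` is obtained by gluing the
closed faces along the arcs of chords that they have in common. Thus `X` is completed by the
limits of chords that shrink to a corner, which are rays supporting `P` at that corner. -/

/-- The disjoint union of the closed faces of `Δ`. -/
abbrev CutSpace {χ : ℝ} (P : GeoPolygon χ) : Type :=
  Σ F : openFaces (Chord.Delta P), closure (Chord.ray '' (F : Set (Chord P)))

/-- Two closed faces are glued along the arcs (endpoints included) made of the rays of their
common boundary chords. -/
def Glued {χ : ℝ} (P : GeoPolygon χ) (p q : CutSpace P) : Prop :=
  (p.2 : V3) = q.2 ∧ AccPt (p.2 : V3)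
    (Filter.principal (Chord.ray '' (closure (p.1 : Set (Chord P)) ∩ closure (q.1 : Set (Chord P)))))

/-- The phase space `X(P)`. -/
def PhaseSpace {χ : ℝ} (P : GeoPolygon χ) : Type := Quot (Glued P)

instance {χ : ℝ} (P : GeoPolygon χ) : TopologicalSpace (PhaseSpace P) :=
  inferInstanceAs (TopologicalSpace (Quot (Glued P)))

namespace PhaseSpace

/-- The map `X → L`, `x ↦ l(x)`, to the sphere of oriented lines. -/
def line {χ : ℝ} (P : GeoPolygon χ) : PhaseSpace P → V3 :=
  Quot.lift (fun p => (p.2 : V3)) fun _ _ h => h.1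

/-- The phase point given by a chord outside `Δ`. -/
def ofChord {χ : ℝ} (P : GeoPolygon χ) (x : {x : Chord P // x ∉ Chord.Delta P}) : PhaseSpace P :=
  Quot.mk _ ⟨⟨connectedComponentIn (Chord.Delta P)ᶜ x.1, x.1, x.2, rfl⟩,
    ⟨x.1.ray, subset_closure (mem_image_of_mem _ (mem_connectedComponentIn x.2))⟩⟩

/-- The support of the graph `Γ` in `X`: all points but the chords that are not in `Γ`. (It contains
the rays supporting `P` at a corner: they are degenerate chords, beginning and ending there.) -/
def Gamma {χ : ℝ} (P : GeoPolygon χ) : Set (PhaseSpace P) :=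
  {ξ | ¬ ∃ x : {x : Chord P // x ∉ Chord.Delta P}, x.1 ∉ Chord.Gamma P ∧ ofChord P x = ξ}

/-- The billiard map on phase points outside `Δ`, as a relation `η = T_b(ξ)`. -/
def IsNext {χ : ℝ} (P : GeoPolygon χ) (ξ η : PhaseSpace P) : Prop :=
  ∃ x y : {x : Chord P // x ∉ Chord.Delta P},
    ofChord P x = ξ ∧ ofChord P y = η ∧ Chord.IsNext x.1 y.1

end PhaseSpace

end

noncomputable section

/-! ### The sphere of unit covectors and its convex cells -/

/-! The surface lies in ℝ³, and the polygon is replaced by the cone over it. An oriented line is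
then a covector up to positive scaling, the side on which it passes a corner `w` is the sign of `f
⬝ᵥ w`, and the reflection about a side of `P` acts linearly on covectors (`covReflection`). After
radial projection to the unit sphere, linear cones become convex spherical polygons and linear
isomorphisms become maps that preserve arcs of great circles. The theorem thus reduces to finite
systems of linear inequalities.

Faces of Δ. A chord outside Δ crosses two oriented sides `o`, `o'` at interior points and runs
inside the interior of the polygon in between; its line is called `Good`. Goodness is an open
condition, because a chord is compact and the polygon is a half-plane near an interior point of a
side. It is also preserved in limits, as long as the two sides are still crossed in their interiors
and no corner reaches the chord. Hence the signs at the finitely many relevant corners cut out a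
convex cone consisting of good lines (`Good.of_pos_cons`), and each face of Δ develops bijectively
onto an open convex spherical polygon (`openFaces_delta`, `ray_image_face`). There are finitely many
faces, and their closures contain no antipodal points (`Good.salient_cons`).

Gluing. If two distinct closed faces have infinitely many common chords, then their open cells are
disjoint, and all but finitely many lines common to the two closed cells carry a common chord
(`common_chords`). So `X` is glued from convex polygons along entire intersections, which is what
`CellGluing` records. For every such gluing, the unions of pieces of polygons around a point
(`star`) form a neighbourhood basis. This yields compactness, the Hausdorff property, charts off the
vertices of the arrangement, and the absence of pinching points. A subdivision of the polygons by
circles of the arrangement has a convex geodesic graph as its skeleton: the edges are the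
one-dimensional cells of the arrangement, and degenerate vertices are removed by merging edges.

Billiard map. The reflected ray enters the polygon and must leave it, because some linear form is
positive both on `P` and on its reflection; this is where admissibility enters for the sphere. So a
longest next chord exists, and it is unique (`existsUnique_next`). For faces `F`, `F'` of Δ, the
chords of `F` sent to `F'` are cut out of `F` by pulling back the half-spaces of `F'` under a linear
reflection. These convex cells are disjoint because the next chord is unique, and their closures
cover because only lines on finitely many great circles have a next chord in Δ. Reversing chords
gives the same for the images. The linear involutions match the two subdivisions, so
`exists_piecewiseConvexTransformation` produces `T`, and the skeleton of the first subdivision is Γ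
(`gamma_eq_skeleton`). -/

theorem dot_expand (a b : V3) : a ⬝ᵥ b = a 0 * b 0 + a 1 * b 1 + a 2 * b 2 :=
  Matrix.vec3_dotProduct a b

theorem dot_self_pos {v : V3} (h : v ≠ 0) : 0 < v ⬝ᵥ v := by
  rcases (Finset.sum_nonneg fun i _ => mul_self_nonneg (v i) : 0 ≤ v ⬝ᵥ v).lt_or_eq with h1 | h1
  · exact h1
  · exact absurd (dotProduct_self_eq_zero.1 h1.symm) h

theorem ne_zero_of_unit {v : V3} (h : v ⬝ᵥ v = 1) : v ≠ 0 := by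
  rintro rfl; simp at h

theorem ne_zero_of_dot_pos {c v : V3} (h : 0 < c ⬝ᵥ v) : v ≠ 0 := by
  rintro rfl; simp at h

@[fun_prop]
theorem continuous_dot {α : Type*} [TopologicalSpace α] {f g : α → V3} (hf : Continuous f)
    (hg : Continuous g) : Continuous fun x => f x ⬝ᵥ g x := by
  simp only [dot_expand]; fun_prop

@[fun_prop]
theorem continuous_cross {α : Type*} [TopologicalSpace α] {f g : α → V3} (hf : Continuous f)
    (hg : Continuous g) : Continuous fun x => crossProduct (f x) (g x) := by
  simp only [cross_apply]
  refine continuous_pi fun i => ?_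
  fin_cases i <;> simp <;> fun_prop

/-- Radial projection to the unit sphere. -/
def unitize (v : V3) : V3 := (Real.sqrt (v ⬝ᵥ v))⁻¹ • v

theorem sqrt_dot_pos {v : V3} (h : v ≠ 0) : 0 < Real.sqrt (v ⬝ᵥ v) :=
  Real.sqrt_pos.2 (dot_self_pos h)

theorem unitize_unit {v : V3} (h : v ≠ 0) : unitize v ⬝ᵥ unitize v = 1 := by
  have h1 := sqrt_dot_pos h
  have h2 := Real.mul_self_sqrt (dot_self_pos h).le
  simp only [unitize, smul_dotProduct, dotProduct_smul, smul_eq_mul]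
  field_simp
  nlinarith

theorem unitize_of_unit {v : V3} (h : v ⬝ᵥ v = 1) : unitize v = v := by
  simp [unitize, h]

theorem unitize_smul {r : ℝ} (hr : 0 < r) (v : V3) : unitize (r • v) = unitize v := by
  have : Real.sqrt (r • v ⬝ᵥ r • v) = r * Real.sqrt (v ⬝ᵥ v) := by
    rw [smul_dotProduct, dotProduct_smul, smul_eq_mul, smul_eq_mul, ← mul_assoc,
      Real.sqrt_mul (by positivity), Real.sqrt_mul_self hr.le]
  rw [unitize, unitize, this, smul_smul, mul_inv, mul_comm, ← mul_assoc, mul_inv_cancel₀ hr.ne',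
    one_mul]

theorem exists_unitize_eq {v : V3} (h : v ≠ 0) : ∃ r : ℝ, 0 < r ∧ unitize v = r • v :=
  ⟨_, inv_pos.2 (sqrt_dot_pos h), rfl⟩

theorem dot_unitize_pos {s v : V3} (h : 0 < s ⬝ᵥ v) : 0 < s ⬝ᵥ unitize v := by
  obtain ⟨r, hr, h1⟩ := exists_unitize_eq (ne_zero_of_dot_pos h)
  rw [h1, dotProduct_smul]; exact mul_pos hr h

theorem dot_unitize_pos_iff {s v : V3} (hv : v ≠ 0) : 0 < s ⬝ᵥ unitize v ↔ 0 < s ⬝ᵥ v := by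
  obtain ⟨r, hr, h1⟩ := exists_unitize_eq hv
  rw [h1, dotProduct_smul, smul_eq_mul, mul_pos_iff_of_pos_left hr]

theorem dot_unitize_nonneg {s v : V3} (h : 0 ≤ s ⬝ᵥ v) : 0 ≤ s ⬝ᵥ unitize v := by
  rw [unitize, dotProduct_smul]; exact mul_nonneg (inv_nonneg.2 (Real.sqrt_nonneg _)) h

theorem continuousAt_unitize {v : V3} (h : v ≠ 0) : ContinuousAt unitize v := by
  have : ContinuousAt (fun v : V3 => Real.sqrt (v ⬝ᵥ v)) v := by
    apply Continuous.continuousAt; fun_prop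
  exact (this.inv₀ (sqrt_dot_pos h).ne').smul continuousAt_id

theorem unitize_eq_iff {v w : V3} (hv : v ≠ 0) (hw : w ≠ 0) :
    unitize v = unitize w ↔ ∃ r : ℝ, 0 < r ∧ v = r • w := by
  constructor
  · intro h
    refine ⟨Real.sqrt (v ⬝ᵥ v) * (Real.sqrt (w ⬝ᵥ w))⁻¹,
      mul_pos (sqrt_dot_pos hv) (inv_pos.2 (sqrt_dot_pos hw)), ?_⟩
    rw [mul_smul, ← unitize, ← h, unitize, smul_smul, mul_inv_cancel₀ (sqrt_dot_pos hv).ne',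
      one_smul]
  · rintro ⟨r, hr, rfl⟩; exact unitize_smul hr w

/-- Nonnegative combinations of unit vectors that are unit again: the minor arc of a great circle. -/
def minorArc (p q : V3) : Set V3 :=
  {l | l ⬝ᵥ l = 1 ∧ ∃ s t : ℝ, 0 ≤ s ∧ 0 ≤ t ∧ l = s • p + t • q}

/-- The open spherical polygon cut out by a set of half-spaces. -/
def openCell (S : Set V3) : Set V3 := {f | f ⬝ᵥ f = 1 ∧ ∀ s ∈ S, 0 < s ⬝ᵥ f}

/-- The closed spherical polygon cut out by a set of half-spaces. -/
def closedCell (S : Set V3) : Set V3 := {f | f ⬝ᵥ f = 1 ∧ ∀ s ∈ S, 0 ≤ s ⬝ᵥ f}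

/-- The closed polygon with these half-spaces contains no pair of antipodal points. -/
def Salient (S : Set V3) : Prop := ∀ f : V3, (∀ s ∈ S, s ⬝ᵥ f = 0) → f = 0

theorem Salient.mono {S S' : Set V3} (h : Salient S) (hS : S ⊆ S') : Salient S' :=
  fun f hf => h f fun s hs => hf s (hS hs)

theorem Salient.nonempty {S : Set V3} (h : Salient S) : S.Nonempty := by
  by_contra h1
  rw [not_nonempty_iff_eq_empty] at h1
  subst h1
  have := congrFun (h ![1, 0, 0] (by simp)) 0
  simp at this

theorem openCell_subset (S : Set V3) : openCell S ⊆ closedCell S :=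
  fun _ h => ⟨h.1, fun s hs => (h.2 s hs).le⟩

theorem isClosed_closedCell (S : Set V3) : IsClosed (closedCell S) := by
  have : closedCell S = {f | f ⬝ᵥ f = 1} ∩ ⋂ s ∈ S, {f | 0 ≤ s ⬝ᵥ f} := by
    ext f; simp [closedCell]
  rw [this]
  refine (isClosed_eq (by fun_prop) (by fun_prop)).inter (isClosed_biInter fun s _ => ?_)
  exact isClosed_le (by fun_prop) (by fun_prop)

theorem isCompact_unitSphere : IsCompact {f : V3 | f ⬝ᵥ f = 1} := by
  refine Metric.isCompact_of_isClosed_isBounded (isClosed_eq (by fun_prop) (by fun_prop)) ?_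
  refine (Metric.isBounded_closedBall (x := (0 : V3)) (r := 1)).subset fun f hf => ?_
  rw [mem_closedBall_zero_iff, pi_norm_le_iff_of_nonneg zero_le_one]
  have h : f 0 * f 0 + f 1 * f 1 + f 2 * f 2 = 1 := by rw [← dot_expand]; exact hf
  intro i
  rw [Real.norm_eq_abs, abs_le]
  fin_cases i <;> simp <;> constructor <;>
    nlinarith [mul_self_nonneg (f 0), mul_self_nonneg (f 1), mul_self_nonneg (f 2)]

theorem isCompact_closedCell (S : Set V3) : IsCompact (closedCell S) :=
  isCompact_unitSphere.of_isClosed_subset (isClosed_closedCell S) fun _ h => h.1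

theorem Salient.neg_notMem {S : Set V3} (h : Salient S) {l : V3} (hl : l ∈ closedCell S) :
    -l ∉ closedCell S := by
  intro h1
  refine ne_zero_of_unit hl.1 (h l fun s hs => le_antisymm ?_ (hl.2 s hs))
  have := h1.2 s hs
  rw [dotProduct_neg] at this; linarith

theorem Salient.comb_ne_zero {S : Set V3} (h : Salient S) {p q : V3} (hp : p ∈ closedCell S)
    (hq : q ∈ closedCell S) {a b : ℝ} (ha : 0 ≤ a) (hb : 0 ≤ b) (hab : 0 < a + b) :
    a • p + b • q ≠ 0 := by
  intro h0
  have key : ∀ s ∈ S, a * (s ⬝ᵥ p) + b * (s ⬝ᵥ q) = 0 := fun s _ => by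
    have := congrArg (s ⬝ᵥ ·) h0
    simpa [dotProduct_add, dotProduct_smul] using this
  rcases ha.lt_or_eq with ha' | ha'
  · refine ne_zero_of_unit hp.1 (h p fun s hs => ?_)
    have h1 := key s hs
    have h2 := mul_nonneg hb (hq.2 s hs)
    have h3 := mul_nonneg ha (hp.2 s hs)
    have : a * (s ⬝ᵥ p) = 0 := by linarith
    exact (mul_eq_zero.1 this).resolve_left ha'.ne'
  · subst ha'
    refine ne_zero_of_unit hq.1 (h q fun s hs => ?_)
    have h1 := key s hs
    have : b * (s ⬝ᵥ q) = 0 := by linarith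
    exact (mul_eq_zero.1 this).resolve_left (by linarith)

theorem unitize_comb_mem_closedCell {S : Set V3} {p q : V3} (hp : p ∈ closedCell S)
    (hq : q ∈ closedCell S) {a b : ℝ} (ha : 0 ≤ a) (hb : 0 ≤ b) (h : a • p + b • q ≠ 0) :
    unitize (a • p + b • q) ∈ closedCell S := by
  refine ⟨unitize_unit h, fun s hs => dot_unitize_nonneg ?_⟩
  have := hp.2 s hs
  have := hq.2 s hs
  simp only [dotProduct_add, dotProduct_smul, smul_eq_mul]
  positivity

theorem unitize_comb_mem_openCell {S : Set V3} (hS : S.Nonempty) {p q : V3} (hp : p ∈ openCell S)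
    (hq : q ∈ closedCell S) {a b : ℝ} (ha : 0 < a) (hb : 0 ≤ b) :
    unitize (a • p + b • q) ∈ openCell S := by
  have key : ∀ s ∈ S, 0 < s ⬝ᵥ (a • p + b • q) := fun s hs => by
    have := hp.2 s hs
    have := hq.2 s hs
    simp only [dotProduct_add, dotProduct_smul, smul_eq_mul]
    positivity
  obtain ⟨s, hs⟩ := hS
  exact ⟨unitize_unit (ne_zero_of_dot_pos (key s hs)), fun s hs => dot_unitize_pos (key s hs)⟩

/-- The standard perturbation: if `l` lies in a closed cell and `p` in the open cell, this curve
enters the open cell at once. The density arguments for cells rest on it. -/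
theorem tendsto_unitize_comb {l p : V3} (hl : l ⬝ᵥ l = 1) :
    Filter.Tendsto (fun t : ℝ => unitize (l + t • p)) (𝓝[>] 0) (𝓝 l) := by
  have h1 : ContinuousAt (fun t : ℝ => unitize (l + t • p)) 0 := by
    refine ContinuousAt.comp (g := unitize) ?_ ?_
    · simpa using continuousAt_unitize (ne_zero_of_unit hl)
    · apply Continuous.continuousAt; fun_prop
  have h2 := h1.tendsto
  simp only [zero_smul, add_zero, unitize_of_unit hl] at h2
  exact h2.mono_left nhdsWithin_le_nhds

theorem closedCell_subset_closure {S : Set V3} (hS : S.Nonempty) {p : V3} (hp : p ∈ openCell S) :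
    closedCell S ⊆ closure (openCell S) := by
  intro l hl
  refine mem_closure_of_tendsto (tendsto_unitize_comb (p := p) hl.1) ?_
  filter_upwards [self_mem_nhdsWithin] with t ht
  have := unitize_comb_mem_openCell hS hp hl ht zero_le_one
  rwa [one_smul, add_comm] at this

theorem closure_openCell {S : Set V3} (hS : S.Nonempty) (h : (openCell S).Nonempty) :
    closure (openCell S) = closedCell S := by
  obtain ⟨p, hp⟩ := h
  exact (closure_minimal (openCell_subset S) (isClosed_closedCell S)).antisymm
    (closedCell_subset_closure hS hp)

/-- For a finite set of half-spaces, the open cell is open in the sphere. -/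
theorem eventually_pos {S : Set V3} (hS : S.Finite) (l : V3) :
    ∀ᶠ m in 𝓝 l, ∀ s ∈ S, 0 < s ⬝ᵥ l → 0 < s ⬝ᵥ m := by
  rw [Filter.eventually_all_finite hS]
  intro s _
  by_cases h : 0 < s ⬝ᵥ l
  · have : Continuous fun m : V3 => s ⬝ᵥ m := by fun_prop
    filter_upwards [this.continuousAt.eventually (lt_mem_nhds h)] with m hm _ using hm
  · exact Filter.Eventually.of_forall fun m hm => absurd hm h

theorem minorArc_subset_closedCell {S : Set V3} {p q : V3} (hp : p ∈ closedCell S)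
    (hq : q ∈ closedCell S) : minorArc p q ⊆ closedCell S := by
  rintro l ⟨hl, s, t, hs, ht, rfl⟩
  have := unitize_comb_mem_closedCell hp hq hs ht (ne_zero_of_unit hl)
  rwa [unitize_of_unit hl] at this

theorem minorArc_subset_openCell {S : Set V3} {p q : V3} (hp : p ∈ openCell S)
    (hq : q ∈ openCell S) : minorArc p q ⊆ openCell S := by
  rintro l ⟨hl, a, b, ha, hb, rfl⟩
  refine ⟨hl, fun s hs => ?_⟩
  have h1 := hp.2 s hs
  have h2 := hq.2 s hs
  simp only [dotProduct_add, dotProduct_smul, smul_eq_mul]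
  rcases ha.lt_or_eq with ha' | ha'
  · positivity
  · subst ha'
    rcases hb.lt_or_eq with hb' | hb'
    · positivity
    · subst hb'; simp at hl

theorem left_mem_minorArc {p q : V3} (hp : p ⬝ᵥ p = 1) : p ∈ minorArc p q :=
  ⟨hp, 1, 0, zero_le_one, le_rfl, by simp⟩

theorem right_mem_minorArc {p q : V3} (hq : q ⬝ᵥ q = 1) : q ∈ minorArc p q :=
  ⟨hq, 0, 1, le_rfl, zero_le_one, by simp⟩

/-- Two unit vectors on a line are equal or antipodal. -/
theorem eq_or_eq_neg_of_smul {p q : V3} (hp : p ⬝ᵥ p = 1) (hq : q ⬝ᵥ q = 1) {r : ℝ}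
    (h : p = r • q) : p = q ∨ p = -q := by
  subst h
  have h1 : r * r = 1 := by simpa [hq] using hp
  rcases mul_self_eq_one_iff.1 h1 with rfl | rfl <;> simp

/-- Pairing a vanishing combination with `p` and with `q` and adding gives `(a + b) * (1 + p ⬝ᵥ q) =
0`, while `p ⬝ᵥ q > -1` for unit vectors that are not antipodal. -/
theorem comb_ne_zero {p q : V3} (hp : p ⬝ᵥ p = 1) (hq : q ⬝ᵥ q = 1) (hpq : p ≠ -q) {a b : ℝ}
    (hab : 0 < a + b) : a • p + b • q ≠ 0 := by
  intro h
  have h1 : p ⬝ᵥ (a • p + b • q) = 0 := by simp [h]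
  have h2 : q ⬝ᵥ (a • p + b • q) = 0 := by simp [h]
  simp only [dotProduct_add, dotProduct_smul, hp, hq, dotProduct_comm q p, smul_eq_mul] at h1 h2
  have hlt : -1 < p ⬝ᵥ q := by
    have h3 : p + q ≠ 0 := fun h => hpq (eq_neg_of_add_eq_zero_left h)
    have h4 := dot_self_pos h3
    simp only [dotProduct_add, add_dotProduct, hp, hq, dotProduct_comm q p] at h4
    linarith
  nlinarith

theorem isPreconnected_minorArc {p q : V3} (hp : p ⬝ᵥ p = 1) (hq : q ⬝ᵥ q = 1) (hpq : p ≠ -q) :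
    IsPreconnected (minorArc p q) := by
  -- The arc is the radial projection of an affine segment, which avoids the origin because its
  -- endpoints are not antipodal.
  have : minorArc p q = (fun t : ℝ => unitize ((1 - t) • p + t • q)) '' Icc 0 1 := by
    ext l
    constructor
    · rintro ⟨hl, s, t, hs, ht, rfl⟩
      have hst : 0 < s + t := by
        rcases (add_nonneg hs ht).lt_or_eq with h | h
        · exact h
        · have hs0 : s = 0 := by linarith
          have ht0 : t = 0 := by linarith
          simp [hs0, ht0] at hl
      refine ⟨t / (s + t), ⟨by positivity, by rw [div_le_one hst]; linarith⟩, ?_⟩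
      have : (1 - t / (s + t)) • p + (t / (s + t)) • q = (s + t)⁻¹ • (s • p + t • q) := by
        rw [smul_add, smul_smul, smul_smul]
        congr 2 <;> field_simp
        ring
      show unitize _ = _
      rw [this, unitize_smul (inv_pos.2 hst), unitize_of_unit hl]
    · rintro ⟨t, ⟨h0, h1⟩, rfl⟩
      have hne := comb_ne_zero hp hq hpq (a := 1 - t) (b := t) (by linarith)
      refine ⟨unitize_unit hne, ?_⟩
      obtain ⟨r, hr, h⟩ := exists_unitize_eq hne
      refine ⟨r * (1 - t), r * t, mul_nonneg hr.le (sub_nonneg.2 h1), mul_nonneg hr.le h0, ?_⟩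
      show unitize _ = _
      rw [h, smul_add, smul_smul, smul_smul]
  rw [this]
  refine (convex_Icc (0 : ℝ) 1).isPreconnected.image _ fun t ht => ?_
  refine ContinuousAt.continuousWithinAt (ContinuousAt.comp (g := unitize) ?_ ?_)
  · exact continuousAt_unitize (comb_ne_zero hp hq hpq (by linarith))
  · apply Continuous.continuousAt; fun_prop

theorem isPreconnected_openCell {S : Set V3} (hS : S.Nonempty) : IsPreconnected (openCell S) := by
  refine isPreconnected_of_forall_pair fun p hp q hq => ⟨minorArc p q,
    minorArc_subset_openCell hp hq, left_mem_minorArc hp.1, right_mem_minorArc hq.1,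
    isPreconnected_minorArc hp.1 hq.1 ?_⟩
  rintro rfl
  obtain ⟨s, hs⟩ := hS
  have h1 := hp.2 s hs
  have h2 := hq.2 s hs
  rw [dotProduct_neg] at h1; linarith

/-- A spherical cap around `l`. -/
def cap (l : V3) (δ : ℝ) : Set V3 := {m | 1 - δ < l ⬝ᵥ m}

theorem isOpen_cap (l : V3) (δ : ℝ) : IsOpen (cap l δ) := by
  have : Continuous fun m : V3 => l ⬝ᵥ m := by fun_prop
  exact isOpen_lt continuous_const this

theorem mem_cap_self {l : V3} (hl : l ⬝ᵥ l = 1) {δ : ℝ} (hδ : 0 < δ) : l ∈ cap l δ := by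
  simp [cap, hl, hδ]

/-- Caps form a neighbourhood basis in the sphere. -/
theorem exists_cap_subset {l : V3} (hl : l ⬝ᵥ l = 1) {U : Set V3} (hU : U ∈ 𝓝 l) :
    ∃ δ, 0 < δ ∧ δ ≤ 1 ∧ ∀ m, m ⬝ᵥ m = 1 → m ∈ cap l δ → m ∈ U := by
  obtain ⟨ε, hε, h⟩ := Metric.mem_nhds_iff.1 hU
  refine ⟨min 1 (ε ^ 2 / 2), by positivity, min_le_left _ _, fun m hm hc => h ?_⟩
  have h1 : 1 - ε ^ 2 / 2 < l ⬝ᵥ m := by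
    have : 1 - min 1 (ε ^ 2 / 2) < l ⬝ᵥ m := hc
    have := min_le_right 1 (ε ^ 2 / 2)
    linarith
  rw [dot_expand] at h1 hm hl
  rw [Metric.mem_ball, dist_pi_lt_iff hε]
  intro i
  rw [Real.dist_eq]
  refine abs_lt_of_sq_lt_sq ?_ hε.le
  have h0 := sq_nonneg (m 0 - l 0)
  have h1 := sq_nonneg (m 1 - l 1)
  have h2 := sq_nonneg (m 2 - l 2)
  fin_cases i <;> simp <;> nlinarith

/-- For a unit vector `s • p + t • q` one has `1 ≤ (s + t) ^ 2`, hence `1 ≤ s + t`; as `1 - δ` is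
not negative, the bounds at `p` and `q` add up to the bound at the combination. -/
theorem minorArc_subset_cap {l p q : V3} {δ : ℝ} (hδ : δ ≤ 1) (hp : p ⬝ᵥ p = 1) (hq : q ⬝ᵥ q = 1)
    (hpc : p ∈ cap l δ) (hqc : q ∈ cap l δ) : minorArc p q ⊆ cap l δ := by
  rintro m ⟨hm, s, t, hs, ht, rfl⟩
  have h1 : 1 - δ < l ⬝ᵥ p := hpc
  have h2 : 1 - δ < l ⬝ᵥ q := hqc
  have hpq : p ⬝ᵥ q ≤ 1 := by
    have : 0 ≤ (p - q) ⬝ᵥ (p - q) := Finset.sum_nonneg fun i _ => mul_self_nonneg _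
    simp only [dotProduct_sub, sub_dotProduct, hp, hq, dotProduct_comm q p] at this
    linarith
  have hst : 1 ≤ s + t := by
    simp only [dotProduct_add, add_dotProduct, dotProduct_smul, smul_dotProduct, hp, hq,
      dotProduct_comm q p, smul_eq_mul] at hm
    nlinarith [mul_nonneg hs ht]
  show 1 - δ < l ⬝ᵥ (s • p + t • q)
  simp only [dotProduct_add, dotProduct_smul, smul_eq_mul]
  rcases hs.lt_or_eq with hs' | hs'
  · nlinarith
  · subst hs'; nlinarith

theorem cross_eq_zero_iff {p q : V3} (hq : q ≠ 0) : crossProduct p q = 0 ↔ ∃ r : ℝ, p = r • q := by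
  constructor
  · intro h
    refine ⟨(p ⬝ᵥ q) / (q ⬝ᵥ q), ?_⟩
    have h1 := cross_cross_eq_smul_sub_smul p q q
    rw [h] at h1
    simp only [map_zero, LinearMap.zero_apply] at h1
    have h2 : (q ⬝ᵥ q) • p = (p ⬝ᵥ q) • q := by
      have := sub_eq_zero.1 h1.symm
      simpa [dotProduct_comm] using this.symm
    rw [div_eq_inv_mul, mul_smul, ← h2, smul_smul, inv_mul_cancel₀ (dot_self_pos hq).ne', one_smul]
  · rintro ⟨r, rfl⟩; simp

theorem cross_ne_zero_of_unit {p q : V3} (hp : p ⬝ᵥ p = 1) (hq : q ⬝ᵥ q = 1) (h1 : p ≠ q)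
    (h2 : p ≠ -q) : crossProduct p q ≠ 0 := by
  intro h
  obtain ⟨r, hr⟩ := (cross_eq_zero_iff (ne_zero_of_unit hq)).1 h
  rcases eq_or_eq_neg_of_smul hp hq hr with h | h
  · exact h1 h
  · exact h2 h

theorem dot_cross_left (p q : V3) : crossProduct p q ⬝ᵥ p = 0 := by
  rw [dotProduct_comm]; exact dot_self_cross p q

theorem dot_cross_right (p q : V3) : crossProduct p q ⬝ᵥ q = 0 := by
  rw [dotProduct_comm]; exact dot_cross_self p q

theorem exists_orthogonal (l : V3) : ∃ g : V3, g ≠ 0 ∧ g ⬝ᵥ l = 0 := by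
  by_cases h : l 0 = 0 ∧ l 1 = 0
  · refine ⟨![1, 0, 0], fun h0 => by simpa using congrFun h0 0, ?_⟩
    rw [dot_expand]; simp [h.1]
  · refine ⟨![-l 1, l 0, 0], fun h0 => h ⟨by simpa using congrFun h0 1, by simpa using congrFun h0 0⟩,
      ?_⟩
    rw [dot_expand]; simp; ring

/-- An open cell is two-dimensional, so it is not contained in a great circle: a point of it on the
circle can be pushed off in the direction `g`. Moving from `l` a little towards such a point gives
`m`. -/
theorem exists_mem_openCell_off_circle {S : Set V3} (hfin : S.Finite) (hS : S.Nonempty)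
    (hne : (openCell S).Nonempty) {l : V3} (hl : l ∈ closedCell S) {g : V3} (hg : g ≠ 0)
    {U : Set V3} (hU : U ∈ 𝓝 l) : ∃ m ∈ openCell S, m ∈ U ∧ g ⬝ᵥ m ≠ 0 := by
  obtain ⟨p, hp, hgp⟩ : ∃ p ∈ openCell S, g ⬝ᵥ p ≠ 0 := by
    obtain ⟨p, hp⟩ := hne
    by_cases hgp : g ⬝ᵥ p = 0
    · have h1 := (tendsto_unitize_comb (p := g) hp.1).eventually (eventually_pos hfin p)
      obtain ⟨t, h2, ht⟩ := (h1.and self_mem_nhdsWithin).exists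
      have h3 : 0 < g ⬝ᵥ (p + t • g) := by
        rw [dotProduct_add, hgp, dotProduct_smul, zero_add]
        exact mul_pos ht (dot_self_pos hg)
      exact ⟨_, ⟨unitize_unit (ne_zero_of_dot_pos h3), fun s hs => h2 s hs (hp.2 s hs)⟩,
        (dot_unitize_pos h3).ne'⟩
    · exact ⟨p, hp, hgp⟩
  have h1 := tendsto_unitize_comb (p := p) hl.1
  have h2 : ∀ᶠ t in 𝓝[>] (0 : ℝ), unitize (l + t • p) ∈ openCell S := by
    filter_upwards [self_mem_nhdsWithin] with t ht
    have := unitize_comb_mem_openCell hS hp hl ht zero_le_one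
    rwa [one_smul, add_comm] at this
  have h3 : ∀ᶠ t in 𝓝[>] (0 : ℝ), g ⬝ᵥ unitize (l + t • p) ≠ 0 := by
    by_cases hgl : g ⬝ᵥ l = 0
    · filter_upwards [self_mem_nhdsWithin, h2] with t ht h4
      have h5 : l + t • p ≠ 0 := fun h => ne_zero_of_unit h4.1 (by simp [unitize, h])
      obtain ⟨r, hr, h6⟩ := exists_unitize_eq h5
      rw [h6, dotProduct_smul, dotProduct_add, hgl, dotProduct_smul, zero_add]
      exact mul_ne_zero hr.ne' (mul_ne_zero (ne_of_gt ht) hgp)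
    · have hc : Continuous fun m : V3 => g ⬝ᵥ m := by fun_prop
      exact h1.eventually (hc.continuousAt.eventually_ne hgl)
  obtain ⟨t, h4, h5, h6⟩ := (h2.and ((h1.eventually hU).and h3)).exists
  exact ⟨_, h4, h5, h6⟩

/-- A two-dimensional convex cell does not become disconnected near a point when the point is
removed. -/
theorem isPreconnected_punctured {S : Set V3} (hfin : S.Finite) (hS : Salient S)
    (hne : (openCell S).Nonempty) {l : V3} (hl : l ∈ closedCell S) {δ : ℝ} (h0 : 0 < δ)
    (h1 : δ ≤ 1) : IsPreconnected ((closedCell S ∩ cap l δ) \ {l}) := by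
  have sub : ∀ p ∈ (closedCell S ∩ cap l δ) \ {l}, ∀ q ∈ (closedCell S ∩ cap l δ) \ {l},
      l ∉ minorArc p q → ∃ t ⊆ (closedCell S ∩ cap l δ) \ {l}, p ∈ t ∧ q ∈ t ∧ IsPreconnected t := by
    intro p hp q hq h
    refine ⟨minorArc p q, fun m hm => ⟨⟨minorArc_subset_closedCell hp.1.1 hq.1.1 hm,
      minorArc_subset_cap h1 hp.1.1.1 hq.1.1.1 hp.1.2 hq.1.2 hm⟩, fun h2 => h (h2 ▸ hm)⟩,
      left_mem_minorArc hp.1.1.1, right_mem_minorArc hq.1.1.1,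
      isPreconnected_minorArc hp.1.1.1 hq.1.1.1 ?_⟩
    rintro rfl
    exact hS.neg_notMem hq.1.1 hp.1.1
  refine isPreconnected_of_forall_pair fun p hp q hq => ?_
  by_cases h : l ∈ minorArc p q
  -- Here `p`, `l`, `q` lie on one great circle. A nearby point `m` of the open cell off this circle
  -- provides a detour, since neither the arc from `p` to `m` nor the one from `q` to `m` passes
  -- through `l`.
  · obtain ⟨-, s, t, hs, ht, hlst⟩ := h
    have hlp : crossProduct l p ≠ 0 := by
      refine cross_ne_zero_of_unit hl.1 hp.1.1.1 (fun h => hp.2 h.symm) ?_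
      rintro rfl
      exact hS.neg_notMem hp.1.1 hl
    have hlq : crossProduct l q ≠ 0 := by
      refine cross_ne_zero_of_unit hl.1 hq.1.1.1 (fun h => hq.2 h.symm) ?_
      rintro rfl
      exact hS.neg_notMem hq.1.1 hl
    obtain ⟨m, hm, hmc, hgm⟩ := exists_mem_openCell_off_circle hfin hS.nonempty hne hl hlp
      ((isOpen_cap l δ).mem_nhds (mem_cap_self hl.1 h0))
    have hml : m ≠ l := by
      rintro rfl; exact hgm (dot_cross_left _ _)
    have hm' : m ∈ (closedCell S ∩ cap l δ) \ {l} := ⟨⟨openCell_subset S hm, hmc⟩, hml⟩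
    have hgq : crossProduct l p ⬝ᵥ q = 0 := by
      have h2 : t ≠ 0 := by
        rintro rfl
        apply hlp
        rw [hlst]; simp
      have h3 : crossProduct l p ⬝ᵥ l = 0 := dot_cross_left _ _
      have h4 : crossProduct l p ⬝ᵥ p = 0 := dot_cross_right _ _
      nth_rw 2 [hlst] at h3
      simpa [dotProduct_add, dotProduct_smul, h4, h2] using h3
    have off : ∀ r : V3, crossProduct l p ⬝ᵥ r = 0 → crossProduct l r ≠ 0 → l ∉ minorArc r m := by
      rintro r hr hlr ⟨-, s, t, -, -, h⟩
      have h3 : crossProduct l p ⬝ᵥ l = 0 := dot_cross_left _ _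
      nth_rw 2 [h] at h3
      have h4 : t = 0 := by simpa [dotProduct_add, dotProduct_smul, hr, hgm] using h3
      apply hlr
      rw [h, h4]; simp
    obtain ⟨t1, h1, h2, h3, h4⟩ := sub p hp m hm' (off p (dot_cross_right _ _) hlp)
    obtain ⟨t2, h1', h2', h3', h4'⟩ := sub q hq m hm' (off q hgq hlq)
    exact ⟨t1 ∪ t2, union_subset h1 h1', Or.inl h2, Or.inr h2', h4.union m h3 h3' h4'⟩
  · exact sub p hp q hq h

/-! ### The arrangement of great circles -/

/-- The intersection points of distinct circles of the arrangement. -/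
def arrVertices (V : Set V3) : Set V3 :=
  {l | l ⬝ᵥ l = 1 ∧ ∃ v ∈ V, ∃ w ∈ V, crossProduct v w ≠ 0 ∧ v ⬝ᵥ l = 0 ∧ w ⬝ᵥ l = 0}

theorem exists_smul_cross {v w l : V3} (h : crossProduct v w ≠ 0) (hv : v ⬝ᵥ l = 0)
    (hw : w ⬝ᵥ l = 0) : ∃ r : ℝ, l = r • crossProduct v w := by
  refine (cross_eq_zero_iff h).1 ?_
  rw [dot_expand] at hv hw
  ext i
  fin_cases i <;> simp [cross_apply]
  · linear_combination v 0 * hw - w 0 * hv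
  · linear_combination v 1 * hw - w 1 * hv
  · linear_combination v 2 * hw - w 2 * hv

theorem finite_arrVertices {V : Set V3} (hV : V.Finite) : (arrVertices V).Finite := by
  refine (hV.biUnion fun v _ => hV.biUnion fun w _ =>
    (Set.toFinite {unitize (crossProduct v w), -unitize (crossProduct v w)})).subset ?_
  rintro l ⟨hl, v, hv, w, hw, h, h1, h2⟩
  simp only [mem_iUnion]
  refine ⟨v, hv, w, hw, ?_⟩
  obtain ⟨r, hr⟩ := exists_smul_cross h h1 h2
  obtain ⟨r', h4, h3⟩ := exists_unitize_eq h
  refine eq_or_eq_neg_of_smul hl (unitize_unit h) (r := r * r'⁻¹) ?_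
  rw [h3, smul_smul, mul_assoc, inv_mul_cancel₀ h4.ne', mul_one, hr]

/-- The closed cell of the arrangement whose relative interior contains `l`. -/
def signCell (V : Set V3) (l : V3) : Set V3 :=
  {m | m ⬝ᵥ m = 1 ∧ ∀ v ∈ V, (v ⬝ᵥ l = 0 → v ⬝ᵥ m = 0) ∧ (0 < v ⬝ᵥ l → 0 ≤ v ⬝ᵥ m) ∧
    (v ⬝ᵥ l < 0 → v ⬝ᵥ m ≤ 0)}

theorem self_mem_signCell {V : Set V3} {l : V3} (hl : l ⬝ᵥ l = 1) : l ∈ signCell V l :=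
  ⟨hl, fun _ _ => ⟨id, le_of_lt, le_of_lt⟩⟩

theorem signCell_subset_closedCell {V S : Set V3} (hS : S ⊆ V) {l : V3} (hl : l ∈ closedCell S) :
    signCell V l ⊆ closedCell S := by
  refine fun m hm => ⟨hm.1, fun s hs => ?_⟩
  rcases (hl.2 s hs).lt_or_eq with h | h
  · exact (hm.2 s (hS hs)).2.1 h
  · exact ((hm.2 s (hS hs)).1 h.symm).ge

/-- A circle through `m` that is not the circle of `v₀` would make `m` a vertex, so the circles
through `m` are exactly those through `l`. On all other circles the weak sign inherited from `l` is
strict at `m`. Thus edges of the arrangement that meet off the vertices coincide. -/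
theorem signCell_eq {V : Set V3} {l m v₀ : V3} (hv₀ : v₀ ∈ V)
    (h0 : v₀ ≠ 0) (hl0 : v₀ ⬝ᵥ l = 0) (hm : m ∈ signCell V l)
    (hmV : m ∉ arrVertices V) : signCell V m = signCell V l := by
  have hne : ∀ v ∈ V, v ⬝ᵥ m = 0 → v ⬝ᵥ l = 0 := by
    intro v hv h
    have h1 : crossProduct v v₀ = 0 := by
      by_contra h1
      exact hmV ⟨hm.1, v, hv, v₀, hv₀, h1, h, (hm.2 v₀ hv₀).1 hl0⟩
    obtain ⟨r, rfl⟩ := (cross_eq_zero_iff h0).1 h1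
    simp [hl0]
  ext k
  refine and_congr_right fun hk => forall₂_congr fun v hv => ?_
  have hmv := hm.2 v hv
  have := hne v hv
  rcases lt_trichotomy (v ⬝ᵥ l) 0 with h | h | h
  · have h1 : v ⬝ᵥ m < 0 := lt_of_le_of_ne (hmv.2.2 h) fun h2 => h.ne (this h2)
    simp [h, h1, h.ne, h1.ne, h.le.not_gt, h1.le.not_gt]
  · simp [h, hmv.1 h]
  · have h1 : 0 < v ⬝ᵥ m := lt_of_le_of_ne (hmv.2.1 h) fun h2 => h.ne' (this h2.symm)
    simp [h, h1, h.ne', h1.ne', h.le.not_gt, h1.le.not_gt]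

/-- A functional that is positive on a closed cell without antipodal points. -/
theorem Salient.exists_functional {S : Set V3} (hfin : S.Finite) (hS : Salient S) :
    ∃ c : V3, (∀ m : V3, (∀ s ∈ S, 0 ≤ s ⬝ᵥ m) → m ≠ 0 → 0 < c ⬝ᵥ m) := by
  refine ⟨∑ s ∈ hfin.toFinset, s, fun m hm h0 => ?_⟩
  have h1 : (∑ s ∈ hfin.toFinset, s) ⬝ᵥ m = ∑ s ∈ hfin.toFinset, s ⬝ᵥ m := sum_dotProduct _ _ _
  rw [h1]
  refine lt_of_le_of_ne (Finset.sum_nonneg fun s hs => hm s (hfin.mem_toFinset.1 hs)) fun h2 => h0 ?_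
  refine hS m fun s hs => ?_
  exact (Finset.sum_eq_zero_iff_of_nonneg fun s hs => hm s (hfin.mem_toFinset.1 hs)).1 h2.symm s
    (hfin.mem_toFinset.2 hs)

/-- The one-dimensional closed cells in a polygon are arcs between consecutive vertices. -/
theorem signCell_eq_minorArc {V S : Set V3} (hV : V.Finite) (hSV : S ⊆ V) (hS : Salient S)
    {l v₀ : V3} (hl : l ∈ closedCell S) (hlV : l ∉ arrVertices V) (hv₀ : v₀ ∈ V) (h0 : v₀ ≠ 0)
    (hl0 : v₀ ⬝ᵥ l = 0) :
    ∃ p ∈ arrVertices V, ∃ q ∈ arrVertices V, p ≠ q ∧ signCell V l = minorArc p q ∧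
      ∀ m ∈ signCell V l, m ∈ arrVertices V → m = p ∨ m = q := by
  obtain ⟨c, hc⟩ := hS.exists_functional (hV.subset hSV)
  have hcl : 0 < c ⬝ᵥ l := hc l hl.2 (ne_zero_of_unit hl.1)
  have hpar : ∀ v ∈ V, v ⬝ᵥ l = 0 → ∃ r : ℝ, v = r • v₀ := by
    intro v hv h
    refine (cross_eq_zero_iff h0).1 ?_
    by_contra h1
    exact hlV ⟨hl.1, v, hv, v₀, hv₀, h1, h, hl0⟩
  -- In the affine plane `c = 1` the circle of `v₀` is a straight line with direction `d`, and its
  -- intersection with the polygon is a bounded segment.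
  set d : V3 := crossProduct v₀ c with hd
  have hd0 : d ≠ 0 := by
    intro h
    have hc0 : c ≠ 0 := by rintro rfl; simp at hcl
    obtain ⟨r, hr⟩ := (cross_eq_zero_iff hc0).1 h
    have hr0 : r ≠ 0 := by rintro rfl; exact h0 (by simpa using hr)
    rw [hr, smul_dotProduct, smul_eq_mul] at hl0
    rcases mul_eq_zero.1 hl0 with h | h
    · exact hr0 h
    · exact hcl.ne' h
  have hv₀d : v₀ ⬝ᵥ d = 0 := dot_self_cross _ _
  have hcd : c ⬝ᵥ d = 0 := dot_cross_self _ _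
  set l' : V3 := (c ⬝ᵥ l)⁻¹ • l with hl'
  have hcl' : c ⬝ᵥ l' = 1 := by
    rw [hl', dotProduct_smul, smul_eq_mul, inv_mul_cancel₀ hcl.ne']
  have hinv := inv_pos.2 hcl
  -- signs along the line `l' + t d`
  set σ : V3 → ℝ := fun v => SignType.sign (v ⬝ᵥ l) with hσ
  set N : Set V3 := {v ∈ V | v ⬝ᵥ l ≠ 0} with hN
  have hNfin : N.Finite := hV.subset fun v h => h.1
  have hσl : ∀ v ∈ N, 0 < σ v * (v ⬝ᵥ l') := by
    intro v hv
    rw [hl', dotProduct_smul, smul_eq_mul]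
    rcases lt_or_gt_of_ne hv.2 with h | h
    · simp only [hσ, sign_neg h]; simp; nlinarith
    · simp only [hσ, sign_pos h]; simp; positivity
  have hmem : ∀ m : V3, m ⬝ᵥ m = 1 → v₀ ⬝ᵥ m = 0 →
      (m ∈ signCell V l ↔ ∀ v ∈ N, 0 ≤ σ v * (v ⬝ᵥ m)) := by
    intro m hm hm0
    constructor
    · intro h v hv
      rcases lt_or_gt_of_ne hv.2 with h1 | h1
      · simp only [hσ, sign_neg h1]; have := (h.2 v hv.1).2.2 h1; simp; linarith
      · simp only [hσ, sign_pos h1]; have := (h.2 v hv.1).2.1 h1; simp; linarith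
    · intro h
      refine ⟨hm, fun v hv => ⟨fun h1 => ?_, fun h1 => ?_, fun h1 => ?_⟩⟩
      · obtain ⟨r, rfl⟩ := hpar v hv h1; simp [hm0]
      · have := h v ⟨hv, h1.ne'⟩; simp only [hσ, sign_pos h1] at this; simpa using this
      · have := h v ⟨hv, h1.ne⟩; simp only [hσ, sign_neg h1] at this; simpa using this
  set z : ℝ → V3 := fun t => l' + t • d with hz
  have hcz : ∀ t, c ⬝ᵥ z t = 1 := fun t => by simp [hz, dotProduct_add, hcd, hcl']
  have hz0 : ∀ t, z t ≠ 0 := fun t => ne_zero_of_dot_pos (c := c) (by rw [hcz]; exact one_pos)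
  have hv₀z : ∀ t, v₀ ⬝ᵥ z t = 0 := fun t => by simp [hz, dotProduct_add, hv₀d, hl', hl0]
  have hzdot : ∀ v t, v ⬝ᵥ z t = v ⬝ᵥ l' + t * (v ⬝ᵥ d) := fun v t => by
    simp [hz, dotProduct_add]
  set T : Set ℝ := {t | ∀ v ∈ N, 0 ≤ σ v * (v ⬝ᵥ z t)} with hT
  have hTclosed : IsClosed T := by
    have : T = ⋂ v ∈ N, {t | 0 ≤ σ v * (v ⬝ᵥ z t)} := by ext t; simp [hT]
    rw [this]
    refine isClosed_biInter fun v _ => isClosed_le continuous_const ?_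
    simp only [hzdot]; fun_prop
  have h0T : (0 : ℝ) ∈ T := fun v hv => by simpa [hz] using (hσl v hv).le
  have hSN : ∀ s ∈ S, s ⬝ᵥ d ≠ 0 → s ∈ N ∧ σ s = 1 := by
    intro s hs hsd
    have : s ⬝ᵥ l ≠ 0 := by
      intro h
      obtain ⟨r, rfl⟩ := hpar s (hSV hs) h
      exact hsd (by simp [hv₀d])
    refine ⟨⟨hSV hs, this⟩, ?_⟩
    have h1 : 0 < s ⬝ᵥ l := lt_of_le_of_ne (hl.2 s hs) this.symm
    simp [hσ, sign_pos h1]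
  -- The form `c` vanishes on `d` but is positive on nonzero vectors satisfying all constraints, so
  -- neither `d` nor `-d` satisfies them. This bounds the segment at both ends.
  have hneg : ∃ s ∈ S, s ⬝ᵥ d < 0 := by
    by_contra! h
    exact (hc d h hd0).ne' hcd
  have hpos : ∃ s ∈ S, 0 < s ⬝ᵥ d := by
    by_contra! h
    have := hc (-d) (fun s hs => by have := h s hs; rw [dotProduct_neg]; linarith)
      (neg_ne_zero.2 hd0)
    rw [dotProduct_neg, hcd] at this
    simp at this
  have hbdd : Bornology.IsBounded T := by
    obtain ⟨s, hs, hsd⟩ := hneg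
    obtain ⟨s', hs', hsd'⟩ := hpos
    refine (Metric.isBounded_Icc (-(s' ⬝ᵥ l') / (s' ⬝ᵥ d)) (-(s ⬝ᵥ l') / (s ⬝ᵥ d))).subset
      fun t ht => ⟨?_, ?_⟩
    · obtain ⟨h1, h2⟩ := hSN s' hs' hsd'.ne'
      have := ht s' h1
      rw [h2, hzdot, one_mul] at this
      rw [div_le_iff₀ hsd']; linarith
    · obtain ⟨h1, h2⟩ := hSN s hs hsd.ne
      have := ht s h1
      rw [h2, hzdot, one_mul] at this
      rw [le_div_iff_of_neg hsd]; linarith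
  have hTc : IsCompact T := Metric.isCompact_of_isClosed_isBounded hTclosed hbdd
  obtain ⟨a, haT, ha⟩ := hTc.exists_isLeast ⟨0, h0T⟩
  obtain ⟨b, hbT, hb⟩ := hTc.exists_isGreatest ⟨0, h0T⟩
  have hopen : ∀ t, (∀ v ∈ N, 0 < σ v * (v ⬝ᵥ z t)) → T ∈ 𝓝 t := by
    intro t ht
    have : ∀ᶠ t' in 𝓝 t, ∀ v ∈ N, 0 < σ v * (v ⬝ᵥ z t') := by
      rw [Filter.eventually_all_finite hNfin]
      intro v hv
      have hcont : Continuous fun t => σ v * (v ⬝ᵥ z t) := by simp only [hzdot]; fun_prop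
      exact hcont.continuousAt.eventually (lt_mem_nhds (ht v hv))
    filter_upwards [this] with t' h v hv using (h v hv).le
  have hTnhd : T ∈ 𝓝 0 := hopen 0 fun v hv => by simpa [hz] using hσl v hv
  have ha0 : a < 0 := by
    obtain ⟨ε, hε, h⟩ := Metric.mem_nhds_iff.1 hTnhd
    have := ha (h (show -(ε / 2) ∈ Metric.ball 0 ε by
      rw [Metric.mem_ball, dist_zero_right, norm_neg, Real.norm_eq_abs, abs_of_pos] <;> linarith))
    linarith
  have hb0 : 0 < b := by
    obtain ⟨ε, hε, h⟩ := Metric.mem_nhds_iff.1 hTnhd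
    have := hb (h (show ε / 2 ∈ Metric.ball 0 ε by
      rw [Metric.mem_ball, dist_zero_right, Real.norm_eq_abs, abs_of_pos] <;> linarith))
    linarith
  -- At an end of the parameter interval some circle not passing through `l` is met; it differs from
  -- the circle of `v₀`, so the point is a vertex.
  have hvert : ∀ t ∈ T, T ∉ 𝓝 t → unitize (z t) ∈ arrVertices V := by
    intro t ht h
    obtain ⟨v, hv, h1⟩ : ∃ v ∈ N, v ⬝ᵥ z t = 0 := by
      by_contra! h1
      refine h (hopen t fun v hv => lt_of_le_of_ne (ht v hv) (Ne.symm ?_))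
      refine mul_ne_zero (fun h2 => ?_) (h1 v hv)
      have := hσl v hv
      rw [h2, zero_mul] at this
      exact lt_irrefl _ this
    obtain ⟨r, -, hr⟩ := exists_unitize_eq (hz0 t)
    refine ⟨unitize_unit (hz0 t), v, hv.1, v₀, hv₀, fun h2 => ?_, ?_, ?_⟩
    · obtain ⟨r, rfl⟩ := (cross_eq_zero_iff h0).1 h2
      exact hv.2 (by simp [hl0])
    · rw [hr, dotProduct_smul, h1, smul_zero]
    · rw [hr, dotProduct_smul, hv₀z, smul_zero]
  have haN : T ∉ 𝓝 a := by
    intro h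
    obtain ⟨ε, hε, h⟩ := Metric.mem_nhds_iff.1 h
    have := ha (h (show a - ε / 2 ∈ Metric.ball a ε by
      rw [Metric.mem_ball, Real.dist_eq, sub_sub_cancel_left, abs_neg, abs_of_pos] <;> linarith))
    linarith
  have hbN : T ∉ 𝓝 b := by
    intro h
    obtain ⟨ε, hε, h⟩ := Metric.mem_nhds_iff.1 h
    have := hb (h (show b + ε / 2 ∈ Metric.ball b ε by
      rw [Metric.mem_ball, Real.dist_eq, add_sub_cancel_left, abs_of_pos] <;> linarith))
    linarith
  have hparam : ∀ m : V3, m ⬝ᵥ m = 1 → m ∈ signCell V l →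
      ∃ t ∈ Icc a b, 0 < c ⬝ᵥ m ∧ m = (c ⬝ᵥ m) • z t := by
    intro m hm1 hm
    have hm0 : v₀ ⬝ᵥ m = 0 := (hm.2 v₀ hv₀).1 hl0
    have hcm : 0 < c ⬝ᵥ m :=
      hc m (signCell_subset_closedCell hSV hl hm).2 (ne_zero_of_unit hm1)
    obtain ⟨r, hr⟩ := exists_smul_cross (v := v₀) (w := c) (l := m - (c ⬝ᵥ m) • l') hd0
      (by simp [dotProduct_sub, hm0, hl', hl0]) (by simp [dotProduct_sub, hcl'])
    have hmz : m = (c ⬝ᵥ m) • z (r / (c ⬝ᵥ m)) := by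
      simp only [hz, smul_add, smul_smul]
      rw [mul_div_cancel₀ _ hcm.ne', ← hd] at *
      rw [← hr]; abel
    have htT : r / (c ⬝ᵥ m) ∈ T := by
      intro v hv
      have := (hmem m hm1 hm0).1 hm v hv
      rw [hmz, dotProduct_smul, smul_eq_mul, mul_left_comm] at this
      exact nonneg_of_mul_nonneg_right this hcm
    exact ⟨_, ⟨ha htT, hb htT⟩, hcm, hmz⟩
  have hu : ∀ t ∈ T, unitize (z t) ∈ signCell V l := by
    intro t ht
    obtain ⟨r, hr, h⟩ := exists_unitize_eq (hz0 t)
    refine (hmem _ (unitize_unit (hz0 t)) ?_).2 fun v hv => ?_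
    · rw [h, dotProduct_smul, hv₀z, smul_zero]
    · rw [h, dotProduct_smul, smul_eq_mul, mul_left_comm]
      exact mul_nonneg hr.le (ht v hv)
  obtain ⟨ra, hra, hpa⟩ := exists_unitize_eq (hz0 a)
  obtain ⟨rb, hrb, hpb⟩ := exists_unitize_eq (hz0 b)
  refine ⟨unitize (z a), hvert a haT haN, unitize (z b), hvert b hbT hbN, ?_, ?_, ?_⟩
  · intro h
    obtain ⟨r, hr, h1⟩ := (unitize_eq_iff (hz0 a) (hz0 b)).1 h
    have h2 := hcz a
    rw [h1, dotProduct_smul, hcz, smul_eq_mul, mul_one] at h2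
    rw [h2, one_smul] at h1
    have h3 : (b - a) • d = 0 := by
      have : z b - z a = (b - a) • d := by simp [hz, sub_smul]
      rw [← this, h1, sub_self]
    rcases smul_eq_zero.1 h3 with h | h
    · linarith
    · exact hd0 h
  · ext m
    constructor
    · intro hm
      obtain ⟨t, ⟨hta, htb⟩, hcm, hmz⟩ := hparam m hm.1 hm
      have hab : 0 < b - a := by linarith
      refine ⟨hm.1, (c ⬝ᵥ m) * ((b - t) / (b - a)) * ra⁻¹, (c ⬝ᵥ m) * ((t - a) / (b - a)) * rb⁻¹,
        ?_, ?_, ?_⟩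
      · have := sub_nonneg.2 htb; positivity
      · have := sub_nonneg.2 hta; positivity
      · rw [hpa, hpb, smul_smul, smul_smul, mul_assoc _ ra⁻¹, mul_assoc _ rb⁻¹,
          inv_mul_cancel₀ hra.ne', inv_mul_cancel₀ hrb.ne', mul_one, mul_one, mul_smul, mul_smul,
          ← smul_add]
        nth_rw 1 [hmz]
        congr 1
        simp only [hz, smul_add, smul_smul]
        have e1 : (b - t) / (b - a) * a + (t - a) / (b - a) * b = t := by field_simp; ring
        have e2 : (b - t) / (b - a) + (t - a) / (b - a) = 1 := by field_simp; ring
        calc l' + t • d = ((b - t) / (b - a) + (t - a) / (b - a)) • l' +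
              ((b - t) / (b - a) * a + (t - a) / (b - a) * b) • d := by rw [e1, e2, one_smul]
          _ = _ := by rw [add_smul, add_smul]; abel
    · rintro ⟨hm, s, t, hs, ht, rfl⟩
      have h1 := hu a haT
      have h2 := hu b hbT
      refine (hmem _ hm ?_).2 fun v hv => ?_
      · rw [dotProduct_add, dotProduct_smul, dotProduct_smul, (h1.2 v₀ hv₀).1 hl0,
          (h2.2 v₀ hv₀).1 hl0]; simp
      · have h3 := (hmem _ h1.1 ((h1.2 v₀ hv₀).1 hl0)).1 h1 v hv
        have h4 := (hmem _ h2.1 ((h2.2 v₀ hv₀).1 hl0)).1 h2 v hv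
        rw [dotProduct_add, dotProduct_smul, dotProduct_smul, mul_add, smul_eq_mul, smul_eq_mul,
          mul_left_comm, mul_left_comm (σ v)]
        positivity
  · intro m hm hmV
    obtain ⟨t, ⟨hta, htb⟩, hcm, hmz⟩ := hparam m hm.1 hm
    have hmu : m = unitize (z t) := by
      rw [← unitize_of_unit hm.1, hmz]; exact unitize_smul hcm _
    by_contra! hne
    have hta' : a < t := lt_of_le_of_ne hta fun h => hne.1 (by rw [hmu, h])
    have htb' : t < b := lt_of_le_of_ne htb fun h => hne.2 (by rw [hmu, h])
    -- An affine function that is positive at `0` and nonnegative at `a < 0 < b` is positive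
    -- strictly between `a` and `b`.
    have hstrict : ∀ v ∈ N, 0 < σ v * (v ⬝ᵥ z t) := by
      intro v hv
      have h1 := hσl v hv
      have h2 := haT v hv
      have h3 := hbT v hv
      rw [hzdot] at h2 h3 ⊢
      rcases le_total 0 t with h | h
      · have : b * (σ v * (v ⬝ᵥ l' + t * (v ⬝ᵥ d))) =
          (b - t) * (σ v * (v ⬝ᵥ l')) + t * (σ v * (v ⬝ᵥ l' + b * (v ⬝ᵥ d))) := by ring
        have h5 : 0 < b * (σ v * (v ⬝ᵥ l' + t * (v ⬝ᵥ d))) := by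
          rw [this]; have := sub_pos.2 htb'; positivity
        exact pos_of_mul_pos_right h5 hb0.le
      · have : (-a) * (σ v * (v ⬝ᵥ l' + t * (v ⬝ᵥ d))) =
          (t - a) * (σ v * (v ⬝ᵥ l')) + (-t) * (σ v * (v ⬝ᵥ l' + a * (v ⬝ᵥ d))) := by ring
        have h5 : 0 < (-a) * (σ v * (v ⬝ᵥ l' + t * (v ⬝ᵥ d))) := by
          rw [this]; have := sub_pos.2 hta'; have := neg_nonneg.2 h; positivity
        exact pos_of_mul_pos_right h5 (by linarith)
    have hmN : ∀ v ∈ V, v ⬝ᵥ m = 0 → ∃ r : ℝ, v = r • v₀ := by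
      intro v hv h
      by_cases hvl : v ⬝ᵥ l = 0
      · exact hpar v hv hvl
      · have := hstrict v ⟨hv, hvl⟩
        rw [hmz, dotProduct_smul, smul_eq_mul] at h
        rw [(mul_eq_zero.1 h).resolve_left hcm.ne', mul_zero] at this
        exact absurd this (lt_irrefl _)
    obtain ⟨-, v, hv, w, hw, hvw, h1, h2⟩ := hmV
    obtain ⟨r, rfl⟩ := hmN v hv h1
    obtain ⟨r', rfl⟩ := hmN w hw h2
    simp at hvw

/-! ### Geodesic arcs -/

/-- An arc of a great circle of length less than `π` is the minor arc between its endpoints. -/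
theorem trig_image_eq_minorArc {u w : V3} (hu : u ⬝ᵥ u = 1) (hw : w ⬝ᵥ w = 1) (huw : u ⬝ᵥ w = 0)
    {α β : ℝ} (h0 : α < β) (h1 : β < α + Real.pi) :
    (fun θ : ℝ => Real.cos θ • u + Real.sin θ • w) '' Icc α β =
      minorArc (Real.cos α • u + Real.sin α • w) (Real.cos β • u + Real.sin β • w) := by
  have hs : 0 < Real.sin (β - α) := Real.sin_pos_of_pos_of_lt_pi (by linarith) (by linarith)
  have hunit : ∀ x y : ℝ, (x • u + y • w) ⬝ᵥ (x • u + y • w) = x ^ 2 + y ^ 2 := by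
    intro x y
    simp only [dotProduct_add, add_dotProduct, dotProduct_smul, smul_dotProduct, hu, hw, huw,
      dotProduct_comm w u, smul_eq_mul]
    ring
  ext l
  constructor
  · rintro ⟨θ, ⟨ha, hb⟩, rfl⟩
    -- These are the coefficients of spherical linear interpolation.
    refine ⟨?_, Real.sin (β - θ) / Real.sin (β - α), Real.sin (θ - α) / Real.sin (β - α), ?_, ?_, ?_⟩
    · show (Real.cos θ • u + Real.sin θ • w) ⬝ᵥ (Real.cos θ • u + Real.sin θ • w) = 1
      rw [hunit, Real.cos_sq_add_sin_sq]
    · exact div_nonneg (Real.sin_nonneg_of_nonneg_of_le_pi (by linarith) (by linarith)) hs.le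
    · exact div_nonneg (Real.sin_nonneg_of_nonneg_of_le_pi (by linarith) (by linarith)) hs.le
    · have e1 : Real.cos θ = Real.sin (β - θ) / Real.sin (β - α) * Real.cos α +
          Real.sin (θ - α) / Real.sin (β - α) * Real.cos β := by
        field_simp
        rw [Real.sin_sub, Real.sin_sub, Real.sin_sub]; ring
      have e2 : Real.sin θ = Real.sin (β - θ) / Real.sin (β - α) * Real.sin α +
          Real.sin (θ - α) / Real.sin (β - α) * Real.sin β := by
        field_simp
        rw [Real.sin_sub, Real.sin_sub, Real.sin_sub]; ring
      show Real.cos θ • u + Real.sin θ • w = _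
      nth_rw 1 [e1, e2]
      simp only [smul_add, smul_smul, add_smul]
      abel
  · rintro ⟨hl, s, t, hs0, ht0, rfl⟩
    -- `X` and `Y` are the coordinates in the frame `u`, `w` rotated by `α`, so the point has angle
    -- `α + arccos X` because `Y` is nonnegative.
    set X := s + t * Real.cos (β - α) with hX
    set Y := t * Real.sin (β - α) with hY
    have hY0 : 0 ≤ Y := mul_nonneg ht0 hs.le
    have eX : s * Real.cos α + t * Real.cos β = X * Real.cos α - Y * Real.sin α := by
      have : Real.cos β = Real.cos (β - α) * Real.cos α - Real.sin (β - α) * Real.sin α := by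
        rw [← Real.cos_add, sub_add_cancel]
      rw [hX, hY, this]; ring
    have eY : s * Real.sin α + t * Real.sin β = X * Real.sin α + Y * Real.cos α := by
      have : Real.sin β = Real.sin (β - α) * Real.cos α + Real.cos (β - α) * Real.sin α := by
        rw [← Real.sin_add, sub_add_cancel]
      rw [hX, hY, this]; ring
    have hform : s • (Real.cos α • u + Real.sin α • w) + t • (Real.cos β • u + Real.sin β • w) =
        (X * Real.cos α - Y * Real.sin α) • u + (X * Real.sin α + Y * Real.cos α) • w := by
      rw [← eX, ← eY]
      simp only [smul_add, smul_smul, add_smul]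
      abel
    have hXY : X ^ 2 + Y ^ 2 = 1 := by
      rw [hform, hunit] at hl
      have := Real.sin_sq_add_cos_sq α
      nlinarith
    have hX1 : -1 ≤ X ∧ X ≤ 1 := ⟨by nlinarith, by nlinarith⟩
    have hcos : Real.cos (Real.arccos X) = X := Real.cos_arccos hX1.1 hX1.2
    have hsin : Real.sin (Real.arccos X) = Y := by
      rw [Real.sin_arccos, show 1 - X ^ 2 = Y ^ 2 by linarith, Real.sqrt_sq hY0]
    have hφ0 := Real.arccos_nonneg X
    have hφ1 := Real.arccos_le_pi X
    refine ⟨α + Real.arccos X, ⟨by linarith, ?_⟩, ?_⟩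
    -- The sine of the remaining angle `β - α - arccos X` equals `s * sin (β - α)`, which is
    -- nonnegative, so the angle does not pass `β`.
    · by_contra! h
      have h2 : Real.sin (β - α - Real.arccos X) < 0 :=
        Real.sin_neg_of_neg_of_neg_pi_lt (by linarith) (by linarith)
      rw [Real.sin_sub, hcos, hsin, hX, hY] at h2
      have h3 : 0 ≤ s * Real.sin (β - α) := mul_nonneg hs0 hs.le
      nlinarith
    · show Real.cos (α + Real.arccos X) • u + Real.sin (α + Real.arccos X) • w = _
      rw [hform, Real.cos_add, Real.sin_add, hcos, hsin]
      congr 2 <;> ring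

theorem IsGeodesicArc.ne {X : Type} [TopologicalSpace X] {dev : X → V3} {a : Set X} {x y : X}
    (h : IsGeodesicArc dev a x y) : x ≠ y := by
  obtain ⟨γ, -, -, -, -, hinj, -, rfl, rfl, -⟩ := h
  exact fun h => zero_ne_one (hinj h)

theorem IsGeodesicArc.left_mem {X : Type} [TopologicalSpace X] {dev : X → V3} {a : Set X} {x y : X}
    (h : IsGeodesicArc dev a x y) : x ∈ a := by
  obtain ⟨γ, -, -, -, -, -, rfl, rfl, -, -⟩ := h
  exact mem_range_self _

theorem IsGeodesicArc.right_mem {X : Type} [TopologicalSpace X] {dev : X → V3} {a : Set X}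
    {x y : X} (h : IsGeodesicArc dev a x y) : y ∈ a := by
  obtain ⟨γ, -, -, -, -, -, rfl, -, rfl, -⟩ := h
  exact mem_range_self _

/-- A geodesic arc which develops into a cell develops onto a minor arc. -/
theorem IsGeodesicArc.image_eq {X : Type} [TopologicalSpace X] {dev : X → V3} {a : Set X} {x y : X}
    (h : IsGeodesicArc dev a x y) {S : Set V3} (hS : Salient S) (ha : dev '' a ⊆ closedCell S) :
    dev '' a = minorArc (dev x) (dev y) := by
  obtain ⟨γ, u, w, θ, -, -, rfl, rfl, rfl, hu, hw, huw, hθc, hθ, hdev⟩ := h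
  have hmem : ∀ t, dev (γ t) ∈ closedCell S := fun t => ha (mem_image_of_mem _ (mem_range_self t))
  have h01 : θ 0 < θ 1 := hθ zero_lt_one
  have hlt : θ 1 < θ 0 + Real.pi := by
    -- An arc of length at least `π` contains the antipode of its starting point, which a salient
    -- cell excludes.
    by_contra! h
    obtain ⟨t, ht⟩ := mem_range_of_exists_le_of_exists_ge hθc
      (⟨0, by linarith [Real.pi_pos]⟩ : ∃ t, θ t ≤ θ 0 + Real.pi) ⟨1, h⟩
    refine hS.neg_notMem (hmem 0) ?_
    have := hmem t
    rw [hdev, ht, Real.cos_add_pi, Real.sin_add_pi] at this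
    rw [hdev]
    simpa [add_comm] using this
  have hrange : range θ = Icc (θ 0) (θ 1) := by
    ext r
    constructor
    · rintro ⟨t, rfl⟩
      exact ⟨hθ.monotone t.2.1, hθ.monotone t.2.2⟩
    · intro hr
      exact mem_range_of_exists_le_of_exists_ge hθc ⟨0, hr.1⟩ ⟨1, hr.2⟩
  rw [hdev, hdev, ← trig_image_eq_minorArc hu hw huw h01 hlt, ← hrange, ← range_comp, ← range_comp]
  exact congrArg range (funext hdev)

/-- A continuous lift of a minor arc is a geodesic arc. -/
theorem isGeodesicArc_of_lift {X : Type} [TopologicalSpace X] {dev : X → V3} {p q : V3}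
    (hp : p ⬝ᵥ p = 1) (hq : q ⬝ᵥ q = 1) (h1 : p ≠ q) (h2 : p ≠ -q) (g : minorArc p q → X)
    (hg : Continuous g) (hdev : ∀ l, dev (g l) = l) :
    IsGeodesicArc dev (range g) (g ⟨p, left_mem_minorArc hp⟩) (g ⟨q, right_mem_minorArc hq⟩) := by
  have hlt1 : p ⬝ᵥ q < 1 := by
    have h4 := dot_self_pos (sub_ne_zero.2 h1)
    simp only [dotProduct_sub, sub_dotProduct, hp, hq, dotProduct_comm q p] at h4
    linarith
  have hlt2 : -1 < p ⬝ᵥ q := by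
    have h4 := dot_self_pos (v := p + q) fun h => h2 (eq_neg_of_add_eq_zero_left h)
    simp only [dotProduct_add, add_dotProduct, hp, hq, dotProduct_comm q p] at h4
    linarith
  set Δ := Real.arccos (p ⬝ᵥ q) with hΔ
  have hcos : Real.cos Δ = p ⬝ᵥ q := Real.cos_arccos hlt2.le hlt1.le
  have hΔ0 : 0 < Δ := Real.arccos_pos.2 hlt1
  have hΔ1 : Δ < Real.pi := by
    refine lt_of_le_of_ne (Real.arccos_le_pi _) fun h => ?_
    change Δ = Real.pi at h
    rw [h, Real.cos_pi] at hcos; linarith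
  have hs : 0 < Real.sin Δ := Real.sin_pos_of_pos_of_lt_pi hΔ0 hΔ1
  have hsc := Real.sin_sq_add_cos_sq Δ
  -- The arc is parametrized by the angle from `p`; `w` is the unit tangent vector at `p` pointing
  -- towards `q`.
  set w : V3 := (Real.sin Δ)⁻¹ • (q - Real.cos Δ • p) with hw
  have hpw : p ⬝ᵥ w = 0 := by
    rw [hw, dotProduct_smul, dotProduct_sub, dotProduct_smul, hp, hcos]; simp
  have hww : w ⬝ᵥ w = 1 := by
    simp only [hw, dotProduct_sub, sub_dotProduct, dotProduct_smul, smul_dotProduct, hp, hq,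
      dotProduct_comm q p, ← hcos, smul_eq_mul]
    field_simp
    nlinarith
  have hqw : Real.cos Δ • p + Real.sin Δ • w = q := by
    rw [hw, smul_smul, mul_inv_cancel₀ hs.ne', one_smul]; abel
  have himg := trig_image_eq_minorArc hp hww hpw hΔ0 (by linarith : Δ < 0 + Real.pi)
  rw [hqw, Real.cos_zero, Real.sin_zero, one_smul, zero_smul, add_zero] at himg
  have hmem : ∀ t : unitInterval, Real.cos (t * Δ) • p + Real.sin (t * Δ) • w ∈ minorArc p q := by
    intro t
    rw [← himg]
    exact ⟨t * Δ, ⟨mul_nonneg t.2.1 hΔ0.le, mul_le_of_le_one_left hΔ0.le t.2.2⟩, rfl⟩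
  have hθmono : StrictMono fun t : unitInterval => (t : ℝ) * Δ := fun s t h =>
    mul_lt_mul_of_pos_right h hΔ0
  refine ⟨fun t => g ⟨_, hmem t⟩, p, w, fun t => t * Δ, ?_, ?_, ?_, ?_, ?_, hp, hww, hpw, by fun_prop,
    hθmono, fun t => hdev _⟩
  · exact hg.comp (Continuous.subtype_mk (by fun_prop) _)
  · intro s t h
    have h3 := congrArg dev h
    simp only [hdev] at h3
    have h4 := congrArg (p ⬝ᵥ ·) h3
    simp only [dotProduct_add, dotProduct_smul, hp, hpw, smul_eq_mul, mul_one, mul_zero,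
      add_zero] at h4
    have hI : ∀ t : unitInterval, (t : ℝ) * Δ ∈ Icc 0 Real.pi := fun t =>
      ⟨mul_nonneg t.2.1 hΔ0.le, (mul_le_of_le_one_left hΔ0.le t.2.2).trans hΔ1.le⟩
    exact hθmono.injective (Real.injOn_cos (hI s) (hI t) h4)
  · apply subset_antisymm
    · rintro _ ⟨t, rfl⟩; exact mem_range_self _
    · rintro _ ⟨⟨l, hl⟩, rfl⟩
      obtain ⟨θ, ⟨h3, h4⟩, h5⟩ := himg.symm ▸ hl
      refine ⟨⟨θ / Δ, div_nonneg h3 hΔ0.le, (div_le_one hΔ0).2 h4⟩, ?_⟩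
      refine congrArg g (Subtype.ext ?_)
      simp only [div_mul_cancel₀ _ hΔ0.ne']
      exact h5
  · show g _ = g _
    congr 1; apply Subtype.ext; simp
  · show g _ = g _
    congr 1; apply Subtype.ext; simp [hqw]

/-! ### Surfaces glued from convex spherical polygons -/

/-- The surface `Quot r` is glued from the spherical polygons `D i`, along arcs of circles of the
arrangement `V`. -/
structure CellGluing {ι : Type} (S : ι → Set V3) (D : ι → Set V3)
    (r : (Σ i, D i) → (Σ i, D i) → Prop) (V : Set V3) (dev : Quot r → V3) : Prop where
  finite_index : Finite ι
  finite : V.Finite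
  zero_notMem : (0 : V3) ∉ V
  subset : ∀ i, S i ⊆ V
  eq_closedCell : ∀ i, D i = closedCell (S i)
  nonempty : ∀ i, (openCell (S i)).Nonempty
  salient : ∀ i, Salient (S i)
  dev_mk : ∀ p, dev (Quot.mk r p) = p.2
  symm : ∀ p q, r p q → r q p
  val_eq : ∀ p q, r p q → (p.2 : V3) = q.2
  -- This excludes partial gluing: a link between two polygons can be transported to any other point
  -- that they share.
  full : ∀ i j, i ≠ j → ∀ l m (hli : l ∈ D i) (hlj : l ∈ D j) (hmi : m ∈ D i) (hmj : m ∈ D j),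
    r ⟨i, l, hli⟩ ⟨j, l, hlj⟩ → r ⟨i, m, hmi⟩ ⟨j, m, hmj⟩
  disjoint : ∀ p q, r p q → p.1 ≠ q.1 → Disjoint (openCell (S p.1)) (openCell (S q.1))
  nontrivial : ∀ p q, r p q → p.1 ≠ q.1 → ∃ m, m ∈ D p.1 ∧ m ∈ D q.1 ∧ m ≠ p.2
  -- Vertices are exempt: the ends of a chain of polygons around a vertex need not share an arc, and
  -- their overlap is how cone points arise.
  trans : ∀ p q s, r p q → r q s → (p.2 : V3) ∉ arrVertices V → p.1 ≠ q.1 → q.1 ≠ s.1 →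
    p.1 ≠ s.1 → r p s

namespace CellGluing

variable {ι : Type} {S : ι → Set V3} {D : ι → Set V3}
  {r : (Σ i, D i) → (Σ i, D i) → Prop} {V : Set V3} {dev : Quot r → V3}

/-- A point of a closed polygon as a point of the surface. -/
abbrev pt (r : (Σ i, D i) → (Σ i, D i) → Prop) (i : ι) (l : V3) (h : l ∈ D i) : Quot r :=
  Quot.mk r ⟨i, l, h⟩

/-- The part of a polygon with developed image in `A`. -/
def lift (r : (Σ i, D i) → (Σ i, D i) → Prop) (i : ι) (A : Set V3) : Set (Quot r) :=
  {x | ∃ l, ∃ h : l ∈ D i, l ∈ A ∧ pt r i l h = x}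

theorem exists_pt (x : Quot r) : ∃ i l, ∃ h : l ∈ D i, pt r i l h = x := by
  obtain ⟨⟨i, l, h⟩, rfl⟩ := Quot.exists_rep x
  exact ⟨i, l, h, rfl⟩

theorem continuous_pt (i : ι) : Continuous fun l : D i => pt r i l l.2 :=
  continuous_quot_mk.comp (continuous_sigmaMk (σ := fun i => D i) (i := i))

end CellGluing

/-! ### Topology of a surface glued from convex polygons -/

namespace CellGluing

variable {ι : Type} {S : ι → Set V3} {D : ι → Set V3}
  {r : (Σ i, D i) → (Σ i, D i) → Prop} {V : Set V3} {dev : Quot r → V3}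

theorem dev_pt (H : CellGluing S D r V dev) {i : ι} {l : V3} (h : l ∈ D i) :
    dev (pt r i l h) = l := H.dev_mk _

theorem unit_of_mem (H : CellGluing S D r V dev) {i : ι} {l : V3} (h : l ∈ D i) : l ⬝ᵥ l = 1 := by
  rw [H.eq_closedCell] at h; exact h.1

theorem finite_S (H : CellGluing S D r V dev) (i : ι) : (S i).Finite := H.finite.subset (H.subset i)

theorem isCompact_D (H : CellGluing S D r V dev) (i : ι) : IsCompact (D i) := by
  rw [H.eq_closedCell]; exact isCompact_closedCell _

theorem continuous_dev (H : CellGluing S D r V dev) : Continuous dev := by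
  rw [isQuotientMap_quot_mk.continuous_iff, continuous_sigma_iff]
  intro i
  have : (dev ∘ Quot.mk r) ∘ Sigma.mk i = fun l : D i => (l : V3) := funext fun l => H.dev_mk _
  exact (congrArg Continuous this).mpr continuous_subtype_val

theorem pt_congr {i j : ι} {l m : V3} (hij : i = j) (hlm : l = m) (h : l ∈ D i) (h' : m ∈ D j) :
    pt r i l h = pt r j m h' := by subst hij hlm; rfl

theorem eqvGen_val (H : CellGluing S D r V dev) {p q : Σ i, D i} (h : Relation.EqvGen r p q) :
    (p.2 : V3) = q.2 := by
  rw [← H.dev_mk, ← H.dev_mk, Quot.eqvGen_sound h]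

/-- Every polygon in the chain of identifications contains the old point, hence by `hm` also the new
one, so `full` transfers the chain link by link. -/
theorem move_eqvGen (H : CellGluing S D r V dev) {p q : Σ i, D i} (h : Relation.EqvGen r p q) {m : V3}
    (hm : ∀ k, (p.2 : V3) ∈ D k → m ∈ D k) (hp : m ∈ D p.1) (hq : m ∈ D q.1) :
    pt r p.1 m hp = pt r q.1 m hq := by
  induction h with
  | rel p q h =>
    obtain ⟨i, l, hl⟩ := p
    obtain ⟨j, l', hl'⟩ := q
    obtain rfl : l = l' := H.val_eq _ _ h
    by_cases hij : i = j
    · exact pt_congr hij rfl _ _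
    · exact Quot.sound (H.full i j hij _ _ _ _ hp hq h)
  | refl p => rfl
  | symm p q h ih => exact (ih (by rwa [H.eqvGen_val h]) hq hp).symm
  | trans p q s h1 h2 ih1 ih2 =>
    have hmq : m ∈ D q.1 := hm _ (by rw [H.eqvGen_val h1]; exact q.2.2)
    exact (ih1 hm hp hmq).trans (ih2 (by rwa [← H.eqvGen_val h1]) hmq hq)

/-- Points in polygons remain identified when they move to faces of all polygons around them. -/
theorem move (H : CellGluing S D r V dev) {i j : ι} {l m : V3} {hi : l ∈ D i} {hj : l ∈ D j}
    (h : pt r i l hi = pt r j l hj) (hm : ∀ k, l ∈ D k → m ∈ D k) :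
    pt r i m (hm i hi) = pt r j m (hm j hj) :=
  H.move_eqvGen (Quot.eqvGen_exact h) hm _ _

/-- The polygons are finitely many and closed. The conclusion is the hypothesis needed to apply
`move` from a nearby point `m` back to `l`. -/
theorem eventually_near (H : CellGluing S D r V dev) (l : V3) :
    ∀ᶠ m in 𝓝 l, ∀ k, m ∈ D k → l ∈ D k := by
  have := H.finite_index
  rw [Filter.eventually_all]
  intro k
  by_cases h : l ∈ D k
  · exact Filter.Eventually.of_forall fun _ _ => h
  · filter_upwards [(H.isCompact_D k).isClosed.isOpen_compl.mem_nhds h] with m hm hmk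
    exact absurd hmk hm

/-- The union of the parts in `A` of all polygons around a point `x` over `l`. -/
def star (r : (Σ i, D i) → (Σ i, D i) → Prop) (l : V3) (x : Quot r) (A : Set V3) : Set (Quot r) :=
  {y | ∃ k m, ∃ hm : m ∈ D k, ∃ hl : l ∈ D k, m ∈ A ∧ pt r k l hl = x ∧ pt r k m hm = y}

/-- By `move`, whether a point over `A` belongs to the star depends only on the polygon that
contains it, so the preimage in each polygon is either all of its part in `A` or empty. -/
theorem isOpen_star (H : CellGluing S D r V dev) {l : V3} {x : Quot r} {A : Set V3} (hA : IsOpen A)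
    (hnear : ∀ m ∈ A, ∀ k, m ∈ D k → l ∈ D k) : IsOpen (star r l x A) := by
  have key : ∀ k m (hm : m ∈ D k), pt r k m hm ∈ star r l x A ↔
      m ∈ A ∧ ∃ hl : l ∈ D k, pt r k l hl = x := by
    intro k m hm
    constructor
    · rintro ⟨k', m', hm', hl', hA', h1, h2⟩
      obtain rfl : m' = m := by rw [← H.dev_pt hm', h2, H.dev_pt]
      have := H.move h2 (hnear m' hA')
      exact ⟨hA', hnear _ hA' _ hm, this.symm.trans h1⟩
    · rintro ⟨h1, h2, h3⟩
      exact ⟨k, m, hm, h2, h1, h3, rfl⟩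
  rw [← isQuotientMap_quot_mk.isOpen_preimage, isOpen_sigma_iff]
  intro k
  by_cases h : ∃ hl : l ∈ D k, pt r k l hl = x
  · convert hA.preimage (continuous_subtype_val (p := fun l => l ∈ D k)) using 1
    ext m
    exact (key k m m.2).trans (and_iff_left h)
  · convert isOpen_empty
    ext m
    simp only [mem_preimage, mem_empty_iff_false, iff_false]
    exact fun h1 => h ((key k m m.2).1 h1).2

theorem self_mem_star {l : V3} {x : Quot r} {A : Set V3} {i : ι} {h : l ∈ D i}
    (hx : pt r i l h = x) (hA : l ∈ A) : x ∈ star r l x A := ⟨i, l, h, h, hA, hx, hx⟩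

theorem exists_star_subset (H : CellGluing S D r V dev) {l : V3} {x : Quot r} {U : Set (Quot r)}
    (hU : ∀ k (hl : l ∈ D k), pt r k l hl = x → ∀ᶠ m in 𝓝 l, ∀ hm : m ∈ D k, pt r k m hm ∈ U) :
    ∃ A : Set V3, IsOpen A ∧ l ∈ A ∧ (∀ m ∈ A, ∀ k, m ∈ D k → l ∈ D k) ∧ star r l x A ⊆ U := by
  have := H.finite_index
  have h1 : ∀ᶠ m in 𝓝 l, ∀ k, ∀ hl : l ∈ D k, pt r k l hl = x → ∀ hm : m ∈ D k, pt r k m hm ∈ U := by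
    rw [Filter.eventually_all]
    intro k
    by_cases h : ∃ hl : l ∈ D k, pt r k l hl = x
    · obtain ⟨hl, h⟩ := h
      filter_upwards [hU k hl h] with m hm _ _ using hm
    · exact Filter.Eventually.of_forall fun m hl hx => absurd ⟨hl, hx⟩ h
  obtain ⟨A, hA, hAo, hlA⟩ := eventually_nhds_iff.1 (h1.and (H.eventually_near l))
  refine ⟨A, hAo, hlA, fun m hm => (hA m hm).2, ?_⟩
  rintro y ⟨k, m, hm, hl, hmA, h2, rfl⟩
  exact (hA m hmA).1 k hl h2 hm

/-- Reduces neighbourhoods in the quotient to neighbourhoods in each polygon incident to the point;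
small stars show that this local condition suffices. -/
theorem mem_nhds_iff (H : CellGluing S D r V dev) {i : ι} {l : V3} (h : l ∈ D i)
    {U : Set (Quot r)} : U ∈ 𝓝 (pt r i l h) ↔ ∀ k (hl : l ∈ D k), pt r k l hl = pt r i l h →
      ∀ᶠ m in 𝓝 l, ∀ hm : m ∈ D k, pt r k m hm ∈ U := by
  constructor
  · intro hU k hl hk
    rw [← hk] at hU
    have := (continuous_pt (r := r) k).continuousAt.preimage_mem_nhds (x := ⟨l, hl⟩) hU
    rw [nhds_subtype, Filter.mem_comap] at this
    obtain ⟨t, ht, h1⟩ := this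
    filter_upwards [ht] with m hm hmk using h1 (show (⟨m, hmk⟩ : D k) ∈ _ from hm)
  · intro hU
    obtain ⟨A, hA, hl, hnear, hsub⟩ := H.exists_star_subset hU
    exact Filter.mem_of_superset ((H.isOpen_star hA hnear).mem_nhds (self_mem_star rfl hl)) hsub

theorem t2Space (H : CellGluing S D r V dev) : T2Space (Quot r) := by
  refine ⟨fun x y hxy => ?_⟩
  -- Points with different lines are separated by `dev`. Distinct points with the same line have
  -- disjoint stars, because a common point of the stars would identify them by `move`.
  by_cases hd : dev x = dev y
  · obtain ⟨i, l, hl, rfl⟩ := exists_pt x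
    obtain ⟨j, m, hm, rfl⟩ := exists_pt y
    obtain rfl : l = m := by rwa [H.dev_pt, H.dev_pt] at hd
    obtain ⟨A, hA, hAo, hlA⟩ := eventually_nhds_iff.1 (H.eventually_near l)
    refine ⟨star r l (pt r i l hl) A, star r l (pt r j l hm) A, H.isOpen_star hAo hA,
      H.isOpen_star hAo hA, self_mem_star rfl hlA, self_mem_star rfl hlA, ?_⟩
    rw [Set.disjoint_left]
    rintro z ⟨k, m, hm, hl, hmA, h1, rfl⟩ ⟨k', m', hm', hl', hmA', h1', h2⟩
    obtain rfl : m' = m := by rw [← H.dev_pt hm', h2, H.dev_pt]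
    exact hxy (h1.symm.trans ((H.move h2.symm (hA m' hmA)).trans h1'))
  · exact separated_by_continuous H.continuous_dev hd

theorem compactSpace (H : CellGluing S D r V dev) : CompactSpace (Quot r) := by
  have := H.finite_index
  have : ∀ i, CompactSpace (D i) := fun i => isCompact_iff_compactSpace.1 (H.isCompact_D i)
  infer_instance

theorem finite_fibres (H : CellGluing S D r V dev) (v : V3) : (dev ⁻¹' {v}).Finite := by
  have := H.finite_index
  refine (Set.finite_iUnion (f := fun i => {x : Quot r | ∃ h : v ∈ D i, pt r i v h = x})
    fun i => Set.Subsingleton.finite ?_).subset ?_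
  · rintro x ⟨h, rfl⟩ y ⟨h', rfl⟩; rfl
  · intro x hx
    obtain ⟨i, l, hl, rfl⟩ := exists_pt x
    have : l = v := by rw [← H.dev_pt hl]; exact hx
    subst this
    exact mem_iUnion.2 ⟨i, hl, rfl⟩

theorem finite_dev_preimage (H : CellGluing S D r V dev) {A : Set V3} (hA : A.Finite) :
    (dev ⁻¹' A).Finite :=
  Set.Finite.preimage' hA fun v _ => H.finite_fibres v

/-- Off the vertices the gluing relation is transitive up to equality, so a chain of identifications
collapses to one link. -/
theorem rel_of_eqvGen (H : CellGluing S D r V dev) {p q : Σ i, D i} (h : Relation.EqvGen r p q)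
    (hp : (p.2 : V3) ∉ arrVertices V) : p = q ∨ r p q := by
  have ext : ∀ p q : Σ i, D i, p.1 = q.1 → r p q → p = q := by
    rintro ⟨i, l, hl⟩ ⟨j, m, hm⟩ hij h
    obtain rfl : l = m := H.val_eq _ _ h
    obtain rfl : i = j := hij
    rfl
  induction h with
  | rel p q h => exact Or.inr h
  | refl p => exact Or.inl rfl
  | symm p q h ih =>
    rcases ih (by rwa [H.eqvGen_val h]) with rfl | h1
    · exact Or.inl rfl
    · exact Or.inr (H.symm _ _ h1)
  | trans p q s h1 h2 ih1 ih2 =>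
    rcases ih1 hp with rfl | h3
    · exact ih2 hp
    · rcases ih2 (by rwa [← H.eqvGen_val h1]) with rfl | h4
      · exact Or.inr h3
      · by_cases e1 : p.1 = q.1
        · rw [ext p q e1 h3]; exact Or.inr h4
        by_cases e2 : q.1 = s.1
        · rw [← ext q s e2 h4]; exact Or.inr h3
        by_cases e3 : p.1 = s.1
        · left
          obtain ⟨i, l, hl⟩ := p
          obtain ⟨j, m, hm⟩ := s
          obtain rfl : l = m := (H.val_eq _ _ h3).trans (H.val_eq _ _ h4)
          obtain rfl : i = j := e3
          rfl
        · exact Or.inr (H.trans p q s h3 h4 hp e1 e2 e3)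

/-- Off the vertices of the arrangement, the developing map is injective on stars. -/
theorem injOn_star (H : CellGluing S D r V dev) {l : V3} (hl : l ∉ arrVertices V) {x : Quot r}
    {A : Set V3} : InjOn dev (star r l x A) := by
  rintro y ⟨k, m, hm, hl1, -, h1, rfl⟩ y' ⟨k', m', hm', hl', -, h1', rfl⟩ h
  obtain rfl : m = m' := by rwa [H.dev_pt, H.dev_pt] at h
  by_cases hk : k = k'
  · exact pt_congr hk rfl _ _
  rcases H.rel_of_eqvGen (Quot.eqvGen_exact (h1.trans h1'.symm)) hl with h2 | h2
  · exact absurd (congrArg Sigma.fst h2) hk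
  · exact Quot.sound (H.full k k' hk _ _ _ _ hm hm' h2)

theorem isFlatAt (H : CellGluing S D r V dev) {x : Quot r} (hx : dev x ∉ arrVertices V) :
    IsFlatAt dev x := by
  obtain ⟨i, l, hl, rfl⟩ := exists_pt x
  rw [H.dev_pt] at hx
  obtain ⟨A, hA, hAo, hlA⟩ := eventually_nhds_iff.1 (H.eventually_near l)
  exact ⟨_, (H.isOpen_star hAo hA).mem_nhds (self_mem_star rfl hlA), H.injOn_star hx⟩

/-- A face around a point which is not a vertex of the arrangement is locally everything or a
half-plane. -/
theorem exists_local_halfspace (H : CellGluing S D r V dev) {l : V3} (hl : l ∉ arrVertices V) :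
    ∃ v₀ : V3, v₀ ≠ 0 ∧ ∀ k, l ∈ D k → ∃ ν : V3, (ν = 0 ∨ ν = v₀ ∨ ν = -v₀) ∧
      ∀ m, m ⬝ᵥ m = 1 → (∀ v ∈ V, 0 < v ⬝ᵥ l → 0 < v ⬝ᵥ m) → (m ∈ D k ↔ 0 ≤ ν ⬝ᵥ m) := by
  by_cases h : ∃ v₀ ∈ V, v₀ ⬝ᵥ l = 0
  · obtain ⟨v₀, hv₀, hl0⟩ := h
    have h0 : v₀ ≠ 0 := by rintro rfl; exact H.zero_notMem hv₀
    refine ⟨v₀, h0, fun k hk => ?_⟩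
    have hlu := H.unit_of_mem hk
    rw [H.eq_closedCell] at hk ⊢
    obtain ⟨p, hp⟩ := H.nonempty k
    -- Two independent covectors vanishing at `l` would make it a vertex.
    have hpar : ∀ s ∈ S k, s ⬝ᵥ l = 0 → ∃ c : ℝ, s = c • v₀ := by
      intro s hs h
      refine (cross_eq_zero_iff h0).1 ?_
      by_contra h1
      exact hl ⟨hlu, s, H.subset k hs, v₀, hv₀, h1, h, hl0⟩
    by_cases h1 : ∃ s ∈ S k, s ⬝ᵥ l = 0
    · obtain ⟨s₀, hs₀, hsl₀⟩ := h1
      obtain ⟨c₀, hc₀⟩ := hpar s₀ hs₀ hsl₀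
      -- The sign of `ν` is fixed by an interior point `p` of the polygon; then every constraint
      -- active at `l` is a positive multiple of `ν`, and the others are positive nearby.
      have key : ∀ ν : V3, (ν = v₀ ∨ ν = -v₀) → 0 < ν ⬝ᵥ p → ∀ m, m ⬝ᵥ m = 1 →
          (∀ v ∈ V, 0 < v ⬝ᵥ l → 0 < v ⬝ᵥ m) → (m ∈ closedCell (S k) ↔ 0 ≤ ν ⬝ᵥ m) := by
        intro ν hν hνp m hm hVm
        have hpar' : ∀ s ∈ S k, s ⬝ᵥ l = 0 → ∃ c : ℝ, 0 < c ∧ s = c • ν := by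
          intro s hs h
          obtain ⟨c, hc⟩ := hpar s hs h
          have h2 := hp.2 s hs
          have h3 : ∃ c : ℝ, s = c • ν := by
            rcases hν with rfl | rfl
            · exact ⟨c, hc⟩
            · exact ⟨-c, by simpa using hc⟩
          obtain ⟨c, rfl⟩ := h3
          rw [smul_dotProduct, smul_eq_mul] at h2
          exact ⟨c, pos_of_mul_pos_left h2 hνp.le, rfl⟩
        constructor
        · intro h
          obtain ⟨c, hc, h3⟩ := hpar' s₀ hs₀ hsl₀
          have := h.2 s₀ hs₀
          rw [h3, smul_dotProduct, smul_eq_mul] at this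
          exact nonneg_of_mul_nonneg_right this hc
        · intro h
          refine ⟨hm, fun s hs => ?_⟩
          rcases (hk.2 s hs).lt_or_eq with h4 | h4
          · exact (hVm s (H.subset k hs) h4).le
          · obtain ⟨c, hc, rfl⟩ := hpar' s hs h4.symm
            rw [smul_dotProduct]; exact mul_nonneg hc.le h
      have hsp := hp.2 s₀ hs₀
      rw [hc₀, smul_dotProduct, smul_eq_mul] at hsp
      rcases lt_trichotomy (v₀ ⬝ᵥ p) 0 with h2 | h2 | h2
      · exact ⟨-v₀, Or.inr (Or.inr rfl), key _ (Or.inr rfl) (by rw [neg_dotProduct]; linarith)⟩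
      · rw [h2, mul_zero] at hsp; exact absurd hsp (lt_irrefl _)
      · exact ⟨v₀, Or.inr (Or.inl rfl), key _ (Or.inl rfl) h2⟩
    · refine ⟨0, Or.inl rfl, fun m hm hVm => ⟨fun _ => by simp, fun _ => ⟨hm, fun s hs => ?_⟩⟩⟩
      exact (hVm s (H.subset k hs) (lt_of_le_of_ne (hk.2 s hs) fun h2 => h1 ⟨s, hs, h2.symm⟩)).le
  · refine ⟨![1, 0, 0], fun h => by simpa using congrFun h 0, fun k hk => ⟨0, Or.inl rfl,
      fun m hm hVm => ⟨fun _ => by simp, fun _ => ?_⟩⟩⟩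
    rw [H.eq_closedCell] at hk ⊢
    refine ⟨hm, fun s hs => ?_⟩
    exact (hVm s (H.subset k hs) (lt_of_le_of_ne (hk.2 s hs)
      fun h2 => h ⟨s, H.subset k hs, h2.symm⟩)).le

theorem isEmbedding_domRestrict {X : Type} [TopologicalSpace X] [CompactSpace X] {f : X → V3}
    (hf : Continuous f) {C U : Set X} (hC : IsClosed C) (hinj : InjOn f C) (hU : U ⊆ C) :
    IsEmbedding (U.domRestrict f) := by
  have : CompactSpace C := isCompact_iff_compactSpace.1 hC.isCompact
  have h1 : IsEmbedding (fun x : C => f x) :=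
    ((hf.comp continuous_subtype_val).isClosedEmbedding hinj.injective).isEmbedding
  exact h1.comp (IsEmbedding.inclusion hU)

/-- Each polygon around the point is locally a disc or one of the two half-discs of a single circle.
The developed star is therefore a disc or one half-disc. The embedding property comes from
injectivity on a compact neighbourhood. -/
theorem exists_chart (H : CellGluing S D r V dev) {x : Quot r} (hx : dev x ∉ arrVertices V) :
    ∃ U : Set (Quot r), IsOpen U ∧ x ∈ U ∧ IsEmbedding (U.domRestrict dev) ∧
      ∃ O : Set V3, IsOpen O ∧ (dev '' U = O ∩ {v | v ⬝ᵥ v = 1} ∨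
        ∃ ν : V3, ν ≠ 0 ∧ dev '' U = O ∩ {v | v ⬝ᵥ v = 1 ∧ 0 ≤ ν ⬝ᵥ v}) := by
  obtain ⟨i, l, hl, rfl⟩ := exists_pt x
  rw [H.dev_pt] at hx
  have := H.compactSpace
  have := H.t2Space
  obtain ⟨A₀, hA₀o, hlA₀, hA₀, -⟩ := H.exists_star_subset (l := l) (x := pt r i l hl) (U := univ)
    fun _ _ _ => Filter.Eventually.of_forall fun _ _ => mem_univ _
  obtain ⟨C, hC, hCcl, hCsub⟩ := exists_mem_nhds_isClosed_subset
    ((H.isOpen_star hA₀o hA₀).mem_nhds (self_mem_star (x := pt r i l hl) rfl hlA₀))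
  obtain ⟨A₁, hA₁o, hlA₁, hA₁, hsub₁⟩ := H.exists_star_subset ((H.mem_nhds_iff hl).1 hC)
  obtain ⟨A₂, hA₂, hA₂o, hlA₂⟩ := eventually_nhds_iff.1 (eventually_pos H.finite l)
  set A := A₁ ∩ A₂
  have hAo : IsOpen A := hA₁o.inter hA₂o
  have hsub : star r l (pt r i l hl) A ⊆ C := by
    refine Subset.trans ?_ hsub₁
    rintro y ⟨k, m, hm, hl, hmA, h⟩
    exact ⟨k, m, hm, hl, hmA.1, h⟩
  refine ⟨star r l (pt r i l hl) A, H.isOpen_star hAo fun m hm => hA₁ m hm.1,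
    self_mem_star rfl ⟨hlA₁, hlA₂⟩,
    isEmbedding_domRestrict H.continuous_dev hCcl ((H.injOn_star hx).mono hCsub) hsub, A, hAo, ?_⟩
  obtain ⟨v₀, hv₀, hloc⟩ := H.exists_local_halfspace hx
  have himg : ∀ m, m ∈ dev '' star r l (pt r i l hl) A ↔
      m ∈ A ∧ ∃ k, ∃ hlk : l ∈ D k, pt r k l hlk = pt r i l hl ∧ m ∈ D k := by
    intro m
    constructor
    · rintro ⟨y, ⟨k, m', hm, hlk, hmA, h1, rfl⟩, h2⟩
      obtain rfl : m' = m := by rwa [H.dev_pt] at h2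
      exact ⟨hmA, k, hlk, h1, hm⟩
    · rintro ⟨hmA, k, hlk, h1, hm⟩
      exact ⟨pt r k m hm, ⟨k, m, hm, hlk, hmA, h1, rfl⟩, H.dev_pt hm⟩
  have himg_sub : ∀ m ∈ dev '' star r l (pt r i l hl) A, m ∈ A ∧ m ⬝ᵥ m = 1 := by
    intro m hm
    obtain ⟨h1, k, _, _, h2⟩ := (himg m).1 hm
    exact ⟨h1, H.unit_of_mem h2⟩
  by_cases hfull : ∀ m ∈ A, m ⬝ᵥ m = 1 → m ∈ dev '' star r l (pt r i l hl) A
  · left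
    ext m
    exact ⟨fun h => himg_sub m h, fun h => hfull m h.1 h.2⟩
  · right
    have hcase : ∀ k (hlk : l ∈ D k), pt r k l hlk = pt r i l hl →
        ∃ ν, (ν = v₀ ∨ ν = -v₀) ∧ ∀ m ∈ A, m ⬝ᵥ m = 1 → (m ∈ D k ↔ 0 ≤ ν ⬝ᵥ m) := by
      intro k hlk hk
      obtain ⟨ν, hν, h⟩ := hloc k hlk
      rcases hν with rfl | hν
      · refine absurd (fun m hm hm1 => (himg m).2 ⟨hm, k, hlk, hk, ?_⟩) hfull
        exact (h m hm1 (hA₂ m hm.2)).2 (by simp)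
      · exact ⟨ν, hν, fun m hm hm1 => h m hm1 (hA₂ m hm.2)⟩
    obtain ⟨ν, hν, hνi⟩ := hcase i hl rfl
    refine ⟨ν, ?_, ?_⟩
    · rcases hν with rfl | rfl
      · exact hv₀
      · exact neg_ne_zero.2 hv₀
    · ext m
      constructor
      · intro hm
        obtain ⟨hmA, hm1⟩ := himg_sub m hm
        refine ⟨hmA, hm1, ?_⟩
        obtain ⟨-, k, hlk, hk, hmk⟩ := (himg m).1 hm
        obtain ⟨ν', hν', h⟩ := hcase k hlk hk
        have h1 := (h m hmA hm1).1 hmk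
        by_cases e : ν' = ν
        · rwa [← e]
        · have e' : ν' = -ν := by
            rcases hν with rfl | rfl <;> rcases hν' with rfl | rfl <;> simp_all
          refine absurd (fun m' hm' hm1' => (himg m').2 ⟨hm', ?_⟩) hfull
          rcases le_total 0 (ν ⬝ᵥ m') with h2 | h2
          · exact ⟨i, hl, rfl, (hνi m' hm' hm1').2 h2⟩
          · exact ⟨k, hlk, hk, (h m' hm' hm1').2 (by rw [e', neg_dotProduct]; linarith)⟩
      · rintro ⟨hmA, hm1, hm⟩
        exact (himg m).2 ⟨hmA, i, hl, rfl, (hνi m hmA hm1).2 hm⟩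

theorem isPreconnected_lift (i : ι) {A : Set V3} (hA : IsPreconnected A) (hAD : A ⊆ D i) :
    IsPreconnected (lift r i A) := by
  have h1 : IsPreconnected (Subtype.val ⁻¹' A : Set (D i)) := by
    rw [← IsInducing.subtypeVal.isPreconnected_image, Subtype.image_preimage_coe,
      inter_eq_right.2 hAD]
    exact hA
  convert h1.image _ (continuous_pt (r := r) i).continuousOn using 1
  ext x
  constructor
  · rintro ⟨l, h, hl, rfl⟩; exact ⟨⟨l, h⟩, hl, rfl⟩
  · rintro ⟨⟨l, h⟩, hl, rfl⟩; exact ⟨l, h, hl, rfl⟩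

/-- Each polygon around `x` remains connected near `x` when `x` is removed, and two glued polygons
share a further point arbitrarily close to `x`. Any two polygons around `x` are joined by a chain of
gluings, so the punctured star is connected. -/
theorem not_pinched (H : CellGluing S D r V dev) (x : Quot r) {U : Set (Quot r)} (hU : U ∈ 𝓝 x) :
    ∃ N : Set (Quot r), N ∈ 𝓝 x ∧ N ⊆ U ∧ IsConnected (N \ {x}) := by
  obtain ⟨i, l, hl, hx⟩ := exists_pt x
  rw [← hx] at hU
  obtain ⟨A, hAo, hlA, hA, hsub⟩ := H.exists_star_subset ((H.mem_nhds_iff hl).1 hU)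
  rw [hx] at hsub
  have hl1 := H.unit_of_mem hl
  obtain ⟨δ, hδ, hδ1, hcap⟩ := exists_cap_subset hl1 (hAo.mem_nhds hlA)
  have hsubA : star r l x (cap l δ) ⊆ star r l x A := by
    rintro y ⟨k, m, hm, hlk, hmA, h⟩
    exact ⟨k, m, hm, hlk, hcap m (H.unit_of_mem hm) hmA, h⟩
  refine ⟨star r l x (cap l δ), (H.isOpen_star (isOpen_cap l δ) fun m hm k hk =>
    hA m (hcap m (H.unit_of_mem hk) hm) k hk).mem_nhds (self_mem_star hx (mem_cap_self hl1 hδ)),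
    hsubA.trans hsub, ?_⟩
  set P : ι → Set (Quot r) := fun k => lift r k ((D k ∩ cap l δ) \ {l}) with hP
  have hPsub : ∀ k (hlk : l ∈ D k), pt r k l hlk = x → P k ⊆ star r l x (cap l δ) \ {x} := by
    rintro k hlk hk _ ⟨m, hm, hmc, rfl⟩
    refine ⟨⟨k, m, hm, hlk, hmc.1.2, hk, rfl⟩, fun h => hmc.2 ?_⟩
    have h1 := congrArg dev (h.trans hk.symm)
    rwa [H.dev_pt, H.dev_pt] at h1
  have hPpre : ∀ k, l ∈ D k → IsPreconnected (P k) := by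
    intro k hk
    refine isPreconnected_lift k ?_ fun m hm => hm.1.1
    rw [H.eq_closedCell] at hk ⊢
    exact isPreconnected_punctured (H.finite_S k) (H.salient k) (H.nonempty k) hk hδ hδ1
  have hPne : ∀ k, l ∈ D k → (P k).Nonempty := by
    intro k hk
    obtain ⟨g, hg, hgl⟩ := exists_orthogonal l
    have hk' := hk
    rw [H.eq_closedCell] at hk'
    obtain ⟨m, hm, hmc, hgm⟩ := exists_mem_openCell_off_circle (H.finite_S k) (H.salient k).nonempty
      (H.nonempty k) hk' hg ((isOpen_cap l δ).mem_nhds (mem_cap_self hl1 hδ))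
    have hmD : m ∈ D k := by rw [H.eq_closedCell]; exact openCell_subset _ hm
    exact ⟨_, m, hmD, ⟨⟨hmD, hmc⟩, by rintro rfl; exact hgm hgl⟩, rfl⟩
  have chain : ∀ p q : Σ i, D i, Relation.EqvGen r p q → (p.2 : V3) = l → Quot.mk r p = x →
      ∃ t, t ⊆ star r l x (cap l δ) \ {x} ∧ P p.1 ⊆ t ∧ P q.1 ⊆ t ∧ IsPreconnected t := by
    intro p q h
    induction h with
    | rel p q h =>
      intro hp hpx
      obtain ⟨i, l', hl'⟩ := p
      obtain ⟨j, m, hm⟩ := q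
      obtain rfl : l' = l := hp
      obtain rfl : l' = m := H.val_eq _ _ h
      have hqx : pt r j l' hm = x := (Quot.sound h).symm.trans hpx
      by_cases hij : i = j
      · subst hij
        exact ⟨P i, hPsub i hl' hpx, Subset.rfl, Subset.rfl, hPpre i hl'⟩
      -- The two convex polygons share the arc from `l'` to `m`; a point of it close to `l'`
      -- connects the two punctured pieces.
      · obtain ⟨m, hmi, hmj, hne⟩ := H.nontrivial _ _ h hij
        have h1 : ∀ᶠ t in 𝓝[>] (0 : ℝ), unitize (l' + t • m) ∈ cap l' δ :=
          (tendsto_unitize_comb hl1).eventually ((isOpen_cap l' δ).mem_nhds (mem_cap_self hl1 hδ))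
        obtain ⟨t, ht, ht0⟩ := (h1.and self_mem_nhdsWithin).exists
        have ht0' : (0 : ℝ) < t := ht0
        have hlc : l' ∈ closedCell (S i) := by rw [← H.eq_closedCell]; exact hl'
        have hmc : m ∈ closedCell (S i) := by rw [← H.eq_closedCell]; exact hmi
        have hlc' : l' ∈ closedCell (S j) := by rw [← H.eq_closedCell]; exact hm
        have hmc' : m ∈ closedCell (S j) := by rw [← H.eq_closedCell]; exact hmj
        have hnz : l' + t • m ≠ 0 := by
          have := (H.salient i).comb_ne_zero hlc hmc zero_le_one ht0'.le (by linarith)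
          rwa [one_smul] at this
        have hni : unitize (l' + t • m) ∈ D i := by
          rw [H.eq_closedCell]
          have := unitize_comb_mem_closedCell hlc hmc zero_le_one ht0'.le (by rwa [one_smul])
          rwa [one_smul] at this
        have hnj : unitize (l' + t • m) ∈ D j := by
          rw [H.eq_closedCell]
          have := unitize_comb_mem_closedCell hlc' hmc' zero_le_one ht0'.le (by rwa [one_smul])
          rwa [one_smul] at this
        have hnl : unitize (l' + t • m) ≠ l' := by
          intro h2
          obtain ⟨c, hc, h3⟩ := exists_unitize_eq hnz
          have hml : m = (t⁻¹ * (c⁻¹ - 1)) • l' := by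
            have h4 : c • (l' + t • m) = l' := by rw [← h3, h2]
            have h5 : l' + t • m = c⁻¹ • l' := by
              rw [← h4, smul_smul, inv_mul_cancel₀ hc.ne', one_smul, h4]
            rw [mul_smul, sub_smul, one_smul, ← h5, add_sub_cancel_left, smul_smul,
              inv_mul_cancel₀ ht0'.ne', one_smul]
          rcases eq_or_eq_neg_of_smul hmc.1 hlc.1 hml with h4 | h4
          · exact hne h4
          · exact (H.salient i).neg_notMem hlc (h4 ▸ hmc)
        refine ⟨P i ∪ P j, union_subset (hPsub i hl' hpx) (hPsub j hm hqx), subset_union_left,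
          subset_union_right, (hPpre i hl').union (pt r i _ hni) ⟨_, hni, ⟨⟨hni, ht⟩, hnl⟩, rfl⟩
            ⟨_, hnj, ⟨⟨hnj, ht⟩, hnl⟩, ?_⟩ (hPpre j hm)⟩
        exact (Quot.sound (H.full i j hij _ _ _ _ hni hnj h)).symm
    | refl p =>
      intro hp hpx
      have hlp : l ∈ D p.1 := hp ▸ p.2.2
      obtain ⟨i, l', hl'⟩ := p
      obtain rfl : l' = l := hp
      exact ⟨P i, hPsub i hl' hpx, Subset.rfl, Subset.rfl, hPpre i hl'⟩
    | symm p q h ih =>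
      intro hp hpx
      obtain ⟨t, h1, h2, h3, h4⟩ := ih ((H.eqvGen_val h).trans hp) ((Quot.eqvGen_sound h).trans hpx)
      exact ⟨t, h1, h3, h2, h4⟩
    | trans p q s h1 h2 ih1 ih2 =>
      intro hp hpx
      have hq : (q.2 : V3) = l := (H.eqvGen_val h1).symm.trans hp
      obtain ⟨t, a1, a2, a3, a4⟩ := ih1 hp hpx
      obtain ⟨t', b1, b2, b3, b4⟩ := ih2 hq ((Quot.eqvGen_sound h1).symm.trans hpx)
      obtain ⟨z, hz⟩ := hPne q.1 (hq ▸ q.2.2)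
      exact ⟨t ∪ t', union_subset a1 b1, a2.trans subset_union_left, b3.trans subset_union_right,
        a4.union z (a3 hz) (b2 hz) b4⟩
  obtain ⟨z, hz⟩ := hPne i hl
  refine ⟨⟨z, hPsub i hl hx hz⟩, isPreconnected_of_forall z ?_⟩
  rintro y ⟨⟨k, m, hm, hlk, hmc, hk, rfl⟩, hyx⟩
  obtain ⟨t, h1, h2, h3, h4⟩ := chain _ _ (Quot.eqvGen_exact (hx.trans hk.symm)) rfl hx
  refine ⟨t, h1, h2 hz, h3 ⟨m, hm, ⟨⟨hm, hmc⟩, ?_⟩, rfl⟩, h4⟩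
  rintro rfl
  exact hyx hk

theorem isGeodesicSurface (H : CellGluing S D r V dev) : IsGeodesicSurface dev where
  compact := H.compactSpace
  hausdorff := H.t2Space
  continuous_dev := H.continuous_dev
  dev_unit x := by
    obtain ⟨i, l, hl, rfl⟩ := exists_pt x
    rw [H.dev_pt]; exact H.unit_of_mem hl
  finite_fibres := H.finite_fibres
  charts := ⟨dev ⁻¹' arrVertices V, H.finite_dev_preimage (finite_arrVertices H.finite),
    fun _ hx => H.exists_chart hx⟩
  not_pinched x _ hU := H.not_pinched x hU

end CellGluing

/-! ### Graphs of geodesic arcs -/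

/-- The components of a disjoint union of open connected sets. -/
theorem openFaces_compl_iUnion {X κ : Type} [TopologicalSpace X] {U : κ → Set X}
    (hU : ∀ k, IsOpen (U k)) (hc : ∀ k, IsConnected (U k))
    (hd : ∀ k k', U k ≠ U k' → Disjoint (U k) (U k')) : openFaces (⋃ k, U k)ᶜ = range U := by
  have key : ∀ k, ∀ x ∈ U k, connectedComponentIn (⋃ k, U k) x = U k := by
    intro k x hx
    refine subset_antisymm ?_
      ((hc k).isPreconnected.subset_connectedComponentIn hx (subset_iUnion U k))
    -- The other members of the family form an open set disjoint from `U k`, so the component cannot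
    -- leave `U k`.
    refine IsPreconnected.subset_left_of_subset_union (hU k)
      (isOpen_iUnion fun k' => isOpen_iUnion fun _ : U k ≠ U k' => hU k') ?_ ?_
      ⟨x, mem_connectedComponentIn (mem_iUnion.2 ⟨k, hx⟩), hx⟩ isPreconnected_connectedComponentIn
    · simp only [disjoint_iUnion_right]
      exact fun k' h => hd k k' h
    · intro y hy
      obtain ⟨k', hk'⟩ := mem_iUnion.1 (connectedComponentIn_subset _ _ hy)
      by_cases h : U k = U k'
      · exact Or.inl (h ▸ hk')
      · exact Or.inr (mem_iUnion.2 ⟨k', mem_iUnion.2 ⟨h, hk'⟩⟩)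
  ext F
  simp only [openFaces, compl_compl, mem_ofPred_eq]
  constructor
  · rintro ⟨x, hx, rfl⟩
    obtain ⟨k, hk⟩ := mem_iUnion.1 hx
    exact ⟨k, (key k x hk).symm⟩
  · rintro ⟨k, rfl⟩
    obtain ⟨x, hx⟩ := (hc k).nonempty
    exact ⟨x, mem_iUnion.2 ⟨k, hx⟩, (key k x hx).symm⟩

/-- An endpoint of an arc which lies on a smaller arc is an endpoint of the smaller arc. -/
theorem IsGeodesicArc.endpoint_of_subset {X : Type} [TopologicalSpace X] [T2Space X] {dev : X → V3}
    {a b : Set X} {x y p q z : X} (hb : IsGeodesicArc dev b x y) (ha : IsGeodesicArc dev a p q)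
    (hab : a ⊆ b) (hz : z = x ∨ z = y) (hza : z ∈ a) : z = p ∨ z = q := by
  obtain ⟨γ, -, -, -, hγ, hγi, rfl, rfl, rfl, -⟩ := hb
  obtain ⟨δ, -, -, -, hδ, hδi, rfl, rfl, rfl, -⟩ := ha
  choose h hh using fun s => hab (mem_range_self s)
  have hc : Continuous h := by
    rw [(hγ.isClosedEmbedding hγi).isEmbedding.continuous_iff]
    exact (congrArg Continuous (funext hh : γ ∘ h = δ)).mpr hδ
  have hi : Function.Injective h := fun s t e => hδi (by rw [← hh, ← hh, e])
  obtain ⟨s, rfl⟩ := hza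
  have hz' : h s = 0 ∨ h s = 1 := by
    rcases hz with e | e <;> rw [← hh s] at e
    · exact Or.inl (hγi e)
    · exact Or.inr (hγi e)
  -- A continuous injective self-map of the interval is strictly monotone, so only endpoints can go
  -- to endpoints.
  have hs : s = 0 ∨ s = 1 := by
    rcases hc.strictMono_of_inj_boundedOrder' hi with hm | hm
    · rcases hz' with e | e
      · left; exact hi (le_antisymm (e.le.trans unitInterval.nonneg') (hm.monotone unitInterval.nonneg'))
      · right; exact hi (le_antisymm (hm.monotone unitInterval.le_one') (unitInterval.le_one'.trans e.ge))
    · rcases hz' with e | e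
      · right; exact hi (le_antisymm (e.le.trans unitInterval.nonneg') (hm.antitone unitInterval.le_one'))
      · left; exact hi (le_antisymm (hm.antitone unitInterval.nonneg') (unitInterval.le_one'.trans e.ge))
  rcases hs with rfl | rfl
  · exact Or.inl rfl
  · exact Or.inr rfl

/-- A finite geodesic graph, possibly with degenerate vertices. -/
structure IsPreGraph {X : Type} [TopologicalSpace X] (dev : X → V3) (G W : Set X)
    (E : Set (Set X)) : Prop where
  finite_vertices : W.Finite
  finite_edges : E.Finite
  support : G = W ∪ ⋃₀ E
  edge : ∀ a ∈ E, ∃ x y, IsGeodesicArc dev a x y ∧ a ∩ W = {x, y}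
  meet : ∀ a ∈ E, ∀ a' ∈ E, a ≠ a' → a ∩ a' ⊆ W
  cone : ∀ x, ¬ IsFlatAt dev x → x ∈ W

/-- Degenerate vertices can be removed. -/
theorem IsPreGraph.merge {X : Type} [TopologicalSpace X] [T2Space X] {dev : X → V3} {G W : Set X}
    {E : Set (Set X)} (h : IsPreGraph dev G W E) {v : X} (hv : v ∈ W) (hflat : IsFlatAt dev v)
    {a a' : Set X} (ha : a ∈ E) (ha' : a' ∈ E) (hne : a ≠ a') (hva : v ∈ a ∩ a')
    (honly : ∀ b ∈ E, v ∈ b → b = a ∨ b = a') {x y : X} (harc : IsGeodesicArc dev (a ∪ a') x y)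
    (hvx : v ≠ x) (hvy : v ≠ y) :
    IsPreGraph dev G (W \ {v}) (insert (a ∪ a') (E \ {a, a'})) := by
  have hother : ∀ b ∈ E \ {a, a'}, v ∉ b := by
    rintro b ⟨hb, hb'⟩ hvb
    exact hb' (honly b hb hvb)
  obtain ⟨p, q, hpq, hW⟩ := h.edge a ha
  obtain ⟨p', q', hpq', hW'⟩ := h.edge a' ha'
  have hvpq : v ∈ ({p, q} : Set X) := hW ▸ ⟨hva.1, hv⟩
  have hvpq' : v ∈ ({p', q'} : Set X) := hW' ▸ ⟨hva.2, hv⟩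
  obtain ⟨o, ho⟩ : ∃ o, ({p, q} : Set X) = {v, o} := by
    rcases hvpq with rfl | rfl
    · exact ⟨q, rfl⟩
    · exact ⟨p, pair_comm _ _⟩
  obtain ⟨o', ho'⟩ : ∃ o', ({p', q'} : Set X) = {v, o'} := by
    rcases hvpq' with rfl | rfl
    · exact ⟨q', rfl⟩
    · exact ⟨p', pair_comm _ _⟩
  -- The endpoints of the merged arc are endpoints of its two parts and differ from `v`, so they are
  -- the far endpoints `o` and `o'`.
  have hend : ∀ z, (z = x ∨ z = y) → z = o ∨ z = o' := by
    intro z hz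
    have hzv : z ≠ v := by rcases hz with rfl | rfl <;> [exact hvx.symm; exact hvy.symm]
    have hz' : z ∈ a ∪ a' := by
      rcases hz with rfl | rfl
      · exact harc.left_mem
      · exact harc.right_mem
    rcases hz' with h1 | h1
    · have : z ∈ ({p, q} : Set X) := harc.endpoint_of_subset hpq subset_union_left hz h1
      rw [ho] at this
      exact Or.inl (this.resolve_left hzv)
    · have : z ∈ ({p', q'} : Set X) := harc.endpoint_of_subset hpq' subset_union_right hz h1
      rw [ho'] at this
      exact Or.inr (this.resolve_left hzv)
  have hov : o ≠ v := by
    rintro rfl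
    have : q = p := by
      have h1 : p ∈ ({o, o} : Set X) := ho ▸ Or.inl rfl
      have h2 : q ∈ ({o, o} : Set X) := ho ▸ Or.inr rfl
      simp at h1 h2; rw [h1, h2]
    exact hpq.ne this.symm
  have hov' : o' ≠ v := by
    rintro rfl
    have : q' = p' := by
      have h1 : p' ∈ ({o', o'} : Set X) := ho' ▸ Or.inl rfl
      have h2 : q' ∈ ({o', o'} : Set X) := ho' ▸ Or.inr rfl
      simp at h1 h2; rw [h1, h2]
    exact hpq'.ne this.symm
  have hxy : ({x, y} : Set X) = {o, o'} := by
    have hne := harc.ne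
    rcases hend x (Or.inl rfl) with e1 | e1 <;> rcases hend y (Or.inr rfl) with e2 | e2 <;>
      subst e1 <;> subst e2
    · exact absurd rfl hne
    · rfl
    · exact pair_comm _ _
    · exact absurd rfl hne
  refine ⟨h.finite_vertices.sdiff, (h.finite_edges.sdiff).insert _, ?_, ?_, ?_, ?_⟩
  · rw [h.support]
    ext z
    simp only [mem_union, mem_sUnion, mem_sdiff, mem_insert_iff, mem_singleton_iff]
    constructor
    · rintro (hz | ⟨b, hb, hz⟩)
      · by_cases e : z = v
        · exact Or.inr ⟨a ∪ a', Or.inl rfl, Or.inl (e ▸ hva.1)⟩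
        · exact Or.inl ⟨hz, e⟩
      · by_cases e : b = a ∨ b = a'
        · refine Or.inr ⟨a ∪ a', Or.inl rfl, ?_⟩
          rcases e with rfl | rfl
          · exact Or.inl hz
          · exact Or.inr hz
        · exact Or.inr ⟨b, Or.inr ⟨hb, e⟩, hz⟩
    · rintro (hz | ⟨b, rfl | hb, hz⟩)
      · exact Or.inl hz.1
      · rcases hz with hz | hz
        · exact Or.inr ⟨a, ha, hz⟩
        · exact Or.inr ⟨a', ha', hz⟩
      · exact Or.inr ⟨b, hb.1, hz⟩
  · rintro b (rfl | hb)
    · refine ⟨x, y, harc, ?_⟩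
      rw [hxy, ← inter_sdiff_assoc, union_inter_distrib_right, hW, hW', ho, ho']
      ext z
      simp only [mem_sdiff, mem_union, mem_insert_iff, mem_singleton_iff]
      constructor
      · rintro ⟨(h1 | h1) | (h1 | h1), h2⟩
        · exact absurd h1 h2
        · exact Or.inl h1
        · exact absurd h1 h2
        · exact Or.inr h1
      · rintro (rfl | rfl)
        · exact ⟨Or.inl (Or.inr rfl), hov⟩
        · exact ⟨Or.inr (Or.inr rfl), hov'⟩
    · obtain ⟨x, y, hxy, hb'⟩ := h.edge b hb.1
      refine ⟨x, y, hxy, ?_⟩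
      rw [← inter_sdiff_assoc, hb', ← hb']
      exact sdiff_singleton_eq_self fun h1 => hother b hb h1.1
  · have hmix : ∀ b ∈ E \ {a, a'}, b ∩ (a ∪ a') ⊆ W \ {v} := by
      rintro b hb z ⟨hzb, hz⟩
      refine ⟨?_, fun e => hother b hb (e ▸ hzb)⟩
      rcases hz with hz | hz
      · exact h.meet b hb.1 a ha (fun e => hb.2 (Or.inl e)) ⟨hzb, hz⟩
      · exact h.meet b hb.1 a' ha' (fun e => hb.2 (Or.inr e)) ⟨hzb, hz⟩
    rintro b (rfl | hb) b' (rfl | hb') hbb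
    · exact absurd rfl hbb
    · rw [inter_comm]; exact hmix b' hb'
    · exact hmix b hb
    · rintro z ⟨hz, hz'⟩
      exact ⟨h.meet b hb.1 b' hb'.1 hbb ⟨hz, hz'⟩, fun e => hother b hb (e ▸ hz)⟩
  · intro z hz
    refine ⟨h.cone z hz, ?_⟩
    rintro rfl
    exact hz hflat

/-- Merging at a degenerate vertex keeps the support and removes one vertex, so strong induction on
the number of vertices applies. -/
theorem IsPreGraph.isGeodesicGraph {X : Type} [TopologicalSpace X] [T2Space X] {dev : X → V3}
    {G W : Set X} {E : Set (Set X)} (h : IsPreGraph dev G W E) : IsGeodesicGraph dev G := by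
  induction hn : W.ncard using Nat.strong_induction_on generalizing W E with
  | _ n ih =>
    by_cases hdeg : ∃ v ∈ W, IsFlatAt dev v ∧ ∃ a ∈ E, ∃ a' ∈ E, a ≠ a' ∧ v ∈ a ∩ a' ∧
      (∀ a'' ∈ E, v ∈ a'' → a'' = a ∨ a'' = a') ∧
      ∃ x y, IsGeodesicArc dev (a ∪ a') x y ∧ v ≠ x ∧ v ≠ y
    · obtain ⟨v, hv, hflat, a, ha, a', ha', hne, hva, honly, x, y, harc, hvx, hvy⟩ := hdeg
      refine ih _ ?_ (h.merge hv hflat ha ha' hne hva honly harc hvx hvy) rfl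
      rw [← hn]
      exact ncard_sdiff_singleton_lt_of_mem hv h.finite_vertices
    · exact ⟨W, E, h.finite_vertices, h.finite_edges, h.support, h.edge, h.meet, h.cone,
        fun v hv hf hd => hdeg ⟨v, hv, hf, hd⟩⟩

/-- A cell depends only on the signs at `l` of the finitely many covectors. -/
theorem finite_range_signCell {V : Set V3} (hV : V.Finite) : (range (signCell V)).Finite := by
  have : Finite V := hV
  refine (Set.finite_range fun σ : V → SignType => {m : V3 | m ⬝ᵥ m = 1 ∧ ∀ v : V,
    (σ v = 0 → (v : V3) ⬝ᵥ m = 0) ∧ (σ v = 1 → 0 ≤ (v : V3) ⬝ᵥ m) ∧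
    (σ v = -1 → (v : V3) ⬝ᵥ m ≤ 0)}).subset ?_
  rintro _ ⟨l, rfl⟩
  refine ⟨fun v => SignType.sign ((v : V3) ⬝ᵥ l), ?_⟩
  ext m
  simp only [signCell, mem_ofPred_eq, Subtype.forall, sign_eq_zero_iff, sign_eq_one_iff,
    sign_eq_neg_one_iff]

/-! ### Skeletons of subdivisions and convexity of faces -/

namespace CellGluing

variable {ι : Type} {S : ι → Set V3} {D : ι → Set V3}
  {r : (Σ i, D i) → (Σ i, D i) → Prop} {V : Set V3} {dev : Quot r → V3}

theorem disjoint_openCell_closedCell {S S' : Set V3} (hS : S.Finite) (hS' : S'.Nonempty)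
    (hne : (openCell S').Nonempty) (h : Disjoint (openCell S) (openCell S')) :
    Disjoint (openCell S) (closedCell S') := by
  rw [Set.disjoint_left]
  intro l hl hl'
  rw [← closure_openCell hS' hne, mem_closure_iff_nhds] at hl'
  obtain ⟨m, hm, hm'⟩ := hl' _ (eventually_pos hS l)
  exact Set.disjoint_left.1 h ⟨hm'.1, fun s hs => hm s hs (hl.2 s hs)⟩ hm'

theorem openCell_subset_D (H : CellGluing S D r V dev) {i : ι} {T : Set V3} (hT : S i ⊆ T) :
    openCell T ⊆ D i := by
  rw [H.eq_closedCell]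
  exact fun l hl => ⟨hl.1, fun s hs => (hl.2 s (hT hs)).le⟩

theorem closedCell_subset_D (H : CellGluing S D r V dev) {i : ι} {T : Set V3} (hT : S i ⊆ T) :
    closedCell T ⊆ D i := by
  rw [H.eq_closedCell]
  exact fun l hl => ⟨hl.1, fun s hs => hl.2 s (hT hs)⟩

/-- Distinct glued polygons have disjoint interiors, and the interior of one is open and so misses
the closure of the other. Hence interior points are glued to no other polygon. -/
theorem eq_of_mem_openCell (H : CellGluing S D r V dev) {i j : ι} {l : V3} (hl : l ∈ openCell (S i))
    {hi : l ∈ D i} {hj : l ∈ D j} (h : pt r i l hi = pt r j l hj) : i = j := by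
  have key : ∀ p q, r p q → (p.2 : V3) ∈ openCell (S p.1) → p.1 = q.1 := by
    intro p q h hp
    by_contra hne
    have hq : (p.2 : V3) ∈ closedCell (S q.1) := by
      rw [H.val_eq _ _ h, ← H.eq_closedCell]; exact q.2.2
    exact Set.disjoint_left.1 (disjoint_openCell_closedCell (H.finite_S _) (H.salient _).nonempty
      (H.nonempty _) (H.disjoint p q h hne)) hp hq
  -- The hypothesis is symmetric in the two ends so that the induction passes through the symmetric
  -- case and can propagate in either direction along a chain.
  have gen : ∀ p q, Relation.EqvGen r p q →
      ((p.2 : V3) ∈ openCell (S p.1) ∨ (q.2 : V3) ∈ openCell (S q.1)) → p.1 = q.1 := by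
    intro p q h
    induction h with
    | rel p q h =>
      rintro (h1 | h1)
      · exact key p q h h1
      · exact (key q p (H.symm _ _ h) h1).symm
    | refl p => exact fun _ => rfl
    | symm p q h ih => exact fun h1 => (ih h1.symm).symm
    | trans p q s h1 h2 ih1 ih2 =>
      rintro (h | h)
      · have e := ih1 (Or.inl h)
        refine e.trans (ih2 (Or.inl ?_))
        rw [← H.eqvGen_val h1]; exact congrArg S e ▸ h
      · have e := ih2 (Or.inr h)
        refine (ih1 (Or.inr ?_)).trans e
        rw [H.eqvGen_val h2]; exact congrArg S e.symm ▸ h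
  exact gen _ _ (Quot.eqvGen_exact h) (Or.inl hl)

theorem isOpen_lift_openCell (H : CellGluing S D r V dev) {i : ι} {T : Set V3} (hT : S i ⊆ T)
    (hTV : T ⊆ V) : IsOpen (lift r i (openCell T)) := by
  rw [isOpen_iff_mem_nhds]
  rintro _ ⟨l, h, hl, rfl⟩
  rw [H.mem_nhds_iff]
  intro k hk hkx
  obtain rfl := H.eq_of_mem_openCell ⟨hl.1, fun s hs => hl.2 s (hT hs)⟩ hkx.symm
  filter_upwards [eventually_pos (H.finite.subset hTV) l] with m hm hmD
  exact ⟨m, hmD, ⟨H.unit_of_mem hmD, fun s hs => hm s hs (hl.2 s hs)⟩, rfl⟩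

theorem injOn_lift (H : CellGluing S D r V dev) (i : ι) (A : Set V3) : InjOn dev (lift r i A) := by
  rintro _ ⟨l, h, -, rfl⟩ _ ⟨m, h', -, rfl⟩ e
  rw [H.dev_pt, H.dev_pt] at e
  exact pt_congr rfl e _ _

theorem eq_lift_image (H : CellGluing S D r V dev) {i : ι} {A : Set V3} {a : Set (Quot r)}
    (ha : a ⊆ lift r i A) : a = lift r i (dev '' a) := by
  ext x
  constructor
  · intro hx
    obtain ⟨l, h, hl, rfl⟩ := ha hx
    exact ⟨l, h, ⟨_, hx, H.dev_pt h⟩, rfl⟩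
  · rintro ⟨l, h, ⟨y, hy, rfl⟩, rfl⟩
    obtain ⟨m, h', hm, rfl⟩ := ha hy
    have e := H.dev_pt h'
    rwa [pt_congr rfl e h h']

theorem isClosed_lift (H : CellGluing S D r V dev) {i : ι} {A : Set V3} (hA : IsClosed A) :
    IsClosed (lift r i A) := by
  have := H.t2Space
  have : CompactSpace (D i) := isCompact_iff_compactSpace.1 (H.isCompact_D i)
  have h : lift r i A = (fun l : D i => pt r i l l.2) '' (Subtype.val ⁻¹' A) := by
    ext x
    constructor
    · rintro ⟨l, h, hl, rfl⟩; exact ⟨⟨l, h⟩, hl, rfl⟩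
    · rintro ⟨⟨l, h⟩, hl, rfl⟩; exact ⟨l, h, hl, rfl⟩
  rw [h]
  exact ((hA.preimage continuous_subtype_val).isCompact.image (continuous_pt i)).isClosed

theorem closure_lift_openCell (H : CellGluing S D r V dev) {i : ι} {T : Set V3} (hT : S i ⊆ T)
    (hne : (openCell T).Nonempty) : closure (lift r i (openCell T)) = lift r i (closedCell T) := by
  apply subset_antisymm
  · refine closure_minimal ?_ (H.isClosed_lift (isClosed_closedCell T))
    rintro _ ⟨l, h, hl, rfl⟩
    exact ⟨l, h, openCell_subset T hl, rfl⟩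
  · rintro _ ⟨l, h, hl, rfl⟩
    have hc : (⟨l, h⟩ : D i) ∈ closure (Subtype.val ⁻¹' openCell T) := by
      rw [IsInducing.subtypeVal.closure_eq_preimage_closure_image, Subtype.image_preimage_coe,
        inter_eq_right.2 (H.openCell_subset_D hT), mem_preimage,
        closure_openCell ((H.salient i).mono hT).nonempty hne]
      exact hl
    have := image_closure_subset_closure_image (continuous_pt (r := r) i) (mem_image_of_mem _ hc)
    refine closure_mono ?_ this
    rintro _ ⟨⟨m, hm⟩, hmT, rfl⟩
    exact ⟨m, hm, hmT, rfl⟩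

theorem isGeodesicArc_lift (H : CellGluing S D r V dev) {i : ι} {p q : V3} (hp : p ∈ D i)
    (hq : q ∈ D i) (hpq : p ≠ q) :
    IsGeodesicArc dev (lift r i (minorArc p q)) (pt r i p hp) (pt r i q hq) := by
  have hp' := hp
  have hq' := hq
  rw [H.eq_closedCell] at hp' hq'
  have hsub : minorArc p q ⊆ D i := by
    rw [H.eq_closedCell]; exact minorArc_subset_closedCell hp' hq'
  have h := isGeodesicArc_of_lift (dev := dev) hp'.1 hq'.1 hpq
    (by rintro rfl; exact (H.salient i).neg_notMem hq' hp') (fun l => pt r i l (hsub l.2))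
    ((continuous_pt i).comp (continuous_inclusion hsub)) fun l => H.dev_pt _
  convert h using 1
  ext x
  constructor
  · rintro ⟨l, h, hl, rfl⟩; exact ⟨⟨l, hl⟩, rfl⟩
  · rintro ⟨⟨l, hl⟩, rfl⟩; exact ⟨l, hsub hl, hl, rfl⟩

/-- Uniqueness of geodesics: in a single polygon a set is determined by its developed image, and an
arc developed into a salient cell is the minor arc between its ends. -/
theorem eq_lift_minorArc (H : CellGluing S D r V dev) {i : ι} {A : Set V3} {a : Set (Quot r)}
    (ha : a ⊆ lift r i A) {x y : Quot r} (h : IsGeodesicArc dev a x y) :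
    a = lift r i (minorArc (dev x) (dev y)) := by
  rw [← h.image_eq (H.salient i)]
  · exact H.eq_lift_image ha
  · rintro _ ⟨z, hz, rfl⟩
    obtain ⟨l, hl, -, rfl⟩ := ha hz
    rw [H.dev_pt, ← H.eq_closedCell]; exact hl

theorem isGeodesicallyConvex_lift (H : CellGluing S D r V dev) (i : ι) (T : Set V3) :
    IsGeodesicallyConvex dev (lift r i (closedCell T)) := by
  rintro _ ⟨p, hp, hpT, rfl⟩ _ ⟨q, hq, hqT, rfl⟩ hne
  have hpq : p ≠ q := fun h => hne (pt_congr rfl h _ _)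
  refine ⟨lift r i (minorArc p q), ⟨?_, H.isGeodesicArc_lift hp hq hpq⟩, ?_⟩
  · rintro _ ⟨l, h, hl, rfl⟩
    exact ⟨l, h, minorArc_subset_closedCell hpT hqT hl, rfl⟩
  · rintro a ⟨ha, h⟩
    rw [H.eq_lift_minorArc ha h, H.dev_pt, H.dev_pt]

/-- A subdivision of the faces into smaller polygons, with sides on the circles of the
arrangement. -/
structure Subdivision (S : ι → Set V3) (V : Set V3) {κ : Type} (φ : κ → ι) (T : κ → Set V3) :
    Prop where
  finite_index : Finite κ
  superset : ∀ k, S (φ k) ⊆ T k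
  subset : ∀ k, T k ⊆ V
  nonempty : ∀ k, (openCell (T k)).Nonempty
  disjoint : ∀ k k', k ≠ k' → φ k = φ k' → Disjoint (openCell (T k)) (openCell (T k'))
  cover : ∀ i, ∀ l ∈ closedCell (S i), ∃ k, φ k = i ∧ l ∈ closedCell (T k)

variable {κ : Type} {φ : κ → ι} {T : κ → Set V3}

/-- The support of the graph formed by the sides of a subdivision. -/
def skeleton (r : (Σ i, D i) → (Σ i, D i) → Prop) (φ : κ → ι) (T : κ → Set V3) : Set (Quot r) :=
  (⋃ k, lift r (φ k) (openCell (T k)))ᶜ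

theorem disjoint_lift_openCell (H : CellGluing S D r V dev) (hK : Subdivision S V φ T) {k k' : κ}
    (h : k ≠ k') : Disjoint (lift r (φ k) (openCell (T k))) (lift r (φ k') (openCell (T k'))) := by
  rw [Set.disjoint_left]
  rintro _ ⟨l, hl, hlk, rfl⟩ ⟨m, hm, hmk, e⟩
  obtain rfl : m = l := by rw [← H.dev_pt hm, e, H.dev_pt]
  have e' := H.eq_of_mem_openCell ⟨hmk.1, fun s hs => hmk.2 s (hK.superset k' hs)⟩ e
  exact Set.disjoint_left.1 (hK.disjoint k k' h e'.symm) hlk hmk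

theorem openFaces_skeleton (H : CellGluing S D r V dev) (hK : Subdivision S V φ T) :
    openFaces (skeleton r φ T) = range fun k => lift r (φ k) (openCell (T k)) := by
  refine openFaces_compl_iUnion (fun k => H.isOpen_lift_openCell (hK.superset k) (hK.subset k))
    (fun k => ⟨?_, isPreconnected_lift _ (isPreconnected_openCell
      ((H.salient _).mono (hK.superset k)).nonempty) (H.openCell_subset_D (hK.superset k))⟩)
    fun k k' h => H.disjoint_lift_openCell hK fun e => h (by rw [e])
  obtain ⟨l, hl⟩ := hK.nonempty k
  exact ⟨_, l, H.openCell_subset_D (hK.superset k) hl, hl, rfl⟩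

/-- A point of one closed piece that is not interior to it is not interior to another piece either:
such a piece would lie in the same polygon, where open pieces miss the other closed pieces. -/
theorem mem_skeleton (H : CellGluing S D r V dev) (hK : Subdivision S V φ T) {k : κ} {l : V3}
    (hl : l ∈ D (φ k)) (hlT : l ∈ closedCell (T k)) :
    pt r (φ k) l hl ∈ skeleton r φ T ↔ l ∉ openCell (T k) := by
  constructor
  · exact fun h h1 => h (mem_iUnion.2 ⟨k, l, hl, h1, rfl⟩)
  · rintro h h1
    obtain ⟨k', m, hm, hmk, e⟩ := mem_iUnion.1 h1
    obtain rfl : m = l := by rw [← H.dev_pt hm, e, H.dev_pt]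
    have e' := H.eq_of_mem_openCell ⟨hmk.1, fun s hs => hmk.2 s (hK.superset k' hs)⟩ e
    have hne : k' ≠ k := by rintro rfl; exact h hmk
    exact Set.disjoint_left.1 (disjoint_openCell_closedCell (H.finite.subset (hK.subset k'))
      ((H.salient _).mono (hK.superset k)).nonempty (hK.nonempty k) (hK.disjoint k' k hne e'))
      hmk hlT

/-- The vertices are the skeleton points over vertices of the arrangement. The edges are lifts of
one-dimensional cells of the whole arrangement, not only of the sides of one piece, so that edges
coming from different pieces match. -/
theorem isPreGraph_skeleton (H : CellGluing S D r V dev) (hK : Subdivision S V φ T) :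
    IsPreGraph dev (skeleton r φ T) (dev ⁻¹' arrVertices V ∩ skeleton r φ T)
      {a | ∃ k l, l ∈ closedCell (T k) ∧ l ∉ arrVertices V ∧ (∃ v ∈ T k, v ⬝ᵥ l = 0) ∧
        a = lift r (φ k) (signCell V l)} := by
  have := hK.finite_index
  have hsub : ∀ k l, l ∈ closedCell (T k) → (∃ v ∈ T k, v ⬝ᵥ l = 0) →
      lift r (φ k) (signCell V l) ⊆ skeleton r φ T := by
    rintro k l hl ⟨v, hv, hvl⟩ _ ⟨m, hm, hml, rfl⟩
    rw [H.mem_skeleton hK hm (signCell_subset_closedCell (hK.subset k) hl hml)]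
    intro h
    exact (h.2 v hv).ne' ((hml.2 v (hK.subset k hv)).1 hvl)
  have hnz : ∀ k, ∀ v ∈ T k, v ≠ 0 := by
    rintro k v hv rfl
    exact H.zero_notMem (hK.subset k hv)
  refine ⟨(H.finite_dev_preimage (finite_arrVertices H.finite)).inter_of_left _, ?_, ?_, ?_, ?_, ?_⟩
  · refine ((Set.finite_univ (α := κ)).image2 (fun k A => lift r (φ k) A)
      (finite_range_signCell H.finite)).subset ?_
    rintro a ⟨k, l, -, -, -, rfl⟩
    exact ⟨k, mem_univ _, _, mem_range_self l, rfl⟩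
  · ext x
    constructor
    · intro hx
      by_cases hd : dev x ∈ arrVertices V
      · exact Or.inl ⟨hd, hx⟩
      · right
        obtain ⟨i, l, hl, rfl⟩ := exists_pt x
        rw [H.dev_pt] at hd
        obtain ⟨k, rfl, hlk⟩ := hK.cover i l (by rw [← H.eq_closedCell]; exact hl)
        rw [H.mem_skeleton hK hl hlk] at hx
        refine ⟨_, ⟨k, l, hlk, hd, ?_, rfl⟩, l, hl, self_mem_signCell hlk.1, rfl⟩
        by_contra! h
        exact hx ⟨hlk.1, fun s hs => lt_of_le_of_ne (hlk.2 s hs) (h s hs).symm⟩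
    · rintro (hx | ⟨a, ⟨k, l, hl, -, hv, rfl⟩, hx⟩)
      · exact hx.2
      · exact hsub k l hl hv hx
  · rintro a ⟨k, l, hl, hlV, hv, rfl⟩
    have hv' := hv
    obtain ⟨v, hvT, hvl⟩ := hv'
    obtain ⟨p, hp, q, hq, hpq, harc, hends⟩ := signCell_eq_minorArc H.finite (hK.subset k)
      ((H.salient _).mono (hK.superset k)) hl hlV (hK.subset k hvT) (hnz k v hvT) hvl
    have hsD : signCell V l ⊆ D (φ k) := fun m hm =>
      H.closedCell_subset_D (hK.superset k) (signCell_subset_closedCell (hK.subset k) hl hm)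
    have hps : p ∈ signCell V l := harc ▸ left_mem_minorArc hp.1
    have hqs : q ∈ signCell V l := harc ▸ right_mem_minorArc hq.1
    refine ⟨pt r (φ k) p (hsD hps), pt r (φ k) q (hsD hqs), ?_, ?_⟩
    · rw [harc]; exact H.isGeodesicArc_lift _ _ hpq
    · ext x
      constructor
      · rintro ⟨⟨m, hm, hml, rfl⟩, hmV, -⟩
        rw [mem_preimage, H.dev_pt] at hmV
        rcases hends m hml hmV with rfl | rfl
        · exact Or.inl rfl
        · exact Or.inr rfl
      · rintro (rfl | rfl)
        · have hm : pt r (φ k) p (hsD hps) ∈ lift r (φ k) (signCell V l) := ⟨p, _, hps, rfl⟩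
          exact ⟨hm, by rw [mem_preimage, H.dev_pt]; exact hp, hsub k l hl hv hm⟩
        · have hm : pt r (φ k) q (hsD hqs) ∈ lift r (φ k) (signCell V l) := ⟨q, _, hqs, rfl⟩
          exact ⟨hm, by rw [mem_preimage, H.dev_pt]; exact hq, hsub k l hl hv hm⟩
  -- At a common point that is not a vertex, both arcs develop onto the cell of that point, and
  -- `move` carries the identification along this cell; so the edges are equal.
  · rintro a ⟨k, l, hl, hlV, hv, rfl⟩ a' ⟨k', l', hl', hlV', hv', rfl⟩ hne x ⟨hx, hx'⟩
    refine ⟨?_, hsub k l hl hv hx⟩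
    by_contra hxV
    obtain ⟨m, hm, hml, rfl⟩ := hx
    obtain ⟨m', hm', hml', e⟩ := hx'
    obtain rfl : m' = m := by rw [← H.dev_pt hm', e, H.dev_pt]
    rw [mem_preimage, H.dev_pt] at hxV
    obtain ⟨v, hvT, hvl⟩ := hv
    obtain ⟨v', hvT', hvl'⟩ := hv'
    have e1 := signCell_eq (hK.subset k hvT) (hnz k v hvT) hvl hml hxV
    have e2 := signCell_eq (hK.subset k' hvT') (hnz k' v' hvT') hvl' hml' hxV
    apply hne
    rw [← e1, ← e2]
    have hmv : ∀ n ∈ signCell V m', ∀ j, m' ∈ D j → n ∈ D j := by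
      intro n hn j hj
      rw [H.eq_closedCell] at hj ⊢
      exact signCell_subset_closedCell (H.subset j) hj hn
    ext y
    constructor
    · rintro ⟨n, hn, hnm, rfl⟩
      exact ⟨n, hmv n hnm _ hm', hnm, H.move e (hmv n hnm)⟩
    · rintro ⟨n, hn, hnm, rfl⟩
      exact ⟨n, hmv n hnm _ hm, hnm, H.move e.symm (hmv n hnm)⟩
  · intro x hx
    refine ⟨?_, ?_⟩
    · by_contra h
      exact hx (H.isFlatAt h)
    · intro h
      -- Open pieces are open in the surface and develop injectively, so they contain no cone
      -- points.
      obtain ⟨k, hk⟩ := mem_iUnion.1 h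
      exact hx ⟨_, (H.isOpen_lift_openCell (hK.superset k) (hK.subset k)).mem_nhds hk,
        H.injOn_lift _ _⟩

theorem isConvexGeodesicGraph_skeleton (H : CellGluing S D r V dev) (hK : Subdivision S V φ T) :
    IsConvexGeodesicGraph dev (skeleton r φ T) where
  graph := by
    have := H.t2Space
    exact (H.isPreGraph_skeleton hK).isGeodesicGraph
  finite_faces := by
    have := hK.finite_index
    rw [H.openFaces_skeleton hK]; exact finite_range _
  cover := by
    rw [H.openFaces_skeleton hK, biUnion_range, eq_univ_iff_forall]
    intro x
    obtain ⟨i, l, hl, rfl⟩ := exists_pt x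
    obtain ⟨k, rfl, hlk⟩ := hK.cover i l (by rw [← H.eq_closedCell]; exact hl)
    refine mem_iUnion.2 ⟨k, ?_⟩
    rw [H.closure_lift_openCell (hK.superset k) (hK.nonempty k)]
    exact ⟨l, hl, hlk, rfl⟩
  convex := by
    rw [H.openFaces_skeleton hK]
    rintro _ ⟨k, rfl⟩
    show IsGeodesicallyConvex dev (closure (lift r (φ k) (openCell (T k))))
    rw [H.closure_lift_openCell (hK.superset k) (hK.nonempty k)]
    exact H.isGeodesicallyConvex_lift _ _

end CellGluing

/-! ### Linear maps between the pieces of two subdivisions -/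

theorem contDiffAt_unitize {v : V3} (hv : v ≠ 0) : ContDiffAt ℝ ∞ unitize v := by
  have h1 : ContDiffAt ℝ ∞ (fun v : V3 => v ⬝ᵥ v) v := by
    simp only [dot_expand]; fun_prop
  have h2 := dot_self_pos hv
  exact ((h1.sqrt h2.ne').inv (sqrt_dot_pos hv).ne').smul contDiffAt_id

theorem contDiffAt_unitize_linear (L : V3 →ₗ[ℝ] V3) {v : V3} (hv : L v ≠ 0) :
    ContDiffAt ℝ ∞ (fun v => unitize (L v)) v :=
  ContDiffAt.comp v (contDiffAt_unitize hv) (LinearMap.toContinuousLinearMap L).contDiff.contDiffAt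

/-- Linear maps respect nonnegative combinations, and positive rescaling of the endpoints is
absorbed in the coefficients. -/
theorem unitize_image_minorArc (L : V3 →ₗ[ℝ] V3) (hL : ∀ v, L v = 0 → v = 0) {p q : V3}
    (hp : p ⬝ᵥ p = 1) (hq : q ⬝ᵥ q = 1) (hpq : p ≠ -q) :
    (fun l => unitize (L l)) '' minorArc p q = minorArc (unitize (L p)) (unitize (L q)) := by
  have hp0 : L p ≠ 0 := fun h => ne_zero_of_unit hp (hL _ h)
  have hq0 : L q ≠ 0 := fun h => ne_zero_of_unit hq (hL _ h)
  obtain ⟨a, ha, hpa⟩ := exists_unitize_eq hp0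
  obtain ⟨b, hb, hqb⟩ := exists_unitize_eq hq0
  ext m
  constructor
  · rintro ⟨l, ⟨hl, s, t, hs, ht, rfl⟩, rfl⟩
    have h0 : L (s • p + t • q) ≠ 0 := fun h => ne_zero_of_unit hl (hL _ h)
    obtain ⟨c, hc, h⟩ := exists_unitize_eq h0
    refine ⟨unitize_unit h0, c * s * a⁻¹, c * t * b⁻¹, by positivity, by positivity, ?_⟩
    show unitize _ = _
    rw [h, hpa, hqb, smul_smul, smul_smul, mul_assoc _ a⁻¹, mul_assoc _ b⁻¹,
      inv_mul_cancel₀ ha.ne', inv_mul_cancel₀ hb.ne', mul_one, mul_one]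
    simp [smul_smul]
  · rintro ⟨hm, s, t, hs, ht, rfl⟩
    have hst : 0 < s * a + t * b := by
      rcases hs.lt_or_eq with h | h
      · positivity
      · rcases ht.lt_or_eq with h' | h'
        · positivity
        · simp [← h, ← h'] at hm
    have h0 : (s * a) • p + (t * b) • q ≠ 0 := comb_ne_zero hp hq hpq hst
    obtain ⟨c, hc, h⟩ := exists_unitize_eq h0
    refine ⟨unitize ((s * a) • p + (t * b) • q), ⟨unitize_unit h0, c * (s * a), c * (t * b),
      by positivity, by positivity, by rw [h, smul_add, smul_smul, smul_smul]⟩, ?_⟩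
    show unitize (L _) = _
    rw [h, map_smul, unitize_smul hc, map_add, map_smul, map_smul, mul_smul, mul_smul, ← hpa, ← hqb]
    exact unitize_of_unit hm

namespace CellGluing

variable {ι : Type} {S : ι → Set V3} {D : ι → Set V3}
  {r : (Σ i, D i) → (Σ i, D i) → Prop} {V : Set V3} {dev : Quot r → V3}
  {κ : Type} {φ φ' : κ → ι} {T T' : κ → Set V3}

/-- Linear isomorphisms that map the polygons of one subdivision onto those of another one. -/
structure LinearMatching (T T' : κ → Set V3) (L L' : κ → V3 →ₗ[ℝ] V3) : Prop where
  left_inv : ∀ k v, L' k (L k v) = v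
  right_inv : ∀ k v, L k (L' k v) = v
  pos_iff : ∀ k v, (∀ s ∈ T k, 0 < s ⬝ᵥ v) ↔ ∀ s ∈ T' k, 0 < s ⬝ᵥ L k v
  nonneg_iff : ∀ k v, (∀ s ∈ T k, 0 ≤ s ⬝ᵥ v) ↔ ∀ s ∈ T' k, 0 ≤ s ⬝ᵥ L k v

variable {L L' : κ → V3 →ₗ[ℝ] V3}

namespace LinearMatching

theorem ne_zero (hL : LinearMatching T T' L L') (k : κ) {v : V3} (hv : v ≠ 0) : L k v ≠ 0 := by
  intro h
  apply hv
  rw [← hL.left_inv k v, h, map_zero]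

theorem symm (hL : LinearMatching T T' L L') : LinearMatching T' T L' L :=
  ⟨hL.right_inv, hL.left_inv, fun k v => by rw [hL.pos_iff, hL.right_inv],
    fun k v => by rw [hL.nonneg_iff, hL.right_inv]⟩

theorem mem_closedCell (hL : LinearMatching T T' L L') {k : κ} {l : V3} (hl : l ∈ closedCell (T k)) :
    unitize (L k l) ∈ closedCell (T' k) :=
  ⟨unitize_unit (hL.ne_zero k (ne_zero_of_unit hl.1)),
    fun s hs => dot_unitize_nonneg ((hL.nonneg_iff k l).1 hl.2 s hs)⟩

theorem unitize_unitize (hL : LinearMatching T T' L L') (k : κ) {l : V3} (hl : l ⬝ᵥ l = 1) :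
    unitize (L' k (unitize (L k l))) = l := by
  obtain ⟨c, hc, h⟩ := exists_unitize_eq (hL.ne_zero k (ne_zero_of_unit hl))
  rw [h, map_smul, hL.left_inv, unitize_smul hc, unitize_of_unit hl]

end LinearMatching

/-- In developed coordinates the map is a linear isomorphism followed by radial projection, and so
is its inverse. Geodesics in a piece are lifts of minor arcs, which such maps preserve; the
embedding property follows from compactness. -/
theorem isConvexTransformation_of_linear (H : CellGluing S D r V dev)
    (hK : Subdivision S V φ T) (hL : LinearMatching T T' L L') {k : κ}
    {Y : Set (Quot r)} (hY : Y = lift r (φ k) (closedCell (T k))) (f : Y → Quot r)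
    (hf : ∀ x, ∃ h, f x = pt r (φ' k) (unitize (L k (dev x))) h) :
    IsConvexTransformation dev Y f := by
  have := H.t2Space
  have := H.compactSpace
  have hmem : ∀ x : Y, dev x ∈ closedCell (T k) := by
    rintro ⟨x, hx⟩
    obtain ⟨l, h, hl, rfl⟩ := hY ▸ hx
    rwa [H.dev_pt]
  have hne : ∀ x : Y, L k (dev x) ≠ 0 := fun x => hL.ne_zero k (ne_zero_of_unit (hmem x).1)
  have hdev : ∀ x : Y, dev (f x) = unitize (L k (dev x)) := fun x => by
    obtain ⟨h, e⟩ := hf x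
    rw [e, H.dev_pt]
  have hinvdev : ∀ x : Y, dev x = unitize (L' k (dev (f x))) := fun x => by
    rw [hdev, hL.unitize_unitize k (hmem x).1]
  have hcont : Continuous f := by
    choose h e using hf
    rw [funext e]
    refine (continuous_pt (r := r) (φ' k)).comp
      (Continuous.subtype_mk (f := fun x : Y => unitize (L k (dev x))) ?_ h)
    rw [continuous_iff_continuousAt]
    intro x
    refine ContinuousAt.comp (g := fun v => unitize (L k v)) ?_
      (H.continuous_dev.comp continuous_subtype_val).continuousAt
    exact (contDiffAt_unitize_linear (L k) (hne x)).continuousAt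
  have hinj : Function.Injective f := by
    intro x y e
    apply Subtype.ext
    have hx : (x : Quot r) ∈ lift r (φ k) (closedCell (T k)) := hY ▸ x.2
    have hy : (y : Quot r) ∈ lift r (φ k) (closedCell (T k)) := hY ▸ y.2
    refine H.injOn_lift _ _ hx hy ?_
    rw [hinvdev x, hinvdev y, e]
  have hYc : IsClosed Y := hY ▸ H.isClosed_lift (isClosed_closedCell _)
  have : CompactSpace Y := isCompact_iff_compactSpace.1 hYc.isCompact
  refine ⟨(hcont.isClosedEmbedding hinj).isEmbedding, fun x => ?_, fun x => ?_, ?_⟩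
  · exact ⟨_, contDiffAt_unitize_linear (L k) (hne x), Filter.Eventually.of_forall hdev⟩
  · refine ⟨fun v => unitize (L' k v), contDiffAt_unitize_linear _ (hL.symm.ne_zero k ?_),
      Filter.Eventually.of_forall hinvdev⟩
    rw [hdev]; exact ne_zero_of_unit (unitize_unit (hne x))
  · intro x y a ha harc
    have ha' : a ⊆ lift r (φ k) (closedCell (T k)) := hY ▸ ha
    obtain ⟨hx, ex⟩ := hf x
    obtain ⟨hy, ey⟩ := hf y
    have hxy : unitize (L k (dev x)) ≠ unitize (L k (dev y)) := by
      rw [← hdev, ← hdev]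
      intro e
      have h1 : dev x = dev y := by rw [hinvdev x, hinvdev y, e]
      exact harc.ne (H.injOn_lift _ _ (ha' harc.left_mem) (ha' harc.right_mem) h1)
    have h1 := H.isGeodesicArc_lift hx hy hxy
    rw [← ex, ← ey] at h1
    convert h1 using 1
    have h2 : dev '' a = minorArc (dev x) (dev y) := by
      refine harc.image_eq ((H.salient _).mono (hK.superset k)) ?_
      rintro _ ⟨z, hz, rfl⟩
      exact hmem ⟨z, ha hz⟩
    rw [← unitize_image_minorArc (L k)
      (fun v h => by_contra fun h' => hL.ne_zero k h' h) (hmem x).1 (hmem y).1, ← h2]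
    · ext z
      constructor
      · rintro ⟨w, hw, rfl⟩
        obtain ⟨h, e⟩ := hf w
        exact ⟨_, h, ⟨_, ⟨_, hw, rfl⟩, rfl⟩, e.symm⟩
      · rintro ⟨m, hm, ⟨_, ⟨w, hw, rfl⟩, rfl⟩, rfl⟩
        obtain ⟨h, e⟩ := hf ⟨w, ha hw⟩
        exact ⟨⟨w, ha hw⟩, hw, e⟩
    · intro e
      have := (((H.salient _).mono (hK.superset k))).neg_notMem (hmem y)
      exact this (e ▸ hmem x)

/-- A map which is linear on the pieces of a subdivision, and maps them onto the pieces of another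
subdivision, extends to a piecewise convex transformation. -/
theorem exists_piecewiseConvexTransformation (H : CellGluing S D r V dev)
    (hK : Subdivision S V φ T) (hK' : Subdivision S V φ' T') (hL : LinearMatching T T' L L')
    (Tb : Quot r → Quot r) (hTb : ∀ k l (h : l ∈ D (φ k)), l ∈ openCell (T k) →
      ∃ h', Tb (pt r (φ k) l h) = pt r (φ' k) (unitize (L k l)) h') :
    (∀ F ∈ openFaces (skeleton r φ T), ContinuousOn Tb F) ∧
    ∃ Tc : (F : openFaces (skeleton r φ T)) → closure (F : Set (Quot r)) → Quot r,
      (∀ T' : (F : openFaces (skeleton r φ T)) → closure (F : Set (Quot r)) → Quot r,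
        (∀ F, Continuous (T' F) ∧ ∀ ξ : closure (F : Set (Quot r)),
          (ξ : Quot r) ∈ (F : Set (Quot r)) → T' F ξ = Tb ξ) ↔ T' = Tc) ∧
      IsPiecewiseConvexTransformation dev (skeleton r φ T) Tc ∧
      ∀ (F : openFaces (skeleton r φ T)) (ξ : closure (F : Set (Quot r))),
        (ξ : Quot r) ∉ skeleton r φ T → Tc F ξ = Tb ξ := by
  have := H.t2Space
  have hF := H.openFaces_skeleton hK
  have hex : ∀ F : openFaces (skeleton r φ T), ∃ k, (F : Set (Quot r)) =
      lift r (φ k) (openCell (T k)) := by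
    rintro ⟨F, hF'⟩
    rw [hF] at hF'
    obtain ⟨k, rfl⟩ := hF'
    exact ⟨k, rfl⟩
  choose kf hkf using hex
  have hlne : ∀ k, (lift r (φ k) (openCell (T k))).Nonempty := by
    intro k
    obtain ⟨l, hl⟩ := hK.nonempty k
    exact ⟨_, l, H.openCell_subset_D (hK.superset k) hl, hl, rfl⟩
  have hlne' : ∀ k, (lift r (φ' k) (openCell (T' k))).Nonempty := by
    intro k
    obtain ⟨l, hl⟩ := hK'.nonempty k
    exact ⟨_, l, H.openCell_subset_D (hK'.superset k) hl, hl, rfl⟩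
  have hkinj : ∀ k k', lift r (φ k) (openCell (T k)) = lift r (φ k') (openCell (T k')) → k = k' := by
    intro k k' e
    by_contra hne
    have h1 := H.disjoint_lift_openCell hK hne
    rw [← e, disjoint_self] at h1
    exact (hlne k).ne_empty h1
  have hksurj : ∀ k, ∃ F, kf F = k := by
    intro k
    refine ⟨⟨lift r (φ k) (openCell (T k)), hF ▸ mem_range_self k⟩, ?_⟩
    exact hkinj _ _ (hkf _).symm
  have hcl : ∀ F : openFaces (skeleton r φ T), closure (F : Set (Quot r)) =
      lift r (φ (kf F)) (closedCell (T (kf F))) := by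
    intro F
    rw [hkf F, H.closure_lift_openCell (hK.superset _) (hK.nonempty _)]
  have hmem : ∀ (F : openFaces (skeleton r φ T)) (ξ : closure (F : Set (Quot r))),
      unitize (L (kf F) (dev ξ)) ∈ D (φ' (kf F)) := by
    rintro F ⟨ξ, hξ⟩
    obtain ⟨l, h, hl, rfl⟩ := hcl F ▸ hξ
    refine H.closedCell_subset_D (hK'.superset _) (hL.mem_closedCell ?_)
    rwa [H.dev_pt]
  -- The formula valid on an open face makes sense on its closure and serves as the extension.
  set Tc : (F : openFaces (skeleton r φ T)) → closure (F : Set (Quot r)) → Quot r :=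
    fun F ξ => pt r (φ' (kf F)) (unitize (L (kf F) (dev ξ))) (hmem F ξ) with hTc
  have hconv : ∀ F : openFaces (skeleton r φ T), IsConvexTransformation dev (closure (F : Set (Quot r))) (Tc F) := fun F =>
    H.isConvexTransformation_of_linear hK hL (hcl F) (Tc F) fun ξ => ⟨hmem F ξ, rfl⟩
  have hTcb : ∀ (F : openFaces (skeleton r φ T)) (ξ : closure (F : Set (Quot r))),
      (ξ : Quot r) ∈ (F : Set (Quot r)) → Tc F ξ = Tb ξ := by
    rintro F ⟨ξ, hξ⟩ hξF
    have h1 : ξ ∈ lift r (φ (kf F)) (openCell (T (kf F))) := hkf F ▸ hξF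
    obtain ⟨l, h, hl, rfl⟩ := h1
    obtain ⟨h', e⟩ := hTb _ l h hl
    show _ = Tb _
    rw [e]
    exact pt_congr rfl (by rw [H.dev_pt]) _ _
  have hrange : ∀ F, range (Tc F) = lift r (φ' (kf F)) (closedCell (T' (kf F))) := by
    intro F
    ext y
    constructor
    · rintro ⟨⟨ξ, hξ⟩, rfl⟩
      refine ⟨_, hmem F ⟨ξ, hξ⟩, ?_, rfl⟩
      obtain ⟨l, h, hl, rfl⟩ := hcl F ▸ hξ
      refine hL.mem_closedCell ?_
      rwa [H.dev_pt]
    · rintro ⟨m, hm, hmT, rfl⟩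
      have h1 := hL.symm.mem_closedCell hmT
      refine ⟨⟨pt r (φ (kf F)) _ (H.closedCell_subset_D (hK.superset _) h1),
        (hcl F).symm ▸ ⟨_, _, h1, rfl⟩⟩, ?_⟩
      exact pt_congr rfl (by rw [H.dev_pt, hL.symm.unitize_unitize _ hmT.1]) _ _
  have hrange' : ∀ F, range (Tc F) = closure (lift r (φ' (kf F)) (openCell (T' (kf F)))) := by
    intro F
    rw [hrange, H.closure_lift_openCell (hK'.superset _) (hK'.nonempty _)]
  refine ⟨?_, Tc, ?_, ⟨H.isGeodesicSurface, H.isConvexGeodesicGraph_skeleton hK, hconv, ?_, ?_,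
    skeleton r φ' T', H.isConvexGeodesicGraph_skeleton hK', ?_⟩, ?_⟩
  · intro F hF'
    rw [continuousOn_iff_continuous_domRestrict]
    have h1 : Continuous fun ξ : F => Tc ⟨F, hF'⟩ ⟨ξ, subset_closure ξ.2⟩ :=
      (hconv ⟨F, hF'⟩).embedding.continuous.comp (continuous_inclusion subset_closure)
    refine h1.congr fun ξ => ?_
    exact hTcb ⟨F, hF'⟩ ⟨ξ, subset_closure ξ.2⟩ ξ.2
  · intro T'
    constructor
    · intro h
      funext F
      -- Uniqueness of the extension: an open face is dense in its closure and the target is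
      -- Hausdorff.
      have hd : Dense (Subtype.val ⁻¹' (F : Set (Quot r)) : Set (closure (F : Set (Quot r)))) := by
        intro ξ
        rw [IsInducing.subtypeVal.closure_eq_preimage_closure_image, Subtype.image_preimage_coe,
          inter_eq_right.2 subset_closure]
        exact ξ.2
      refine Continuous.ext_on hd (h F).1 (hconv F).embedding.continuous fun ξ hξ => ?_
      rw [(h F).2 ξ hξ, hTcb F ξ hξ]
    · rintro rfl F
      exact ⟨(hconv F).embedding.continuous, hTcb F⟩
  · rw [eq_univ_iff_forall]
    intro x
    obtain ⟨i, l, hl, rfl⟩ := exists_pt x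
    obtain ⟨k, rfl, hlk⟩ := hK'.cover i l (by rw [← H.eq_closedCell]; exact hl)
    obtain ⟨F, rfl⟩ := hksurj k
    refine mem_iUnion.2 ⟨F, ?_⟩
    rw [hrange]
    exact ⟨l, hl, hlk, rfl⟩
  · intro F F' hne
    have hk : kf F ≠ kf F' := fun e => hne (Subtype.ext (by rw [hkf F, hkf F', e]))
    have hd := H.disjoint_lift_openCell hK' hk
    have ho := H.isOpen_lift_openCell (hK'.superset (kf F')) (hK'.subset (kf F'))
    rw [hrange', hrange', Set.disjoint_left]
    intro y hy hy'
    have h1 : y ∈ closure (lift r (φ' (kf F')) (openCell (T' (kf F')))) := interior_subset hy'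
    -- A common interior point of two images is approached by the open piece of the second, and the
    -- resulting point by the open piece of the first; but the open pieces are disjoint.
    obtain ⟨z, hz, hz'⟩ := mem_closure_iff.1 h1 _ isOpen_interior hy
    obtain ⟨w, hw, hw'⟩ := mem_closure_iff.1 (interior_subset hz) _ ho hz'
    exact Set.disjoint_left.1 hd hw' hw
  · rw [H.openFaces_skeleton hK', ← range_comp]
    ext Y
    constructor
    · rintro ⟨k, rfl⟩
      obtain ⟨F, rfl⟩ := hksurj k
      exact ⟨F, hrange' F⟩
    · rintro ⟨F, rfl⟩
      exact ⟨kf F, (hrange' F).symm⟩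
  · intro F ξ hξ
    have h1 : (ξ : Quot r) ∈ ⋃ k, lift r (φ k) (openCell (T k)) := not_not.1 hξ
    obtain ⟨k, hk⟩ := mem_iUnion.1 h1
    have hcl' : (ξ : Quot r) ∈ closure (lift r (φ (kf F)) (openCell (T (kf F)))) := by
      rw [← hkf F]; exact ξ.2
    -- The open piece containing `ξ` meets the face whose closure contains `ξ`, so it is that face.
    obtain ⟨z, hz, hz'⟩ := mem_closure_iff.1 hcl' _
      (H.isOpen_lift_openCell (hK.superset k) (hK.subset k)) hk
    have e : k = kf F := by
      by_contra hne
      exact Set.disjoint_left.1 (H.disjoint_lift_openCell hK hne) hz hz'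
    refine hTcb F ξ ?_
    have h2 := (hkf F).symm
    rw [← e] at h2
    exact (Set.ext_iff.1 h2 _).1 hk

end CellGluing

/-! ### Polygons as cones in `ℝ³` -/

theorem cross_cross_same (f g h : V3) :
    crossProduct (crossProduct f g) (crossProduct f h) = (f ⬝ᵥ crossProduct g h) • f := by
  ext i
  rw [dot_expand]
  fin_cases i <;> simp [cross_apply] <;> ring

theorem cross_cross_expand (f a b : V3) :
    crossProduct f (crossProduct a b) = (f ⬝ᵥ b) • a - (f ⬝ᵥ a) • b := by
  ext i
  rw [dot_expand, dot_expand]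
  fin_cases i <;> simp [cross_apply] <;> ring

/-- Coordinates in the frame `a, b, a × b`. -/
theorem frame_expand (a b v : V3) :
    (crossProduct a b ⬝ᵥ crossProduct a b) • v =
      (crossProduct v b ⬝ᵥ crossProduct a b) • a + (crossProduct a v ⬝ᵥ crossProduct a b) • b +
        (crossProduct a b ⬝ᵥ v) • crossProduct a b := by
  ext i
  simp only [dot_expand]
  fin_cases i <;> simp [cross_apply] <;> ring

theorem plane_coords {a b v : V3} (hab : crossProduct a b ≠ 0) (hv : crossProduct a b ⬝ᵥ v = 0) :
    v = ((crossProduct v b ⬝ᵥ crossProduct a b) / (crossProduct a b ⬝ᵥ crossProduct a b)) • a +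
      ((crossProduct a v ⬝ᵥ crossProduct a b) / (crossProduct a b ⬝ᵥ crossProduct a b)) • b := by
  have h := frame_expand a b v
  rw [hv, zero_smul, add_zero] at h
  have h0 := (dot_self_pos hab).ne'
  rw [div_eq_inv_mul, div_eq_inv_mul, mul_smul, mul_smul, ← smul_add, ← h, smul_smul,
    inv_mul_cancel₀ h0, one_smul]

theorem comb_inj {a b : V3} (hab : crossProduct a b ≠ 0) {s t s' t' : ℝ}
    (h : s • a + t • b = s' • a + t' • b) : s = s' ∧ t = t' := by
  have h1 := congrArg (fun v => crossProduct v b) h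
  have h2 := congrArg (fun v => crossProduct a v) h
  simp only [map_add, map_smul, LinearMap.add_apply, LinearMap.smul_apply, cross_self, smul_zero,
    add_zero, zero_add] at h1 h2
  exact ⟨smul_left_injective ℝ hab h1, smul_left_injective ℝ hab h2⟩

/-- The cone over a geodesic polygon: `A i`, `B i` are the endpoints of the sides, `K` is the cone
over the region and `I` the cone over its interior. -/
structure ConePolygon {n : ℕ} (A B : Fin n → V3) (K I : Set V3) (c : V3) : Prop where
  smul_mem : ∀ v ∈ K, ∀ r : ℝ, 0 < r → r • v ∈ K
  isOpen : IsOpen I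
  subset : I ⊆ K
  interior_subset : interior K ⊆ I
  isClosed : IsClosed (insert 0 K)
  dense : K ⊆ closure I
  boundary : ∀ v, (v ∈ K ∧ v ∉ I) ↔ ∃ i, ∃ s t : ℝ, 0 ≤ s ∧ 0 ≤ t ∧ 0 < s + t ∧ v = s • A i + t • B i
  pos : ∀ v ∈ K, 0 < c ⬝ᵥ v
  cross_ne : ∀ i, crossProduct (A i) (B i) ≠ 0
  meet : ∀ i j, i ≠ j → ∀ s t s' t' : ℝ, 0 ≤ s → 0 ≤ t → 0 < s + t → 0 ≤ s' → 0 ≤ t' → 0 < s' + t' →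
    s • A i + t • B i = s' • A j + t' • B j → s = 0 ∨ t = 0

namespace ConePolygon

variable {n : ℕ} {A B : Fin n → V3} {K I : Set V3} {c : V3}

/-- `v` lies in the closed cone over the `i`-th side. -/
def InSide (A B : Fin n → V3) (i : Fin n) (v : V3) : Prop :=
  ∃ s t : ℝ, 0 ≤ s ∧ 0 ≤ t ∧ 0 < s + t ∧ v = s • A i + t • B i

/-- `v` lies in the open cone over the `i`-th side. -/
def InSideInt (A B : Fin n → V3) (i : Fin n) (v : V3) : Prop :=
  ∃ s t : ℝ, 0 < s ∧ 0 < t ∧ v = s • A i + t • B i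

/-- The corners. -/
def cornerSet (A B : Fin n → V3) : Set V3 := range A ∪ range B

/-- The covector of the line containing a side. -/
abbrev sideCov (A B : Fin n → V3) (i : Fin n) : V3 := crossProduct (A i) (B i)

theorem InSideInt.inSide {i : Fin n} {v : V3} (h : InSideInt A B i v) : InSide A B i v := by
  obtain ⟨s, t, hs, ht, h⟩ := h
  exact ⟨s, t, hs.le, ht.le, by positivity, h⟩

theorem InSide.sideCov_dot {i : Fin n} {v : V3} (h : InSide A B i v) : sideCov A B i ⬝ᵥ v = 0 := by
  obtain ⟨s, t, -, -, -, rfl⟩ := h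
  rw [dotProduct_add, dotProduct_smul, dotProduct_smul, dot_cross_left, dot_cross_right]; simp

theorem InSideInt.smul {i : Fin n} {v : V3} (h : InSideInt A B i v) {r : ℝ} (hr : 0 < r) :
    InSideInt A B i (r • v) := by
  obtain ⟨s, t, hs, ht, rfl⟩ := h
  exact ⟨r * s, r * t, by positivity, by positivity, by rw [smul_add, smul_smul, smul_smul]⟩

theorem InSide.smul {i : Fin n} {v : V3} (h : InSide A B i v) {r : ℝ} (hr : 0 < r) :
    InSide A B i (r • v) := by
  obtain ⟨s, t, hs, ht, hst, rfl⟩ := h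
  exact ⟨r * s, r * t, by positivity, by positivity, by rw [← mul_add]; positivity,
    by rw [smul_add, smul_smul, smul_smul]⟩

theorem mem_of_inSide (C : ConePolygon A B K I c) {i : Fin n} {v : V3} (h : InSide A B i v) :
    v ∈ K ∧ v ∉ I := (C.boundary v).2 ⟨i, h⟩

theorem A_mem (C : ConePolygon A B K I c) (i : Fin n) : A i ∈ K :=
  (C.mem_of_inSide (i := i) ⟨1, 0, zero_le_one, le_rfl, by norm_num, by simp⟩).1

theorem B_mem (C : ConePolygon A B K I c) (i : Fin n) : B i ∈ K :=
  (C.mem_of_inSide (i := i) ⟨0, 1, le_rfl, zero_le_one, by norm_num, by simp⟩).1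

theorem corner_mem (C : ConePolygon A B K I c) {w : V3} (hw : w ∈ cornerSet A B) : w ∈ K := by
  rcases hw with ⟨i, rfl⟩ | ⟨i, rfl⟩
  · exact C.A_mem i
  · exact C.B_mem i

theorem eq_of_inSideInt (C : ConePolygon A B K I c) {i j : Fin n} {v : V3}
    (h : InSideInt A B i v) (h' : InSide A B j v) : i = j := by
  by_contra hij
  obtain ⟨s, t, hs, ht, rfl⟩ := h
  obtain ⟨s', t', hs', ht', hst', e⟩ := h'
  rcases C.meet i j hij s t s' t' hs.le ht.le (by positivity) hs' ht' hst' e with h | h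
  · exact hs.ne' h
  · exact ht.ne' h

theorem corner_notMem_sideInt (C : ConePolygon A B K I c) {i : Fin n} {w : V3}
    (hw : w ∈ cornerSet A B) {r : ℝ} (hr : 0 < r) : ¬ InSideInt A B i (r • w) := by
  intro h
  have h' : ∃ j, InSide A B j (r • w) ∧ ¬ InSideInt A B j (r • w) := by
    rcases hw with ⟨j, rfl⟩ | ⟨j, rfl⟩
    · refine ⟨j, ⟨r, 0, hr.le, le_rfl, by simpa, by simp⟩, ?_⟩
      rintro ⟨s, t, hs, ht, e⟩
      have : r • A j + (0 : ℝ) • B j = s • A j + t • B j := by rw [← e]; simp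
      exact ht.ne (comb_inj (C.cross_ne j) this).2
    · refine ⟨j, ⟨0, r, le_rfl, hr.le, by simpa, by simp⟩, ?_⟩
      rintro ⟨s, t, hs, ht, e⟩
      have : (0 : ℝ) • A j + r • B j = s • A j + t • B j := by rw [← e]; simp
      exact hs.ne (comb_inj (C.cross_ne j) this).1
  obtain ⟨j, h1, h2⟩ := h'
  obtain rfl := C.eq_of_inSideInt h h1
  exact h2 h

/-- A boundary point is interior to a side or a corner. -/
theorem inSideInt_or_corner (C : ConePolygon A B K I c) {v : V3} (hv : v ∈ K) (hvI : v ∉ I) :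
    (∃ i, InSideInt A B i v) ∨ ∃ w ∈ cornerSet A B, ∃ r : ℝ, 0 < r ∧ v = r • w := by
  obtain ⟨i, s, t, hs, ht, hst, rfl⟩ := (C.boundary v).1 ⟨hv, hvI⟩
  rcases hs.lt_or_eq with hs' | hs'
  · rcases ht.lt_or_eq with ht' | ht'
    · exact Or.inl ⟨i, s, t, hs', ht', rfl⟩
    · subst ht'
      exact Or.inr ⟨A i, Or.inl ⟨i, rfl⟩, s, hs', by simp⟩
  · subst hs'
    exact Or.inr ⟨B i, Or.inr ⟨i, rfl⟩, t, by linarith, by simp⟩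

theorem inSide_iff (C : ConePolygon A B K I c) (i : Fin n) (v : V3) :
    InSide A B i v ∨ v = 0 ↔ sideCov A B i ⬝ᵥ v = 0 ∧
      0 ≤ crossProduct v (B i) ⬝ᵥ sideCov A B i ∧ 0 ≤ crossProduct (A i) v ⬝ᵥ sideCov A B i := by
  have hg := dot_self_pos (C.cross_ne i)
  constructor
  · rintro (h | rfl)
    · refine ⟨h.sideCov_dot, ?_⟩
      obtain ⟨s, t, hs, ht, -, rfl⟩ := h
      simp only [map_add, map_smul, LinearMap.add_apply, LinearMap.smul_apply, cross_self,
        smul_zero, add_zero, zero_add, smul_dotProduct, smul_eq_mul]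
      exact ⟨by positivity, by positivity⟩
    · simp
  · rintro ⟨h1, h2, h3⟩
    have h4 := plane_coords (C.cross_ne i) h1
    by_cases h5 : v = 0
    · exact Or.inr h5
    left
    refine ⟨_, _, div_nonneg h2 hg.le, div_nonneg h3 hg.le, ?_, h4⟩
    rcases (add_nonneg (div_nonneg h2 hg.le) (div_nonneg h3 hg.le)).lt_or_eq with h | h
    · exact h
    · have e1 := div_nonneg h2 hg.le
      have e2 := div_nonneg h3 hg.le
      refine absurd ?_ h5
      rw [h4, show _ / _ = (0 : ℝ) from le_antisymm (by linarith) e1,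
        show crossProduct (A i) v ⬝ᵥ _ / _ = (0 : ℝ) from le_antisymm (by linarith) e2]
      simp

theorem isClosed_side (C : ConePolygon A B K I c) (i : Fin n) :
    IsClosed {v | InSide A B i v ∨ v = 0} := by
  have h : {v | InSide A B i v ∨ v = 0} = {v | sideCov A B i ⬝ᵥ v = 0} ∩
      ({v | 0 ≤ crossProduct v (B i) ⬝ᵥ sideCov A B i} ∩
        {v | 0 ≤ crossProduct (A i) v ⬝ᵥ sideCov A B i}) := by
    ext v; exact C.inSide_iff i v
  rw [h]
  exact (isClosed_eq (by fun_prop) (by fun_prop)).inter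
    ((isClosed_le (by fun_prop) (by fun_prop)).inter (isClosed_le (by fun_prop) (by fun_prop)))

theorem ne_zero (C : ConePolygon A B K I c) {v : V3} (hv : v ∈ K) : v ≠ 0 :=
  ne_zero_of_dot_pos (C.pos v hv)

theorem isOpen_compl (C : ConePolygon A B K I c) : IsOpen {v | v ∉ K ∧ v ≠ 0} := by
  convert C.isClosed.isOpen_compl using 1
  ext v
  simp only [mem_ofPred_eq, mem_compl_iff, mem_insert_iff, not_or]
  exact and_comm

/-- Near an interior point of a side, the polygon is a half-plane. -/
theorem exists_halfplane (C : ConePolygon A B K I c) {i : Fin n} {b : V3}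
    (hb : InSideInt A B i b) : ∃ ε : ℝ, (ε = 1 ∨ ε = -1) ∧ ∀ᶠ v in 𝓝 b,
      (0 < ε * (sideCov A B i ⬝ᵥ v) → v ∈ I) ∧ (ε * (sideCov A B i ⬝ᵥ v) < 0 → v ∉ K) ∧
      (sideCov A B i ⬝ᵥ v = 0 → InSideInt A B i v) := by
  set g := sideCov A B i with hg
  have hgg := dot_self_pos (C.cross_ne i)
  have hbK := C.mem_of_inSide hb.inSide
  have hb0 : b ≠ 0 := C.ne_zero hbK.1
  have hgb : g ⬝ᵥ b = 0 := hb.inSide.sideCov_dot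
  -- Both coordinates along the side are positive at `b`, hence near `b`; so the plane of the side
  -- contains near `b` only interior points of the side.
  have e1 : ∀ᶠ v in 𝓝 b, g ⬝ᵥ v = 0 → InSideInt A B i v := by
    have h1 : 0 < crossProduct b (B i) ⬝ᵥ g ∧ 0 < crossProduct (A i) b ⬝ᵥ g := by
      obtain ⟨s, t, hs, ht, rfl⟩ := hb
      simp only [map_add, map_smul, LinearMap.add_apply, LinearMap.smul_apply, cross_self,
        smul_zero, add_zero, zero_add, smul_dotProduct, smul_eq_mul]
      exact ⟨by positivity, by positivity⟩
    have c1 : Continuous fun v => crossProduct v (B i) ⬝ᵥ g := by fun_prop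
    have c2 : Continuous fun v => crossProduct (A i) v ⬝ᵥ g := by fun_prop
    filter_upwards [c1.continuousAt.eventually (lt_mem_nhds h1.1),
      c2.continuousAt.eventually (lt_mem_nhds h1.2)] with v h2 h3 h4
    exact ⟨_, _, div_pos h2 hgg, div_pos h3 hgg, plane_coords (C.cross_ne i) h4⟩
  have e2 : ∀ᶠ v in 𝓝 b, ∀ j, j ≠ i → ¬ InSide A B j v := by
    rw [Filter.eventually_all]
    intro j
    by_cases hj : j = i
    · exact Filter.Eventually.of_forall fun v h => absurd hj h
    · have : b ∉ {v | InSide A B j v ∨ v = 0} := by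
        rintro (h | h)
        · exact hj (C.eq_of_inSideInt hb h).symm
        · exact hb0 h
      filter_upwards [(C.isClosed_side j).isOpen_compl.mem_nhds this] with v hv _ h
      exact hv (Or.inl h)
  obtain ⟨ρ, hρ, hball⟩ := Metric.eventually_nhds_iff_ball.1 (e1.and e2)
  set U := Metric.ball b ρ
  have hconv : ∀ ε : ℝ, IsPreconnected (U ∩ {v | 0 < ε * (g ⬝ᵥ v)}) := by
    intro ε
    refine Convex.isPreconnected ((convex_ball b ρ).inter ?_)
    intro x hx y hy s t hs ht hst
    have hx' : 0 < ε * (g ⬝ᵥ x) := hx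
    have hy' : 0 < ε * (g ⬝ᵥ y) := hy
    show 0 < ε * (g ⬝ᵥ (s • x + t • y))
    have : ε * (g ⬝ᵥ (s • x + t • y)) = s * (ε * (g ⬝ᵥ x)) + t * (ε * (g ⬝ᵥ y)) := by
      rw [dotProduct_add, dotProduct_smul, dotProduct_smul, smul_eq_mul, smul_eq_mul]; ring
    rw [this]
    rcases hs.lt_or_eq with h | h
    · positivity
    · obtain rfl : t = 1 := by linarith
      rw [← h]; simpa using hy'
  -- Each half-ball is connected and contains no boundary point, so it lies entirely in the interior
  -- or entirely outside.
  have hdich : ∀ ε : ℝ, (U ∩ {v | 0 < ε * (g ⬝ᵥ v)} ⊆ I) ∨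
      (U ∩ {v | 0 < ε * (g ⬝ᵥ v)} ⊆ {v | v ∉ K ∧ v ≠ 0}) := by
    intro ε
    have hdisj : Disjoint I {v | v ∉ K ∧ v ≠ 0} := by
      rw [Set.disjoint_left]; exact fun v hv h => h.1 (C.subset hv)
    refine (isPreconnected_iff_subset_of_disjoint.1 (hconv ε)) I _ C.isOpen C.isOpen_compl ?_ ?_
    · rintro v ⟨hvU, hv⟩
      have hv' : 0 < ε * (g ⬝ᵥ v) := hv
      have hgv : g ⬝ᵥ v ≠ 0 := by intro h; rw [h, mul_zero] at hv'; exact lt_irrefl _ hv'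
      by_cases hvK : v ∈ K
      · left
        by_contra hvI
        obtain ⟨j, hj⟩ := (C.boundary v).1 ⟨hvK, hvI⟩
        by_cases hji : j = i
        · subst hji
          exact hgv (InSide.sideCov_dot hj)
        · exact (hball v hvU).2 j hji hj
      · exact Or.inr ⟨hvK, fun h => hgv (by rw [h]; simp)⟩
    · rw [hdisj.inter_eq, inter_empty]
  have hU : U ∈ 𝓝 b := Metric.ball_mem_nhds b hρ
  have hmain : ∀ ε : ℝ, (ε = 1 ∨ ε = -1) → U ∩ {v | 0 < ε * (g ⬝ᵥ v)} ⊆ I →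
      U ∩ {v | 0 < -ε * (g ⬝ᵥ v)} ⊆ {v | v ∉ K ∧ v ≠ 0} →
      ∃ ε : ℝ, (ε = 1 ∨ ε = -1) ∧ ∀ᶠ v in 𝓝 b,
        (0 < ε * (g ⬝ᵥ v) → v ∈ I) ∧ (ε * (g ⬝ᵥ v) < 0 → v ∉ K) ∧
        (g ⬝ᵥ v = 0 → InSideInt A B i v) := by
    intro ε hε h1 h2
    refine ⟨ε, hε, ?_⟩
    filter_upwards [hU] with v hv
    exact ⟨fun h => h1 ⟨hv, h⟩, fun h => (h2 ⟨hv, by show 0 < -ε * _; linarith⟩).1,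
      (hball v hv).1⟩
  -- Both halves inside would make `b` an interior point, and both halves outside would contradict
  -- that the interior is dense in the polygon.
  rcases hdich 1 with h1 | h1 <;> rcases hdich (-1) with h2 | h2
  · exfalso
    apply hbK.2
    -- both half-discs are in the interior, hence the whole disc is in the polygon
    have hUK : U ⊆ K := by
      intro v hv
      rcases lt_trichotomy (g ⬝ᵥ v) 0 with h | h | h
      · exact C.subset (h2 ⟨hv, by show (0 : ℝ) < -1 * _; linarith⟩)
      · exact (C.mem_of_inSide ((hball v hv).1 h).inSide).1
      · exact C.subset (h1 ⟨hv, by show (0 : ℝ) < 1 * _; linarith⟩)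
    exact C.interior_subset (mem_interior_iff_mem_nhds.2 (Filter.mem_of_superset hU hUK))
  · exact hmain 1 (Or.inl rfl) h1 h2
  · exact hmain (-1) (Or.inr rfl) h2 (by simpa using h1)
  · exfalso
    obtain ⟨v, hvU, hvI⟩ := mem_closure_iff_nhds.1 (C.dense hbK.1) U hU
    have hvK := C.subset hvI
    rcases lt_trichotomy (g ⬝ᵥ v) 0 with h | h | h
    · exact (h2 ⟨hvU, by show (0 : ℝ) < -1 * _; linarith⟩).1 hvK
    · exact (C.mem_of_inSide ((hball v hvU).1 h).inSide).2 hvI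
    · exact (h1 ⟨hvU, by show (0 : ℝ) < 1 * _; linarith⟩).1 hvK

end ConePolygon

/-! ### Chords of a cone polygon with endpoints interior to two given sides -/

theorem cramer (f g h w : V3) : (f ⬝ᵥ crossProduct g h) • w =
    (w ⬝ᵥ h) • crossProduct f g - (w ⬝ᵥ g) • crossProduct f h + (w ⬝ᵥ f) • crossProduct g h := by
  ext i
  simp only [dot_expand]
  fin_cases i <;> simp [cross_apply] <;> ring

/-- The three-term relation between vectors of a plane. -/
theorem plane_relation {f u v w : V3} (hu : f ⬝ᵥ u = 0) (hv : f ⬝ᵥ v = 0) (hw : f ⬝ᵥ w = 0) :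
    (f ⬝ᵥ crossProduct u w) • v = (f ⬝ᵥ crossProduct v w) • u + (f ⬝ᵥ crossProduct u v) • w := by
  have h1 := cramer u v w f
  rw [hw, hv, hu] at h1
  simp only [zero_smul, sub_zero, add_zero] at h1
  have h2 : (f ⬝ᵥ crossProduct u w) • v - ((f ⬝ᵥ crossProduct v w) • u +
      (f ⬝ᵥ crossProduct u v) • w) = -((u ⬝ᵥ crossProduct v w) • f) := by
    ext i
    simp only [dot_expand]
    fin_cases i <;> simp [cross_apply] <;> ring
  rw [h1, neg_zero, sub_eq_zero] at h2
  exact h2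

namespace ConePolygon

/-- The initial endpoint of an oriented side. -/
def tl {n : ℕ} (A B : Fin n → V3) (o : Fin n × Bool) : V3 := if o.2 then A o.1 else B o.1

/-- The final endpoint of an oriented side. -/
def hd {n : ℕ} (A B : Fin n → V3) (o : Fin n × Bool) : V3 := if o.2 then B o.1 else A o.1

/-- The covector of an oriented side. -/
def oCov {n : ℕ} (A B : Fin n → V3) (o : Fin n × Bool) : V3 := crossProduct (tl A B o) (hd A B o)

/-- The point where the line `f` crosses the line of an oriented side. -/
def hit {n : ℕ} (A B : Fin n → V3) (o : Fin n × Bool) (f : V3) : V3 := crossProduct f (oCov A B o)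

/-- The line `f` crosses the oriented side `o` at an interior point, in the positive direction. -/
def Crosses {n : ℕ} (A B : Fin n → V3) (o : Fin n × Bool) (f : V3) : Prop :=
  f ⬝ᵥ tl A B o < 0 ∧ 0 < f ⬝ᵥ hd A B o

/-- The linear form whose sign gives the order of the points where `f` crosses `o`, `o'`. -/
def lam {n : ℕ} (A B : Fin n → V3) (o o' : Fin n × Bool) (f : V3) : ℝ :=
  f ⬝ᵥ crossProduct (oCov A B o) (oCov A B o')

/-- The line `f` carries a chord from `o` to `o'` whose interior is interior to the polygon. -/
structure Good {n : ℕ} (A B : Fin n → V3) (I : Set V3) (o o' : Fin n × Bool) (f : V3) : Prop where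
  left : Crosses A B o f
  right : Crosses A B o' f
  lam_pos : 0 < lam A B o o' f
  mem : ∀ s t : ℝ, 0 < s → 0 < t → s • hit A B o f + t • hit A B o' f ∈ I

variable {n : ℕ} {A B : Fin n → V3} {K I : Set V3} {c : V3}

theorem hit_eq (o : Fin n × Bool) (f : V3) :
    hit A B o f = (f ⬝ᵥ hd A B o) • tl A B o + (-(f ⬝ᵥ tl A B o)) • hd A B o := by
  rw [hit, oCov, cross_cross_expand, neg_smul, sub_eq_add_neg]

theorem continuous_hit (o : Fin n × Bool) : Continuous (hit A B o) := by
  unfold hit; fun_prop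

theorem continuous_lam (o o' : Fin n × Bool) : Continuous (lam A B o o') := by
  unfold lam; fun_prop

theorem dot_hit (o : Fin n × Bool) (f : V3) : f ⬝ᵥ hit A B o f = 0 := dot_self_cross _ _

theorem oCov_dot_hit (o : Fin n × Bool) (f : V3) : oCov A B o ⬝ᵥ hit A B o f = 0 :=
  dot_cross_self _ _

theorem oCov_dot_hit_right (o o' : Fin n × Bool) (f : V3) :
    oCov A B o ⬝ᵥ hit A B o' f = -lam A B o o' f := by
  unfold hit lam
  simp only [dot_expand]; simp [cross_apply]; ring

theorem oCov_dot_hit_left (o o' : Fin n × Bool) (f : V3) :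
    oCov A B o' ⬝ᵥ hit A B o f = lam A B o o' f := by
  unfold hit lam
  simp only [dot_expand]; simp [cross_apply]; ring

theorem hit_cross_hit (o o' : Fin n × Bool) (f : V3) :
    crossProduct (hit A B o f) (hit A B o' f) = lam A B o o' f • f := cross_cross_same _ _ _

theorem oCov_eq (o : Fin n × Bool) : ∃ ε : ℝ, (ε = 1 ∨ ε = -1) ∧
    oCov A B o = ε • sideCov A B o.1 := by
  unfold oCov tl hd
  split_ifs
  · exact ⟨1, Or.inl rfl, by simp⟩
  · exact ⟨-1, Or.inr rfl, by rw [neg_one_smul, ← cross_anticomm]⟩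

theorem inSideInt_oriented {o : Fin n × Bool} {v : V3} :
    InSideInt A B o.1 v ↔ ∃ s t : ℝ, 0 < s ∧ 0 < t ∧ v = s • tl A B o + t • hd A B o := by
  unfold InSideInt tl hd
  split_ifs
  · rfl
  · constructor
    · rintro ⟨s, t, hs, ht, rfl⟩; exact ⟨t, s, ht, hs, add_comm _ _⟩
    · rintro ⟨s, t, hs, ht, rfl⟩; exact ⟨t, s, ht, hs, add_comm _ _⟩

theorem inSide_oriented {o : Fin n × Bool} {v : V3} :
    InSide A B o.1 v ↔ ∃ s t : ℝ, 0 ≤ s ∧ 0 ≤ t ∧ 0 < s + t ∧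
      v = s • tl A B o + t • hd A B o := by
  unfold InSide tl hd
  split_ifs
  · rfl
  · constructor
    · rintro ⟨s, t, hs, ht, h, rfl⟩; exact ⟨t, s, ht, hs, by linarith, add_comm _ _⟩
    · rintro ⟨s, t, hs, ht, h, rfl⟩; exact ⟨t, s, ht, hs, by linarith, add_comm _ _⟩

theorem tl_mem_cornerSet (o : Fin n × Bool) : tl A B o ∈ cornerSet A B := by
  unfold tl; split_ifs
  · exact Or.inl ⟨_, rfl⟩
  · exact Or.inr ⟨_, rfl⟩

theorem hd_mem_cornerSet (o : Fin n × Bool) : hd A B o ∈ cornerSet A B := by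
  unfold hd; split_ifs
  · exact Or.inr ⟨_, rfl⟩
  · exact Or.inl ⟨_, rfl⟩

theorem finite_cornerSet : (cornerSet A B).Finite := (finite_range A).union (finite_range B)

theorem Crosses.inSideInt {o : Fin n × Bool} {f : V3} (h : Crosses A B o f) :
    InSideInt A B o.1 (hit A B o f) :=
  inSideInt_oriented.2 ⟨_, _, h.2, neg_pos.2 h.1, hit_eq o f⟩

theorem isOpen_crosses (o : Fin n × Bool) : IsOpen {f | Crosses A B o f} := by
  have h : {f | Crosses A B o f} = {f | f ⬝ᵥ tl A B o < 0} ∩ {f | 0 < f ⬝ᵥ hd A B o} := rfl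
  rw [h]
  exact (isOpen_lt (by fun_prop) (by fun_prop)).inter (isOpen_lt (by fun_prop) (by fun_prop))

theorem Crosses.comb {o : Fin n × Bool} {f f' : V3} (h : Crosses A B o f) (h' : Crosses A B o f')
    {s t : ℝ} (hs : 0 ≤ s) (ht : 0 ≤ t) (hst : 0 < s + t) : Crosses A B o (s • f + t • f') := by
  unfold Crosses at *
  simp only [add_dotProduct, smul_dotProduct, smul_eq_mul]
  rcases hs.lt_or_eq with hs | rfl
  · exact ⟨by nlinarith, by nlinarith⟩
  · have : 0 < t := by linarith
    exact ⟨by nlinarith, by nlinarith⟩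

/-- An interior point of a side determines where a transversal line crosses it. -/
theorem exists_crosses {i : Fin n} {v f : V3} (hv : InSideInt A B i v) (hf : f ⬝ᵥ v = 0)
    (hA : f ⬝ᵥ A i ≠ 0) :
    ∃ o : Fin n × Bool, o.1 = i ∧ Crosses A B o f ∧ ∃ r : ℝ, 0 < r ∧ v = r • hit A B o f := by
  obtain ⟨s, t, hs, ht, rfl⟩ := hv
  rw [dotProduct_add, dotProduct_smul, dotProduct_smul, smul_eq_mul, smul_eq_mul] at hf
  have hB : f ⬝ᵥ B i = -(s * (f ⬝ᵥ A i)) / t := by field_simp; linarith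
  rcases lt_or_gt_of_ne hA with h | h
  · have hB' : 0 < f ⬝ᵥ B i := by rw [hB]; apply div_pos _ ht; nlinarith
    refine ⟨(i, true), rfl, ⟨by simpa [tl] using h, by simpa [hd] using hB'⟩, s / (f ⬝ᵥ B i),
      div_pos hs hB', ?_⟩
    rw [hit_eq, smul_add, smul_smul, smul_smul]
    simp only [tl, hd, if_true]
    rw [div_mul_cancel₀ _ hB'.ne']
    congr 2
    field_simp
    linarith
  · have hB' : f ⬝ᵥ B i < 0 := by rw [hB]; apply div_neg_of_neg_of_pos _ ht; nlinarith
    refine ⟨(i, false), rfl, ⟨by simpa [tl] using hB', by simpa [hd] using h⟩, t / (f ⬝ᵥ A i),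
      div_pos ht h, ?_⟩
    rw [hit_eq, smul_add, smul_smul, smul_smul]
    simp only [tl, hd, Bool.false_eq_true, if_false]
    rw [div_mul_cancel₀ _ h.ne', add_comm]
    congr 2
    field_simp
    linarith

theorem crosses_unique {o o' : Fin n × Bool} {f : V3} (h : Crosses A B o f) (h' : Crosses A B o' f)
    (e : o.1 = o'.1) : o = o' := by
  obtain ⟨i, x⟩ := o
  obtain ⟨j, y⟩ := o'
  obtain rfl : i = j := e
  have h1 := h.1
  have h2 := h.2
  have h3 := h'.1
  have h4 := h'.2
  cases x <;> cases y <;> simp [tl, hd] at h1 h2 h3 h4 ⊢ <;> linarith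

theorem comb_mem_pos {u v : V3} (hu : 0 < c ⬝ᵥ u) (hv : 0 < c ⬝ᵥ v) {s t : ℝ} (hs : 0 ≤ s)
    (ht : 0 ≤ t) (hst : 0 < s + t) : 0 < c ⬝ᵥ (s • u + t • v) := by
  rw [dotProduct_add, dotProduct_smul, dotProduct_smul, smul_eq_mul, smul_eq_mul]
  rcases hs.lt_or_eq with hs | rfl
  · nlinarith
  · have : 0 < t := by linarith
    nlinarith

theorem pos_multiple {u v : V3} {r : ℝ} (hu : 0 < c ⬝ᵥ u) (hv : 0 < c ⬝ᵥ v) (h : u = r • v) :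
    0 < r := by
  rw [h, dotProduct_smul, smul_eq_mul] at hu
  exact pos_of_mul_pos_left hu hv.le

theorem InSideInt.mem (C : ConePolygon A B K I c) {i : Fin n} {v : V3} (h : InSideInt A B i v) :
    v ∈ K := (C.mem_of_inSide h.inSide).1

/-- Two different sides are not crossed at the same point. -/
theorem lam_ne_zero (C : ConePolygon A B K I c) {o o' : Fin n × Bool} {f : V3} (hne : o.1 ≠ o'.1)
    (h : Crosses A B o f) (h' : Crosses A B o' f) : lam A B o o' f ≠ 0 := by
  intro h0
  have h1 := hit_cross_hit (A := A) (B := B) o o' f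
  rw [h0, zero_smul] at h1
  have m1 := h.inSideInt.mem C
  have m2 := h'.inSideInt.mem C
  obtain ⟨r, hr⟩ := (cross_eq_zero_iff (C.ne_zero m2)).1 h1
  have hr0 := pos_multiple (C.pos _ m1) (C.pos _ m2) hr
  apply hne
  refine C.eq_of_inSideInt h.inSideInt ?_
  rw [hr]
  exact (h'.inSideInt.smul hr0).inSide

theorem lam_eq_zero_of_eq {o o' : Fin n × Bool} (h : o.1 = o'.1) (f : V3) : lam A B o o' f = 0 := by
  obtain ⟨ε, -, h1⟩ := oCov_eq (A := A) (B := B) o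
  obtain ⟨ε', -, h2⟩ := oCov_eq (A := A) (B := B) o'
  unfold lam
  rw [h1, h2, h]
  simp

theorem lam_comb (o o' : Fin n × Bool) (f f' : V3) (s t : ℝ) :
    lam A B o o' (s • f + t • f') = s * lam A B o o' f + t * lam A B o o' f' := by
  unfold lam
  simp only [add_dotProduct, smul_dotProduct, smul_eq_mul]

/-- The order in which two sides are crossed is constant. -/
theorem lam_pos_of (C : ConePolygon A B K I c) {o o' : Fin n × Bool} {f f' : V3}
    (h1 : Crosses A B o f) (h1' : Crosses A B o' f) (h2 : Crosses A B o f')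
    (h2' : Crosses A B o' f') (h : 0 < lam A B o o' f) : 0 < lam A B o o' f' := by
  by_contra hneg
  push Not at hneg
  have hne : o.1 ≠ o'.1 := fun e => h.ne' (lam_eq_zero_of_eq e f)
  have h3 : lam A B o o' f - lam A B o o' f' > 0 := by linarith
  -- If the order changed, the form would vanish at this combination of `f` and `f'`, although it
  -- still crosses both sides.
  refine C.lam_ne_zero hne (h1.comb h2 (s := -lam A B o o' f') (t := lam A B o o' f)
    (by linarith) h.le (by linarith)) (h1'.comb h2' (by linarith) h.le (by linarith)) ?_
  rw [lam_comb]; ring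

/-- The corners which may lie on a chord from `o` to `o'`. -/
def Between (A B : Fin n → V3) (o o' : Fin n × Bool) (w : V3) : Prop :=
  w ∈ cornerSet A B ∧ oCov A B o ⬝ᵥ w < 0 ∧ 0 < oCov A B o' ⬝ᵥ w

/-- By Cramer's rule the coefficients of `w` with respect to the two crossing points are, up to the
positive factor `lam`, its values under the two side covectors. So which corners can lie on a chord
between the two sides does not depend on the line. -/
theorem comb_of_between {o o' : Fin n × Bool} {f w : V3} (hl : 0 < lam A B o o' f)
    (hf : f ⬝ᵥ w = 0) (h1 : oCov A B o ⬝ᵥ w < 0) (h2 : 0 < oCov A B o' ⬝ᵥ w) :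
    ∃ s t : ℝ, 0 < s ∧ 0 < t ∧ w = s • hit A B o f + t • hit A B o' f := by
  have h := cramer f (oCov A B o) (oCov A B o') w
  rw [dotProduct_comm w f, hf, zero_smul, add_zero, dotProduct_comm w, dotProduct_comm w] at h
  refine ⟨(oCov A B o' ⬝ᵥ w) / lam A B o o' f, -(oCov A B o ⬝ᵥ w) / lam A B o o' f,
    div_pos h2 hl, div_pos (by linarith) hl, ?_⟩
  have h' : lam A B o o' f • w = (oCov A B o' ⬝ᵥ w) • hit A B o f +
      (-(oCov A B o ⬝ᵥ w)) • hit A B o' f := by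
    rw [neg_smul, ← sub_eq_add_neg]; exact h
  rw [div_eq_inv_mul, div_eq_inv_mul, mul_smul, mul_smul, ← smul_add, ← h', smul_smul,
    inv_mul_cancel₀ hl.ne', one_smul]

theorem between_of_comb {o o' : Fin n × Bool} {f w : V3} (hl : 0 < lam A B o o' f) {s t : ℝ}
    (hs : 0 < s) (ht : 0 < t) (h : w = s • hit A B o f + t • hit A B o' f) :
    oCov A B o ⬝ᵥ w < 0 ∧ 0 < oCov A B o' ⬝ᵥ w := by
  subst h
  simp only [dotProduct_add, dotProduct_smul, smul_eq_mul, oCov_dot_hit, oCov_dot_hit_right o o',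
    oCov_dot_hit_left o o']
  constructor <;> nlinarith

/-- A segment in the polygon does not cross a side at an interior point. -/
theorem sideCov_dot_eq_zero (C : ConePolygon A B K I c) {b e : V3}
    (hK : ∀ s t : ℝ, 0 < s → 0 < t → s • b + t • e ∈ K) {s t : ℝ} (hs : 0 < s) (ht : 0 < t)
    {k : Fin n} (hk : InSideInt A B k (s • b + t • e)) : sideCov A B k ⬝ᵥ e = 0 := by
  have hgp := hk.inSide.sideCov_dot
  rw [dotProduct_add, dotProduct_smul, dotProduct_smul, smul_eq_mul, smul_eq_mul] at hgp
  obtain ⟨ε, hε, hloc⟩ := C.exists_halfplane hk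
  have hcont : Filter.Tendsto (fun δ : ℝ => s • b + (t + δ) • e) (𝓝 0) (𝓝 (s • b + t • e)) := by
    have : Continuous fun δ : ℝ => s • b + (t + δ) • e := by fun_prop
    simpa using this.tendsto 0
  have hpos : ∀ᶠ δ : ℝ in 𝓝 0, 0 < t + δ := by
    have : Continuous fun δ : ℝ => t + δ := by fun_prop
    exact this.continuousAt.eventually (lt_mem_nhds (by simpa))
  obtain ⟨ρ, hρ, hball⟩ := Metric.eventually_nhds_iff_ball.1 ((hcont.eventually hloc).and hpos)
  -- The point can be moved along the segment in both directions, and remaining in the polygon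
  -- forces a weak sign for `δ` as well as for `-δ`.
  have side : ∀ δ : ℝ, |δ| < ρ → 0 ≤ ε * (δ * (sideCov A B k ⬝ᵥ e)) := by
    intro δ hδ
    obtain ⟨h1, h2⟩ := hball δ (by simpa using hδ)
    by_contra hneg
    push Not at hneg
    refine h1.2.1 ?_ (hK s (t + δ) hs h2)
    rw [dotProduct_add, dotProduct_smul, dotProduct_smul, smul_eq_mul, smul_eq_mul]
    have : s * (sideCov A B k ⬝ᵥ b) + (t + δ) * (sideCov A B k ⬝ᵥ e) =
      δ * (sideCov A B k ⬝ᵥ e) := by linarith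
    rw [this]; exact hneg
  have s1 := side (ρ / 2) (by rw [abs_of_pos (by linarith)]; linarith)
  have s2 := side (-(ρ / 2)) (by rw [abs_neg, abs_of_pos (by linarith)]; linarith)
  have h3 : ε * (ρ / 2 * (sideCov A B k ⬝ᵥ e)) = 0 := by linarith
  have hε0 : ε ≠ 0 := by rcases hε with rfl | rfl <;> norm_num
  have := (mul_eq_zero.1 h3).resolve_left hε0
  exact (mul_eq_zero.1 this).resolve_left (by linarith)

/-- A segment in the polygon which contains no corner and whose endpoints are transversal interior
points of sides is interior to the polygon. -/
theorem segment_subset_interior (C : ConePolygon A B K I c) {i j : Fin n} {b e : V3}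
    (hb : InSideInt A B i b) (he : InSideInt A B j e)
    (hi : crossProduct b e ⬝ᵥ A i ≠ 0) (hj : crossProduct b e ⬝ᵥ A j ≠ 0)
    (hK : ∀ s t : ℝ, 0 < s → 0 < t → s • b + t • e ∈ K)
    (hw : ∀ w ∈ cornerSet A B, ∀ s t : ℝ, 0 < s → 0 < t → w ≠ s • b + t • e) {s t : ℝ}
    (hs : 0 < s) (ht : 0 < t) : s • b + t • e ∈ I := by
  by_contra hI
  have hbe : crossProduct b e ≠ 0 := by intro h; rw [h] at hi; simp at hi
  rcases C.inSideInt_or_corner (hK s t hs ht) hI with ⟨k, hk⟩ | ⟨w, hwc, r, hr, h⟩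
  swap
  · refine hw w hwc (r⁻¹ * s) (r⁻¹ * t) (by positivity) (by positivity) ?_
    rw [mul_smul, mul_smul, ← smul_add, h, smul_smul, inv_mul_cancel₀ hr.ne', one_smul]
  have hgp := hk.inSide.sideCov_dot
  rw [dotProduct_add, dotProduct_smul, dotProduct_smul, smul_eq_mul, smul_eq_mul] at hgp
  by_cases hge : sideCov A B k ⬝ᵥ e = 0
  · -- the segment runs along the side `k`
    have hgb : sideCov A B k ⬝ᵥ b = 0 := by
      rw [hge, mul_zero, add_zero] at hgp
      exact (mul_eq_zero.1 hgp).resolve_left hs.ne'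
    have hfg : crossProduct (sideCov A B k) (crossProduct b e) = 0 := by
      rw [cross_cross_expand, hge, hgb]; simp
    obtain ⟨q, hq⟩ := (cross_eq_zero_iff hbe).1 hfg
    have hq0 : q ≠ 0 := by
      rintro rfl
      exact C.cross_ne k (by simpa using hq)
    have perp : ∀ v, sideCov A B k ⬝ᵥ v = 0 → crossProduct b e ⬝ᵥ v = 0 := by
      intro v hv
      rw [hq, smul_dotProduct, smul_eq_mul] at hv
      exact (mul_eq_zero.1 hv).resolve_left hq0
    have hik : i ≠ k := by rintro rfl; exact hi (perp _ (dot_cross_left _ _))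
    have hjk : j ≠ k := by rintro rfl; exact hj (perp _ (dot_cross_left _ _))
    have hA := plane_coords hbe (perp (A k) (dot_cross_left _ _))
    have hB := plane_coords hbe (perp (B k) (dot_cross_right _ _))
    -- The endpoints of the side `k` are written in the basis `b`, `e`. As no corner lies on the
    -- open segment, neither endpoint has two positive coordinates.
    set x := (crossProduct (A k) e ⬝ᵥ crossProduct b e) / (crossProduct b e ⬝ᵥ crossProduct b e)
    set y := (crossProduct b (A k) ⬝ᵥ crossProduct b e) / (crossProduct b e ⬝ᵥ crossProduct b e)
    set x' := (crossProduct (B k) e ⬝ᵥ crossProduct b e) / (crossProduct b e ⬝ᵥ crossProduct b e)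
    set y' := (crossProduct b (B k) ⬝ᵥ crossProduct b e) / (crossProduct b e ⬝ᵥ crossProduct b e)
    have nA : ¬ (0 < x ∧ 0 < y) := fun h => hw (A k) (Or.inl ⟨k, rfl⟩) x y h.1 h.2 hA
    have nB : ¬ (0 < x' ∧ 0 < y') := fun h => hw (B k) (Or.inr ⟨k, rfl⟩) x' y' h.1 h.2 hB
    obtain ⟨α, β, hα, hβ, hp⟩ := hk
    have hp' : s • b + t • e = (α * x + β * x') • b + (α * y + β * y') • e := by
      rw [hp, hA, hB]; module
    obtain ⟨e1, e2⟩ := comb_inj hbe hp'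
    have cA := C.pos _ (C.A_mem k)
    have cB := C.pos _ (C.B_mem k)
    have cb := C.pos _ (hb.mem C)
    have ce := C.pos _ (he.mem C)
    -- a nonnegative combination of the endpoints of the side which is a multiple of `v`
    have key : ∀ (p q d : ℝ) (v : V3), 0 ≤ p → 0 ≤ q → 0 < p + q → 0 < c ⬝ᵥ v →
        p • A k + q • B k = d • v → InSide A B k v := by
      intro p q d v hp hq hpq hv h
      have hd : 0 < d := pos_multiple (comb_mem_pos cA cB hp hq hpq) hv h
      refine ⟨d⁻¹ * p, d⁻¹ * q, by positivity, by positivity, by rw [← mul_add]; positivity, ?_⟩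
      rw [mul_smul, mul_smul, ← smul_add, h, smul_smul, inv_mul_cancel₀ hd.ne', one_smul]
    -- Eliminating `b` from the two expansions exhibits a multiple of `e` as a nonnegative
    -- combination of the endpoints of the side.
    have he' : x ≤ 0 ∨ x' ≤ 0 → InSide A B k e := by
      rintro (hx | hx)
      · have hx' : 0 < x' := by nlinarith
        refine key x' (-x) (x' * y - x * y') e hx'.le (by linarith) (by linarith) ce ?_
        rw [hA, hB]; module
      · have hx' : 0 < x := by nlinarith
        refine key (-x') x (x * y' - x' * y) e (by linarith) hx'.le (by linarith) ce ?_
        rw [hA, hB]; module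
    by_cases hx : x ≤ 0 ∨ x' ≤ 0
    · exact hjk (C.eq_of_inSideInt he (he' hx))
    -- In the remaining case both coordinates along `e` are nonpositive, which contradicts the
    -- positive coefficient `t`.
    · push Not at hx
      have hy : y ≤ 0 ∧ y' ≤ 0 := ⟨not_lt.1 fun h => nA ⟨hx.1, h⟩, not_lt.1 fun h => nB ⟨hx.2, h⟩⟩
      nlinarith
  · exact hge (C.sideCov_dot_eq_zero hK hs ht hk)

end ConePolygon

/-! ### The cells of good lines -/

namespace ConePolygon

variable {n : ℕ} {A B : Fin n → V3} {K I : Set V3} {c : V3}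

/-- A chord without corners, with transversal endpoints interior to sides, is carried by a good
line. -/
theorem exists_good (C : ConePolygon A B K I c) {i j : Fin n} {b e f : V3} {r : ℝ} (hr : 0 < r)
    (hf : f = r • crossProduct b e) (hb : InSideInt A B i b) (he : InSideInt A B j e)
    (hi : f ⬝ᵥ A i ≠ 0) (hj : f ⬝ᵥ A j ≠ 0)
    (hK : ∀ s t : ℝ, 0 < s → 0 < t → s • b + t • e ∈ K)
    (hw : ∀ w ∈ cornerSet A B, ∀ s t : ℝ, 0 < s → 0 < t → w ≠ s • b + t • e) :
    ∃ o o' : Fin n × Bool, o.1 = i ∧ o'.1 = j ∧ Good A B I o o' f ∧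
      (∃ r : ℝ, 0 < r ∧ b = r • hit A B o f) ∧ ∃ r : ℝ, 0 < r ∧ e = r • hit A B o' f := by
  have hfb : f ⬝ᵥ b = 0 := by rw [hf, smul_dotProduct, dot_cross_left, smul_zero]
  have hfe : f ⬝ᵥ e = 0 := by rw [hf, smul_dotProduct, dot_cross_right, smul_zero]
  obtain ⟨o, ho, h1, r1, hr1, e1⟩ := exists_crosses hb hfb hi
  obtain ⟨o', ho', h2, r2, hr2, e2⟩ := exists_crosses he hfe hj
  refine ⟨o, o', ho, ho', ⟨h1, h2, ?_, ?_⟩, ⟨r1, hr1, e1⟩, r2, hr2, e2⟩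
  -- Computing the covector from the crossing points reproduces `f` with a positive multiple of
  -- `lam` as factor; this determines the sign of `lam`.
  · have h3 : f = (r * (r1 * r2 * lam A B o o' f)) • f := by
      conv_lhs => rw [hf, e1, e2]
      simp only [map_smul, LinearMap.smul_apply, hit_cross_hit]
      module
    have hf0 : f ≠ 0 := by rintro rfl; simp at hi
    have h4 : 1 = r * (r1 * r2 * lam A B o o' f) :=
      smul_left_injective ℝ hf0 (by simpa using h3)
    have h5 : 0 < r * (r1 * r2) * lam A B o o' f := by linarith
    exact pos_of_mul_pos_right h5 (by positivity)
  · intro s t hs ht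
    have hi' : crossProduct b e ⬝ᵥ A i ≠ 0 := by
      intro h; apply hi; rw [hf, smul_dotProduct, h, smul_zero]
    have hj' : crossProduct b e ⬝ᵥ A j ≠ 0 := by
      intro h; apply hj; rw [hf, smul_dotProduct, h, smul_zero]
    have := C.segment_subset_interior hb he hi' hj' hK hw (s := s / r1) (t := t / r2)
      (by positivity) (by positivity)
    rw [e1, e2, smul_smul, smul_smul, div_mul_cancel₀ _ hr1.ne', div_mul_cancel₀ _ hr2.ne'] at this
    exact this

theorem smul_mem_interior (C : ConePolygon A B K I c) {v : V3} (hv : v ∈ I) {r : ℝ} (hr : 0 < r) :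
    r • v ∈ I := by
  by_contra h
  obtain ⟨i, hi⟩ := (C.boundary _).1 ⟨C.smul_mem _ (C.subset hv) r hr, h⟩
  have h1 : InSide A B i (r • v) := hi
  have h2 := h1.smul (inv_pos.2 hr)
  rw [smul_smul, inv_mul_cancel₀ hr.ne', one_smul] at h2
  exact (C.mem_of_inSide h2).2 hv

/-- Separates goodness into a condition that is closed under limits, namely that the segment stays
in the polygon, and finitely many linear conditions on `f`, namely that no corner lies on the open
segment. -/
theorem good_iff (C : ConePolygon A B K I c) {o o' : Fin n × Bool} {f : V3}
    (h1 : Crosses A B o f) (h2 : Crosses A B o' f) (hl : 0 < lam A B o o' f) :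
    Good A B I o o' f ↔ (∀ s t : ℝ, 0 < s → 0 < t → s • hit A B o f + t • hit A B o' f ∈ K) ∧
      ∀ w, Between A B o o' w → f ⬝ᵥ w ≠ 0 := by
  constructor
  · intro h
    refine ⟨fun s t hs ht => C.subset (h.mem s t hs ht), fun w hw h0 => ?_⟩
    obtain ⟨s, t, hs, ht, e⟩ := comb_of_between hl h0 hw.2.1 hw.2.2
    have hI := h.mem s t hs ht
    rw [← e] at hI
    rcases hw.1 with ⟨i, rfl⟩ | ⟨i, rfl⟩
    · exact (C.mem_of_inSide (i := i) ⟨1, 0, zero_le_one, le_rfl, by norm_num, by simp⟩).2 hI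
    · exact (C.mem_of_inSide (i := i) ⟨0, 1, le_rfl, zero_le_one, by norm_num, by simp⟩).2 hI
  · rintro ⟨hK, hw⟩
    refine ⟨h1, h2, hl, fun s t hs ht => ?_⟩
    have hx : ∀ o : Fin n × Bool, Crosses A B o f → f ⬝ᵥ A o.1 ≠ 0 := by
      rintro ⟨i, x⟩ ⟨h, h'⟩
      cases x
      · simp [tl, hd] at h h' ⊢; exact h'.ne'
      · simp [tl, hd] at h h' ⊢; exact h.ne
    refine C.segment_subset_interior h1.inSideInt h2.inSideInt ?_ ?_ hK ?_ hs ht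
    · rw [hit_cross_hit, smul_dotProduct]; exact mul_ne_zero hl.ne' (hx o h1)
    · rw [hit_cross_hit, smul_dotProduct]; exact mul_ne_zero hl.ne' (hx o' h2)
    · intro w hwc s t hs ht e
      refine hw w ⟨hwc, between_of_comb hl hs ht e⟩ ?_
      rw [e, dotProduct_add, dotProduct_smul, dotProduct_smul, dot_hit, dot_hit]; simp

/-- The chord is parametrized by `[0, 1]`. Every parameter has a neighbourhood in which the points
stay interior, also for nearby lines, and compactness of `[0, 1]` makes the neighbourhood of `f`
uniform. At the two ends the local half-plane picture is used instead of openness of `I`. -/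
theorem isOpen_good (C : ConePolygon A B K I c) (o o' : Fin n × Bool) :
    IsOpen {f | Good A B I o o' f} := by
  rw [isOpen_iff_eventually]
  intro f hf
  have hl := hf.lam_pos
  have el : ∀ᶠ f' in 𝓝 f, 0 < lam A B o o' f' :=
    (continuous_lam o o').continuousAt.eventually (lt_mem_nhds hl)
  have e1 := (isOpen_crosses (A := A) (B := B) o).mem_nhds hf.left
  have e2 := (isOpen_crosses (A := A) (B := B) o').mem_nhds hf.right
  set p : V3 × ℝ → V3 := fun x => (1 - x.2) • hit A B o x.1 + x.2 • hit A B o' x.1 with hp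
  have hpc : Continuous p := by
    have h1 := (continuous_hit (A := A) (B := B) o).comp (continuous_fst (X := V3) (Y := ℝ))
    have h2 := (continuous_hit (A := A) (B := B) o').comp (continuous_fst (X := V3) (Y := ℝ))
    exact ((continuous_const.sub continuous_snd).smul h1).add (continuous_snd.smul h2)
  have hmem : ∀ s : ℝ, 0 < s → s < 1 → p (f, s) ∈ I := fun s h0 h1 =>
    hf.mem (1 - s) s (by linarith) h0
  have lam_pair : ∀ x : V3 × ℝ, oCov A B o ⬝ᵥ p x = -(x.2 * lam A B o o' x.1) ∧
      oCov A B o' ⬝ᵥ p x = (1 - x.2) * lam A B o o' x.1 := by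
    intro x
    simp only [hp, dotProduct_add, dotProduct_smul, smul_eq_mul, oCov_dot_hit,
      oCov_dot_hit_right o o', oCov_dot_hit_left o o']
    constructor <;> ring
  -- near an endpoint: `q` is the oriented side and `σ` the sign on the segment
  have endpt : ∀ (q : Fin n × Bool) (s₀ σ : ℝ), InSideInt A B q.1 (p (f, s₀)) →
      (∀ x : V3 × ℝ, 0 < lam A B o o' x.1 → 0 < x.2 → x.2 < 1 → 0 < σ * (oCov A B q ⬝ᵥ p x)) →
      s₀ ∈ closure (Ioo (0 : ℝ) 1) →
      ∀ᶠ x : V3 × ℝ in 𝓝 (f, s₀), 0 < x.2 → x.2 < 1 → p x ∈ I := by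
    intro q s₀ σ hq hσ hs₀
    obtain ⟨ε, hε, hloc⟩ := C.exists_halfplane hq
    obtain ⟨ε', hε', hcov⟩ := oCov_eq (A := A) (B := B) q
    have hev := hpc.continuousAt.eventually hloc
    -- The given chord itself shows that its sign with respect to the side agrees with the inner
    -- side of the polygon.
    have hσε : 0 ≤ σ * (ε' * ε) := by
      have hev' : ∀ᶠ s : ℝ in 𝓝 s₀, (fun v => ε * (sideCov A B q.1 ⬝ᵥ v) < 0 → v ∉ K) (p (f, s)) := by
        have : Continuous fun s : ℝ => (f, s) := by fun_prop
        filter_upwards [this.continuousAt.eventually hev] with s hs using hs.2.1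
      obtain ⟨s, hs, hs1⟩ := mem_closure_iff_nhds.1 hs₀ _ hev'
      have h1 := hσ (f, s) hl hs1.1 hs1.2
      have h2 : 0 ≤ ε * (sideCov A B q.1 ⬝ᵥ p (f, s)) := by
        by_contra hneg
        push Not at hneg
        exact hs hneg (C.subset (hmem s hs1.1 hs1.2))
      rw [hcov, smul_dotProduct, smul_eq_mul] at h1
      have h3 : 0 ≤ (σ * (ε' * (sideCov A B q.1 ⬝ᵥ p (f, s)))) *
        (ε * (sideCov A B q.1 ⬝ᵥ p (f, s))) := mul_nonneg h1.le h2
      have h4 : (σ * (ε' * (sideCov A B q.1 ⬝ᵥ p (f, s)))) * (ε * (sideCov A B q.1 ⬝ᵥ p (f, s)))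
        = (σ * (ε' * ε)) * (sideCov A B q.1 ⬝ᵥ p (f, s)) ^ 2 := by ring
      have h5 : sideCov A B q.1 ⬝ᵥ p (f, s) ≠ 0 := by
        intro h; rw [h] at h1; simp at h1
      rw [h4] at h3
      exact nonneg_of_mul_nonneg_left h3 (by positivity)
    have hl' : ∀ᶠ x : V3 × ℝ in 𝓝 (f, s₀), 0 < lam A B o o' x.1 :=
      (continuous_fst (X := V3) (Y := ℝ)).continuousAt.eventually (p := fun f' => 0 < lam A B o o' f') el
    filter_upwards [hev, hl'] with x hx hlx h0 h1
    refine hx.1 ?_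
    have h2 := hσ x hlx h0 h1
    rw [hcov, smul_dotProduct, smul_eq_mul] at h2
    have hsq : ε' * ε' = 1 := by rcases hε' with rfl | rfl <;> norm_num
    have hsq' : ε * ε = 1 := by rcases hε with rfl | rfl <;> norm_num
    have hσ0 : 0 < σ * (ε' * ε) := by
      refine hσε.lt_of_ne fun h => ?_
      have : σ = 0 := by
        have h6 : σ * (ε' * ε) * (ε' * ε) = σ * ((ε' * ε') * (ε * ε)) := by ring
        rw [← h, hsq, hsq'] at h6; linarith
      rw [this] at h2; simp at h2
    have h7 : σ * (ε' * (sideCov A B q.1 ⬝ᵥ p x)) =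
        (σ * (ε' * ε)) * (ε * (sideCov A B q.1 ⬝ᵥ p x)) := by
      linear_combination (-(σ * ε' * (sideCov A B q.1 ⬝ᵥ p x))) * hsq'
    rw [h7] at h2
    exact pos_of_mul_pos_right h2 hσ0.le
  have hall : ∀ s₀ ∈ Icc (0 : ℝ) 1, ∀ᶠ x : V3 × ℝ in 𝓝 (f, s₀), 0 < x.2 → x.2 < 1 → p x ∈ I := by
    intro s₀ hs₀
    have hcl : s₀ ∈ closure (Ioo (0 : ℝ) 1) := by rwa [closure_Ioo zero_ne_one]
    rcases hs₀.1.lt_or_eq with h0 | rfl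
    · rcases hs₀.2.lt_or_eq with h1 | rfl
      · filter_upwards [hpc.continuousAt.eventually (C.isOpen.mem_nhds (hmem s₀ h0 h1))] with x hx _ _
          using hx
      · refine endpt o' 1 1 ?_ ?_ hcl
        · simpa [hp] using hf.right.inSideInt
        · intro x hx h2 h3
          rw [(lam_pair x).2]; nlinarith
    · refine endpt o 0 (-1) ?_ ?_ hcl
      · simpa [hp] using hf.left.inSideInt
      · intro x hx h2 h3
        rw [(lam_pair x).1]; nlinarith
  have hcomp := isCompact_Icc.eventually_forall_of_forall_eventually
    (P := fun f' s => 0 < s → s < 1 → p (f', s) ∈ I) (x₀ := f) hall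
  filter_upwards [el, e1, e2, hcomp] with f' h1 h2 h3 h4
  refine ⟨h2, h3, h1, fun s t hs ht => ?_⟩
  have h5 := h4 (t / (s + t)) ⟨by positivity, by rw [div_le_one (by linarith)]; linarith⟩
    (by positivity) (by rw [div_lt_one (by linarith)]; linarith)
  have h6 := C.smul_mem_interior h5 (r := s + t) (by linarith)
  have e7 : (s + t) • p (f', t / (s + t)) = s • hit A B o f' + t • hit A B o' f' := by
    simp only [hp, smul_add, smul_smul]
    congr 2
    · field_simp
      ring
    · field_simp
  rwa [e7] at h6

/-- The linear conditions which describe the cell of a good line. -/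
def cons (A B : Fin n → V3) (o o' : Fin n × Bool) (f : V3) : Set V3 :=
  {-tl A B o, hd A B o, -tl A B o', hd A B o'} ∪
    ({w | Between A B o o' w ∧ 0 < f ⬝ᵥ w} ∪ {w | Between A B o o' (-w) ∧ 0 < f ⬝ᵥ w})

theorem pos_cons {o o' : Fin n × Bool} {f f' : V3} (h : ∀ s ∈ cons A B o o' f, 0 < s ⬝ᵥ f') :
    Crosses A B o f' ∧ Crosses A B o' f' ∧
      ∀ w, Between A B o o' w → f ⬝ᵥ w ≠ 0 → 0 < (f ⬝ᵥ w) * (f' ⬝ᵥ w) := by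
  have h1 := h (-tl A B o) (Or.inl (by simp))
  have h2 := h (hd A B o) (Or.inl (by simp))
  have h3 := h (-tl A B o') (Or.inl (by simp))
  have h4 := h (hd A B o') (Or.inl (by simp))
  rw [neg_dotProduct, dotProduct_comm] at h1 h3
  rw [dotProduct_comm] at h2 h4
  refine ⟨⟨by linarith, h2⟩, ⟨by linarith, h4⟩, fun w hw h0 => ?_⟩
  rcases lt_or_gt_of_ne h0 with h5 | h5
  · have := h (-w) (Or.inr (Or.inr ⟨by rwa [neg_neg], by rw [dotProduct_neg]; linarith⟩))
    rw [neg_dotProduct, dotProduct_comm] at this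
    nlinarith
  · have := h w (Or.inr (Or.inl ⟨hw, h5⟩))
    rw [dotProduct_comm] at this
    positivity

theorem Good.pos_cons_self {o o' : Fin n × Bool} {f : V3} (h : Good A B I o o' f) :
    ∀ s ∈ cons A B o o' f, 0 < s ⬝ᵥ f := by
  have h1 := h.left
  have h2 := h.right
  rintro s ((rfl | rfl | rfl | rfl) | ⟨-, hs⟩ | ⟨-, hs⟩)
  · rw [neg_dotProduct, dotProduct_comm]; linarith [h1.1]
  · rw [dotProduct_comm]; exact h1.2
  · rw [neg_dotProduct, dotProduct_comm]; linarith [h2.1]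
  · rw [dotProduct_comm]; exact h2.2
  · rwa [dotProduct_comm]
  · rwa [dotProduct_comm]

/-- The cell of a good line consists of good lines. -/
theorem Good.of_pos_cons (C : ConePolygon A B K I c) {o o' : Fin n × Bool} {f f' : V3}
    (h : Good A B I o o' f) (h' : ∀ s ∈ cons A B o o' f, 0 < s ⬝ᵥ f') : Good A B I o o' f' := by
  set Q : Set V3 := {f' | ∀ s ∈ cons A B o o' f, 0 < s ⬝ᵥ f'} with hQ
  have hconv : Convex ℝ Q := by
    intro x hx y hy s t hs ht hst u hu
    have h1 : 0 < u ⬝ᵥ x := hx u hu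
    have h2 : 0 < u ⬝ᵥ y := hy u hu
    rw [dotProduct_add, dotProduct_smul, dotProduct_smul, smul_eq_mul, smul_eq_mul]
    rcases hs.lt_or_eq with h | rfl
    · nlinarith
    · obtain rfl : t = 1 := by linarith
      nlinarith
  -- The cell is convex and goodness is open, so it remains to see that goodness is closed within
  -- the cell. A limit segment stays in the closed cone, and the sign conditions keep the corners
  -- off it.
  refine hconv.isPreconnected.subset_of_closure_inter_subset (C.isOpen_good o o')
    ⟨f, h.pos_cons_self, h⟩ ?_ h'
  rintro f₁ ⟨hcl, hQ₁⟩
  obtain ⟨h1, h2, h3⟩ := pos_cons hQ₁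
  have hl := C.lam_pos_of h.left h.right h1 h2 h.lam_pos
  have hgi := (C.good_iff h.left h.right h.lam_pos).1 h
  refine (C.good_iff h1 h2 hl).2 ⟨fun s t hs ht => ?_, fun w hw h0 => ?_⟩
  · have hc : Continuous fun f' => s • hit A B o f' + t • hit A B o' f' :=
      ((continuous_hit o).const_smul s).add ((continuous_hit o').const_smul t)
    have hm : s • hit A B o f₁ + t • hit A B o' f₁ ∈ closure (insert 0 K) :=
      map_mem_closure (f := fun f' => s • hit A B o f' + t • hit A B o' f') hc hcl fun f' hf' => Or.inr (C.subset (hf'.mem s t hs ht))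
    rw [C.isClosed.closure_eq] at hm
    refine hm.resolve_left (ne_zero_of_dot_pos (c := c) ?_)
    exact comb_mem_pos (C.pos _ (h1.inSideInt.mem C)) (C.pos _ (h2.inSideInt.mem C)) hs.le ht.le
      (by linarith)
  · have := h3 w hw (hgi.2 w hw)
    rw [h0, mul_zero] at this
    exact lt_irrefl _ this

theorem cons_eq (C : ConePolygon A B K I c) {o o' : Fin n × Bool} {f f' : V3}
    (h : Good A B I o o' f) (h' : ∀ s ∈ cons A B o o' f, 0 < s ⬝ᵥ f') :
    cons A B o o' f' = cons A B o o' f := by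
  obtain ⟨h1, h2, h3⟩ := pos_cons h'
  have hgi := ((C.good_iff h.left h.right h.lam_pos).1 h).2
  have key : ∀ w, Between A B o o' w → (0 < f' ⬝ᵥ w ↔ 0 < f ⬝ᵥ w) := by
    intro w hw
    have := h3 w hw (hgi w hw)
    constructor
    · intro h; exact pos_of_mul_pos_left this h.le
    · intro h; exact pos_of_mul_pos_right this h.le
  have key' : ∀ w, Between A B o o' (-w) → (0 < f' ⬝ᵥ w ↔ 0 < f ⬝ᵥ w) := by
    intro w hw
    have := h3 _ hw (hgi _ hw)
    rw [dotProduct_neg, dotProduct_neg, neg_mul_neg] at this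
    constructor
    · intro h; exact pos_of_mul_pos_left this h.le
    · intro h; exact pos_of_mul_pos_right this h.le
  unfold cons
  congr 2
  · ext w; exact and_congr_right fun hw => key w hw
  · ext w; exact and_congr_right fun hw => key' w hw

/-- A nonzero vector annihilated by the four endpoint constraints would be parallel to the covectors
of both sides, so `lam` would vanish identically. -/
theorem Good.salient_cons {o o' : Fin n × Bool} {f : V3}
    (h : Good A B I o o' f) : Salient (cons A B o o' f) := by
  intro v hv
  have e1 := hv (-tl A B o) (Or.inl (by simp))
  have e2 := hv (hd A B o) (Or.inl (by simp))
  have e3 := hv (-tl A B o') (Or.inl (by simp))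
  have e4 := hv (hd A B o') (Or.inl (by simp))
  rw [neg_dotProduct, neg_eq_zero, dotProduct_comm] at e1 e3
  rw [dotProduct_comm] at e2 e4
  by_contra hv0
  have h1 : hit A B o v = 0 := by rw [hit_eq, e1, e2]; simp
  have h2 : hit A B o' v = 0 := by rw [hit_eq, e3, e4]; simp
  have h3 : crossProduct (oCov A B o) v = 0 := by
    rw [← cross_anticomm]; show -hit A B o v = 0; rw [h1, neg_zero]
  have h4 : crossProduct (oCov A B o') v = 0 := by
    rw [← cross_anticomm]; show -hit A B o' v = 0; rw [h2, neg_zero]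
  obtain ⟨r, hr⟩ := (cross_eq_zero_iff hv0).1 h3
  obtain ⟨r', hr'⟩ := (cross_eq_zero_iff hv0).1 h4
  have := h.lam_pos
  rw [lam, hr, hr'] at this
  simp at this

theorem cons_subset (o o' : Fin n × Bool) (f : V3) :
    cons A B o o' f ⊆ {v | v ∈ cornerSet A B ∨ -v ∈ cornerSet A B} := by
  rintro s ((rfl | rfl | rfl | rfl) | ⟨hs, -⟩ | ⟨hs, -⟩)
  · exact Or.inr (by rw [neg_neg]; exact tl_mem_cornerSet _)
  · exact Or.inl (hd_mem_cornerSet _)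
  · exact Or.inr (by rw [neg_neg]; exact tl_mem_cornerSet _)
  · exact Or.inl (hd_mem_cornerSet _)
  · exact Or.inl hs.1
  · exact Or.inr hs.1

/-- Two segments of the same line which are interior to the polygon but for their endpoints have
the same endpoints if they overlap. -/
theorem endpoints_eq_of_overlap {f z b e b' e' : V3} (hf : f ≠ 0)
    (hb : f ⬝ᵥ b = 0) (he : f ⬝ᵥ e = 0) (hb' : f ⬝ᵥ b' = 0) (he' : f ⬝ᵥ e' = 0) (hz : f ⬝ᵥ z = 0)
    (bI : b ∉ I) (eI : e ∉ I) (bI' : b' ∉ I) (eI' : e' ∉ I)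
    (h1 : ∀ s t : ℝ, 0 < s → 0 < t → s • b + t • z ∈ I)
    (h2 : ∀ s t : ℝ, 0 < s → 0 < t → s • z + t • e ∈ I)
    (h1' : ∀ s t : ℝ, 0 < s → 0 < t → s • b' + t • z ∈ I)
    (h2' : ∀ s t : ℝ, 0 < s → 0 < t → s • z + t • e' ∈ I)
    (bz : 0 < f ⬝ᵥ crossProduct b z) (ze : 0 < f ⬝ᵥ crossProduct z e)
    (bz' : 0 < f ⬝ᵥ crossProduct b' z) (ze' : 0 < f ⬝ᵥ crossProduct z e') :
    crossProduct b b' = 0 ∧ crossProduct e e' = 0 := by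
  have zero : ∀ u v, f ⬝ᵥ u = 0 → f ⬝ᵥ v = 0 → f ⬝ᵥ crossProduct u v = 0 →
      crossProduct u v = 0 := by
    intro u v hu hv h
    by_contra hne
    have h3 := frame_expand u v f
    rw [dotProduct_comm f] at h
    rw [h, zero_smul, add_zero] at h3
    apply hf
    have h4 : (crossProduct u v ⬝ᵥ crossProduct u v) * (f ⬝ᵥ f) = 0 := by
      rw [← smul_eq_mul, ← dotProduct_smul, h3, dotProduct_add, dotProduct_smul, dotProduct_smul,
        hu, hv]
      simp
    rcases mul_eq_zero.1 h4 with h5 | h5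
    · exact absurd h5 (dot_self_pos hne).ne'
    · by_contra hf0; exact (dot_self_pos hf0).ne' h5
  have anti : ∀ u v : V3, f ⬝ᵥ crossProduct u v = -(f ⬝ᵥ crossProduct v u) := by
    intro u v; rw [← cross_anticomm, dotProduct_neg]
  have ex : ∀ u v w : V3, f ⬝ᵥ u = 0 → f ⬝ᵥ v = 0 → f ⬝ᵥ w = 0 → 0 < f ⬝ᵥ crossProduct u w →
      v = ((f ⬝ᵥ crossProduct u w)⁻¹ * (f ⬝ᵥ crossProduct v w)) • u +
        ((f ⬝ᵥ crossProduct u w)⁻¹ * (f ⬝ᵥ crossProduct u v)) • w := by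
    intro u v w hu hv hw h
    rw [mul_smul, mul_smul, ← smul_add, ← plane_relation hu hv hw, smul_smul,
      inv_mul_cancel₀ h.ne', one_smul]
  -- If `b` and `b'` were on different rays, one of them would lie strictly between the other and
  -- `z`, hence in the interior. The same applies to `e` and `e'`.
  refine ⟨zero _ _ hb hb' ?_, zero _ _ he he' ?_⟩
  · rcases lt_trichotomy (f ⬝ᵥ crossProduct b b') 0 with h | h | h
    · refine absurd (h1' _ _ ?_ ?_) (ex b' b z hb' hb hz bz' ▸ bI)
      · positivity
      · have := anti b' b
        exact mul_pos (inv_pos.2 bz') (by linarith)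
    · exact h
    · refine absurd (h1 _ _ ?_ ?_) (ex b b' z hb hb' hz bz ▸ bI') <;> positivity
  · rcases lt_trichotomy (f ⬝ᵥ crossProduct e e') 0 with h | h | h
    · refine absurd (h2 _ _ ?_ ?_) (ex z e' e hz he' he ze ▸ eI')
      · have := anti e' e
        exact mul_pos (inv_pos.2 ze) (by linarith)
      · positivity
    · exact h
    · refine absurd (h2' _ _ ?_ ?_) (ex z e e' hz he he' ze' ▸ eI) <;> positivity

end ConePolygon

/-! ### The cone over a geodesic polygon -/

/-- The quadratic form of the surface. -/
def quadForm (χ : ℝ) (v : V3) : ℝ := χ * (v 0 ^ 2 + v 1 ^ 2) + v 2 ^ 2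

/-- The vectors which are projected to the surface. -/
def projDomain (χ : ℝ) : Set V3 := {v | 0 < quadForm χ v ∧ (χ ≤ 0 → 0 < v 2)}

theorem quadForm_smul (χ r : ℝ) (v : V3) : quadForm χ (r • v) = r ^ 2 * quadForm χ v := by
  simp [quadForm]; ring

theorem continuous_quadForm (χ : ℝ) : Continuous (quadForm χ) := by
  unfold quadForm; fun_prop

theorem isOpen_projDomain (χ : ℝ) : IsOpen (projDomain χ) := by
  have h1 : IsOpen {v : V3 | 0 < quadForm χ v} :=
    isOpen_lt continuous_const (continuous_quadForm χ)
  by_cases h : χ ≤ 0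
  · have h2 : IsOpen {v : V3 | 0 < v 2} := isOpen_lt continuous_const (continuous_apply 2)
    convert h1.inter h2 using 1
    ext v; simp [projDomain, h]
  · convert h1 using 1
    ext v; simp [projDomain, h]

theorem modelPlane_subset (χ : ℝ) : modelPlane χ ⊆ projDomain χ := fun _ h =>
  ⟨by show 0 < χ * _ + _; rw [h.1]; exact one_pos, h.2⟩

theorem smul_mem_projDomain {χ : ℝ} {v : V3} (hv : v ∈ projDomain χ) {r : ℝ} (hr : 0 < r) :
    r • v ∈ projDomain χ :=
  ⟨by rw [quadForm_smul]; have := hv.1; positivity, fun h => by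
    have := hv.2 h; simp only [Pi.smul_apply, smul_eq_mul]; positivity⟩

theorem normalize_mem {χ : ℝ} {v : V3} (hv : v ∈ projDomain χ) :
    (Real.sqrt (quadForm χ v))⁻¹ • v ∈ modelPlane χ := by
  have h := hv.1
  refine ⟨?_, fun h' => ?_⟩
  · show quadForm χ _ = 1
    rw [quadForm_smul, inv_pow, Real.sq_sqrt h.le, inv_mul_cancel₀ h.ne']
  · have := hv.2 h'
    simp only [Pi.smul_apply, smul_eq_mul]; positivity

theorem exists_mem_modelPlane (χ : ℝ) : (![0, 0, 1] : V3) ∈ modelPlane χ := by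
  simp [modelPlane]

open Classical in
/-- Central projection to the surface. -/
def toPlane (χ : ℝ) (v : V3) : modelPlane χ :=
  if h : v ∈ projDomain χ then ⟨_, normalize_mem h⟩ else ⟨_, exists_mem_modelPlane χ⟩

theorem coe_toPlane {χ : ℝ} {v : V3} (h : v ∈ projDomain χ) :
    (toPlane χ v : V3) = (Real.sqrt (quadForm χ v))⁻¹ • v := by
  rw [toPlane, dif_pos h]

theorem exists_toPlane {χ : ℝ} {v : V3} (h : v ∈ projDomain χ) :
    ∃ r : ℝ, 0 < r ∧ v = r • (toPlane χ v : V3) :=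
  ⟨Real.sqrt (quadForm χ v), Real.sqrt_pos.2 h.1, by
    rw [coe_toPlane h, smul_smul, mul_inv_cancel₀ (Real.sqrt_pos.2 h.1).ne', one_smul]⟩

theorem continuousOn_toPlane (χ : ℝ) : ContinuousOn (toPlane χ) (projDomain χ) := by
  have h : ContinuousOn (fun v : V3 => (Real.sqrt (quadForm χ v))⁻¹ • v) (projDomain χ) := by
    refine ContinuousOn.smul (ContinuousOn.inv₀ (f := fun v => Real.sqrt (quadForm χ v)) ?_ ?_)
      continuousOn_id
    · exact (Real.continuous_sqrt.comp (continuous_quadForm χ)).continuousOn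
    · intro v hv
      exact (Real.sqrt_pos.2 hv.1).ne'
  rw [continuousOn_iff_continuous_domRestrict] at h ⊢
  refine continuous_induced_rng.2 (h.congr fun v => ?_)
  exact (coe_toPlane v.2).symm

/-- Points of the surface on the same ray from the origin are equal. -/
theorem modelPlane_ray_inj {χ : ℝ} {p q : modelPlane χ} {r : ℝ} (hr : 0 < r)
    (h : (p : V3) = r • (q : V3)) : p = q := by
  have h1 : quadForm χ p = 1 := p.2.1
  have h2 : quadForm χ q = 1 := q.2.1
  rw [h, quadForm_smul, h2, mul_one] at h1
  have : r = 1 := by nlinarith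
  exact Subtype.ext (by rw [h, this, one_smul])

theorem toPlane_smul {χ : ℝ} (p : modelPlane χ) {r : ℝ} (hr : 0 < r) :
    toPlane χ (r • (p : V3)) = p := by
  have h : r • (p : V3) ∈ projDomain χ := smul_mem_projDomain (modelPlane_subset χ p.2) hr
  obtain ⟨r', hr', e⟩ := exists_toPlane h
  refine modelPlane_ray_inj (r := r'⁻¹ * r) (by positivity) ?_
  have e' := congrArg (fun v => r'⁻¹ • v) e
  simp only [smul_smul, inv_mul_cancel₀ hr'.ne', one_smul] at e'
  exact e'.symm

theorem modelPlane_ne_zero {χ : ℝ} (p : modelPlane χ) : (p : V3) ≠ 0 := by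
  intro h
  have h1 : quadForm χ p = 1 := p.2.1
  rw [h] at h1
  simp [quadForm] at h1

theorem eq_or_antipodal {χ : ℝ} {p q : modelPlane χ} (h : crossProduct (p : V3) q = 0) :
    p = q ∨ (p : V3) = -q := by
  obtain ⟨r, hr⟩ := (cross_eq_zero_iff (modelPlane_ne_zero q)).1 h
  have h1 : quadForm χ p = 1 := p.2.1
  have h2 : quadForm χ q = 1 := q.2.1
  rw [hr, quadForm_smul, h2, mul_one] at h1
  rcases (mul_self_eq_one_iff.1 ((sq r).symm.trans h1)) with h | h
  · left; exact Subtype.ext (by rw [hr, h, one_smul])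
  · right; rw [hr, h, neg_one_smul]

theorem comb_mem_projDomain {χ : ℝ} (hχ : χ = 0 ∨ χ = 1 ∨ χ = -1) {p q : V3}
    (hp : p ∈ projDomain χ) (hq : q ∈ projDomain χ) {s t : ℝ} (hs : 0 ≤ s) (ht : 0 ≤ t)
    (hst : 0 < s + t) (h0 : s • p + t • q ≠ 0) : s • p + t • q ∈ projDomain χ := by
  rcases hs.lt_or_eq with hs | rfl
  swap
  · rw [zero_smul, zero_add]; exact smul_mem_projDomain hq (by linarith)
  rcases ht.lt_or_eq with ht | rfl
  swap
  · rw [zero_smul, add_zero]; exact smul_mem_projDomain hp (by linarith)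
  have h2 : χ ≤ 0 → 0 < (s • p + t • q) 2 := by
    intro h
    have := hp.2 h
    have := hq.2 h
    simp only [Pi.add_apply, Pi.smul_apply, smul_eq_mul]
    positivity
  refine ⟨?_, h2⟩
  rcases hχ with rfl | rfl | rfl
  · have := h2 le_rfl
    simp only [quadForm, zero_mul, zero_add]
    positivity
  · have := dot_self_pos h0
    rw [dot_expand] at this
    simp only [quadForm]; nlinarith
  · have p2 := hp.2 (by norm_num)
    have q2 := hq.2 (by norm_num)
    have p1 := hp.1
    have q1 := hq.1
    simp only [quadForm] at p1 q1 ⊢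
    simp only [Pi.add_apply, Pi.smul_apply, smul_eq_mul]
    -- The reversed Cauchy–Schwarz inequality for two future timelike vectors.
    have hB : p 0 * q 0 + p 1 * q 1 < p 2 * q 2 := by
      refine lt_of_pow_lt_pow_left₀ 2 (by positivity) ?_
      have e1 : (p 0 * q 0 + p 1 * q 1) ^ 2 ≤ (p 0 ^ 2 + p 1 ^ 2) * (q 0 ^ 2 + q 1 ^ 2) := by
        nlinarith [sq_nonneg (p 0 * q 1 - p 1 * q 0)]
      have e2 : (p 0 ^ 2 + p 1 ^ 2) * (q 0 ^ 2 + q 1 ^ 2) ≤ (p 0 ^ 2 + p 1 ^ 2) * q 2 ^ 2 :=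
        mul_le_mul_of_nonneg_left (by linarith) (by positivity)
      have e3 : (p 0 ^ 2 + p 1 ^ 2) * q 2 ^ 2 < p 2 ^ 2 * q 2 ^ 2 :=
        mul_lt_mul_of_pos_right (by linarith) (by positivity)
      rw [mul_pow]; linarith
    nlinarith [mul_pos hs ht, mul_pos (mul_pos hs ht) (sub_pos.2 hB), mul_pos (pow_pos hs 2) p1,
      mul_pos (pow_pos ht 2) q1]

namespace GeoPolygon

variable {χ : ℝ}

/-- The first endpoints of the sides, as vectors. -/
def vA (P : GeoPolygon χ) (i : Fin P.n) : V3 := P.A i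

/-- The second endpoints of the sides, as vectors. -/
def vB (P : GeoPolygon χ) (i : Fin P.n) : V3 := P.B i

/-- The cone over the region. -/
def coneK (P : GeoPolygon χ) : Set V3 := {v | ∃ p ∈ P.region, ∃ r : ℝ, 0 < r ∧ v = r • (p : V3)}

/-- The cone over the interior of the region. -/
def coneI (P : GeoPolygon χ) : Set V3 :=
  {v | ∃ p ∈ interior P.region, ∃ r : ℝ, 0 < r ∧ v = r • (p : V3)}

theorem mem_coneK_iff {P : GeoPolygon χ} {p : modelPlane χ} : (p : V3) ∈ P.coneK ↔ p ∈ P.region := by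
  constructor
  · rintro ⟨q, hq, r, hr, h⟩
    rwa [modelPlane_ray_inj hr h]
  · exact fun h => ⟨p, h, 1, one_pos, by simp⟩

theorem mem_coneI_iff {P : GeoPolygon χ} {p : modelPlane χ} :
    (p : V3) ∈ P.coneI ↔ p ∈ interior P.region := by
  constructor
  · rintro ⟨q, hq, r, hr, h⟩
    rwa [modelPlane_ray_inj hr h]
  · exact fun h => ⟨p, h, 1, one_pos, by simp⟩

theorem smul_mem_coneK {P : GeoPolygon χ} {v : V3} (h : v ∈ P.coneK) {r : ℝ} (hr : 0 < r) :
    r • v ∈ P.coneK := by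
  obtain ⟨p, hp, r', hr', rfl⟩ := h
  exact ⟨p, hp, r * r', by positivity, by rw [smul_smul]⟩

theorem smul_mem_coneI {P : GeoPolygon χ} {v : V3} (h : v ∈ P.coneI) {r : ℝ} (hr : 0 < r) :
    r • v ∈ P.coneI := by
  obtain ⟨p, hp, r', hr', rfl⟩ := h
  exact ⟨p, hp, r * r', by positivity, by rw [smul_smul]⟩

theorem smul_mem_coneK_iff {P : GeoPolygon χ} {v : V3} {r : ℝ} (hr : 0 < r) :
    r • v ∈ P.coneK ↔ v ∈ P.coneK :=
  ⟨fun h => by simpa [smul_smul, hr.ne'] using smul_mem_coneK h (inv_pos.2 hr),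
    fun h => smul_mem_coneK h hr⟩

theorem smul_mem_coneI_iff {P : GeoPolygon χ} {v : V3} {r : ℝ} (hr : 0 < r) :
    r • v ∈ P.coneI ↔ v ∈ P.coneI :=
  ⟨fun h => by simpa [smul_smul, hr.ne'] using smul_mem_coneI h (inv_pos.2 hr),
    fun h => smul_mem_coneI h hr⟩

theorem coneK_subset (P : GeoPolygon χ) : P.coneK ⊆ projDomain χ := by
  rintro v ⟨p, -, r, hr, rfl⟩
  exact smul_mem_projDomain (modelPlane_subset χ p.2) hr

theorem vcross_ne (P : GeoPolygon χ) (i : Fin P.n) : crossProduct (P.vA i) (P.vB i) ≠ 0 := by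
  intro h
  rcases eq_or_antipodal h with h | h
  · exact P.ne i h
  · exact P.not_antipodal i h

/-- The positive form `c` is the height for curvature at most zero and comes from the open
hemisphere of admissibility on the sphere. The other properties are those of the polygon,
transported along rays from the origin. -/
theorem exists_conePolygon (hχ : χ = 0 ∨ χ = 1 ∨ χ = -1) (P : GeoPolygon χ)
    (hP : χ = 1 → P.Admissible) : ∃ c, ConePolygon P.vA P.vB P.coneK P.coneI c := by
  have hcomb : ∀ i, ∀ s t : ℝ, 0 ≤ s → 0 ≤ t → 0 < s + t →
      ∃ p ∈ geoSegment (P.A i) (P.B i), ∃ r : ℝ, 0 < r ∧ s • P.vA i + t • P.vB i = r • (p : V3) := by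
    intro i s t hs ht hst
    have h0 : s • P.vA i + t • P.vB i ≠ 0 := by
      intro h
      have := comb_inj (P.vcross_ne i) (s' := 0) (t' := 0) (h.trans (by simp))
      linarith [this.1, this.2]
    have hd : s • P.vA i + t • P.vB i ∈ projDomain χ :=
      comb_mem_projDomain hχ (modelPlane_subset χ (P.A i).2) (modelPlane_subset χ (P.B i).2) hs ht
        hst h0
    obtain ⟨r, hr, h⟩ := exists_toPlane hd
    refine ⟨toPlane χ (s • P.vA i + t • P.vB i), ⟨r⁻¹ * s, r⁻¹ * t, by positivity, by positivity, ?_⟩,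
      r, hr, h⟩
    rw [mul_smul, mul_smul, ← smul_add]
    show _ = r⁻¹ • (s • P.vA i + t • P.vB i)
    rw [h, smul_smul, inv_mul_cancel₀ hr.ne', one_smul, toPlane_smul _ hr]
  have hclosed : IsClosed P.region := P.compact.isClosed
  have hne : P.region.Nonempty := by
    refine ⟨P.A ⟨0, P.n_pos⟩, hclosed.frontier_subset ?_⟩
    rw [P.boundary]
    exact mem_iUnion.2 ⟨⟨0, P.n_pos⟩, 1, 0, zero_le_one, le_rfl, by simp⟩
  have hc : ∃ c : V3, ∀ p ∈ P.region, 0 < c ⬝ᵥ (p : V3) := by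
    by_cases h : χ = 1
    · obtain ⟨c, hc, -⟩ := hP h ⟨0, P.n_pos⟩
      exact ⟨c, hc⟩
    · refine ⟨![0, 0, 1], fun p _ => ?_⟩
      have : χ ≤ 0 := by rcases hχ with rfl | rfl | rfl <;> simp_all
      have h2 := p.2.2 this
      rw [dot_expand]
      simpa using h2
  obtain ⟨c, hc⟩ := hc
  have hbd : ∀ v, (v ∈ P.coneK ∧ v ∉ P.coneI) ↔
      ∃ i, ∃ s t : ℝ, 0 ≤ s ∧ 0 ≤ t ∧ 0 < s + t ∧ v = s • P.vA i + t • P.vB i := by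
    intro v
    constructor
    · rintro ⟨⟨p, hp, r, hr, rfl⟩, hI⟩
      rw [smul_mem_coneI_iff hr, mem_coneI_iff] at hI
      have hf : p ∈ frontier P.region := by rw [hclosed.frontier_eq]; exact ⟨hp, hI⟩
      rw [P.boundary] at hf
      obtain ⟨i, s, t, hs, ht, h⟩ := mem_iUnion.1 hf
      refine ⟨i, r * s, r * t, by positivity, by positivity, ?_, ?_⟩
      · rcases (add_nonneg hs ht).lt_or_eq with h' | h'
        · rw [← mul_add]; positivity
        · have h1 : s = 0 := by linarith
          have h2 : t = 0 := by linarith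
          rw [h1, h2] at h
          exact absurd (by simpa using h) (modelPlane_ne_zero p)
      · rw [h, smul_add, smul_smul, smul_smul]; rfl
    · rintro ⟨i, s, t, hs, ht, hst, rfl⟩
      obtain ⟨p, hp, r, hr, h⟩ := hcomb i s t hs ht hst
      rw [h, smul_mem_coneI_iff hr, smul_mem_coneK_iff hr, mem_coneI_iff, mem_coneK_iff]
      have hf : p ∈ frontier P.region := by rw [P.boundary]; exact mem_iUnion.2 ⟨i, hp⟩
      rwa [hclosed.frontier_eq] at hf
  refine ⟨c, fun v hv r hr => smul_mem_coneK hv hr, ?_, ?_, ?_, ?_, ?_, hbd, ?_, P.vcross_ne, ?_⟩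
  · have h := (continuousOn_toPlane χ).isOpen_inter_preimage (isOpen_projDomain χ)
      (isOpen_interior (s := P.region))
    convert h using 1
    ext v
    constructor
    · rintro ⟨p, hp, r, hr, rfl⟩
      refine ⟨smul_mem_projDomain (modelPlane_subset χ p.2) hr, ?_⟩
      rwa [mem_preimage, toPlane_smul p hr]
    · rintro ⟨h1, h2⟩
      obtain ⟨r, hr, e⟩ := exists_toPlane h1
      exact ⟨_, h2, r, hr, e⟩
  · rintro v ⟨p, hp, r, hr, rfl⟩
    exact ⟨p, interior_subset hp, r, hr, rfl⟩
  -- The map `x ↦ r • x` pulls a neighbourhood in ℝ³ back to a neighbourhood on the surface.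
  · intro v hv
    obtain ⟨p, hp, r, hr, rfl⟩ := interior_subset hv
    refine ⟨p, mem_interior.2 ⟨(fun x : modelPlane χ => r • (x : V3)) ⁻¹' interior P.coneK, ?_,
      isOpen_interior.preimage (by fun_prop), hv⟩, r, hr, rfl⟩
    intro x hx
    have h : r • (x : V3) ∈ P.coneK := interior_subset hx
    rwa [smul_mem_coneK_iff hr, mem_coneK_iff] at h
  -- The cone with its apex consists of the vectors that are nonnegative multiples of a point of the
  -- region. This is a closed relation, and projecting along the compact region preserves
  -- closedness.
  · have : CompactSpace P.region := isCompact_iff_compactSpace.1 P.compact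
    have h1 : IsClosed {x : V3 × P.region | crossProduct x.1 (x.2 : V3) = 0 ∧
        0 ≤ x.1 ⬝ᵥ (x.2 : V3)} :=
      (isClosed_eq (continuous_cross continuous_fst
        (continuous_subtype_val.comp (continuous_subtype_val.comp continuous_snd)))
        continuous_const).inter (isClosed_le continuous_const (continuous_dot continuous_fst
        (continuous_subtype_val.comp (continuous_subtype_val.comp continuous_snd))))
    have h2 := isClosedMap_fst_of_compactSpace _ h1
    convert h2 using 1
    ext v
    simp only [mem_insert_iff, mem_image, Prod.exists, exists_and_right, exists_eq_right]
    constructor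
    · rintro (rfl | ⟨p, hp, r, hr, rfl⟩)
      · obtain ⟨p, hp⟩ := hne
        exact ⟨⟨p, hp⟩, by simp⟩
      · refine ⟨⟨p, hp⟩, by simp, ?_⟩
        simp only [smul_dotProduct, smul_eq_mul]
        have := dot_self_pos (modelPlane_ne_zero p)
        positivity
    · rintro ⟨⟨p, hp⟩, h1, h2⟩
      obtain ⟨r, rfl⟩ := (cross_eq_zero_iff (modelPlane_ne_zero p)).1 h1
      simp only [smul_dotProduct, smul_eq_mul] at h2
      have hr := nonneg_of_mul_nonneg_left h2 (dot_self_pos (modelPlane_ne_zero p))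
      rcases hr.lt_or_eq with hr | rfl
      · exact Or.inr ⟨p, hp, r, hr, rfl⟩
      · left; simp
  · rintro v ⟨p, hp, r, hr, rfl⟩
    rw [← P.regular] at hp
    exact map_mem_closure (f := fun x : modelPlane χ => r • (x : V3)) (by fun_prop) hp
      fun x hx => ⟨x, hx, r, hr, rfl⟩
  · rintro v ⟨p, hp, r, hr, rfl⟩
    have := hc p hp
    rw [dotProduct_smul, smul_eq_mul]; positivity
  · intro i j hij s t s' t' hs ht hst hs' ht' hst' e
    obtain ⟨p, hp, r, hr, h⟩ := hcomb i s t hs ht hst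
    obtain ⟨p', hp', r', hr', h'⟩ := hcomb j s' t' hs' ht' hst'
    have hpp : p = p' := by
      refine modelPlane_ray_inj (r := r⁻¹ * r') (by positivity) ?_
      rw [mul_smul, ← h', ← e, h, smul_smul, inv_mul_cancel₀ hr.ne', one_smul]
    subst hpp
    rcases (P.meet i j hij ⟨hp, hp'⟩).1 with h1 | h1
    · right
      rw [h1] at h
      exact (comb_inj (P.vcross_ne i) (s' := r) (t' := 0) (h.trans (by simp [vA]))).2
    · left
      rw [h1] at h
      exact (comb_inj (P.vcross_ne i) (s' := 0) (t' := r) (h.trans (by simp [vB]))).1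

end GeoPolygon

/-! ### Chords of a geodesic polygon -/

open ConePolygon

namespace GeoPolygon

variable {χ : ℝ} {P : GeoPolygon χ} {c : V3}

theorem mem_corners_iff {p : modelPlane χ} :
    p ∈ P.corners ↔ (p : V3) ∈ cornerSet P.vA P.vB := by
  constructor
  · rintro (⟨i, rfl⟩ | ⟨i, rfl⟩)
    · exact Or.inl ⟨i, rfl⟩
    · exact Or.inr ⟨i, rfl⟩
  · rintro (⟨i, h⟩ | ⟨i, h⟩)
    · exact Or.inl ⟨i, Subtype.ext h⟩
    · exact Or.inr ⟨i, Subtype.ext h⟩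

theorem mem_corners_of_smul {w : V3} {p : modelPlane χ} {r : ℝ} (hr : 0 < r)
    (hw : w ∈ cornerSet P.vA P.vB) (h : (p : V3) = r • w) : p ∈ P.corners := by
  rcases hw with ⟨i, rfl⟩ | ⟨i, rfl⟩
  · exact Or.inl ⟨i, (modelPlane_ray_inj hr h).symm⟩
  · exact Or.inr ⟨i, (modelPlane_ray_inj hr h).symm⟩

theorem mem_side_iff {p : modelPlane χ} {i : Fin P.n} :
    p ∈ P.side i ↔ InSide P.vA P.vB i (p : V3) := by
  constructor
  · rintro ⟨s, t, hs, ht, h⟩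
    refine ⟨s, t, hs, ht, ?_, h⟩
    rcases (add_nonneg hs ht).lt_or_eq with h' | h'
    · exact h'
    · rw [show s = 0 by linarith, show t = 0 by linarith] at h
      exact absurd (by simpa using h) (modelPlane_ne_zero p)
  · rintro ⟨s, t, hs, ht, -, h⟩
    exact ⟨s, t, hs, ht, h⟩

theorem inSideInt_of_mem_side {p : modelPlane χ} {i : Fin P.n} (h : p ∈ P.side i)
    (hc : p ∉ P.corners) : InSideInt P.vA P.vB i (p : V3) := by
  obtain ⟨s, t, hs, ht, hst, h⟩ := mem_side_iff.1 h
  rcases hs.lt_or_eq with hs' | rfl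
  · rcases ht.lt_or_eq with ht' | rfl
    · exact ⟨s, t, hs', ht', h⟩
    · exact absurd (mem_corners_of_smul hs' (Or.inl ⟨i, rfl⟩) (by simpa using h)) hc
  · exact absurd (mem_corners_of_smul (r := t) (by linarith) (Or.inr ⟨i, rfl⟩) (by simpa using h)) hc

theorem notMem_corners_of_inSideInt (C : ConePolygon P.vA P.vB P.coneK P.coneI c)
    {p : modelPlane χ} {i : Fin P.n} (h : InSideInt P.vA P.vB i (p : V3)) : p ∉ P.corners := by
  intro hc
  refine C.corner_notMem_sideInt (mem_corners_iff.1 hc) one_pos (i := i) ?_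
  rwa [one_smul]

theorem mem_frontier_iff {p : modelPlane χ} :
    p ∈ frontier P.region ↔ (p : V3) ∈ P.coneK ∧ (p : V3) ∉ P.coneI := by
  rw [P.compact.isClosed.frontier_eq, mem_coneK_iff, mem_coneI_iff]; rfl

theorem exists_side_of_notMem_corners {p : modelPlane χ} (h : p ∈ frontier P.region)
    (hc : p ∉ P.corners) : ∃ i, InSideInt P.vA P.vB i (p : V3) := by
  rw [P.boundary] at h
  obtain ⟨i, hi⟩ := mem_iUnion.1 h
  exact ⟨i, inSideInt_of_mem_side hi hc⟩

theorem isChord_of {p q : modelPlane χ}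
    (hp : (p : V3) ∈ P.coneK ∧ (p : V3) ∉ P.coneI) (hq : (q : V3) ∈ P.coneK ∧ (q : V3) ∉ P.coneI)
    (hpq : crossProduct (p : V3) q ≠ 0)
    (hK : ∀ s t : ℝ, 0 < s → 0 < t → s • (p : V3) + t • (q : V3) ∈ P.coneK)
    (htr : ∀ i, InSideInt P.vA P.vB i (p : V3) ∨ InSideInt P.vA P.vB i (q : V3) →
      crossProduct (p : V3) q ⬝ᵥ P.vA i ≠ 0) : P.IsChord (p, q) := by
  refine ⟨mem_frontier_iff.2 hp, mem_frontier_iff.2 hq, ?_, ?_, ?_⟩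
  · rintro h
    have h' : p = q := h
    exact hpq (by rw [h', cross_self])
  · rintro v ⟨s, t, hs, ht, h⟩
    have h' : (v : V3) = s • (p : V3) + t • (q : V3) := h
    rw [← mem_coneK_iff]
    rcases hs.lt_or_eq with hs' | rfl
    · rcases ht.lt_or_eq with ht' | rfl
      · rw [h']; exact hK s t hs' ht'
      · rw [h', zero_smul, add_zero]; exact smul_mem_coneK hp.1 hs'
    · rcases ht.lt_or_eq with ht' | rfl
      · rw [h', zero_smul, zero_add]; exact smul_mem_coneK hq.1 ht'
      · exact absurd (by simpa using h') (modelPlane_ne_zero v)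
  · rintro i z (rfl | rfl) hz hzc
    · exact htr i (Or.inl (inSideInt_of_mem_side hz hzc))
    · exact htr i (Or.inr (inSideInt_of_mem_side hz hzc))

end GeoPolygon

namespace Chord

open GeoPolygon

variable {χ : ℝ} {P : GeoPolygon χ} {c : V3}

/-- The (non-normalized) covector of the line of a chord. -/
def cov (x : Chord P) : V3 := crossProduct (x.b : V3) (x.e : V3)

theorem ray_eq (x : Chord P) : x.ray = unitize x.cov := rfl

theorem ext' {x y : Chord P} (hb : x.b = y.b) (he : x.e = y.e) : x = y :=
  Subtype.ext (Prod.ext hb he)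

theorem continuous_b : Continuous fun x : Chord P => (x.b : V3) :=
  continuous_subtype_val.comp (continuous_fst.comp continuous_subtype_val)

theorem continuous_e : Continuous fun x : Chord P => (x.e : V3) :=
  continuous_subtype_val.comp (continuous_snd.comp continuous_subtype_val)

theorem continuous_cov : Continuous (cov : Chord P → V3) :=
  continuous_cross continuous_b continuous_e

theorem b_mem (x : Chord P) : (x.b : V3) ∈ P.coneK ∧ (x.b : V3) ∉ P.coneI :=
  mem_frontier_iff.1 x.2.1

theorem e_mem (x : Chord P) : (x.e : V3) ∈ P.coneK ∧ (x.e : V3) ∉ P.coneI :=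
  mem_frontier_iff.1 x.2.2.1

theorem cov_dot_b (x : Chord P) : x.cov ⬝ᵥ (x.b : V3) = 0 := dot_cross_left _ _

theorem cov_dot_e (x : Chord P) : x.cov ⬝ᵥ (x.e : V3) = 0 := dot_cross_right _ _

theorem cov_ne_zero (C : ConePolygon P.vA P.vB P.coneK P.coneI c) (x : Chord P) : x.cov ≠ 0 := by
  intro h
  rcases eq_or_antipodal h with h | h
  · exact x.2.2.2.1 h
  · have h1 := C.pos _ x.b_mem.1
    have h2 := C.pos _ x.e_mem.1
    rw [h, dotProduct_neg] at h1
    linarith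

theorem segment_mem (hχ : χ = 0 ∨ χ = 1 ∨ χ = -1) (C : ConePolygon P.vA P.vB P.coneK P.coneI c)
    (x : Chord P) {s t : ℝ} (hs : 0 ≤ s) (ht : 0 ≤ t) (hst : 0 < s + t) :
    s • (x.b : V3) + t • (x.e : V3) ∈ P.coneK := by
  have h0 : s • (x.b : V3) + t • (x.e : V3) ≠ 0 :=
    ne_zero_of_dot_pos (comb_mem_pos (C.pos _ x.b_mem.1) (C.pos _ x.e_mem.1) hs ht hst)
  have hd := comb_mem_projDomain hχ (modelPlane_subset χ x.b.2) (modelPlane_subset χ x.e.2) hs ht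
    hst h0
  obtain ⟨r, hr, h⟩ := exists_toPlane hd
  have h1 : toPlane χ (s • (x.b : V3) + t • (x.e : V3)) ∈ P.region := by
    refine x.2.2.2.2.1 ⟨r⁻¹ * s, r⁻¹ * t, by positivity, by positivity, ?_⟩
    rw [mul_smul, mul_smul, ← smul_add]
    have e' := congrArg (fun v => r⁻¹ • v) h
    simp only [smul_smul, inv_mul_cancel₀ hr.ne', one_smul] at e'
    exact e'.symm
  rw [h]
  exact smul_mem_coneK (mem_coneK_iff.2 h1) hr

theorem transversal (C : ConePolygon P.vA P.vB P.coneK P.coneI c) (x : Chord P) {i : Fin P.n}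
    (h : InSideInt P.vA P.vB i (x.b : V3) ∨ InSideInt P.vA P.vB i (x.e : V3)) :
    x.cov ⬝ᵥ P.vA i ≠ 0 := by
  rcases h with h | h
  · exact x.2.2.2.2.2 i _ (Or.inl rfl) (mem_side_iff.2 h.inSide) (notMem_corners_of_inSideInt C h)
  · exact x.2.2.2.2.2 i _ (Or.inr rfl) (mem_side_iff.2 h.inSide) (notMem_corners_of_inSideInt C h)

/-- The chord `x` runs from the oriented side `o` to the oriented side `o'`, and its interior is
interior to the polygon. -/
structure Runs (o o' : Fin P.n × Bool) (x : Chord P) : Prop where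
  good : Good P.vA P.vB P.coneI o o' x.cov
  left : ∃ r : ℝ, 0 < r ∧ (x.b : V3) = r • hit P.vA P.vB o x.cov
  right : ∃ r : ℝ, 0 < r ∧ (x.e : V3) = r • hit P.vA P.vB o' x.cov

theorem Runs.inSideInt_b {o o' : Fin P.n × Bool} {x : Chord P} (h : Runs o o' x) :
    InSideInt P.vA P.vB o.1 (x.b : V3) := by
  obtain ⟨r, hr, e⟩ := h.left
  rw [e]; exact h.good.left.inSideInt.smul hr

theorem Runs.inSideInt_e {o o' : Fin P.n × Bool} {x : Chord P} (h : Runs o o' x) :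
    InSideInt P.vA P.vB o'.1 (x.e : V3) := by
  obtain ⟨r, hr, e⟩ := h.right
  rw [e]; exact h.good.right.inSideInt.smul hr

theorem runs_of (C : ConePolygon P.vA P.vB P.coneK P.coneI c) {o o' : Fin P.n × Bool} {x : Chord P}
    (h : Good P.vA P.vB P.coneI o o' x.cov) (hb : InSideInt P.vA P.vB o.1 (x.b : V3))
    (he : InSideInt P.vA P.vB o'.1 (x.e : V3)) : Runs o o' x := by
  refine ⟨h, ?_, ?_⟩
  · obtain ⟨q, hq, h1, h2⟩ := exists_crosses hb x.cov_dot_b (x.transversal C (Or.inl hb))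
    rwa [crosses_unique h1 h.left hq] at h2
  · obtain ⟨q, hq, h1, h2⟩ := exists_crosses he x.cov_dot_e (x.transversal C (Or.inr he))
    rwa [crosses_unique h1 h.right hq] at h2

theorem Runs.interior_mem {o o' : Fin P.n × Bool} {x : Chord P} (h : Runs o o' x) {s t : ℝ}
    (hs : 0 < s) (ht : 0 < t) : s • (x.b : V3) + t • (x.e : V3) ∈ P.coneI := by
  obtain ⟨r, hr, e⟩ := h.left
  obtain ⟨r', hr', e'⟩ := h.right
  rw [e, e', smul_smul, smul_smul]
  exact h.good.mem _ _ (by positivity) (by positivity)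

/-- The points of a chord other than its endpoints. -/
theorem exists_of_mem_carrier {x : Chord P} {v : modelPlane χ} (hv : v ∈ x.carrier)
    (h1 : v ≠ x.b) (h2 : v ≠ x.e) :
    ∃ s t : ℝ, 0 < s ∧ 0 < t ∧ (v : V3) = s • (x.b : V3) + t • (x.e : V3) := by
  obtain ⟨s, t, hs, ht, h⟩ := hv
  rcases hs.lt_or_eq with hs' | rfl
  · rcases ht.lt_or_eq with ht' | rfl
    · exact ⟨s, t, hs', ht', h⟩
    · exact absurd (modelPlane_ray_inj hs' (by simpa using h)) h1
  · rcases ht.lt_or_eq with ht' | rfl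
    · exact absurd (modelPlane_ray_inj ht' (by simpa using h)) h2
    · exact absurd (by simpa using h) (modelPlane_ne_zero v)

theorem corner_notMem_coneI (C : ConePolygon P.vA P.vB P.coneK P.coneI c) {v : modelPlane χ}
    (hv : v ∈ P.corners) : (v : V3) ∉ P.coneI := by
  rcases hv with ⟨i, rfl⟩ | ⟨i, rfl⟩
  · exact (C.mem_of_inSide (i := i) ⟨1, 0, zero_le_one, le_rfl, by norm_num, by simp [vA]⟩).2
  · exact (C.mem_of_inSide (i := i) ⟨0, 1, le_rfl, zero_le_one, by norm_num, by simp [vB]⟩).2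

theorem Runs.notMem_delta (C : ConePolygon P.vA P.vB P.coneK P.coneI c) {o o' : Fin P.n × Bool}
    {x : Chord P} (h : Runs o o' x) : x ∉ Delta P := by
  rintro ((h1 | h1) | ⟨v, hv, h1, h2, h3⟩)
  · exact notMem_corners_of_inSideInt C h.inSideInt_e h1
  · exact notMem_corners_of_inSideInt C h.inSideInt_b h1
  · obtain ⟨s, t, hs, ht, e⟩ := exists_of_mem_carrier h1 h2 h3
    apply corner_notMem_coneI C hv
    rw [e]
    exact h.interior_mem hs ht

/-- Outside Δ the ends are interior to sides and no corner lies on the chord, which is exactly what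
`exists_good` requires. -/
theorem exists_runs (hχ : χ = 0 ∨ χ = 1 ∨ χ = -1) (C : ConePolygon P.vA P.vB P.coneK P.coneI c)
    {x : Chord P} (hx : x ∉ Delta P) : ∃ o o', Runs o o' x := by
  have hb : x.b ∉ P.corners := fun h => hx (Or.inl (Or.inr h))
  have he : x.e ∉ P.corners := fun h => hx (Or.inl (Or.inl h))
  obtain ⟨i, hi⟩ := exists_side_of_notMem_corners x.2.1 hb
  obtain ⟨j, hj⟩ := exists_side_of_notMem_corners x.2.2.1 he
  have hw : ∀ w ∈ cornerSet P.vA P.vB, ∀ s t : ℝ, 0 < s → 0 < t →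
      w ≠ s • (x.b : V3) + t • (x.e : V3) := by
    intro w hw s t hs ht e
    have hwm : ∃ v : modelPlane χ, v ∈ P.corners ∧ (v : V3) = w := by
      rcases hw with ⟨k, rfl⟩ | ⟨k, rfl⟩
      · exact ⟨P.A k, Or.inl ⟨k, rfl⟩, rfl⟩
      · exact ⟨P.B k, Or.inr ⟨k, rfl⟩, rfl⟩
    obtain ⟨v, hv, rfl⟩ := hwm
    refine hx (Or.inr ⟨v, hv, ⟨s, t, hs.le, ht.le, e⟩, ?_, ?_⟩)
    · rintro rfl; exact hb hv
    · rintro rfl; exact he hv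
  obtain ⟨o, o', -, -, h1, h2, h3⟩ := C.exists_good one_pos (f := x.cov) (by rw [one_smul]; rfl)
    hi hj (x.transversal C (Or.inl hi)) (x.transversal C (Or.inr hj))
    (fun s t hs ht => x.segment_mem hχ C hs.le ht.le (by linarith)) hw
  exact ⟨o, o', h1, h2, h3⟩

theorem Runs.unique (C : ConePolygon P.vA P.vB P.coneK P.coneI c) {o o' q q' : Fin P.n × Bool}
    {x : Chord P} (h : Runs o o' x) (h' : Runs q q' x) : o = q ∧ o' = q' :=
  ⟨crosses_unique h.good.left h'.good.left (C.eq_of_inSideInt h.inSideInt_b h'.inSideInt_b.inSide),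
    crosses_unique h.good.right h'.good.right
      (C.eq_of_inSideInt h.inSideInt_e h'.inSideInt_e.inSide)⟩

/-- Chords which run between the same sides on the same line are equal. -/
theorem Runs.eq {o o' : Fin P.n × Bool} {x y : Chord P} (h : Runs o o' x) (h' : Runs o o' y)
    {r : ℝ} (hr : 0 < r) (e : x.cov = r • y.cov) : x = y := by
  have key : ∀ q, hit P.vA P.vB q x.cov = r • hit P.vA P.vB q y.cov := by
    intro q; rw [hit, e, map_smul, LinearMap.smul_apply]; rfl
  refine ext' ?_ ?_
  · obtain ⟨r1, h1, e1⟩ := h.left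
    obtain ⟨r2, h2, e2⟩ := h'.left
    refine modelPlane_ray_inj (r := r1 * r * r2⁻¹) (by positivity) ?_
    rw [e2, e1, key, smul_smul, smul_smul, mul_assoc _ r2⁻¹, inv_mul_cancel₀ h2.ne', mul_one]
  · obtain ⟨r1, h1, e1⟩ := h.right
    obtain ⟨r2, h2, e2⟩ := h'.right
    refine modelPlane_ray_inj (r := r1 * r * r2⁻¹) (by positivity) ?_
    rw [e2, e1, key, smul_smul, smul_smul, mul_assoc _ r2⁻¹, inv_mul_cancel₀ h2.ne', mul_one]

theorem good_endpoints (C : ConePolygon P.vA P.vB P.coneK P.coneI c) {o o' : Fin P.n × Bool} {f : V3}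
    (h : Good P.vA P.vB P.coneI o o' f) :
    ∃ r r' : ℝ, 0 < r ∧ 0 < r' ∧
      (toPlane χ (hit P.vA P.vB o f) : V3) = r • hit P.vA P.vB o f ∧
      (toPlane χ (hit P.vA P.vB o' f) : V3) = r' • hit P.vA P.vB o' f := by
  have key : ∀ v ∈ P.coneK, ∃ r : ℝ, 0 < r ∧ (toPlane χ v : V3) = r • v := by
    intro v hv
    have := coe_toPlane (P.coneK_subset hv)
    exact ⟨_, inv_pos.2 (Real.sqrt_pos.2 (P.coneK_subset hv).1), this⟩
  obtain ⟨r, hr, e⟩ := key _ (h.left.inSideInt.mem C)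
  obtain ⟨r', hr', e'⟩ := key _ (h.right.inSideInt.mem C)
  exact ⟨r, r', hr, hr', e, e'⟩

/-- A good line carries a chord. -/
theorem isChord_of_good (C : ConePolygon P.vA P.vB P.coneK P.coneI c) {o o' : Fin P.n × Bool}
    {f : V3} (h : Good P.vA P.vB P.coneI o o' f) :
    P.IsChord (toPlane χ (hit P.vA P.vB o f), toPlane χ (hit P.vA P.vB o' f)) := by
  obtain ⟨r, r', hr, hr', e, e'⟩ := good_endpoints C h
  have h1 := h.left.inSideInt.smul hr
  have h2 := h.right.inSideInt.smul hr'
  have hx : ∀ (o : Fin P.n × Bool) (i), Crosses P.vA P.vB o f → o.1 = i → f ⬝ᵥ P.vA i ≠ 0 := by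
    rintro ⟨i, x⟩ j ⟨h, h'⟩ rfl
    cases x
    · simp [tl, hd] at h h' ⊢; exact h'.ne'
    · simp [tl, hd] at h h' ⊢; exact h.ne
  have hcov : crossProduct (r • hit P.vA P.vB o f) (r' • hit P.vA P.vB o' f) =
      (r * r' * lam P.vA P.vB o o' f) • f := by
    simp only [map_smul, LinearMap.smul_apply, hit_cross_hit]; module
  have hpos : 0 < r * r' * lam P.vA P.vB o o' f := by have := h.lam_pos; positivity
  refine isChord_of ?_ ?_ ?_ ?_ ?_
  · rw [e]; exact C.mem_of_inSide h1.inSide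
  · rw [e']; exact C.mem_of_inSide h2.inSide
  · rw [e, e', hcov]
    refine smul_ne_zero hpos.ne' ?_
    rintro rfl
    have := h.left.1
    simp at this
  · intro s t hs ht
    rw [e, e', smul_smul, smul_smul]
    exact C.subset (h.mem _ _ (by positivity) (by positivity))
  · rw [e, e', hcov]
    rintro i (hi | hi)
    · rw [smul_dotProduct]
      exact mul_ne_zero hpos.ne' (hx o i h.left (C.eq_of_inSideInt h1 hi.inSide))
    · rw [smul_dotProduct]
      exact mul_ne_zero hpos.ne' (hx o' i h.right (C.eq_of_inSideInt h2 hi.inSide))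

/-- The chord on a good line. -/
def ofGood (C : ConePolygon P.vA P.vB P.coneK P.coneI c) (o o' : Fin P.n × Bool)
    (f : {f : V3 // Good P.vA P.vB P.coneI o o' f}) : Chord P :=
  ⟨(toPlane χ (hit P.vA P.vB o f), toPlane χ (hit P.vA P.vB o' f)), isChord_of_good C f.2⟩

theorem continuous_ofGood (C : ConePolygon P.vA P.vB P.coneK P.coneI c) (o o' : Fin P.n × Bool) :
    Continuous (ofGood C o o') := by
  refine Continuous.subtype_mk (Continuous.prodMk ?_ ?_) _
  · exact (continuousOn_toPlane χ).comp_continuous ((continuous_hit o).comp continuous_subtype_val)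
      fun f => P.coneK_subset (f.2.left.inSideInt.mem C)
  · exact (continuousOn_toPlane χ).comp_continuous ((continuous_hit o').comp continuous_subtype_val)
      fun f => P.coneK_subset (f.2.right.inSideInt.mem C)

theorem cov_ofGood (C : ConePolygon P.vA P.vB P.coneK P.coneI c) {o o' : Fin P.n × Bool}
    (f : {f : V3 // Good P.vA P.vB P.coneI o o' f}) :
    ∃ r : ℝ, 0 < r ∧ (ofGood C o o' f).cov = r • f.1 := by
  obtain ⟨r, r', hr, hr', e, e'⟩ := good_endpoints C f.2
  have := f.2.lam_pos
  refine ⟨r * r' * lam P.vA P.vB o o' f.1, by positivity, ?_⟩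
  show crossProduct (toPlane χ (hit P.vA P.vB o f.1) : V3) (toPlane χ (hit P.vA P.vB o' f.1) : V3) = _
  rw [e, e']
  simp only [map_smul, LinearMap.smul_apply, hit_cross_hit]; module

end Chord

theorem ConePolygon.Good.smul {n : ℕ} {A B : Fin n → V3} {K I : Set V3} {c : V3}
    (C : ConePolygon A B K I c) {o o' : Fin n × Bool} {f : V3}
    (h : Good A B I o o' f) {r : ℝ} (hr : 0 < r) : Good A B I o o' (r • f) := by
  refine h.of_pos_cons C fun s hs => ?_
  rw [dotProduct_smul, smul_eq_mul]
  have := h.pos_cons_self s hs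
  positivity

/-! ### Faces of Δ as convex cells of good lines -/

namespace Chord

open GeoPolygon

variable {χ : ℝ} {P : GeoPolygon χ} {c : V3}

theorem runs_ofGood (C : ConePolygon P.vA P.vB P.coneK P.coneI c) {o o' : Fin P.n × Bool}
    (f : {f : V3 // Good P.vA P.vB P.coneI o o' f}) : Runs o o' (ofGood C o o' f) := by
  obtain ⟨r, hr, e⟩ := cov_ofGood C f
  obtain ⟨r1, r2, hr1, hr2, e1, e2⟩ := good_endpoints C f.2
  refine runs_of C ?_ ?_ ?_
  · rw [e]; exact f.2.smul C hr
  · show InSideInt _ _ _ (toPlane χ (hit P.vA P.vB o f.1) : V3)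
    rw [e1]; exact f.2.left.inSideInt.smul hr1
  · show InSideInt _ _ _ (toPlane χ (hit P.vA P.vB o' f.1) : V3)
    rw [e2]; exact f.2.right.inSideInt.smul hr2

/-- The chords in the cell of the good line `f`. -/
def face (o o' : Fin P.n × Bool) (f : V3) : Set (Chord P) :=
  {y | Runs o o' y ∧ ∀ s ∈ cons P.vA P.vB o o' f, 0 < s ⬝ᵥ y.cov}

theorem finite_cons (o o' : Fin P.n × Bool) (f : V3) : (cons P.vA P.vB o o' f).Finite := by
  refine Set.Finite.subset ?_ (cons_subset o o' f)
  exact finite_cornerSet.union (finite_cornerSet.preimage neg_injective.injOn)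

/-- Near an interior point of a side the polygon is a half-plane, so all boundary points nearby lie
on that side. -/
theorem eventually_inSideInt (C : ConePolygon P.vA P.vB P.coneK P.coneI c) {i : Fin P.n} {v : V3}
    (h : InSideInt P.vA P.vB i v) :
    ∀ᶠ w in 𝓝 v, w ∈ P.coneK → w ∉ P.coneI → InSideInt P.vA P.vB i w := by
  obtain ⟨ε, hε, hloc⟩ := C.exists_halfplane h
  filter_upwards [hloc] with w hw hK hI
  refine hw.2.2 ?_
  by_contra h0
  have hε0 : ε ≠ 0 := by rcases hε with rfl | rfl <;> norm_num
  rcases lt_or_gt_of_ne (mul_ne_zero hε0 h0) with h1 | h1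
  · exact hw.2.1 h1 hK
  · exact hI (hw.1 h1)

/-- Ends of nearby chords stay interior to the same two sides and the strict sign conditions
persist, which already forces goodness by `Good.of_pos_cons`. -/
theorem isOpen_face (C : ConePolygon P.vA P.vB P.coneK P.coneI c) {o o' : Fin P.n × Bool} {f : V3}
    (hf : Good P.vA P.vB P.coneI o o' f) : IsOpen (face (P := P) o o' f) := by
  rw [isOpen_iff_eventually]
  rintro y ⟨hy, hy'⟩
  have h1 := continuous_b.continuousAt.eventually (eventually_inSideInt C hy.inSideInt_b)
  have h2 := continuous_e.continuousAt.eventually (eventually_inSideInt C hy.inSideInt_e)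
  have h3 := continuous_cov.continuousAt.eventually (eventually_pos (finite_cons o o' f) y.cov)
  filter_upwards [h1, h2, h3] with z hz1 hz2 hz3
  have hz : ∀ s ∈ cons P.vA P.vB o o' f, 0 < s ⬝ᵥ z.cov := fun s hs => hz3 s hs (hy' s hs)
  exact ⟨runs_of C (hf.of_pos_cons C hz) (hz1 z.b_mem.1 z.b_mem.2) (hz2 z.e_mem.1 z.e_mem.2), hz⟩

theorem face_eq (C : ConePolygon P.vA P.vB P.coneK P.coneI c) (o o' : Fin P.n × Bool) (f : V3) :
    face (P := P) o o' f =
      ofGood C o o' '' {f' | ∀ s ∈ cons P.vA P.vB o o' f, 0 < s ⬝ᵥ f'.1} := by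
  ext y
  constructor
  · rintro ⟨h1, h2⟩
    refine ⟨⟨y.cov, h1.good⟩, h2, ?_⟩
    obtain ⟨r, hr, e⟩ := cov_ofGood C ⟨y.cov, h1.good⟩
    exact (runs_ofGood C ⟨y.cov, h1.good⟩).eq h1 hr e
  · rintro ⟨f', h, rfl⟩
    refine ⟨runs_ofGood C f', fun s hs => ?_⟩
    obtain ⟨r, hr, e⟩ := cov_ofGood C f'
    rw [e, dotProduct_smul, smul_eq_mul]
    exact mul_pos hr (h s hs)

/-- The face is the continuous image under `ofGood` of a convex set of covectors. -/
theorem isConnected_face (C : ConePolygon P.vA P.vB P.coneK P.coneI c) {o o' : Fin P.n × Bool}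
    {f : V3} (hf : Good P.vA P.vB P.coneI o o' f) : IsConnected (face (P := P) o o' f) := by
  rw [face_eq C o o' f]
  refine IsConnected.image ⟨⟨⟨f, hf⟩, ?_⟩, ?_⟩ _
    (continuous_ofGood C o o').continuousOn
  · exact fun s hs => hf.pos_cons_self s hs
  rw [← Topology.IsInducing.isPreconnected_image (Topology.IsInducing.subtypeVal
    (t := {f : V3 | Good P.vA P.vB P.coneI o o' f}))]
  have h : Subtype.val '' {f' : {f : V3 // Good P.vA P.vB P.coneI o o' f} |
      ∀ s ∈ cons P.vA P.vB o o' f, 0 < s ⬝ᵥ f'.1} =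
      {f' | ∀ s ∈ cons P.vA P.vB o o' f, 0 < s ⬝ᵥ f'} := by
    ext f'
    constructor
    · rintro ⟨f', h, rfl⟩; exact h
    · exact fun h => ⟨⟨f', hf.of_pos_cons C h⟩, h, rfl⟩
  refine (congrArg IsPreconnected h).mpr (Convex.isPreconnected ?_)
  intro x hx y hy s t hs ht hst u hu
  have h1 : 0 < u ⬝ᵥ x := hx u hu
  have h2 : 0 < u ⬝ᵥ y := hy u hu
  exact comb_mem_pos h1 h2 hs ht (by linarith)

theorem self_mem_face {o o' : Fin P.n × Bool} {x : Chord P} (h : Runs o o' x) :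
    x ∈ face o o' x.cov := ⟨h, h.good.pos_cons_self⟩

theorem face_eq_of_mem (C : ConePolygon P.vA P.vB P.coneK P.coneI c) {o o' : Fin P.n × Bool} {f : V3}
    (hf : Good P.vA P.vB P.coneI o o' f) {x : Chord P} (hx : x ∈ face o o' f) :
    cons P.vA P.vB o o' x.cov = cons P.vA P.vB o o' f := C.cons_eq hf hx.2

theorem unitize_mem_openCell {S : Set V3} {f : V3} (hf : f ≠ 0) (h : ∀ s ∈ S, 0 < s ⬝ᵥ f) :
    unitize f ∈ openCell S := ⟨unitize_unit hf, fun s hs => dot_unitize_pos (h s hs)⟩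

theorem pos_of_unitize_mem_openCell {S : Set V3} {f : V3} (hf : f ≠ 0)
    (h : unitize f ∈ openCell S) : ∀ s ∈ S, 0 < s ⬝ᵥ f :=
  fun s hs => (dot_unitize_pos_iff hf).1 (h.2 s hs)

theorem mem_face_iff (C : ConePolygon P.vA P.vB P.coneK P.coneI c) {o o' : Fin P.n × Bool} {f : V3}
    {x : Chord P} : x ∈ face o o' f ↔ Runs o o' x ∧ x.ray ∈ openCell (cons P.vA P.vB o o' f) :=
  and_congr_right fun _ => ⟨fun h => unitize_mem_openCell (x.cov_ne_zero C) h,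
    fun h => pos_of_unitize_mem_openCell (x.cov_ne_zero C) h⟩

theorem ray_ofGood (C : ConePolygon P.vA P.vB P.coneK P.coneI c) {o o' : Fin P.n × Bool}
    (f : {f : V3 // Good P.vA P.vB P.coneI o o' f}) : (ofGood C o o' f).ray = unitize f.1 := by
  obtain ⟨r, hr, e⟩ := cov_ofGood C f
  rw [ray_eq, e, unitize_smul hr]

/-- Identifies the developed face with an open convex spherical polygon; the whole cell is attained
because all its lines are good and hence carry chords. -/
theorem ray_image_face (C : ConePolygon P.vA P.vB P.coneK P.coneI c) {o o' : Fin P.n × Bool} {f : V3}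
    (hf : Good P.vA P.vB P.coneI o o' f) :
    ray '' face (P := P) o o' f = openCell (cons P.vA P.vB o o' f) := by
  refine subset_antisymm ?_ fun l hl => ?_
  · rintro _ ⟨x, hx, rfl⟩
    exact ((mem_face_iff C).1 hx).2
  · rw [face_eq C]
    exact ⟨_, ⟨⟨l, hf.of_pos_cons C hl.2⟩, hl.2, rfl⟩, by rw [ray_ofGood, unitize_of_unit hl.1]⟩

theorem face_congr (C : ConePolygon P.vA P.vB P.coneK P.coneI c) {o o' q q' : Fin P.n × Bool}
    {f g : V3} (hf : Good P.vA P.vB P.coneI o o' f) (hg : Good P.vA P.vB P.coneI q q' g)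
    {x : Chord P} (hx : x ∈ face o o' f) (hx' : x ∈ face q q' g) :
    o = q ∧ o' = q' ∧ cons P.vA P.vB o o' f = cons P.vA P.vB q q' g := by
  obtain ⟨rfl, rfl⟩ := hx.1.unique C hx'.1
  exact ⟨rfl, rfl, (face_eq_of_mem C hf hx).symm.trans (face_eq_of_mem C hg hx')⟩

theorem face_eq_of_cons_eq {o o' : Fin P.n × Bool} {f g : V3}
    (h : cons P.vA P.vB o o' f = cons P.vA P.vB o o' g) :
    face (P := P) o o' f = face o o' g := by
  unfold face; rw [h]

/-- The open faces of `Δ` are the sets of chords in the cells of good lines. -/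
theorem openFaces_delta (hχ : χ = 0 ∨ χ = 1 ∨ χ = -1)
    (C : ConePolygon P.vA P.vB P.coneK P.coneI c) :
    openFaces (Delta P) = {F | ∃ o o' f, Good P.vA P.vB P.coneI o o' f ∧ F = face o o' f} := by
  let κ : Type := {k : (Fin P.n × Bool) × (Fin P.n × Bool) × V3 //
    Good P.vA P.vB P.coneI k.1 k.2.1 k.2.2}
  let U : κ → Set (Chord P) := fun k => face k.1.1 k.1.2.1 k.1.2.2
  have hU : Delta P = (⋃ k, U k)ᶜ := by
    ext x
    rw [mem_compl_iff, mem_iUnion]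
    constructor
    · rintro hx ⟨k, hk⟩
      exact hk.1.notMem_delta C hx
    · intro h
      by_contra hx
      obtain ⟨o, o', ho⟩ := exists_runs hχ C hx
      exact h ⟨⟨(o, o', x.cov), ho.good⟩, self_mem_face ho⟩
  rw [hU, openFaces_compl_iUnion (fun k => isOpen_face C k.2) (fun k => isConnected_face C k.2)]
  · ext F
    constructor
    · rintro ⟨k, rfl⟩
      exact ⟨_, _, _, k.2, rfl⟩
    · rintro ⟨o, o', f, h, rfl⟩
      exact ⟨⟨(o, o', f), h⟩, rfl⟩
  · rintro ⟨⟨o, o', f⟩, h⟩ ⟨⟨q, q', g⟩, h'⟩ hne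
    rw [Set.disjoint_left]
    intro x hx hx'
    obtain ⟨rfl, rfl, e⟩ := face_congr C h h' hx hx'
    exact hne (face_eq_of_cons_eq e)

/-- A face is determined by its two oriented sides and a set of constraints taken from the finite
set of corners and their negatives. -/
theorem finite_openFaces_delta (hχ : χ = 0 ∨ χ = 1 ∨ χ = -1)
    (C : ConePolygon P.vA P.vB P.coneK P.coneI c) : (openFaces (Delta P)).Finite := by
  have hfin : ({v | v ∈ cornerSet P.vA P.vB ∨ -v ∈ cornerSet P.vA P.vB} : Set V3).Finite :=
    finite_cornerSet.union (finite_cornerSet.preimage neg_injective.injOn)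
  refine (((finite_univ (α := (Fin P.n × Bool) × (Fin P.n × Bool))).prod
    hfin.finite_subsets).image fun k : ((Fin P.n × Bool) × (Fin P.n × Bool)) × Set V3 =>
      {y : Chord P | Runs k.1.1 k.1.2 y ∧ ∀ s ∈ k.2, 0 < s ⬝ᵥ y.cov}).subset ?_
  rw [openFaces_delta hχ C]
  rintro F ⟨o, o', f, -, rfl⟩
  exact ⟨((o, o'), cons P.vA P.vB o o' f), ⟨mem_univ _, cons_subset o o' f⟩, rfl⟩

end Chord

/-! ### The gluing of the closed faces -/

open ConePolygon

theorem frequently_notMem_finite {A : Set V3} (hA : A.Finite) (m : V3) : ∀ᶠ y in 𝓝[≠] m, y ∉ A := by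
  have h : (A \ {m}).Finite := hA.subset sdiff_subset
  have h1 : ∀ᶠ y in 𝓝 m, y ∉ A \ {m} := h.isClosed.isOpen_compl.mem_nhds fun h => h.2 rfl
  filter_upwards [mem_nhdsWithin_of_mem_nhds h1, self_mem_nhdsWithin] with y hy hne hyA
  exact hy ⟨hyA, hne⟩

theorem infinite_of_accPt {A : Set V3} {m : V3} (h : AccPt m (Filter.principal A)) :
    A.Infinite := fun hA => by
  rw [accPt_iff_frequently_nhdsNE] at h
  obtain ⟨y, hy, hy'⟩ := (h.and_eventually (frequently_notMem_finite hA m)).exists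
  exact hy' hy

/-- The arc from `m` to a second point of the convex cell accumulates at `m`, even after removal of
finitely many points. This verifies the accumulation condition in `Glued`. -/
theorem accPt_of_closedCell {S A E : Set V3} (hS : Salient S) {m m' : V3} (hm : m ∈ closedCell S)
    (hm' : m' ∈ closedCell S) (hne : m' ≠ m) (hA : A.Finite) (hE : closedCell S \ A ⊆ E) :
    AccPt m (Filter.principal E) := by
  rw [accPt_iff_frequently_nhdsNE]
  have h1 : ∀ t : ℝ, 0 < t → unitize (m + t • m') ∈ closedCell S ∧ unitize (m + t • m') ≠ m := by
    intro t ht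
    have h0 : (1 : ℝ) • m + t • m' ≠ 0 := hS.comb_ne_zero hm hm' zero_le_one ht.le (by linarith)
    have h2 := unitize_comb_mem_closedCell hm hm' zero_le_one ht.le h0
    rw [one_smul] at h2 h0
    refine ⟨h2, fun h => hne ?_⟩
    obtain ⟨r, hr, e⟩ := exists_unitize_eq h0
    rw [h] at e
    have e' : m' = (t⁻¹ * (r⁻¹ - 1)) • m := by
      have e1 : r⁻¹ • m = m + t • m' := by
        conv_lhs => rw [e, smul_smul, inv_mul_cancel₀ hr.ne', one_smul]
      rw [mul_smul, sub_smul, one_smul, e1, add_sub_cancel_left, smul_smul,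
        inv_mul_cancel₀ ht.ne', one_smul]
    rcases eq_or_eq_neg_of_smul hm'.1 hm.1 e' with h | h
    · exact h
    · exact absurd (h ▸ hm') (hS.neg_notMem hm)
  have h2 : Filter.Tendsto (fun t : ℝ => unitize (m + t • m')) (𝓝[>] 0) (𝓝[≠] m) := by
    refine tendsto_nhdsWithin_iff.2 ⟨tendsto_unitize_comb hm.1, ?_⟩
    filter_upwards [self_mem_nhdsWithin] with t ht using (h1 t ht).2
  refine h2.frequently (Filter.Eventually.frequently ?_)
  filter_upwards [h2.eventually (frequently_notMem_finite hA m), self_mem_nhdsWithin] with t ht ht'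
  exact hE ⟨(h1 t ht').1, ht⟩

theorem finite_two_planes {v w : V3} (h : crossProduct v w ≠ 0) :
    {l : V3 | l ⬝ᵥ l = 1 ∧ v ⬝ᵥ l = 0 ∧ w ⬝ᵥ l = 0}.Finite := by
  refine (Set.toFinite {unitize (crossProduct v w), -unitize (crossProduct v w)}).subset ?_
  rintro l ⟨hl, h1, h2⟩
  obtain ⟨r, hr⟩ := exists_smul_cross h h1 h2
  obtain ⟨q, hq, e⟩ := exists_unitize_eq h
  refine eq_or_eq_neg_of_smul hl (unitize_unit h) (r := r * q⁻¹) ?_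
  rw [e, smul_smul, mul_assoc, inv_mul_cancel₀ hq.ne', mul_one, hr]

theorem unit_parallel_finite {g : V3} (hg : g ≠ 0) :
    {l : V3 | l ⬝ᵥ l = 1 ∧ crossProduct l g = 0}.Finite := by
  refine (Set.toFinite {unitize g, -unitize g}).subset ?_
  rintro l ⟨hl, h1⟩
  obtain ⟨r, hr⟩ := (cross_eq_zero_iff hg).1 h1
  obtain ⟨q, hq, e⟩ := exists_unitize_eq hg
  refine eq_or_eq_neg_of_smul hl (unitize_unit hg) (r := r * q⁻¹) ?_
  rw [e, smul_smul, mul_assoc, inv_mul_cancel₀ hq.ne', mul_one, hr]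

namespace ConePolygon

variable {n : ℕ} {A B : Fin n → V3} {K I : Set V3} {c : V3}

theorem oCov_ne_zero (C : ConePolygon A B K I c) (o : Fin n × Bool) : oCov A B o ≠ 0 := by
  obtain ⟨ε, hε, h⟩ := oCov_eq (A := A) (B := B) o
  rw [h]
  exact smul_ne_zero (by rcases hε with rfl | rfl <;> norm_num) (C.cross_ne o.1)

/-- The good lines are determined by the line and a point of the interior of the chord. -/
theorem Good.eq_of_overlap (C : ConePolygon A B K I c) {o o' q q' : Fin n × Bool} {f z : V3}
    (h : Good A B I o o' f) (h' : Good A B I q q' f) (hz : f ⬝ᵥ z = 0)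
    (bz : 0 < f ⬝ᵥ crossProduct (hit A B o f) z) (ze : 0 < f ⬝ᵥ crossProduct z (hit A B o' f))
    (bz' : 0 < f ⬝ᵥ crossProduct (hit A B q f) z) (ze' : 0 < f ⬝ᵥ crossProduct z (hit A B q' f)) :
    o = q ∧ o' = q' := by
  have hf : f ≠ 0 := by rintro rfl; simp at bz
  have comb : ∀ o o', Good A B I o o' f → 0 < f ⬝ᵥ crossProduct (hit A B o f) z →
      0 < f ⬝ᵥ crossProduct z (hit A B o' f) →
      ∃ s t : ℝ, 0 < s ∧ 0 < t ∧ z = s • hit A B o f + t • hit A B o' f := by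
    intro o o' h h1 h2
    have h3 := plane_relation (dot_hit (A := A) (B := B) o f) hz (dot_hit (A := A) (B := B) o' f)
    have hl : 0 < f ⬝ᵥ crossProduct (hit A B o f) (hit A B o' f) := by
      rw [hit_cross_hit, dotProduct_smul, smul_eq_mul]
      exact mul_pos h.lam_pos (dot_self_pos hf)
    refine ⟨_, _, div_pos h2 hl, div_pos h1 hl, ?_⟩
    rw [div_eq_inv_mul, div_eq_inv_mul, mul_smul, mul_smul, ← smul_add, ← h3, smul_smul,
      inv_mul_cancel₀ hl.ne', one_smul]
  obtain ⟨s, t, hs, ht, e⟩ := comb o o' h bz ze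
  obtain ⟨s', t', hs', ht', e'⟩ := comb q q' h' bz' ze'
  have left : ∀ o o', Good A B I o o' f → ∀ s t : ℝ, 0 < s → 0 < t →
      z = s • hit A B o f + t • hit A B o' f →
      (∀ a b : ℝ, 0 < a → 0 < b → a • hit A B o f + b • z ∈ I) ∧
      ∀ a b : ℝ, 0 < a → 0 < b → a • z + b • hit A B o' f ∈ I := by
    intro o o' h s t hs ht e
    constructor
    · intro a b ha hb
      have := h.mem (a + b * s) (b * t) (by positivity) (by positivity)
      convert this using 1
      rw [e]; module
    · intro a b ha hb
      have := h.mem (a * s) (a * t + b) (by positivity) (by positivity)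
      convert this using 1
      rw [e]; module
  obtain ⟨h1, h2⟩ := left o o' h s t hs ht e
  obtain ⟨h1', h2'⟩ := left q q' h' s' t' hs' ht' e'
  obtain ⟨e1, e2⟩ := endpoints_eq_of_overlap hf (dot_hit o f) (dot_hit o' f) (dot_hit q f)
    (dot_hit q' f) hz (C.mem_of_inSide h.left.inSideInt.inSide).2
    (C.mem_of_inSide h.right.inSideInt.inSide).2 (C.mem_of_inSide h'.left.inSideInt.inSide).2
    (C.mem_of_inSide h'.right.inSideInt.inSide).2 h1 h2 h1' h2' bz ze bz' ze'
  have fin : ∀ o q : Fin n × Bool, Crosses A B o f → Crosses A B q f →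
      crossProduct (hit A B o f) (hit A B q f) = 0 → o = q := by
    intro o q ho hq hx
    by_contra hne
    have h1 : o.1 ≠ q.1 := fun h => hne (crosses_unique ho hq h)
    rw [hit_cross_hit] at hx
    exact C.lam_ne_zero h1 ho hq ((smul_eq_zero.1 hx).resolve_right hf)
  exact ⟨fin _ _ h.left h'.left e1, fin _ _ h.right h'.right e2⟩

/-- The cells of two good lines with a common chord in their closure are disjoint. -/
theorem Good.eq_of_limit (C : ConePolygon A B K I c) {o o' q q' : Fin n × Bool} {f g l m : V3}
    (h : Good A B I o o' f) (h' : Good A B I q q' g)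
    (hl : ∀ s ∈ cons A B o o' f, 0 ≤ s ⬝ᵥ l) (hl' : ∀ s ∈ cons A B q q' g, 0 ≤ s ⬝ᵥ l)
    (hm : ∀ s ∈ cons A B o o' f, 0 < s ⬝ᵥ m) (hm' : ∀ s ∈ cons A B q q' g, 0 < s ⬝ᵥ m)
    (hlam : 0 < lam A B o o' l) {r r' : ℝ} (hr : 0 < r) (hr' : 0 < r')
    (e : hit A B q l = r • hit A B o l) (e' : hit A B q' l = r' • hit A B o' l) :
    o = q ∧ o' = q' ∧ cons A B o o' f = cons A B q q' g := by
  have hl0 : l ≠ 0 := by rintro rfl; simp [lam] at hlam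
  have hll := dot_self_pos hl0
  have hlb : 0 < l ⬝ᵥ crossProduct (hit A B o l) (hit A B o' l) := by
    rw [hit_cross_hit, dotProduct_smul, smul_eq_mul]; positivity
  -- the approximating lines
  have hgood : ∀ t : ℝ, 0 < t → Good A B I o o' (l + t • m) ∧ Good A B I q q' (l + t • m) := by
    intro t ht
    constructor
    · refine h.of_pos_cons C fun s hs => ?_
      rw [dotProduct_add, dotProduct_smul, smul_eq_mul]
      have := hl s hs
      have := hm s hs
      positivity
    · refine h'.of_pos_cons C fun s hs => ?_
      rw [dotProduct_add, dotProduct_smul, smul_eq_mul]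
      have := hl' s hs
      have := hm' s hs
      positivity
  have hcont : Continuous fun t : ℝ => l + t • m := by fun_prop
  have hh : ∀ o : Fin n × Bool, Continuous fun t : ℝ => hit A B o (l + t • m) :=
    fun o => (continuous_hit o).comp hcont
  -- At `l` the two chords have the same ends up to positive factors, so the sum of the crossing
  -- points for `o`, `o'` lies strictly between those for `q`, `q'`. This persists for small `t`,
  -- and the two chords of the nearby good line overlap.
  have z1 : ∀ᶠ t in 𝓝[>] (0 : ℝ), 0 < (l + t • m) ⬝ᵥ crossProduct (hit A B q (l + t • m))
      (hit A B o (l + t • m) + hit A B o' (l + t • m)) := by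
    refine mem_nhdsWithin_of_mem_nhds ?_
    refine (continuous_dot hcont (continuous_cross (hh q) ((hh o).add (hh o')))).continuousAt.eventually
      (lt_mem_nhds ?_)
    have h0 : 0 < l ⬝ᵥ crossProduct (hit A B q l) (hit A B o l + hit A B o' l) := by
      rw [e, map_smul, LinearMap.smul_apply, map_add, cross_self, zero_add, dotProduct_smul,
        smul_eq_mul]
      positivity
    simpa only [Pi.add_apply, zero_smul, add_zero] using h0
  have z2 : ∀ᶠ t in 𝓝[>] (0 : ℝ), 0 < (l + t • m) ⬝ᵥ crossProduct
      (hit A B o (l + t • m) + hit A B o' (l + t • m)) (hit A B q' (l + t • m)) := by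
    refine mem_nhdsWithin_of_mem_nhds ?_
    refine (continuous_dot hcont (continuous_cross ((hh o).add (hh o')) (hh q'))).continuousAt.eventually
      (lt_mem_nhds ?_)
    have h0 : 0 < l ⬝ᵥ crossProduct (hit A B o l + hit A B o' l) (hit A B q' l) := by
      rw [e', map_smul, map_add, LinearMap.add_apply, cross_self, add_zero, dotProduct_smul,
        smul_eq_mul]
      positivity
    simpa only [Pi.add_apply, zero_smul, add_zero] using h0
  obtain ⟨t, ⟨h1, h2⟩, ht⟩ := ((z1.and z2).and self_mem_nhdsWithin).exists
  obtain ⟨g1, g2⟩ := hgood t ht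
  have hp : 0 < (l + t • m) ⬝ᵥ crossProduct (hit A B o (l + t • m)) (hit A B o' (l + t • m)) := by
    rw [hit_cross_hit, dotProduct_smul, smul_eq_mul]
    refine mul_pos g1.lam_pos (dot_self_pos ?_)
    rintro h0
    have := g1.lam_pos
    rw [h0] at this; simp [lam] at this
  obtain ⟨rfl, rfl⟩ := g1.eq_of_overlap C g2 (z := hit A B o (l + t • m) + hit A B o' (l + t • m))
    (by rw [dotProduct_add, dot_hit, dot_hit, add_zero])
    (by rw [map_add, cross_self, zero_add]; exact hp)
    (by rw [map_add, LinearMap.add_apply, cross_self, add_zero]; exact hp) h1 h2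
  exact ⟨rfl, rfl, (C.cons_eq h hm).symm.trans (C.cons_eq h' hm')⟩

/-- The line `l` is the limit of the good lines `l + t • f` as `t` decreases to zero; the sign of
`lam` and membership in the closed cone survive the limit. -/
theorem nonneg_cons (C : ConePolygon A B K I c) {o o' : Fin n × Bool} {f l : V3}
    (h : Good A B I o o' f) (hl : ∀ s ∈ cons A B o o' f, 0 ≤ s ⬝ᵥ l) :
    l ⬝ᵥ tl A B o ≤ 0 ∧ 0 ≤ l ⬝ᵥ hd A B o ∧ l ⬝ᵥ tl A B o' ≤ 0 ∧ 0 ≤ l ⬝ᵥ hd A B o' ∧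
      0 ≤ lam A B o o' l ∧
      ∀ s t : ℝ, 0 < s → 0 < t → s • hit A B o l + t • hit A B o' l ∈ insert 0 K := by
  have h1 := hl (-tl A B o) (Or.inl (by simp))
  have h2 := hl (hd A B o) (Or.inl (by simp))
  have h3 := hl (-tl A B o') (Or.inl (by simp))
  have h4 := hl (hd A B o') (Or.inl (by simp))
  rw [neg_dotProduct, dotProduct_comm] at h1 h3
  rw [dotProduct_comm] at h2 h4
  have hgood : ∀ t : ℝ, 0 < t → Good A B I o o' (l + t • f) := by
    intro t ht
    refine h.of_pos_cons C fun s hs => ?_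
    rw [dotProduct_add, dotProduct_smul, smul_eq_mul]
    have := hl s hs
    have := h.pos_cons_self s hs
    positivity
  have hcont : Continuous fun t : ℝ => l + t • f := by fun_prop
  have hlim : Filter.Tendsto (fun t : ℝ => l + t • f) (𝓝[>] 0) (𝓝 l) := by
    have := hcont.tendsto 0
    rw [zero_smul, add_zero] at this
    exact this.mono_left nhdsWithin_le_nhds
  have hcl : l ∈ closure {f | Good A B I o o' f} :=
    mem_closure_of_tendsto hlim (by filter_upwards [self_mem_nhdsWithin] with t ht using hgood t ht)
  refine ⟨by linarith, h2, by linarith, h4, ?_, fun s t hs ht => ?_⟩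
  · have : l ∈ {f | 0 ≤ lam A B o o' f} :=
      closure_minimal (fun f (hf : Good A B I o o' f) => hf.lam_pos.le)
        (isClosed_le continuous_const (continuous_lam o o')) hcl
    exact this
  · have hc : Continuous fun f' => s • hit A B o f' + t • hit A B o' f' :=
      ((continuous_hit o).const_smul s).add ((continuous_hit o').const_smul t)
    have hm := map_mem_closure (f := fun f' => s • hit A B o f' + t • hit A B o' f')
      (t := insert 0 K) hc hcl
      fun f' (hf' : Good A B I o o' f') => Or.inr (C.subset (hf'.mem s t hs ht))
    rwa [C.isClosed.closure_eq] at hm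

theorem inSide_hit {o : Fin n × Bool} {l : V3} (h1 : l ⬝ᵥ tl A B o ≤ 0) (h2 : 0 ≤ l ⬝ᵥ hd A B o)
    (h : hit A B o l ≠ 0) : InSide A B o.1 (hit A B o l) := by
  refine inSide_oriented.2 ⟨_, _, h2, neg_nonneg.2 h1, ?_, hit_eq o l⟩
  rcases (add_nonneg h2 (neg_nonneg.2 h1)).lt_or_eq with h3 | h3
  · exact h3
  · refine absurd ?_ h
    rw [hit_eq, show l ⬝ᵥ hd A B o = 0 by linarith, show l ⬝ᵥ tl A B o = 0 by linarith]
    simp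

theorem crosses_of_inSideInt (C : ConePolygon A B K I c) {o : Fin n × Bool} {l : V3}
    (h : InSideInt A B o.1 (hit A B o l)) : Crosses A B o l := by
  obtain ⟨s, t, hs, ht, e⟩ := inSideInt_oriented.1 h
  rw [hit_eq] at e
  obtain ⟨e1, e2⟩ := comb_inj (C.oCov_ne_zero o) e
  exact ⟨by linarith, by linarith⟩

end ConePolygon

/-! ### Limit chords in the closed faces -/

namespace Chord

open GeoPolygon

variable {χ : ℝ} {P : GeoPolygon χ} {c : V3}

/-- The lines in the closure of the cell carry limit chords, unless the two sides are not crossed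
in order. -/
theorem exists_limit_chord (C : ConePolygon P.vA P.vB P.coneK P.coneI c) {o o' : Fin P.n × Bool}
    {f l : V3} (h : Good P.vA P.vB P.coneI o o' f) (hl : l ∈ closedCell (cons P.vA P.vB o o' f))
    (hlam : lam P.vA P.vB o o' l ≠ 0) :
    ∃ x ∈ closure (face (P := P) o o' f), x.ray = l ∧
      (∃ r : ℝ, 0 < r ∧ (x.b : V3) = r • hit P.vA P.vB o l) ∧
      ∃ r : ℝ, 0 < r ∧ (x.e : V3) = r • hit P.vA P.vB o' l := by
  obtain ⟨h1, h2, h3, h4, h5, h6⟩ := C.nonneg_cons h hl.2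
  have hlp : 0 < lam P.vA P.vB o o' l := h5.lt_of_ne hlam.symm
  have hl0 := ne_zero_of_unit hl.1
  have hx : crossProduct (hit P.vA P.vB o l) (hit P.vA P.vB o' l) ≠ 0 := by
    rw [hit_cross_hit]; exact smul_ne_zero hlam hl0
  have n1 : hit P.vA P.vB o l ≠ 0 := by intro h; rw [h] at hx; simp at hx
  have n2 : hit P.vA P.vB o' l ≠ 0 := by intro h; rw [h] at hx; simp at hx
  have s1 := inSide_hit h1 h2 n1
  have s2 := inSide_hit h3 h4 n2
  have k1 := C.mem_of_inSide s1
  have k2 := C.mem_of_inSide s2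
  have key : ∀ v ∈ P.coneK, ∃ r : ℝ, 0 < r ∧ (toPlane χ v : V3) = r • v := fun v hv =>
    ⟨_, inv_pos.2 (Real.sqrt_pos.2 (P.coneK_subset hv).1), coe_toPlane (P.coneK_subset hv)⟩
  obtain ⟨r, hr, e⟩ := key _ k1.1
  obtain ⟨r', hr', e'⟩ := key _ k2.1
  have hcov : crossProduct (toPlane χ (hit P.vA P.vB o l) : V3) (toPlane χ (hit P.vA P.vB o' l)) =
      (r * r' * lam P.vA P.vB o o' l) • l := by
    rw [e, e']; simp only [map_smul, LinearMap.smul_apply, hit_cross_hit]; module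
  have hpos : 0 < r * r' * lam P.vA P.vB o o' l := by positivity
  have hA : ∀ o : Fin P.n × Bool, Crosses P.vA P.vB o l → l ⬝ᵥ P.vA o.1 ≠ 0 := by
    rintro ⟨i, x⟩ ⟨h, h'⟩
    cases x
    · simp [tl, hd] at h h' ⊢; exact h'.ne'
    · simp [tl, hd] at h h' ⊢; exact h.ne
  have htr : ∀ (o : Fin P.n × Bool) (r : ℝ), 0 < r → InSide P.vA P.vB o.1 (hit P.vA P.vB o l) →
      ∀ i, InSideInt P.vA P.vB i (r • hit P.vA P.vB o l) → l ⬝ᵥ P.vA i ≠ 0 := by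
    intro o r hr hs i hi
    obtain rfl := C.eq_of_inSideInt hi (hs.smul hr)
    refine hA o (C.crosses_of_inSideInt ?_)
    have := hi.smul (inv_pos.2 hr)
    rwa [smul_smul, inv_mul_cancel₀ hr.ne', one_smul] at this
  have hchord : P.IsChord (toPlane χ (hit P.vA P.vB o l), toPlane χ (hit P.vA P.vB o' l)) := by
    refine isChord_of ?_ ?_ ?_ ?_ ?_
    · rw [e]; exact C.mem_of_inSide (s1.smul hr)
    · rw [e']; exact C.mem_of_inSide (s2.smul hr')
    · rw [hcov]; exact smul_ne_zero hpos.ne' hl0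
    · intro s t hs ht
      rw [e, e', smul_smul, smul_smul]
      refine (h6 (s * r) (t * r') (by positivity) (by positivity)).resolve_left ?_
      exact ne_zero_of_dot_pos (comb_mem_pos (C.pos _ k1.1) (C.pos _ k2.1) (by positivity)
        (by positivity) (by positivity))
    · rw [hcov]
      rintro i (hi | hi)
      · rw [e] at hi
        rw [smul_dotProduct]; exact mul_ne_zero hpos.ne' (htr o r hr s1 i hi)
      · rw [e'] at hi
        rw [smul_dotProduct]; exact mul_ne_zero hpos.ne' (htr o' r' hr' s2 i hi)
  let x : Chord P := ⟨_, hchord⟩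
  refine ⟨x, mem_closure_iff_nhds.2 ?_, ?_, ⟨r, hr, e⟩, r', hr', e'⟩
  · intro U hU
    obtain ⟨O, hO, hOU⟩ := (mem_nhds_induced (Subtype.val : {x // P.IsChord x} → _) x U).1 hU
    -- The ends of the chord depend continuously on the line near `l`, and lines of the open cell
    -- approach `l`; so the chord is a limit of chords of the face.
    have c1 : ContinuousAt (fun m => (toPlane χ (hit P.vA P.vB o m), toPlane χ (hit P.vA P.vB o' m))) l := by
      refine ContinuousAt.prodMk ?_ ?_
      · exact ContinuousAt.comp (g := toPlane χ)
          ((continuousOn_toPlane χ).continuousAt ((isOpen_projDomain χ).mem_nhds (P.coneK_subset k1.1)))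
          (continuous_hit o).continuousAt
      · exact ContinuousAt.comp (g := toPlane χ)
          ((continuousOn_toPlane χ).continuousAt ((isOpen_projDomain χ).mem_nhds (P.coneK_subset k2.1)))
          (continuous_hit o').continuousAt
    have hlc : l ∈ closure (openCell (cons P.vA P.vB o o' f)) := by
      rw [closure_openCell h.salient_cons.nonempty ⟨_, unitize_mem_openCell
        (ne_zero_of_dot_pos (c := hd P.vA P.vB o) (by rw [dotProduct_comm]; exact h.left.2))
        h.pos_cons_self⟩]
      exact hl
    obtain ⟨m, hm, hmc⟩ := mem_closure_iff_nhds.1 hlc _ (c1 hO)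
    refine ⟨ofGood C o o' ⟨m, h.of_pos_cons C hmc.2⟩, hOU hm, ?_⟩
    rw [face_eq C]
    exact mem_image_of_mem _ hmc.2
  · show unitize (crossProduct (toPlane χ (hit P.vA P.vB o l) : V3) (toPlane χ (hit P.vA P.vB o' l))) = l
    rw [hcov, unitize_smul hpos, unitize_of_unit hl.1]

theorem continuous_ray (C : ConePolygon P.vA P.vB P.coneK P.coneI c) :
    Continuous (ray : Chord P → V3) := by
  rw [continuous_iff_continuousAt]
  intro x
  exact ContinuousAt.comp (g := unitize) (continuousAt_unitize (x.cov_ne_zero C))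
    continuous_cov.continuousAt

theorem closure_ray_face (C : ConePolygon P.vA P.vB P.coneK P.coneI c) {o o' : Fin P.n × Bool}
    {f : V3} (h : Good P.vA P.vB P.coneI o o' f) :
    closure (ray '' face (P := P) o o' f) = closedCell (cons P.vA P.vB o o' f) := by
  rw [ray_image_face C h, closure_openCell h.salient_cons.nonempty ⟨_, unitize_mem_openCell
    (ne_zero_of_dot_pos (c := hd P.vA P.vB o) (by rw [dotProduct_comm]; exact h.left.2))
    h.pos_cons_self⟩]

theorem ray_mem_closedCell (C : ConePolygon P.vA P.vB P.coneK P.coneI c) {o o' : Fin P.n × Bool}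
    {f : V3} (h : Good P.vA P.vB P.coneI o o' f) {x : Chord P} (hx : x ∈ closure (face o o' f)) :
    x.ray ∈ closedCell (cons P.vA P.vB o o' f) := by
  rw [← closure_ray_face C h]
  exact map_mem_closure (continuous_ray C) hx fun y hy => mem_image_of_mem _ hy

/-- The endpoints of the limit chords. -/
theorem endpoints_of_mem_closure (C : ConePolygon P.vA P.vB P.coneK P.coneI c)
    {o o' : Fin P.n × Bool} {f : V3} (h : Good P.vA P.vB P.coneI o o' f) {x : Chord P}
    (hx : x ∈ closure (face o o' f)) :
    (hit P.vA P.vB o x.ray ≠ 0 → ∃ r : ℝ, 0 < r ∧ (x.b : V3) = r • hit P.vA P.vB o x.ray) ∧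
    (hit P.vA P.vB o' x.ray ≠ 0 → ∃ r : ℝ, 0 < r ∧ (x.e : V3) = r • hit P.vA P.vB o' x.ray) := by
  obtain ⟨h1, h2, h3, h4, -, -⟩ := C.nonneg_cons h (ray_mem_closedCell C h hx).2
  -- Being parallel to the crossing points is a closed condition that holds on the face, so it holds
  -- for limit chords.
  have hb : x ∈ {y : Chord P | crossProduct (y.b : V3) (hit P.vA P.vB o y.ray) = 0 ∧
      crossProduct (y.e : V3) (hit P.vA P.vB o' y.ray) = 0} := by
    refine closure_minimal ?_ ?_ hx
    · rintro y ⟨hy, -⟩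
      obtain ⟨q, hq, eq⟩ := exists_unitize_eq (y.cov_ne_zero C)
      have key : ∀ o, hit P.vA P.vB o y.ray = q • hit P.vA P.vB o y.cov := by
        intro o; rw [ray_eq, eq, hit, map_smul, LinearMap.smul_apply]; rfl
      obtain ⟨r, hr, e⟩ := hy.left
      obtain ⟨r', hr', e'⟩ := hy.right
      constructor
      · rw [key, e]; simp
      · rw [key, e']; simp
    · exact (isClosed_eq (continuous_cross continuous_b ((continuous_hit o).comp (continuous_ray C)))
        continuous_const).inter (isClosed_eq (continuous_cross continuous_e
          ((continuous_hit o').comp (continuous_ray C))) continuous_const)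
  constructor
  · intro h0
    obtain ⟨r, hr⟩ := (cross_eq_zero_iff h0).1 hb.1
    exact ⟨r, pos_multiple (C.pos _ x.b_mem.1) (C.pos _ (C.mem_of_inSide (inSide_hit h1 h2 h0)).1) hr,
      hr⟩
  · intro h0
    obtain ⟨r, hr⟩ := (cross_eq_zero_iff h0).1 hb.2
    exact ⟨r, pos_multiple (C.pos _ x.e_mem.1) (C.pos _ (C.mem_of_inSide (inSide_hit h3 h4 h0)).1) hr,
      hr⟩

theorem hit_ne_zero {o o' : Fin P.n × Bool} {l : V3} (h : lam P.vA P.vB o o' l ≠ 0) :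
    hit P.vA P.vB o l ≠ 0 ∧ hit P.vA P.vB o' l ≠ 0 := by
  have hx : crossProduct (hit P.vA P.vB o l) (hit P.vA P.vB o' l) ≠ 0 := by
    rw [hit_cross_hit]
    refine smul_ne_zero h ?_
    rintro rfl; simp [lam] at h
  constructor
  · intro h; rw [h] at hx; simp at hx
  · intro h; rw [h] at hx; simp at hx

/-- Limit chords of one face are determined by their line. -/
theorem eq_of_mem_closure (C : ConePolygon P.vA P.vB P.coneK P.coneI c)
    {o o' : Fin P.n × Bool} {f : V3} (h : Good P.vA P.vB P.coneI o o' f) {x y : Chord P}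
    (hx : x ∈ closure (face o o' f)) (hy : y ∈ closure (face o o' f)) (e : x.ray = y.ray)
    (hl : lam P.vA P.vB o o' x.ray ≠ 0) : x = y := by
  obtain ⟨n1, n2⟩ := hit_ne_zero hl
  obtain ⟨⟨r, hr, e1⟩, r', hr', e2⟩ :=
    (⟨(endpoints_of_mem_closure C h hx).1 n1, (endpoints_of_mem_closure C h hx).2 n2⟩ : _ ∧ _)
  rw [e] at n1 n2
  obtain ⟨⟨q, hq, e3⟩, q', hq', e4⟩ :=
    (⟨(endpoints_of_mem_closure C h hy).1 n1, (endpoints_of_mem_closure C h hy).2 n2⟩ : _ ∧ _)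
  refine ext' (modelPlane_ray_inj (r := r * q⁻¹) (by positivity) ?_)
    (modelPlane_ray_inj (r := r' * q'⁻¹) (by positivity) ?_)
  · rw [e1, e3, e, smul_smul, mul_assoc, inv_mul_cancel₀ hq.ne', mul_one]
  · rw [e2, e4, e, smul_smul, mul_assoc, inv_mul_cancel₀ hq'.ne', mul_one]

/-- Only finitely many lines carry degenerate limit chords. -/
theorem finite_degenerate (C : ConePolygon P.vA P.vB P.coneK P.coneI c)
    {o o' : Fin P.n × Bool} {f : V3} (h : Good P.vA P.vB P.coneI o o' f) :
    {l | ∃ x ∈ closure (face (P := P) o o' f), x.ray = l ∧ lam P.vA P.vB o o' l = 0}.Finite := by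
  -- If `lam` vanishes and both crossing points are nonzero, the two ends of the chord would be
  -- parallel. So one crossing point vanishes and the line is that of a side.
  refine ((unit_parallel_finite (C.oCov_ne_zero o)).union
    (unit_parallel_finite (C.oCov_ne_zero o'))).subset ?_
  rintro l ⟨x, hx, rfl, hl⟩
  have hu := (ray_mem_closedCell C h hx).1
  by_cases h1 : hit P.vA P.vB o x.ray = 0
  · exact Or.inl ⟨hu, h1⟩
  · by_cases h2 : hit P.vA P.vB o' x.ray = 0
    · exact Or.inr ⟨hu, h2⟩
    · exfalso
      obtain ⟨r, hr, e⟩ := (endpoints_of_mem_closure C h hx).1 h1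
      obtain ⟨r', hr', e'⟩ := (endpoints_of_mem_closure C h hx).2 h2
      apply x.cov_ne_zero C
      rw [cov, e, e']
      simp only [map_smul, LinearMap.smul_apply, hit_cross_hit, hl, zero_smul, smul_zero]

end Chord

open ConePolygon

/-! ### Common boundary chords of two faces -/

namespace Chord

open GeoPolygon

variable {χ : ℝ} {P : GeoPolygon χ} {c : V3}

theorem eq_of_cross_eq_zero (C : ConePolygon P.vA P.vB P.coneK P.coneI c) {p p' : modelPlane χ}
    (hp : (p : V3) ∈ P.coneK) (hp' : (p' : V3) ∈ P.coneK) (h : crossProduct (p : V3) p' = 0) :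
    p = p' := by
  rcases eq_or_antipodal h with h | h
  · exact h
  · have h3 := C.pos _ hp
    have h4 := C.pos _ hp'
    rw [h, dotProduct_neg] at h3
    linarith

/-- The plane spanned by `l₁`, `l₂` is not contained in the kernel of `lam`, so the two planes meet
in a line, which contains only two unit vectors. -/
theorem finite_lam_zero {o o' : Fin P.n × Bool} {l₁ l₂ : V3} (h12 : crossProduct l₁ l₂ ≠ 0)
    (h : lam P.vA P.vB o o' l₁ ≠ 0) :
    {l : V3 | l ⬝ᵥ l = 1 ∧ crossProduct l₁ l₂ ⬝ᵥ l = 0 ∧ lam P.vA P.vB o o' l = 0}.Finite := by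
  have hx : crossProduct (crossProduct l₁ l₂) (crossProduct (oCov P.vA P.vB o) (oCov P.vA P.vB o'))
      ≠ 0 := by
    intro h0
    rw [← cross_anticomm, neg_eq_zero] at h0
    obtain ⟨r, hr⟩ := (cross_eq_zero_iff h12).1 h0
    apply h
    rw [lam, hr, dotProduct_smul, dotProduct_comm, dot_cross_left, smul_zero]
  refine (finite_two_planes hx).subset fun l hl => ⟨hl.1, hl.2.1, ?_⟩
  rw [dotProduct_comm]; exact hl.2.2

/-- Two closed faces with infinitely many common chords have all chords in common but for finitely
many lines. -/
theorem common_chords (C : ConePolygon P.vA P.vB P.coneK P.coneI c)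
    {o o' q q' : Fin P.n × Bool} {f g : V3} (hf : Good P.vA P.vB P.coneI o o' f)
    (hg : Good P.vA P.vB P.coneI q q' g) (h0 : (0 : V3) ∉ cons P.vA P.vB o o' f ∪ cons P.vA P.vB q q' g)
    (hne : face (P := P) o o' f ≠ face q q' g)
    (hinf : (ray '' (closure (face (P := P) o o' f) ∩ closure (face q q' g))).Infinite) :
    Disjoint (openCell (cons P.vA P.vB o o' f)) (openCell (cons P.vA P.vB q q' g)) ∧
    (∃ l₁ l₂, l₁ ≠ l₂ ∧ l₁ ∈ closedCell (cons P.vA P.vB o o' f ∪ cons P.vA P.vB q q' g) ∧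
      l₂ ∈ closedCell (cons P.vA P.vB o o' f ∪ cons P.vA P.vB q q' g)) ∧
    (closedCell (cons P.vA P.vB o o' f ∪ cons P.vA P.vB q q' g) \
      {l | l ∈ ray '' (closure (face (P := P) o o' f) ∩ closure (face q q' g)) ∧
        lam P.vA P.vB o o' l ≠ 0 ∧ lam P.vA P.vB q q' l ≠ 0}).Finite := by
  set S := cons P.vA P.vB o o' f ∪ cons P.vA P.vB q q' g with hS
  set E := ray '' (closure (face (P := P) o o' f) ∩ closure (face q q' g)) with hE
  have hES : E ⊆ closedCell S := by
    rintro _ ⟨x, ⟨hx, hx'⟩, rfl⟩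
    have h1 := ray_mem_closedCell C hf hx
    have h2 := ray_mem_closedCell C hg hx'
    exact ⟨h1.1, fun s hs => hs.elim (h1.2 s) (h2.2 s)⟩
  have hsal : Salient S := hf.salient_cons.mono subset_union_left
  -- Only finitely many common lines are degenerate for one of the faces, so two distinct generic
  -- common lines `l₁`, `l₂` can be chosen.
  have hgen : (E \ ({l | lam P.vA P.vB o o' l = 0} ∪ {l | lam P.vA P.vB q q' l = 0})).Infinite := by
    intro hfin
    refine hinf ((hfin.union ((finite_degenerate C hf).union (finite_degenerate C hg))).subset ?_)
    rintro l hl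
    obtain ⟨x, ⟨hx, hx'⟩, rfl⟩ := hl
    by_cases h1 : lam P.vA P.vB o o' x.ray = 0
    · exact Or.inr (Or.inl ⟨x, hx, rfl, h1⟩)
    · by_cases h2 : lam P.vA P.vB q q' x.ray = 0
      · exact Or.inr (Or.inr ⟨x, hx', rfl, h2⟩)
      · exact Or.inl ⟨⟨x, ⟨hx, hx'⟩, rfl⟩, fun h => h.elim h1 h2⟩
  obtain ⟨l₁, ⟨hl₁, hn₁⟩⟩ := hgen.nonempty
  obtain ⟨l₂, ⟨⟨hl₂, hn₂⟩, h21⟩⟩ := (hgen.sdiff (finite_singleton l₁)).nonempty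
  simp only [mem_union, mem_ofPred_eq, not_or] at hn₁ hn₂
  -- hits at generic common chords
  have hits : ∀ l ∈ E, lam P.vA P.vB o o' l ≠ 0 → lam P.vA P.vB q q' l ≠ 0 →
      (∃ r : ℝ, 0 < r ∧ hit P.vA P.vB q l = r • hit P.vA P.vB o l) ∧
      ∃ r : ℝ, 0 < r ∧ hit P.vA P.vB q' l = r • hit P.vA P.vB o' l := by
    rintro _ ⟨x, ⟨hx, hx'⟩, rfl⟩ h1 h2
    obtain ⟨n1, n2⟩ := hit_ne_zero h1
    obtain ⟨n3, n4⟩ := hit_ne_zero h2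
    have par : ∀ {u v w : V3}, (∃ r : ℝ, 0 < r ∧ u = r • v) → (∃ r : ℝ, 0 < r ∧ u = r • w) →
        ∃ r : ℝ, 0 < r ∧ w = r • v := by
      rintro u v w ⟨r, hr, e⟩ ⟨r', hr', e'⟩
      refine ⟨r'⁻¹ * r, by positivity, ?_⟩
      rw [mul_smul, ← e, e', smul_smul, inv_mul_cancel₀ hr'.ne', one_smul]
    exact ⟨par ((endpoints_of_mem_closure C hf hx).1 n1) ((endpoints_of_mem_closure C hg hx').1 n3),
      par ((endpoints_of_mem_closure C hf hx).2 n2) ((endpoints_of_mem_closure C hg hx').2 n4)⟩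
  -- At a generic common line the crossing points of the two faces agree, so a common line of the
  -- open cells would make the faces equal by `Good.eq_of_limit`.
  have hdisj : Disjoint (openCell (cons P.vA P.vB o o' f)) (openCell (cons P.vA P.vB q q' g)) := by
    rw [Set.disjoint_left]
    intro m hm hm'
    obtain ⟨⟨r, hr, e⟩, r', hr', e'⟩ := hits l₁ hl₁ hn₁.1 hn₁.2
    have hcl := (hES hl₁).2
    obtain ⟨rfl, rfl, e3⟩ := hf.eq_of_limit C hg (l := l₁) (fun s hs => hcl s (Or.inl hs))
      (fun s hs => hcl s (Or.inr hs)) hm.2 hm'.2 ((C.nonneg_cons hf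
        (fun s hs => hcl s (Or.inl hs))).2.2.2.2.1.lt_of_ne (Ne.symm hn₁.1)) hr hr' e e'
    exact hne (face_eq_of_cons_eq e3)
  refine ⟨hdisj, ⟨l₁, l₂, fun h => h21 h.symm, hES hl₁, hES hl₂⟩, ?_⟩
  have h12 : crossProduct l₁ l₂ ≠ 0 := by
    intro h
    obtain ⟨r, hr⟩ := (cross_eq_zero_iff (ne_zero_of_unit (hES hl₂).1)).1 h
    rcases eq_or_eq_neg_of_smul (hES hl₁).1 (hES hl₂).1 hr with h | h
    · exact h21 h.symm
    · exact hsal.neg_notMem (hES hl₂) (h ▸ hES hl₁)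
  -- A common line off the plane of `l₁`, `l₂` would give three independent vectors satisfying all
  -- constraints. No nonzero constraint vanishes on all of them, so their sum would lie in both open
  -- cells.
  have hplane : ∀ m ∈ closedCell S, crossProduct l₁ l₂ ⬝ᵥ m = 0 := by
    intro m hm
    by_contra hv
    have hpos : ∀ s ∈ S, 0 < s ⬝ᵥ (l₁ + l₂ + m) := by
      intro s hs
      have a1 := (hES hl₁).2 s hs
      have a2 := (hES hl₂).2 s hs
      have a3 := hm.2 s hs
      simp only [dotProduct_add]
      by_contra hneg
      have b1 : s ⬝ᵥ l₁ = 0 := by linarith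
      have b2 : s ⬝ᵥ l₂ = 0 := by linarith
      have b3 : s ⬝ᵥ m = 0 := by linarith
      have h := cramer m l₁ l₂ s
      rw [b1, b2, b3, dotProduct_comm] at h
      simp only [zero_smul, sub_zero, add_zero] at h
      exact h0 ((smul_eq_zero.1 h).resolve_left hv ▸ hs)
    have hz : l₁ + l₂ + m ≠ 0 := ne_zero_of_dot_pos (hpos _ hsal.nonempty.some_mem)
    exact Set.disjoint_left.1 hdisj
      (unitize_mem_openCell hz fun s hs => hpos s (Or.inl hs))
      (unitize_mem_openCell hz fun s hs => hpos s (Or.inr hs))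
  refine ((finite_lam_zero h12 hn₁.1).union (finite_lam_zero h12 hn₁.2)).subset ?_
  rintro m ⟨hm, hmE⟩
  have hp := hplane m hm
  by_cases h1 : lam P.vA P.vB o o' m = 0
  · exact Or.inl ⟨hm.1, hp, h1⟩
  by_cases h2 : lam P.vA P.vB q q' m = 0
  · exact Or.inr ⟨hm.1, hp, h2⟩
  exfalso
  refine hmE ⟨?_, h1, h2⟩
  obtain ⟨x, hx, ex, ⟨r1, hr1, e1⟩, r2, hr2, e2⟩ := exists_limit_chord C hf
    (⟨hm.1, fun s hs => hm.2 s (Or.inl hs)⟩ : m ∈ closedCell (cons P.vA P.vB o o' f)) h1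
  obtain ⟨y, hy, ey, ⟨r3, hr3, e3⟩, r4, hr4, e4⟩ := exists_limit_chord C hg
    (⟨hm.1, fun s hs => hm.2 s (Or.inr hs)⟩ : m ∈ closedCell (cons P.vA P.vB q q' g)) h2
  -- The form `lam o q` is linear and vanishes at `l₁` and `l₂`, hence on their whole plane. So the
  -- ends of the limit chords in the two faces agree for every common line, and the chords coincide.
  have lin : ∀ o q : Fin P.n × Bool,
      (∃ r : ℝ, 0 < r ∧ hit P.vA P.vB q l₁ = r • hit P.vA P.vB o l₁) →
      (∃ r : ℝ, 0 < r ∧ hit P.vA P.vB q l₂ = r • hit P.vA P.vB o l₂) →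
      crossProduct (hit P.vA P.vB o m) (hit P.vA P.vB q m) = 0 := by
    rintro o q ⟨r, -, e⟩ ⟨r', -, e'⟩
    have z : ∀ l : V3, l ⬝ᵥ l = 1 → (∃ r : ℝ, hit P.vA P.vB q l = r • hit P.vA P.vB o l) →
        lam P.vA P.vB o q l = 0 := by
      rintro l hl ⟨r, e⟩
      have := hit_cross_hit (A := P.vA) (B := P.vB) o q l
      rw [e, map_smul, cross_self, smul_zero] at this
      exact (smul_eq_zero.1 this.symm).resolve_right (ne_zero_of_unit hl)
    have z1 := z l₁ (hES hl₁).1 ⟨r, e⟩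
    have z2 := z l₂ (hES hl₂).1 ⟨r', e'⟩
    rw [hit_cross_hit, plane_coords h12 hp, lam_comb, z1, z2]
    simp
  obtain ⟨a1, a2⟩ := hits l₁ hl₁ hn₁.1 hn₁.2
  obtain ⟨b1, b2⟩ := hits l₂ hl₂ hn₂.1 hn₂.2
  have x1 := lin o q a1 b1
  have x2 := lin o' q' a2 b2
  have hxy : x = y := by
    refine ext' (eq_of_cross_eq_zero C x.b_mem.1 y.b_mem.1 ?_)
      (eq_of_cross_eq_zero C x.e_mem.1 y.e_mem.1 ?_)
    · rw [e1, e3, map_smul, map_smul, LinearMap.smul_apply, x1]; simp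
    · rw [e2, e4, map_smul, map_smul, LinearMap.smul_apply, x2]; simp
  exact ⟨x, ⟨hx, hxy ▸ hy⟩, ex⟩

/-- A choice of describing data for the open faces of `Δ`. -/
structure FaceChart (P : GeoPolygon χ) (o o' : openFaces (Delta P) → Fin P.n × Bool)
    (f : openFaces (Delta P) → V3) : Prop where
  good : ∀ F, Good P.vA P.vB P.coneI (o F) (o' F) (f F)
  eq_face : ∀ F : openFaces (Delta P), (F : Set (Chord P)) = face (o F) (o' F) (f F)

theorem exists_faceChart (hχ : χ = 0 ∨ χ = 1 ∨ χ = -1)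
    (C : ConePolygon P.vA P.vB P.coneK P.coneI c) : ∃ o o' f, FaceChart P o o' f := by
  have h : ∀ F : openFaces (Delta P), ∃ o o' f, Good P.vA P.vB P.coneI o o' f ∧
      (F : Set (Chord P)) = face o o' f := by
    intro F
    exact (Set.ext_iff.1 (openFaces_delta hχ C) _).1 F.2
  choose o o' f h1 h2 using h
  exact ⟨o, o', f, h1, h2⟩

/-- The phase space is glued from spherical polygons. -/
theorem cellGluing (hχ : χ = 0 ∨ χ = 1 ∨ χ = -1) (C : ConePolygon P.vA P.vB P.coneK P.coneI c)
    {o o' : openFaces (Delta P) → Fin P.n × Bool} {f : openFaces (Delta P) → V3}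
    (H : FaceChart P o o' f) {V : Set V3} (hV : V.Finite) (hV0 : (0 : V3) ∉ V)
    (hVc : ∀ w ∈ cornerSet P.vA P.vB, w ∈ V ∧ -w ∈ V) :
    CellGluing (fun F => cons P.vA P.vB (o F) (o' F) (f F))
      (fun F : openFaces (Delta P) => closure (ray '' (F : Set (Chord P)))) (Glued P) V
      (PhaseSpace.line P) := by
  have hSV : ∀ F, cons P.vA P.vB (o F) (o' F) (f F) ⊆ V := fun F s hs => by
    rcases cons_subset _ _ _ hs with h | h
    · exact (hVc s h).1
    · simpa using (hVc _ h).2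
  have hD : ∀ F : openFaces (Delta P), closure (ray '' (F : Set (Chord P))) =
      closedCell (cons P.vA P.vB (o F) (o' F) (f F)) := by
    intro F
    rw [H.eq_face F, closure_ray_face C (H.good F)]
  have hne : ∀ F F' : openFaces (Delta P), F ≠ F' →
      face (P := P) (o F) (o' F) (f F) ≠ face (o F') (o' F') (f F') := by
    intro F F' h h'
    rw [← H.eq_face, ← H.eq_face] at h'
    exact h (Subtype.ext h')
  have hcommon : ∀ F F' : openFaces (Delta P), F ≠ F' → ∀ l : V3, AccPt l (Filter.principal
      (ray '' (closure (F : Set (Chord P)) ∩ closure (F' : Set (Chord P))))) → _ :=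
    fun F F' hFF l hl => common_chords C (H.good F) (H.good F')
      (fun h => hV0 (h.elim (fun h => hSV F h) fun h => hSV F' h)) (hne F F' hFF)
      (by have := infinite_of_accPt hl; rwa [H.eq_face F, H.eq_face F'] at this)
  have hcell : ∀ F F' : openFaces (Delta P), ∀ l, l ∈ closure (ray '' (F : Set (Chord P))) →
      l ∈ closure (ray '' (F' : Set (Chord P))) →
      l ∈ closedCell (cons P.vA P.vB (o F) (o' F) (f F) ∪ cons P.vA P.vB (o F') (o' F') (f F')) := by
    intro F F' l h h'
    rw [hD] at h h'
    exact ⟨h.1, fun s hs => hs.elim (h.2 s) (h'.2 s)⟩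
  have hcell' : ∀ F F' : openFaces (Delta P), ∀ l,
      l ∈ closedCell (cons P.vA P.vB (o F) (o' F) (f F) ∪ cons P.vA P.vB (o F') (o' F') (f F')) →
      l ∈ closure (ray '' (F : Set (Chord P))) ∧ l ∈ closure (ray '' (F' : Set (Chord P))) := by
    intro F F' l h
    rw [hD, hD]
    exact ⟨⟨h.1, fun s hs => h.2 s (Or.inl hs)⟩, h.1, fun s hs => h.2 s (Or.inr hs)⟩
  refine ⟨(finite_openFaces_delta hχ C).to_subtype, hV, hV0, hSV, hD, ?_, ?_, fun p => rfl, ?_, ?_,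
    ?_, ?_, ?_, ?_⟩
  · intro F
    exact ⟨_, unitize_mem_openCell (ne_zero_of_dot_pos (c := hd P.vA P.vB (o F))
      (by rw [dotProduct_comm]; exact (H.good F).left.2)) (H.good F).pos_cons_self⟩
  · exact fun F => (H.good F).salient_cons
  · rintro p q ⟨h1, h2⟩
    refine ⟨h1.symm, ?_⟩
    rw [inter_comm, ← h1]; exact h2
  · exact fun p q h => h.1
  -- The common cell contains a point other than `m`, and all but finitely many of its lines carry a
  -- common chord; so these lines accumulate at `m`.
  · intro F F' hFF l m hl hl' hm hm' h
    obtain ⟨-, ⟨l₁, l₂, h12, m1, m2⟩, hfin⟩ := hcommon F F' hFF _ h.2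
    have hother : ∃ m' ∈ closedCell (cons P.vA P.vB (o F) (o' F) (f F) ∪
        cons P.vA P.vB (o F') (o' F') (f F')), m' ≠ m := by
      by_cases h : l₁ = m
      · exact ⟨l₂, m2, fun h' => h12 (h.trans h'.symm)⟩
      · exact ⟨l₁, m1, h⟩
    obtain ⟨m', hm'', hne'⟩ := hother
    refine ⟨rfl, accPt_of_closedCell ((H.good F).salient_cons.mono subset_union_left)
      (hcell F F' m hm hm') hm'' hne' hfin ?_⟩
    rintro y ⟨hy, hy'⟩
    by_contra hyE
    refine hy' ⟨hy, fun h => hyE ?_⟩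
    rw [H.eq_face F, H.eq_face F']
    exact h.1
  · intro p q h hpq
    exact (hcommon p.1 q.1 hpq _ h.2).1
  · intro p q h hpq
    obtain ⟨-, ⟨l₁, l₂, h12, m1, m2⟩, -⟩ := hcommon p.1 q.1 hpq _ h.2
    by_cases h' : l₁ = p.2
    · exact ⟨l₂, (hcell' _ _ _ m2).1, (hcell' _ _ _ m2).2, fun e => h12 (h'.trans e.symm)⟩
    · exact ⟨l₁, (hcell' _ _ _ m1).1, (hcell' _ _ _ m1).2, h'⟩
  · rintro ⟨F₁, l, hl₁⟩ ⟨F₂, l', hl₂⟩ ⟨F₃, l'', hl₃⟩ h12 h23 hlV n12 n23 n13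
    obtain rfl : l = l' := h12.1
    obtain rfl : l = l'' := h23.1
    obtain ⟨d12, -, fin12⟩ := hcommon F₁ F₂ n12 _ h12.2
    obtain ⟨d23, -, fin23⟩ := hcommon F₂ F₃ n23 _ h23.2
    refine ⟨rfl, ?_⟩
    have c12 := hcell F₁ F₂ l hl₁ hl₂
    have c23 := hcell F₂ F₃ l hl₂ hl₃
    set S := cons P.vA P.vB (o F₁) (o' F₁) (f F₁) ∪ (cons P.vA P.vB (o F₂) (o' F₂) (f F₂) ∪
      cons P.vA P.vB (o F₃) (o' F₃) (f F₃)) with hS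
    have hlS : l ∈ closedCell S := ⟨c12.1, fun s hs => hs.elim (fun h => c12.2 s (Or.inl h))
      (fun h => c23.2 s h)⟩
    have hSV' : S ⊆ V := union_subset (hSV _) (union_subset (hSV _) (hSV _))
    have hsal : Salient S := (H.good F₁).salient_cons.mono subset_union_left
    -- Otherwise `l` would lie in the disjoint open cells of two faces. As `l` is not a vertex, it
    -- is interior to an arc of the arrangement that lies in all three closed faces.
    have hv : ∃ v ∈ S, v ⬝ᵥ l = 0 := by
      by_contra hcon
      push Not at hcon
      have hpos : ∀ s ∈ S, 0 < s ⬝ᵥ l := fun s hs => (hlS.2 s hs).lt_of_ne (hcon s hs).symm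
      exact Set.disjoint_left.1 d12 (⟨hlS.1, fun s hs => hpos s (Or.inl hs)⟩ : l ∈ openCell _)
        ⟨hlS.1, fun s hs => hpos s (Or.inr (Or.inl hs))⟩
    obtain ⟨v, hvS, hvl⟩ := hv
    obtain ⟨a, ha, b, hb, hab, hcell0, -⟩ := signCell_eq_minorArc hV hSV' hsal hlS hlV (hSV' hvS)
      (fun h => hV0 (h ▸ hSV' hvS)) hvl
    have hsub := signCell_subset_closedCell hSV' hlS
    have hother : ∃ m' ∈ closedCell S, m' ≠ l := by
      by_cases h : a = l
      · exact ⟨b, hsub (hcell0 ▸ right_mem_minorArc hb.1), fun h' => hab (h.trans h'.symm)⟩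
      · exact ⟨a, hsub (hcell0 ▸ left_mem_minorArc ha.1), h⟩
    obtain ⟨m', hm', hne'⟩ := hother
    refine accPt_of_closedCell hsal hlS hm' hne' (fin12.union fin23) ?_
    rintro y ⟨hy, hy'⟩
    rw [mem_union, not_or] at hy'
    have y12 : y ∈ closedCell (cons P.vA P.vB (o F₁) (o' F₁) (f F₁) ∪
        cons P.vA P.vB (o F₂) (o' F₂) (f F₂)) :=
      ⟨hy.1, fun s hs => hy.2 s (hs.elim Or.inl fun h => Or.inr (Or.inl h))⟩
    have y23 : y ∈ closedCell (cons P.vA P.vB (o F₂) (o' F₂) (f F₂) ∪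
        cons P.vA P.vB (o F₃) (o' F₃) (f F₃)) := ⟨hy.1, fun s hs => hy.2 s (Or.inr hs)⟩
    have e12 := not_not.1 fun h => hy'.1 ⟨y12, h⟩
    have e23 := not_not.1 fun h => hy'.2 ⟨y23, h⟩
    obtain ⟨⟨x, ⟨hx1, hx2⟩, ex⟩, -, hlam⟩ := e12
    obtain ⟨⟨z, ⟨hz2, hz3⟩, ez⟩, -, -⟩ := e23
    -- For a nondegenerate line the limit chord of the middle face is unique, so the chord shared
    -- with `F₁` is the one shared with `F₃`.
    have hxz : x = z := eq_of_mem_closure C (H.good F₂) hx2 hz2 (ex.trans ez.symm) (ex ▸ hlam)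
    show y ∈ ray '' (closure (F₁ : Set (Chord P)) ∩ closure (F₃ : Set (Chord P)))
    rw [H.eq_face F₁, H.eq_face F₃]
    exact ⟨x, ⟨hx1, hxz ▸ hz3⟩, ex⟩

end Chord

/-! ### Reflections -/

open ConePolygon

/-- The normal vector of the geodesic with covector `g`. -/
def normalVec (χ : ℝ) (g : V3) : V3 := ![g 0, g 1, χ * g 2]

theorem dot_normalVec (χ : ℝ) (g : V3) :
    g ⬝ᵥ normalVec χ g = g 0 ^ 2 + g 1 ^ 2 + χ * g 2 ^ 2 := by
  rw [dot_expand]; simp [normalVec]; ring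

theorem geoReflection_eq (χ : ℝ) (g v : V3) : geoReflection χ g v =
    v - (2 * (g ⬝ᵥ v) / (g ⬝ᵥ normalVec χ g)) • normalVec χ g := by
  rw [dot_normalVec]; rfl

/-- The action of the reflection about `g` on oriented lines, as a linear map of covectors; it is
the transpose of the reflection up to sign. -/
def covReflection (χ : ℝ) (g : V3) : V3 →ₗ[ℝ] V3 where
  toFun f := (2 * (normalVec χ g ⬝ᵥ f) / (g ⬝ᵥ normalVec χ g)) • g - f
  map_add' f f' := by rw [dotProduct_add, mul_add, add_div]; module
  map_smul' r f := by
    rw [dotProduct_smul, smul_eq_mul, RingHom.id_apply,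
      show 2 * (r * (normalVec χ g ⬝ᵥ f)) / (g ⬝ᵥ normalVec χ g) =
        r * (2 * (normalVec χ g ⬝ᵥ f) / (g ⬝ᵥ normalVec χ g)) by ring]
    module

theorem covReflection_apply (χ : ℝ) (g f : V3) : covReflection χ g f =
    (2 * (normalVec χ g ⬝ᵥ f) / (g ⬝ᵥ normalVec χ g)) • g - f := rfl

theorem covReflection_involutive {χ : ℝ} {g : V3} (hg : g ⬝ᵥ normalVec χ g ≠ 0) (f : V3) :
    covReflection χ g (covReflection χ g f) = f := by
  simp only [covReflection_apply, dotProduct_sub, dotProduct_smul, smul_eq_mul]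
  rw [dotProduct_comm (normalVec χ g) g, div_mul_cancel₀ _ hg,
    show 2 * (2 * (normalVec χ g ⬝ᵥ f) - normalVec χ g ⬝ᵥ f) = 2 * (normalVec χ g ⬝ᵥ f) by ring]
  module

theorem dot_covReflection (χ : ℝ) (g s f : V3) :
    s ⬝ᵥ covReflection χ g f = -geoReflection χ g s ⬝ᵥ f := by
  rw [covReflection_apply, geoReflection_eq, dotProduct_sub, dotProduct_smul, neg_dotProduct,
    sub_dotProduct, smul_dotProduct, smul_eq_mul, smul_eq_mul, dotProduct_comm s g]
  ring

/-- The cofactor rule for cross products: the reflection is an involution of determinant `-1`, so it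
acts on cross products by minus its transpose. -/
theorem cross_geoReflection {χ : ℝ} {g : V3} (hg : g ⬝ᵥ normalVec χ g ≠ 0) (u v : V3) :
    crossProduct (geoReflection χ g u) (geoReflection χ g v) =
      covReflection χ g (crossProduct u v) := by
  have h : crossProduct (geoReflection χ g u) (geoReflection χ g v) = crossProduct u v +
      (2 / (g ⬝ᵥ normalVec χ g)) • ((g ⬝ᵥ u) • crossProduct v (normalVec χ g) -
        (g ⬝ᵥ v) • crossProduct u (normalVec χ g)) := by
    rw [geoReflection_eq, geoReflection_eq]
    simp only [map_sub, map_smul, LinearMap.sub_apply, LinearMap.smul_apply, cross_self, smul_zero,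
      sub_zero]
    rw [← cross_anticomm v (normalVec χ g)]
    simp only [mul_comm (2 : ℝ), mul_div_assoc]
    module
  have h2 : (g ⬝ᵥ u) • crossProduct v (normalVec χ g) - (g ⬝ᵥ v) • crossProduct u (normalVec χ g) =
      (normalVec χ g ⬝ᵥ crossProduct u v) • g - (g ⬝ᵥ normalVec χ g) • crossProduct u v := by
    ext i
    simp only [dot_expand]
    fin_cases i <;> simp [cross_apply] <;> ring
  rw [h, h2, covReflection_apply, smul_sub, smul_smul, smul_smul, div_mul_cancel₀ _ hg]
  rw [show 2 / (g ⬝ᵥ normalVec χ g) * (normalVec χ g ⬝ᵥ crossProduct u v) =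
    2 * (normalVec χ g ⬝ᵥ crossProduct u v) / (g ⬝ᵥ normalVec χ g) by ring]
  module

theorem dot_geoReflection {χ : ℝ} {g : V3} (hg : g ⬝ᵥ normalVec χ g ≠ 0) (v : V3) :
    g ⬝ᵥ geoReflection χ g v = -(g ⬝ᵥ v) := by
  rw [geoReflection_eq, dotProduct_sub, dotProduct_smul, smul_eq_mul, div_mul_cancel₀ _ hg]
  ring

theorem geoReflection_ne_zero {χ : ℝ} {g : V3} (hg : g ⬝ᵥ normalVec χ g ≠ 0) {v : V3} (hv : v ≠ 0) :
    geoReflection χ g v ≠ 0 := by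
  intro h
  have h1 := dot_geoReflection hg v
  rw [h, dotProduct_zero] at h1
  rw [geoReflection_fix χ g v (by linarith)] at h
  exact hv h

/-- The lines of two points of the surface are not null. -/
theorem normalVec_pos {χ : ℝ} (hχ : χ = 0 ∨ χ = 1 ∨ χ = -1) {p q : modelPlane χ}
    (h : crossProduct (p : V3) q ≠ 0) :
    0 < crossProduct (p : V3) q ⬝ᵥ normalVec χ (crossProduct (p : V3) q) := by
  have hp := p.2
  have hq := q.2
  set g := crossProduct (p : V3) q with hg
  have hgp : g ⬝ᵥ (p : V3) = 0 := dot_cross_left _ _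
  have hgg := dot_self_pos h
  rw [dot_normalVec]
  rw [dot_expand] at hgp hgg
  rcases hχ with rfl | rfl | rfl
  · have p2 : (p : V3) 2 = 1 := by
      have h1 := hp.1
      have h2 := hp.2 le_rfl
      nlinarith
    rw [p2] at hgp
    by_contra hneg
    push Not at hneg
    have h0 : g 0 = 0 := by nlinarith [sq_nonneg (g 0), sq_nonneg (g 1)]
    have h1 : g 1 = 0 := by nlinarith [sq_nonneg (g 0), sq_nonneg (g 1)]
    rw [h0, h1] at hgp hgg
    have h2 : g 2 = 0 := by linarith
    rw [h2] at hgg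
    linarith
  · nlinarith
  · have p2 := hp.2 (by norm_num)
    have p1 := hp.1
    -- Cauchy–Schwarz applied to `g ⬝ᵥ p = 0`; since the horizontal part of `p` is shorter than its
    -- height, `g` must be spacelike.
    have e1 : (g 2 * (p : V3) 2) ^ 2 ≤ (g 0 ^ 2 + g 1 ^ 2) * ((p : V3) 0 ^ 2 + (p : V3) 1 ^ 2) := by
      have : g 2 * (p : V3) 2 = -(g 0 * (p : V3) 0 + g 1 * (p : V3) 1) := by linarith
      rw [this]
      nlinarith [sq_nonneg (g 0 * (p : V3) 1 - g 1 * (p : V3) 0)]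
    by_contra hneg
    push Not at hneg
    have e2 : (g 0 ^ 2 + g 1 ^ 2) * (p : V3) 2 ^ 2 ≤ g 2 ^ 2 * (p : V3) 2 ^ 2 :=
      mul_le_mul_of_nonneg_right (by linarith) (by positivity)
    have e3 : g 0 ^ 2 + g 1 ^ 2 ≤ 0 := by
      have : (p : V3) 0 ^ 2 + (p : V3) 1 ^ 2 = (p : V3) 2 ^ 2 - 1 := by linarith
      rw [this, mul_pow] at e1
      nlinarith
    have e4 : (g 2 * (p : V3) 2) ^ 2 ≤ 0 :=
      e1.trans (mul_nonpos_of_nonpos_of_nonneg e3 (by positivity))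
    have h2 : g 2 * (p : V3) 2 = 0 := by nlinarith
    have h2' : g 2 = 0 := (mul_eq_zero.1 h2).resolve_right p2.ne'
    rw [h2'] at hgg
    nlinarith

namespace GeoPolygon

variable {χ : ℝ} {P : GeoPolygon χ} {c : V3}

/-- The action of the reflection about a side on oriented lines. -/
def sideCovReflection (P : GeoPolygon χ) (i : Fin P.n) : V3 →ₗ[ℝ] V3 :=
  covReflection χ (sideCov P.vA P.vB i)

theorem normalVec_sideCov_ne (hχ : χ = 0 ∨ χ = 1 ∨ χ = -1) (P : GeoPolygon χ) (i : Fin P.n) :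
    sideCov P.vA P.vB i ⬝ᵥ normalVec χ (sideCov P.vA P.vB i) ≠ 0 :=
  (normalVec_pos hχ (P.vcross_ne i)).ne'

theorem sideReflection_fix {i : Fin P.n} {v : V3} (h : sideCov P.vA P.vB i ⬝ᵥ v = 0) :
    P.sideReflection i v = v := geoReflection_fix _ _ _ h

theorem sideCovReflection_involutive (hχ : χ = 0 ∨ χ = 1 ∨ χ = -1) (i : Fin P.n) (f : V3) :
    P.sideCovReflection i (P.sideCovReflection i f) = f :=
  covReflection_involutive (P.normalVec_sideCov_ne hχ i) f

theorem dot_sideCovReflection (i : Fin P.n) (s f : V3) :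
    s ⬝ᵥ P.sideCovReflection i f = -P.sideReflection i s ⬝ᵥ f := dot_covReflection _ _ _ _

theorem dot_sideCovReflection_of {i : Fin P.n} {s f : V3} (h : sideCov P.vA P.vB i ⬝ᵥ s = 0) :
    s ⬝ᵥ P.sideCovReflection i f = -(s ⬝ᵥ f) := by
  rw [dot_sideCovReflection, sideReflection_fix h, neg_dotProduct]

/-- A linear form which is positive on the polygon and its reflection. -/
theorem exists_pos_reflection (hχ : χ = 0 ∨ χ = 1 ∨ χ = -1) (hP : χ = 1 → P.Admissible)
    (i : Fin P.n) : ∃ c : V3, ∀ v ∈ P.coneK, 0 < c ⬝ᵥ v ∧ 0 < c ⬝ᵥ P.sideReflection i v := by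
  -- A form that vanishes on the normal vector is invariant under the reflection, so positivity on
  -- the surface suffices.
  have key : ∀ c : V3, c ⬝ᵥ normalVec χ (sideCov P.vA P.vB i) = 0 →
      (∀ p : modelPlane χ, 0 < c ⬝ᵥ (p : V3)) →
      ∃ c : V3, ∀ v ∈ P.coneK, 0 < c ⬝ᵥ v ∧ 0 < c ⬝ᵥ P.sideReflection i v := by
    intro c hc h
    refine ⟨c, ?_⟩
    rintro _ ⟨p, -, r, hr, rfl⟩
    have h1 : 0 < c ⬝ᵥ (r • (p : V3)) := by
      rw [dotProduct_smul, smul_eq_mul]; exact mul_pos hr (h p)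
    refine ⟨h1, ?_⟩
    rw [sideReflection, geoReflection_eq, dotProduct_sub]
    have : c ⬝ᵥ normalVec χ (crossProduct (P.A i : V3) (P.B i)) = 0 := hc
    simp only [dotProduct_smul, this, smul_zero, sub_zero] at h1 ⊢
    exact h1
  rcases hχ with rfl | rfl | rfl
  · refine key ![0, 0, 1] ?_ fun p => ?_
    · rw [dot_expand]; simp [normalVec]
    · have := p.2.2 le_rfl
      rw [dot_expand]; simpa using this
  · obtain ⟨c, h1, h2⟩ := hP rfl i
    refine ⟨c, ?_⟩
    rintro _ ⟨p, hp, r, hr, rfl⟩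
    have h3 : P.sideReflection i (r • (p : V3)) = r • P.sideReflection i (p : V3) := by
      rw [sideReflection, sideReflection, geoReflection_eq, geoReflection_eq, dotProduct_smul,
        smul_eq_mul]
      simp only [mul_div_assoc, mul_left_comm (2 : ℝ)]
      module
    rw [h3, dotProduct_smul, dotProduct_smul]
    exact ⟨mul_pos hr (h1 p hp), mul_pos hr (h2 p hp)⟩
  · have hA := (P.A i).2
    have a2 := hA.2 (by norm_num)
    have a1 := hA.1
    -- This is the Lorentz product with a point of the side: it kills the normal vector, and it is
    -- positive on the hyperboloid by the reversed Cauchy–Schwarz inequality.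
    refine key ![-(P.A i : V3) 0, -(P.A i : V3) 1, (P.A i : V3) 2] ?_ fun p => ?_
    · have : sideCov P.vA P.vB i ⬝ᵥ P.vA i = 0 := dot_cross_left _ _
      rw [dot_expand] at this ⊢
      simp only [vA] at this
      simp [normalVec]
      linarith
    · have p2 := p.2.2 (by norm_num)
      have p1 := p.2.1
      rw [dot_expand]
      simp
      have hB : (P.A i : V3) 0 * (p : V3) 0 + (P.A i : V3) 1 * (p : V3) 1 <
          (P.A i : V3) 2 * (p : V3) 2 := by
        refine lt_of_pow_lt_pow_left₀ 2 (by positivity) ?_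
        have e1 : ((P.A i : V3) 0 * (p : V3) 0 + (P.A i : V3) 1 * (p : V3) 1) ^ 2 ≤
            ((P.A i : V3) 0 ^ 2 + (P.A i : V3) 1 ^ 2) * ((p : V3) 0 ^ 2 + (p : V3) 1 ^ 2) := by
          nlinarith [sq_nonneg ((P.A i : V3) 0 * (p : V3) 1 - (P.A i : V3) 1 * (p : V3) 0)]
        have e2 : ((P.A i : V3) 0 ^ 2 + (P.A i : V3) 1 ^ 2) * ((p : V3) 0 ^ 2 + (p : V3) 1 ^ 2) ≤
            ((P.A i : V3) 0 ^ 2 + (P.A i : V3) 1 ^ 2) * (p : V3) 2 ^ 2 :=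
          mul_le_mul_of_nonneg_left (by linarith) (by positivity)
        have e3 : ((P.A i : V3) 0 ^ 2 + (P.A i : V3) 1 ^ 2) * (p : V3) 2 ^ 2 <
            (P.A i : V3) 2 ^ 2 * (p : V3) 2 ^ 2 :=
          mul_lt_mul_of_pos_right (by linarith) (by positivity)
        rw [mul_pow]; linarith
      linarith

end GeoPolygon

/-! ### Existence of the reflected chord -/

namespace Chord

open GeoPolygon

variable {χ : ℝ} {P : GeoPolygon χ} {c : V3}

/-- The reflection fixes the end of `x`, so the covector through the reflected beginning and this
end is the reflected covector of `x`. -/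
theorem follows_iff (hχ : χ = 0 ∨ χ = 1 ∨ χ = -1) {i : Fin P.n} {x y : Chord P}
    (hx : x.e ∈ P.side i) : Follows i x y ↔
      y.b = x.e ∧ ∃ r : ℝ, 0 < r ∧ y.cov = r • P.sideCovReflection i x.cov := by
  have h : crossProduct (P.sideReflection i x.b) (x.e : V3) = P.sideCovReflection i x.cov := by
    conv_lhs => rw [← sideReflection_fix (i := i) (v := (x.e : V3)) (mem_side_iff.1 hx).sideCov_dot]
    exact cross_geoReflection (P.normalVec_sideCov_ne hχ i) _ _
  unfold Follows
  rw [h]; rfl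

/-- The billiard ray from the end of a chord leaves the polygon at the end of a longest chord. -/
theorem exists_next (hχ : χ = 0 ∨ χ = 1 ∨ χ = -1) (hP : χ = 1 → P.Admissible)
    (C : ConePolygon P.vA P.vB P.coneK P.coneI c) {i : Fin P.n} {x : Chord P}
    (hx : InSideInt P.vA P.vB i (x.e : V3)) :
    ∃ y : Chord P, Follows i x y ∧ ∀ y' : Chord P, Follows i x y' → y'.carrier ⊆ y.carrier := by
  set g := sideCov P.vA P.vB i with hg
  set e : V3 := x.e.1 with he
  -- The reflected ray is `e + t • w`, `t ≥ 0`: with the minus sign it leaves `e` away from the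
  -- reflected beginning of `x`.
  set w : V3 := -P.sideReflection i x.b with hw
  have hside : x.e ∈ P.side i := mem_side_iff.2 hx.inSide
  have hge : g ⬝ᵥ e = 0 := hx.inSide.sideCov_dot
  have heK := x.e_mem
  have hew : crossProduct e w = P.sideCovReflection i x.cov := by
    have h1 : crossProduct (P.sideReflection i x.b) (x.e : V3) = P.sideCovReflection i x.cov := by
      conv_lhs => rw [← sideReflection_fix (i := i) (v := (x.e : V3)) hge]
      exact cross_geoReflection (P.normalVec_sideCov_ne hχ i) _ _
    rw [← h1, hw, map_neg, cross_anticomm]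
  have hA : crossProduct e w ⬝ᵥ P.vA i ≠ 0 := by
    rw [hew, dotProduct_comm, dot_sideCovReflection_of (dot_cross_left _ _), dotProduct_comm]
    exact neg_ne_zero.2 (x.transversal C (Or.inr hx))
  have hew0 : crossProduct e w ≠ 0 := by intro h; rw [h] at hA; simp at hA
  have hgw : g ⬝ᵥ w = g ⬝ᵥ (x.b : V3) := by
    rw [hw, dotProduct_neg, sideReflection]
    have := dot_geoReflection (P.normalVec_sideCov_ne hχ i) (x.b : V3)
    rw [neg_eq_iff_eq_neg]; exact this
  have hz0 : ∀ t : ℝ, e + t • w ≠ 0 := by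
    intro t h
    apply hew0
    rcases eq_or_ne t 0 with rfl | ht
    · rw [zero_smul, add_zero] at h; rw [h]; simp
    · have h1 : crossProduct e (e + t • w) = t • crossProduct e w := by
        rw [map_add, cross_self, zero_add, map_smul]
      rw [h, map_zero] at h1
      exact (smul_eq_zero.1 h1.symm).resolve_left ht
  have hzc : Continuous fun t : ℝ => e + t • w := by fun_prop
  have hclK : IsClosed {t : ℝ | e + t • w ∈ P.coneK} := by
    have := C.isClosed.preimage hzc
    convert this using 1
    ext t
    exact ⟨fun h => Or.inr h, fun h => h.resolve_left (hz0 t)⟩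
  -- the ray enters the polygon
  have hstart : ∃ δ : ℝ, 0 < δ ∧ ∀ t, 0 ≤ t → t ≤ δ → e + t • w ∈ P.coneK := by
    obtain ⟨ε, hε, hloc⟩ := C.exists_halfplane hx
    -- The chord `x` stays in the polygon near `e`, so its beginning is on the inner side. The
    -- reflection and the minus sign in `w` cancel, so the new ray points to the inner side too.
    have hgb : 0 < ε * (g ⬝ᵥ (x.b : V3)) := by
      have hne : ε * (g ⬝ᵥ (x.b : V3)) ≠ 0 := by
        refine mul_ne_zero (by rcases hε with rfl | rfl <;> norm_num) fun h0 => ?_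
        have h1 : crossProduct g x.cov = 0 := by
          rw [cov, cross_cross_expand]
          have : g ⬝ᵥ (x.e : V3) = 0 := hge
          rw [this, h0]; simp
        obtain ⟨r, hr⟩ := (cross_eq_zero_iff (C.cross_ne i)).1 (by
          rw [← cross_anticomm, neg_eq_zero]; exact h1 : crossProduct x.cov g = 0)
        apply x.transversal C (Or.inr hx)
        rw [hr, smul_dotProduct, dot_cross_left, smul_zero]
      refine lt_of_le_of_ne ?_ hne.symm
      by_contra hneg
      push Not at hneg
      have hc : Filter.Tendsto (fun t : ℝ => e + t • (x.b : V3)) (𝓝[>] 0) (𝓝 e) := by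
        have : Continuous fun t : ℝ => e + t • (x.b : V3) := by fun_prop
        have h := this.tendsto 0
        rw [zero_smul, add_zero] at h
        exact h.mono_left nhdsWithin_le_nhds
      obtain ⟨t, h1, ht⟩ := ((hc.eventually hloc).and self_mem_nhdsWithin).exists
      refine h1.2.1 ?_ ?_
      · have ht' : 0 < t := ht
        rw [dotProduct_add, dotProduct_smul, smul_eq_mul]
        have : sideCov P.vA P.vB i ⬝ᵥ e = 0 := hge
        rw [this, zero_add]
        have h5 : sideCov P.vA P.vB i ⬝ᵥ (x.b : V3) = g ⬝ᵥ (x.b : V3) := rfl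
        rw [h5]; nlinarith
      · have := x.segment_mem hχ C (s := t) (t := 1) (le_of_lt ht) zero_le_one
          (by have : (0:ℝ) < t := ht; linarith)
        rwa [one_smul, add_comm] at this
    have h0 : Filter.Tendsto (fun t : ℝ => e + t • w) (𝓝 0) (𝓝 e) := by
      simpa using hzc.tendsto 0
    have h2 := h0.eventually (hloc.mono fun v hv => hv.1)
    obtain ⟨δ, hδ, hball⟩ := Metric.eventually_nhds_iff_ball.1 h2
    refine ⟨δ / 2, by linarith, fun t ht0 ht => ?_⟩
    rcases ht0.lt_or_eq with h0 | rfl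
    · refine C.subset (hball t ?_ ?_)
      · rw [mem_ball_zero_iff, Real.norm_eq_abs, abs_of_pos h0]; linarith
      · rw [dotProduct_add, dotProduct_smul, smul_eq_mul]
        have h3 : sideCov P.vA P.vB i ⬝ᵥ e = 0 := hge
        have h4 : sideCov P.vA P.vB i ⬝ᵥ w = g ⬝ᵥ (x.b : V3) := hgw
        rw [h3, h4, zero_add]; nlinarith
    · rw [zero_smul, add_zero]; exact heK.1
  -- the ray leaves the polygon
  have hleave : ∃ t₁ : ℝ, 0 < t₁ ∧ e + t₁ • w ∉ P.coneK := by
    obtain ⟨c', hc'⟩ := exists_pos_reflection hχ hP i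
    have h1 := (hc' _ heK.1).1
    have h2 := (hc' _ x.b_mem.1).2
    -- At this parameter the form `c'` vanishes on the ray, whereas it is positive on the polygon.
    refine ⟨(c' ⬝ᵥ e) / (c' ⬝ᵥ P.sideReflection i x.b), div_pos h1 h2, fun h => ?_⟩
    have h3 := (hc' _ h).1
    rw [dotProduct_add, dotProduct_smul, smul_eq_mul, hw, dotProduct_neg, mul_neg,
      div_mul_cancel₀ _ h2.ne'] at h3
    linarith
  obtain ⟨δ, hδ, hstart⟩ := hstart
  obtain ⟨t₁, ht₁, hleave⟩ := hleave
  -- Its supremum `τ` is the first exit time. The ray cannot continue in the polygon beyond it, so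
  -- the exit point is on the boundary and the ray does not run along a side there.
  set T : Set ℝ := {t | 0 ≤ t ∧ ∀ s, 0 ≤ s → s ≤ t → e + s • w ∈ P.coneK} with hT
  have hδT : δ ∈ T := ⟨hδ.le, hstart⟩
  have hbdd : BddAbove T := ⟨t₁, fun t ht => by
    by_contra hlt
    push Not at hlt
    exact hleave (ht.2 t₁ ht₁.le hlt.le)⟩
  set τ := sSup T with hτ
  have hδτ : δ ≤ τ := le_csSup hbdd hδT
  have hlt : ∀ s, 0 ≤ s → s < τ → e + s • w ∈ P.coneK := by
    intro s hs hsτ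
    obtain ⟨t, ht, hst⟩ := exists_lt_of_lt_csSup ⟨δ, hδT⟩ hsτ
    exact ht.2 s hs hst.le
  have hτK : e + τ • w ∈ P.coneK := by
    have h1 : τ ∈ closure (Ioo 0 τ) := by
      rw [closure_Ioo (by linarith)]; exact ⟨by linarith, le_rfl⟩
    exact closure_minimal (fun s hs => hlt s hs.1.le hs.2) hclK h1
  have hle : ∀ s, 0 ≤ s → s ≤ τ → e + s • w ∈ P.coneK := fun s hs h =>
    h.lt_or_eq.elim (hlt s hs) fun h => h ▸ hτK
  have hend : ¬ ∀ᶠ t in 𝓝 τ, e + t • w ∈ P.coneK := by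
    intro h
    obtain ⟨ρ, hρ, hball⟩ := Metric.eventually_nhds_iff_ball.1 h
    have : τ + ρ / 2 ∈ T := by
      refine ⟨by linarith, fun s hs hs' => ?_⟩
      rcases le_or_gt s τ with h | h
      · exact hle s hs h
      · refine hball s ?_
        rw [Metric.mem_ball, Real.dist_eq, abs_of_pos (by linarith)]; linarith
    have := le_csSup hbdd this
    linarith
  have hτ0 : 0 < τ := by linarith
  have hτI : e + τ • w ∉ P.coneI := fun h => hend (by
    filter_upwards [hzc.continuousAt.eventually (C.isOpen.mem_nhds h)] with t ht using C.subset ht)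
  obtain ⟨r, hr, hq⟩ := exists_toPlane (P.coneK_subset hτK)
  set q := toPlane χ (e + τ • w) with hqdef
  have hq' : (q : V3) = r⁻¹ • (e + τ • w) := by
    rw [hq, smul_smul, inv_mul_cancel₀ hr.ne', one_smul]
  have hcov : crossProduct e (q : V3) = (r⁻¹ * τ) • crossProduct e w := by
    rw [hq', map_smul, map_add, cross_self, zero_add, map_smul, smul_smul]
  have hchord : P.IsChord (x.e, q) := by
    refine isChord_of heK ?_ ?_ ?_ ?_
    · rw [hq', smul_mem_coneK_iff (inv_pos.2 hr), smul_mem_coneI_iff (inv_pos.2 hr)]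
      exact ⟨hτK, hτI⟩
    · show crossProduct e (q : V3) ≠ 0
      rw [hcov]; exact smul_ne_zero (by positivity) hew0
    · intro s t hs ht
      have h1 : s • (x.e : V3) + t • (q : V3) =
          (s + t * r⁻¹) • (e + ((s + t * r⁻¹)⁻¹ * (t * r⁻¹ * τ)) • w) := by
        have h2 : s + t * r⁻¹ ≠ 0 := by positivity
        rw [hq', smul_add (s + t * r⁻¹), smul_smul (s + t * r⁻¹), mul_inv_cancel_left₀ h2]
        module
      rw [h1]
      refine smul_mem_coneK (hle _ (by positivity) ?_) (by positivity)
      rw [inv_mul_le_iff₀ (by positivity)]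
      nlinarith [mul_pos hs hτ0]
    · intro k hk
      show crossProduct e (q : V3) ⬝ᵥ P.vA k ≠ 0
      rw [hcov, smul_dotProduct]
      refine smul_ne_zero (by positivity) ?_
      rcases hk with hk | hk
      · obtain rfl := C.eq_of_inSideInt hx hk.inSide
        exact hA
      · intro h0
        rw [hq'] at hk
        have hk' : InSideInt P.vA P.vB k (e + τ • w) := by
          have := hk.smul hr
          rwa [smul_smul, mul_inv_cancel₀ hr.ne', one_smul] at this
        -- otherwise the ray runs along the side `k`
        have hpar : crossProduct (crossProduct e w) (sideCov P.vA P.vB k) = 0 := by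
          obtain ⟨α, β, hα, hβ, hz⟩ := hk'
          have h1 : crossProduct e w ⬝ᵥ (e + τ • w) = 0 := by
            rw [dotProduct_add, dotProduct_smul, dot_cross_left, dot_cross_right]; simp
          rw [hz, dotProduct_add, dotProduct_smul, dotProduct_smul, h0, smul_zero, zero_add,
            smul_eq_mul] at h1
          rw [cross_cross_expand, h0, (mul_eq_zero.1 h1).resolve_left hβ.ne']
          simp
        obtain ⟨ρ, hρ⟩ := (cross_eq_zero_iff hew0).1 (by
          rw [← cross_anticomm, hpar, neg_zero] :
            crossProduct (sideCov P.vA P.vB k) (crossProduct e w) = 0)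
        obtain ⟨ε, hε, hloc⟩ := C.exists_halfplane hk'
        refine hend ?_
        filter_upwards [hzc.continuousAt.eventually hloc] with t ht
        refine (ht.2.2 ?_).mem C
        rw [hρ, smul_dotProduct, dotProduct_add, dotProduct_smul, dot_cross_left, dot_cross_right]
        simp
  refine ⟨⟨(x.e, q), hchord⟩, (follows_iff hχ hside).2 ⟨rfl, r⁻¹ * τ, by positivity, ?_⟩, ?_⟩
  · rw [← hew]; exact hcov
  · intro y' hy' v hv
    obtain ⟨hb, κ, hκ, hc⟩ := (follows_iff hχ hside).1 hy'
    rw [← hew, cov, hb] at hc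
    -- A competing chord ends at a combination `a • e + κ • w`. Here `a` must be positive, as
    -- otherwise the chord would reach the point `e + t₁ • w` outside the polygon; and then `κ / a`
    -- is at most the exit time.
    have hpar : crossProduct ((y'.e : V3) - κ • w) e = 0 := by
      rw [← cross_anticomm, map_sub, map_smul, hc, sub_self, neg_zero]
    obtain ⟨a, ha⟩ := (cross_eq_zero_iff (modelPlane_ne_zero x.e)).1 hpar
    have hye : (y'.e : V3) = a • e + κ • w := by rw [← sub_eq_iff_eq_add]; exact ha
    have hseg : ∀ s : ℝ, 0 ≤ s → 0 ≤ 1 - a * s / κ → e + s • w ∈ P.coneK := by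
      intro s hs h1
      rcases hs.lt_or_eq with hs' | rfl
      · have h2 := y'.segment_mem hχ C (s := 1 - a * s / κ) (t := s / κ) h1 (by positivity)
          (by have : 0 < s / κ := by positivity
              linarith)
        rw [hb, hye] at h2
        convert h2 using 1
        have h3 : s / κ * κ = s := by field_simp
        have h4 : a * s / κ = s / κ * a := by ring
        conv_lhs => rw [← h3]
        rw [h4]
        module
      · rw [zero_smul, add_zero]; exact heK.1
    have ha0 : 0 < a := by
      by_contra hneg
      push Not at hneg
      refine hleave (hseg t₁ ht₁.le ?_)
      have : a * t₁ / κ ≤ 0 := div_nonpos_of_nonpos_of_nonneg (by nlinarith) hκ.le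
      linarith
    have hκτ : κ / a ≤ τ := by
      refine le_csSup hbdd ⟨by positivity, fun s hs hs' => hseg s hs ?_⟩
      rw [le_div_iff₀ ha0] at hs'
      have : a * s / κ ≤ 1 := by rw [div_le_one hκ]; linarith
      linarith
    obtain ⟨s, t, hs, ht, hvv⟩ := hv
    rw [hb, hye] at hvv
    rw [div_le_iff₀ ha0] at hκτ
    refine ⟨s + t * (a - κ / τ), t * (κ / τ * r), ?_, by positivity, ?_⟩
    · have : κ / τ ≤ a := by rw [div_le_iff₀ hτ0]; linarith
      have : 0 ≤ a - κ / τ := by linarith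
      positivity
    · show (v : V3) = (s + t * (a - κ / τ)) • e + (t * (κ / τ * r)) • (q : V3)
      rw [hvv, hq', smul_smul, mul_assoc t, mul_assoc (κ / τ), mul_inv_cancel₀ hr.ne', mul_one]
      have h3 : κ = κ / τ * τ := by field_simp
      show s • e + t • (a • e + κ • w) = _
      conv_lhs => rw [h3]
      module

end Chord

/-! ### The billiard map -/

open ConePolygon

namespace Chord

open GeoPolygon

variable {χ : ℝ} {P : GeoPolygon χ} {c : V3}

theorem b_mem_carrier (x : Chord P) : x.b ∈ x.carrier :=
  ⟨1, 0, zero_le_one, le_rfl, by simp⟩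

theorem e_mem_carrier (x : Chord P) : x.e ∈ x.carrier :=
  ⟨0, 1, le_rfl, zero_le_one, by simp⟩

theorem cov_dot_of_mem_carrier {x : Chord P} {v : modelPlane χ} (h : v ∈ x.carrier) :
    x.cov ⬝ᵥ (v : V3) = 0 := by
  obtain ⟨s, t, -, -, h⟩ := h
  rw [h, dotProduct_add, dotProduct_smul, dotProduct_smul, cov_dot_b, cov_dot_e]; simp

theorem eq_of_carrier_subset (C : ConePolygon P.vA P.vB P.coneK P.coneI c) {x y : Chord P}
    (hb : x.b = y.b) (h : x.carrier ⊆ y.carrier) (h' : y.carrier ⊆ x.carrier) : x = y := by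
  refine ext' hb ?_
  obtain ⟨s, t, hs, ht, e⟩ := h x.e_mem_carrier
  obtain ⟨s', t', hs', ht', e'⟩ := h' y.e_mem_carrier
  rw [← hb] at e
  have hc : crossProduct (x.b : V3) (x.e : V3) ≠ 0 := x.cov_ne_zero C
  have h1 : (0 : ℝ) • (x.b : V3) + (1 : ℝ) • (x.e : V3) =
      (s + t * s') • (x.b : V3) + (t * t') • (x.e : V3) := by
    conv_lhs => rw [zero_smul, zero_add, one_smul, e, e']
    module
  obtain ⟨h2, h3⟩ := comb_inj hc h1
  have hs0 : s = 0 := by nlinarith [mul_nonneg ht hs']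
  have ht0 : 0 < t := ht.lt_of_ne fun h => by rw [← h] at h3; simp at h3
  exact modelPlane_ray_inj ht0 (by rw [e, hs0, zero_smul, zero_add])

theorem Follows.b_eq {i : Fin P.n} {x y : Chord P} (h : Follows i x y) : y.b = x.e := h.1

theorem existsUnique_next (hχ : χ = 0 ∨ χ = 1 ∨ χ = -1) (hP : χ = 1 → P.Admissible)
    (C : ConePolygon P.vA P.vB P.coneK P.coneI c) {x : Chord P} (hx : x ∉ DeltaPlus P) :
    ∃! y : Chord P, IsNext x y := by
  obtain ⟨i, hi⟩ := exists_side_of_notMem_corners x.2.2.1 hx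
  obtain ⟨y, hy, hmax⟩ := exists_next hχ hP C (x := x) hi
  refine ⟨y, ⟨hx, i, mem_side_iff.2 hi.inSide, hy, hmax⟩, ?_⟩
  rintro y' ⟨-, j, hj, hy', hmax'⟩
  obtain rfl := C.eq_of_inSideInt hi (mem_side_iff.1 hj)
  exact eq_of_carrier_subset C (hy'.b_eq.trans hy.b_eq.symm) (hmax _ hy') (hmax' _ hy)

/-- The billiard map on chords outside `Δ`. -/
theorem isNext_iff (hχ : χ = 0 ∨ χ = 1 ∨ χ = -1) (hP : χ = 1 → P.Admissible)
    (C : ConePolygon P.vA P.vB P.coneK P.coneI c) {x y : Chord P}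
    (hy : y ∉ Delta P) : IsNext x y ↔ ∃ i, InSideInt P.vA P.vB i (x.e : V3) ∧
      InSideInt P.vA P.vB i (y.b : V3) ∧
      ∃ r : ℝ, 0 < r ∧ y.cov = r • P.sideCovReflection i x.cov := by
  constructor
  · rintro ⟨h1, i, h2, h3, -⟩
    obtain ⟨h4, h5⟩ := (follows_iff hχ h2).1 h3
    have h6 := inSideInt_of_mem_side h2 h1
    exact ⟨i, h6, h4 ▸ h6, h5⟩
  · rintro ⟨i, h1, h2, r, hr, h3⟩
    have hside : x.e ∈ P.side i := mem_side_iff.2 h1.inSide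
    -- Both points lie on the line of `y` and on the line of the side `i`. These lines are
    -- different, so the points are parallel and hence equal.
    have hbe : y.b = x.e := by
      have hv : crossProduct y.cov (sideCov P.vA P.vB i) ≠ 0 := by
        intro h
        obtain ⟨q, hq⟩ := (cross_eq_zero_iff (C.cross_ne i)).1 h
        apply y.transversal C (Or.inl h2)
        rw [hq, smul_dotProduct, dot_cross_left, smul_zero]
      obtain ⟨a, ha⟩ := exists_smul_cross hv y.cov_dot_b h2.inSide.sideCov_dot
      have h4 : y.cov ⬝ᵥ (x.e : V3) = 0 := by
        rw [h3, smul_dotProduct, dotProduct_comm, dot_sideCovReflection_of h1.inSide.sideCov_dot,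
          dotProduct_comm, cov_dot_e]
        simp
      obtain ⟨a', ha'⟩ := exists_smul_cross hv h4 h1.inSide.sideCov_dot
      refine eq_of_cross_eq_zero C y.b_mem.1 x.e_mem.1 ?_
      rw [ha, ha']; simp
    have hfol : Follows i x y := (follows_iff hχ hside).2 ⟨hbe, r, hr, h3⟩
    refine ⟨notMem_corners_of_inSideInt C h1, i, hside, hfol, ?_⟩
    obtain ⟨y₁, hy₁, hmax⟩ := exists_next hχ hP C h1
    suffices h : y = y₁ by rw [h]; exact hmax
    have hb : y.b = y₁.b := hfol.b_eq.trans hy₁.b_eq.symm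
    refine ext' hb ?_
    -- If `y` were shorter than the longest chord `y₁`, its end would be an interior point both of
    -- `y₁` and of a side. Then `y₁` would run along that side, against transversality of `y`.
    by_contra hne
    obtain ⟨s, t, hs, ht, e⟩ := exists_of_mem_carrier (hmax _ hfol y.e_mem_carrier)
      (fun h => y.2.2.2.1 (hb.trans h.symm)) hne
    obtain ⟨q, q', hq⟩ := exists_runs hχ C hy
    have hk := hq.inSideInt_e
    have h4 := hk.inSide.sideCov_dot
    rw [e] at hk
    have h5 := C.sideCov_dot_eq_zero (fun s t hs ht => y₁.segment_mem hχ C hs.le ht.le (by linarith))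
      hs ht hk
    have h6 : sideCov P.vA P.vB q'.1 ⬝ᵥ (y.b : V3) = 0 := by
      rw [e, dotProduct_add, dotProduct_smul, dotProduct_smul, h5, smul_zero, add_zero, ← hb] at h4
      exact (smul_eq_zero.1 h4).resolve_left hs.ne'
    have h7 : crossProduct y.cov (sideCov P.vA P.vB q'.1) = 0 := by
      rw [← cross_anticomm, cov, cross_cross_expand, h6, hq.inSideInt_e.inSide.sideCov_dot]
      simp
    obtain ⟨a, ha⟩ := (cross_eq_zero_iff (C.cross_ne q'.1)).1 h7
    apply y.transversal C (Or.inr hq.inSideInt_e)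
    rw [ha, smul_dotProduct, dot_cross_left, smul_zero]

/-- A generic chord is not mapped to a chord in `Δ`. -/
theorem IsNext.notMem_delta (hχ : χ = 0 ∨ χ = 1 ∨ χ = -1)
    (C : ConePolygon P.vA P.vB P.coneK P.coneI c) {i : Fin P.n} {x y : Chord P}
    (hi : InSideInt P.vA P.vB i (x.e : V3)) (h : IsNext x y)
    (hg : ∀ w ∈ cornerSet P.vA P.vB, P.sideReflection i w ⬝ᵥ x.cov ≠ 0) : y ∉ Delta P := by
  obtain ⟨h1, j, h2, h3, -⟩ := h
  obtain rfl := C.eq_of_inSideInt hi (mem_side_iff.1 h2)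
  obtain ⟨h4, r, hr, h5⟩ := (follows_iff hχ h2).1 h3
  -- A corner on the next chord would put its reflection on the line of `x`.
  have key : ∀ v ∈ P.corners, v ∉ y.carrier := by
    intro v hv hvy
    have h6 := cov_dot_of_mem_carrier hvy
    rw [h5, smul_dotProduct, dotProduct_comm, dot_sideCovReflection, neg_dotProduct, smul_neg,
      neg_eq_zero] at h6
    exact hg _ (mem_corners_iff.1 hv) ((smul_eq_zero.1 h6).resolve_left hr.ne')
  rintro ((h | h) | ⟨v, hv, h6, -, -⟩)
  · exact key _ h y.e_mem_carrier
  · exact key _ h y.b_mem_carrier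
  · exact key _ hv h6

theorem IsNext.notMem_deltaMinus {x y : Chord P} (h : IsNext x y) : y ∉ DeltaMinus P := by
  obtain ⟨h1, i, -, h3, -⟩ := h
  intro h
  exact h1 (h3.b_eq ▸ h)

/-- The reversed chord. -/
def rev (x : Chord P) : Chord P := ⟨(x.e, x.b), x.2.2.1, x.2.1, x.2.2.2.1.symm, by
  refine subset_trans ?_ x.2.2.2.2.1
  rintro v ⟨s, t, hs, ht, e⟩
  exact ⟨t, s, ht, hs, by rw [e, add_comm]; rfl⟩, by
  intro i z hz hzi hzc
  have h := x.2.2.2.2.2 i z (hz.elim (fun h => Or.inr h) fun h => Or.inl h) hzi hzc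
  rw [← cross_anticomm, neg_dotProduct]
  exact neg_ne_zero.2 h⟩

theorem rev_rev (x : Chord P) : x.rev.rev = x := rfl

theorem cov_rev (x : Chord P) : x.rev.cov = -x.cov := (cross_anticomm _ _).symm

theorem rev_notMem_delta {x : Chord P} (hx : x ∉ Delta P) : x.rev ∉ Delta P := by
  rintro ((h | h) | ⟨v, hv, ⟨s, t, hs, ht, e⟩, h1, h2⟩)
  · exact hx (Or.inl (Or.inr h))
  · exact hx (Or.inl (Or.inl h))
  · exact hx (Or.inr ⟨v, hv, ⟨t, s, ht, hs, by rw [e, add_comm]; rfl⟩, h2, h1⟩)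

/-- Reversal negates covectors and the action of the reflection on covectors is a linear involution,
so the defining relation is symmetric under reversal. -/
theorem IsNext.rev (hχ : χ = 0 ∨ χ = 1 ∨ χ = -1) (hP : χ = 1 → P.Admissible)
    (C : ConePolygon P.vA P.vB P.coneK P.coneI c) {x y : Chord P} (hx : x ∉ Delta P)
    (hy : y ∉ Delta P) (h : IsNext x y) : IsNext y.rev x.rev := by
  obtain ⟨i, h1, h2, r, hr, h3⟩ := (isNext_iff hχ hP C hy).1 h
  refine (isNext_iff hχ hP C (rev_notMem_delta hx)).2
    ⟨i, h2, h1, r⁻¹, inv_pos.2 hr, ?_⟩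
  rw [cov_rev, cov_rev, h3, map_neg, map_smul, sideCovReflection_involutive hχ, smul_neg, smul_smul,
    inv_mul_cancel₀ hr.ne', one_smul]

theorem next_unique (hχ : χ = 0 ∨ χ = 1 ∨ χ = -1) (hP : χ = 1 → P.Admissible)
    (C : ConePolygon P.vA P.vB P.coneK P.coneI c) {x y y' : Chord P} (h : IsNext x y)
    (h' : IsNext x y') : y = y' := (existsUnique_next hχ hP C h.1).unique h h'

/-- Reversal turns predecessors into successors, which are unique. -/
theorem prev_unique (hχ : χ = 0 ∨ χ = 1 ∨ χ = -1) (hP : χ = 1 → P.Admissible)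
    (C : ConePolygon P.vA P.vB P.coneK P.coneI c) {x x' y : Chord P} (hx : x ∉ Delta P)
    (hx' : x' ∉ Delta P) (hy : y ∉ Delta P) (h : IsNext x y) (h' : IsNext x' y) : x = x' := by
  have := next_unique hχ hP C (h.rev hχ hP C hx hy) (h'.rev hχ hP C hx' hy)
  rw [← rev_rev x, this, rev_rev]

namespace FaceChart

variable {o o' : openFaces (Delta P) → Fin P.n × Bool} {f : openFaces (Delta P) → V3}

theorem mem_iff (H : FaceChart P o o' f) (C : ConePolygon P.vA P.vB P.coneK P.coneI c)
    {F : openFaces (Delta P)} {x : Chord P} : x ∈ (F : Set (Chord P)) ↔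
      Runs (o F) (o' F) x ∧ x.ray ∈ openCell (cons P.vA P.vB (o F) (o' F) (f F)) := by
  rw [H.eq_face F, mem_face_iff C]

theorem notMem_delta (H : FaceChart P o o' f) (C : ConePolygon P.vA P.vB P.coneK P.coneI c)
    {F : openFaces (Delta P)} {x : Chord P} (hx : x ∈ (F : Set (Chord P))) : x ∉ Delta P :=
  ((H.mem_iff C).1 hx).1.notMem_delta C

theorem exists_mem {x : Chord P} (hx : x ∉ Delta P) : ∃ F : openFaces (Delta P),
    x ∈ (F : Set (Chord P)) :=
  ⟨⟨_, x, hx, rfl⟩, mem_connectedComponentIn hx⟩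

theorem eq_component {F : openFaces (Delta P)} {x : Chord P} (hx : x ∈ (F : Set (Chord P))) :
    connectedComponentIn (Delta P)ᶜ x = F := by
  obtain ⟨F, z, hz, rfl⟩ := F
  exact (connectedComponentIn_eq hx).symm

theorem face_unique {F F' : openFaces (Delta P)} {x : Chord P} (hx : x ∈ (F : Set (Chord P)))
    (hx' : x ∈ (F' : Set (Chord P))) : F = F' :=
  Subtype.ext ((eq_component hx).symm.trans (eq_component hx'))

theorem exists_chord (H : FaceChart P o o' f) (C : ConePolygon P.vA P.vB P.coneK P.coneI c)
    {F : openFaces (Delta P)} {l : V3} (hl : l ∈ openCell (cons P.vA P.vB (o F) (o' F) (f F))) :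
    ∃ x : Chord P, x ∈ (F : Set (Chord P)) ∧ x.ray = l := by
  have : l ∈ ray '' (F : Set (Chord P)) := by
    rw [H.eq_face F, ray_image_face C (H.good F)]; exact hl
  exact this

theorem ray_inj (H : FaceChart P o o' f) (C : ConePolygon P.vA P.vB P.coneK P.coneI c)
    {F : openFaces (Delta P)} {x x' : Chord P} (hx : x ∈ (F : Set (Chord P)))
    (hx' : x' ∈ (F : Set (Chord P))) (h : x.ray = x'.ray) : x = x' := by
  obtain ⟨r, hr, e⟩ := (unitize_eq_iff (x.cov_ne_zero C) (x'.cov_ne_zero C)).1 h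
  exact ((H.mem_iff C).1 hx).1.eq ((H.mem_iff C).1 hx').1 hr e

/-- On a pair of faces the billiard map depends only on the common side and the linear reflection;
maximality of the next chord is automatic outside Δ. -/
theorem isNext_iff (H : FaceChart P o o' f) (hχ : χ = 0 ∨ χ = 1 ∨ χ = -1)
    (hP : χ = 1 → P.Admissible) (C : ConePolygon P.vA P.vB P.coneK P.coneI c)
    {F F' : openFaces (Delta P)} {x y : Chord P} (hx : x ∈ (F : Set (Chord P)))
    (hy : y ∈ (F' : Set (Chord P))) : IsNext x y ↔ (o' F).1 = (o F').1 ∧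
      y.ray = unitize (P.sideCovReflection (o' F).1 x.ray) := by
  have hx1 := ((H.mem_iff C).1 hx).1
  have hy1 := ((H.mem_iff C).1 hy).1
  have hne : P.sideCovReflection (o' F).1 x.cov ≠ 0 := by
    intro h
    apply x.cov_ne_zero C
    rw [← sideCovReflection_involutive hχ (o' F).1 x.cov, h, map_zero]
  obtain ⟨q, hq, e⟩ := exists_unitize_eq (x.cov_ne_zero C)
  rw [ray_eq x, e, map_smul, unitize_smul hq, ray_eq y, unitize_eq_iff (y.cov_ne_zero C) hne,
    Chord.isNext_iff hχ hP C (H.notMem_delta C hy)]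
  constructor
  · rintro ⟨i, h1, h2, h3⟩
    obtain rfl := C.eq_of_inSideInt h1 hx1.inSideInt_e.inSide
    exact ⟨C.eq_of_inSideInt h2 hy1.inSideInt_b.inSide, h3⟩
  · rintro ⟨h1, h2⟩
    exact ⟨_, hx1.inSideInt_e, h1 ▸ hy1.inSideInt_b, h2⟩

end FaceChart

end Chord

/-! ### The faces of `Γ` -/

open ConePolygon

/-- Induction over the circles to be avoided: each one is left by a small move that keeps the
finitely many conditions already achieved. -/
theorem exists_generic_mem_openCell {S G : Set V3} (hfin : S.Finite) (hS : S.Nonempty)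
    (hne : (openCell S).Nonempty) (hG : G.Finite) (h0 : (0 : V3) ∉ G) {l : V3}
    (hl : l ∈ closedCell S) {U : Set V3} (hU : U ∈ 𝓝 l) :
    ∃ m ∈ openCell S, m ∈ U ∧ ∀ g ∈ G, g ⬝ᵥ m ≠ 0 := by
  induction G, hG using Set.Finite.induction_on generalizing U with
  | empty =>
    rw [← closure_openCell hS hne] at hl
    obtain ⟨m, hm, hm'⟩ := mem_closure_iff_nhds.1 hl U hU
    exact ⟨m, hm', hm, fun _ h => h.elim⟩
  | @insert g G hg hG ih =>
    obtain ⟨U', hUU, hUo, hlU⟩ := mem_nhds_iff.1 hU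
    obtain ⟨m, hm, hmU, hmG⟩ := ih (U := U') (fun h => h0 (mem_insert_of_mem _ h)) (hUo.mem_nhds hlU)
    have hev : ∀ᶠ z in 𝓝 m, ∀ g' ∈ G, g' ⬝ᵥ z ≠ 0 := by
      rw [Filter.eventually_all_finite hG]
      intro g' hg'
      have hc : Continuous fun z : V3 => g' ⬝ᵥ z := by fun_prop
      exact hc.continuousAt.eventually_ne (hmG g' hg')
    obtain ⟨z, hz, hzU, hgz⟩ := exists_mem_openCell_off_circle hfin hS hne
      ⟨hm.1, fun s hs => (hm.2 s hs).le⟩ (fun h => h0 (h ▸ mem_insert _ _))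
      (Filter.inter_mem (hUo.mem_nhds hmU) hev)
    exact ⟨z, hz, hUU hzU.1, forall_mem_insert.2 ⟨hgz, hzU.2⟩⟩

/-- A finite union of closed cells is closed, so it is enough to cover the generic points, which are
dense. -/
theorem exists_mem_closedCell_of_generic {κ : Type} [Finite κ] {S G : Set V3} {T : κ → Set V3}
    {p : κ → Prop} (hfin : S.Finite) (hS : S.Nonempty) (hne : (openCell S).Nonempty)
    (hG : G.Finite) (h0 : (0 : V3) ∉ G)
    (h : ∀ m ∈ openCell S, (∀ g ∈ G, g ⬝ᵥ m ≠ 0) → ∃ k, p k ∧ m ∈ openCell (T k)) {l : V3}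
    (hl : l ∈ closedCell S) : ∃ k, p k ∧ l ∈ closedCell (T k) := by
  by_contra hcon
  have hcl : IsClosed (⋃ k : {k // p k}, closedCell (T k)) :=
    isClosed_iUnion_of_finite fun k => isClosed_closedCell _
  have hU : (⋃ k : {k // p k}, closedCell (T k))ᶜ ∈ 𝓝 l := by
    refine hcl.isOpen_compl.mem_nhds fun hl' => ?_
    obtain ⟨k, hk⟩ := mem_iUnion.1 hl'
    exact hcon ⟨k, k.2, hk⟩
  obtain ⟨m, hm, hmU, hmG⟩ := exists_generic_mem_openCell hfin hS hne hG h0 hl hU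
  obtain ⟨k, hk, hmk⟩ := h m hm hmG
  exact hmU (mem_iUnion.2 ⟨⟨k, hk⟩, hmk.1, fun s hs => (hmk.2 s hs).le⟩)

namespace GeoPolygon

variable {χ : ℝ} {P : GeoPolygon χ} {c : V3}

theorem sideReflection_neg (i : Fin P.n) (v : V3) :
    P.sideReflection i (-v) = -P.sideReflection i v := by
  simp only [sideReflection, geoReflection, dotProduct_neg, mul_neg, neg_div, neg_smul]
  abel

/-- The corners, as great circles of lines, with both orientations. -/
def cornerCircles (P : GeoPolygon χ) : Set V3 :=
  {v | v ∈ cornerSet P.vA P.vB ∨ -v ∈ cornerSet P.vA P.vB}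

/-- The great circles that bound the faces of `Γ`. -/
def arrangement (P : GeoPolygon χ) : Set V3 :=
  P.cornerCircles ∪ ⋃ i, P.sideReflection i '' P.cornerCircles

theorem neg_mem_cornerCircles {v : V3} (h : v ∈ P.cornerCircles) : -v ∈ P.cornerCircles :=
  h.elim (fun h => Or.inr (by rwa [neg_neg])) Or.inl

theorem finite_cornerCircles : P.cornerCircles.Finite :=
  (finite_cornerSet (A := P.vA) (B := P.vB)).union
    ((finite_cornerSet (A := P.vA) (B := P.vB)).preimage neg_injective.injOn)

theorem finite_arrangement : P.arrangement.Finite :=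
  finite_cornerCircles.union (finite_iUnion fun _ => finite_cornerCircles.image _)

theorem ne_zero_of_mem_cornerCircles (C : ConePolygon P.vA P.vB P.coneK P.coneI c) {v : V3}
    (h : v ∈ P.cornerCircles) : v ≠ 0 := by
  rcases h with h | h
  · exact C.ne_zero (C.corner_mem h)
  · exact neg_ne_zero.1 (C.ne_zero (C.corner_mem h))

theorem sideReflection_ne_zero (hχ : χ = 0 ∨ χ = 1 ∨ χ = -1) (i : Fin P.n) {v : V3} (h : v ≠ 0) :
    P.sideReflection i v ≠ 0 :=
  geoReflection_ne_zero (P.normalVec_sideCov_ne hχ i) h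

theorem zero_notMem_arrangement (hχ : χ = 0 ∨ χ = 1 ∨ χ = -1)
    (C : ConePolygon P.vA P.vB P.coneK P.coneI c) : (0 : V3) ∉ P.arrangement := by
  rintro (h | h)
  · exact ne_zero_of_mem_cornerCircles C h rfl
  · obtain ⟨i, v, hv, e⟩ := mem_iUnion.1 h
    exact sideReflection_ne_zero hχ i (ne_zero_of_mem_cornerCircles C hv) e

/-- The covectors of `A`, and those of `B` reflected about a side. -/
def reflectedUnion (P : GeoPolygon χ) (i : Fin P.n) (A B : Set V3) : Set V3 :=
  A ∪ (fun s => -P.sideReflection i s) '' B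

theorem reflectedUnion_subset {i : Fin P.n} {A B : Set V3} (hA : A ⊆ P.cornerCircles)
    (hB : B ⊆ P.cornerCircles) : P.reflectedUnion i A B ⊆ P.arrangement := by
  rintro _ (h | ⟨s, hs, rfl⟩)
  · exact Or.inl (hA h)
  · refine Or.inr (mem_iUnion.2 ⟨i, -s, neg_mem_cornerCircles (hB hs), sideReflection_neg i s⟩)

theorem pos_reflectedUnion_iff {i : Fin P.n} {A B : Set V3} {v : V3} :
    (∀ s ∈ P.reflectedUnion i A B, 0 < s ⬝ᵥ v) ↔
      (∀ s ∈ A, 0 < s ⬝ᵥ v) ∧ ∀ s ∈ B, 0 < s ⬝ᵥ P.sideCovReflection i v := by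
  simp only [reflectedUnion, mem_union, or_imp, forall_and, forall_mem_image,
    dot_sideCovReflection]

theorem nonneg_reflectedUnion_iff {i : Fin P.n} {A B : Set V3} {v : V3} :
    (∀ s ∈ P.reflectedUnion i A B, 0 ≤ s ⬝ᵥ v) ↔
      (∀ s ∈ A, 0 ≤ s ⬝ᵥ v) ∧ ∀ s ∈ B, 0 ≤ s ⬝ᵥ P.sideCovReflection i v := by
  simp only [reflectedUnion, mem_union, or_imp, forall_and, forall_mem_image,
    dot_sideCovReflection]

theorem sideCovReflection_ne_zero (hχ : χ = 0 ∨ χ = 1 ∨ χ = -1) (i : Fin P.n) {v : V3}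
    (h : v ≠ 0) : P.sideCovReflection i v ≠ 0 := fun h' => h (by
  rw [← sideCovReflection_involutive hχ i v, h', map_zero])

theorem unitize_sideCovReflection_unitize (hχ : χ = 0 ∨ χ = 1 ∨ χ = -1) (i : Fin P.n) {v : V3}
    (h : v ⬝ᵥ v = 1) :
    unitize (P.sideCovReflection i (unitize (P.sideCovReflection i v))) = v := by
  obtain ⟨q, hq, e⟩ := exists_unitize_eq (sideCovReflection_ne_zero hχ i (ne_zero_of_unit h))
  rw [e, map_smul, sideCovReflection_involutive hχ, unitize_smul hq, unitize_of_unit h]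

end GeoPolygon

namespace Chord

open GeoPolygon

variable {χ : ℝ} {P : GeoPolygon χ} {c : V3}

/-- The covectors that cut out a face of `Δ`. -/
abbrev faceCons (o o' : openFaces (Delta P) → Fin P.n × Bool) (f : openFaces (Delta P) → V3)
    (F : openFaces (Delta P)) : Set V3 := cons P.vA P.vB (o F) (o' F) (f F)

/-- The covectors that cut out the chords of `F` which the billiard map sends to `F'`. -/
def sourceCons (o o' : openFaces (Delta P) → Fin P.n × Bool) (f : openFaces (Delta P) → V3)
    (k : openFaces (Delta P) × openFaces (Delta P)) : Set V3 :=
  P.reflectedUnion (o' k.1).1 (faceCons o o' f k.1) (faceCons o o' f k.2)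

/-- The covectors that cut out the chords of `F'` which come from `F`. -/
def targetCons (o o' : openFaces (Delta P) → Fin P.n × Bool) (f : openFaces (Delta P) → V3)
    (k : openFaces (Delta P) × openFaces (Delta P)) : Set V3 :=
  P.reflectedUnion (o' k.1).1 (faceCons o o' f k.2) (faceCons o o' f k.1)

/-- The pairs of faces of `Δ` such that the billiard map sends chords of the first to the second. -/
abbrev Transition (o o' : openFaces (Delta P) → Fin P.n × Bool) (f : openFaces (Delta P) → V3) :
    Type :=
  {k : openFaces (Delta P) × openFaces (Delta P) //
    (o' k.1).1 = (o k.2).1 ∧ (openCell (sourceCons o o' f k)).Nonempty}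

namespace FaceChart

variable {o o' : openFaces (Delta P) → Fin P.n × Bool} {f : openFaces (Delta P) → V3}

theorem nonempty_faceCell (H : FaceChart P o o' f) (F : openFaces (Delta P)) :
    (openCell (faceCons o o' f F)).Nonempty :=
  ⟨_, unitize_mem_openCell (ne_zero_of_dot_pos (c := hd P.vA P.vB (o F))
    (by rw [dotProduct_comm]; exact (H.good F).left.2)) (H.good F).pos_cons_self⟩

/-- For lines that avoid the reflected corners, the next chord is outside Δ and therefore belongs to
some face. -/
theorem exists_next_mem (H : FaceChart P o o' f) (hχ : χ = 0 ∨ χ = 1 ∨ χ = -1)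
    (hP : χ = 1 → P.Admissible) (C : ConePolygon P.vA P.vB P.coneK P.coneI c)
    {F : openFaces (Delta P)} {x : Chord P} (hx : x ∈ (F : Set (Chord P)))
    (hg : ∀ w ∈ cornerSet P.vA P.vB, P.sideReflection (o' F).1 w ⬝ᵥ x.ray ≠ 0) :
    ∃ F' : openFaces (Delta P), ∃ y ∈ (F' : Set (Chord P)), IsNext x y := by
  obtain ⟨y, hy, -⟩ := existsUnique_next hχ hP C fun h => H.notMem_delta C hx (Or.inl (Or.inl h))
  have hyd : y ∉ Delta P := by
    refine hy.notMem_delta hχ C ((H.mem_iff C).1 hx).1.inSideInt_e fun w hw h0 => hg w hw ?_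
    obtain ⟨q, hq, e⟩ := exists_unitize_eq (x.cov_ne_zero C)
    rw [ray_eq, e, dotProduct_smul, h0, smul_zero]
  obtain ⟨F', hF'⟩ := exists_mem hyd
  exact ⟨F', y, hF', hy⟩

/-- The previous chord is found by applying the billiard map to the reversed chord and reversing the
result. -/
theorem exists_prev_mem (H : FaceChart P o o' f) (hχ : χ = 0 ∨ χ = 1 ∨ χ = -1)
    (hP : χ = 1 → P.Admissible) (C : ConePolygon P.vA P.vB P.coneK P.coneI c)
    {F : openFaces (Delta P)} {y : Chord P} (hy : y ∈ (F : Set (Chord P)))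
    (hg : ∀ w ∈ cornerSet P.vA P.vB, P.sideReflection (o F).1 w ⬝ᵥ y.ray ≠ 0) :
    ∃ F' : openFaces (Delta P), ∃ x ∈ (F' : Set (Chord P)), IsNext x y := by
  have hyd := H.notMem_delta C hy
  obtain ⟨z, hz, -⟩ := existsUnique_next (x := y.rev) hχ hP C fun h =>
    rev_notMem_delta hyd (Or.inl (Or.inl h))
  have hzd : z ∉ Delta P := by
    refine IsNext.notMem_delta (x := y.rev) hχ C (i := (o F).1) ((H.mem_iff C).1 hy).1.inSideInt_b hz
      fun w hw h0 => hg w hw ?_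
    rw [cov_rev, dotProduct_neg, neg_eq_zero] at h0
    obtain ⟨q, hq, e⟩ := exists_unitize_eq (y.cov_ne_zero C)
    rw [ray_eq, e, dotProduct_smul, h0, smul_zero]
  obtain ⟨F', hF'⟩ := exists_mem (rev_notMem_delta hzd)
  exact ⟨F', z.rev, hF', hz.rev hχ hP C (rev_notMem_delta hyd) hzd⟩

theorem ray_mem_of_isNext (H : FaceChart P o o' f) (hχ : χ = 0 ∨ χ = 1 ∨ χ = -1)
    (hP : χ = 1 → P.Admissible) (C : ConePolygon P.vA P.vB P.coneK P.coneI c)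
    {F F' : openFaces (Delta P)} {x y : Chord P} (hx : x ∈ (F : Set (Chord P)))
    (hy : y ∈ (F' : Set (Chord P))) (h : IsNext x y) : (o' F).1 = (o F').1 ∧
      x.ray ∈ openCell (sourceCons o o' f (F, F')) ∧
      y.ray ∈ openCell (targetCons o o' f (F, F')) := by
  obtain ⟨h1, h2⟩ := (H.isNext_iff hχ hP C hx hy).1 h
  have hx1 := ((H.mem_iff C).1 hx).2
  have hy1 := ((H.mem_iff C).1 hy).2
  have hne := sideCovReflection_ne_zero hχ (o' F).1 (ne_zero_of_unit hx1.1)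
  have hne' := sideCovReflection_ne_zero hχ (o' F).1 (ne_zero_of_unit hy1.1)
  refine ⟨h1, ⟨hx1.1, pos_reflectedUnion_iff.2 ⟨hx1.2, fun s hs => ?_⟩⟩,
    hy1.1, pos_reflectedUnion_iff.2 ⟨hy1.2, fun s hs => ?_⟩⟩
  · rw [← dot_unitize_pos_iff hne, ← h2]; exact hy1.2 s hs
  · rw [← dot_unitize_pos_iff hne']
    rw [h2, unitize_sideCovReflection_unitize hχ _ hx1.1]
    exact hx1.2 s hs

theorem exists_next_of_source (H : FaceChart P o o' f) (hχ : χ = 0 ∨ χ = 1 ∨ χ = -1)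
    (hP : χ = 1 → P.Admissible) (C : ConePolygon P.vA P.vB P.coneK P.coneI c)
    {k : openFaces (Delta P) × openFaces (Delta P)} (hk : (o' k.1).1 = (o k.2).1) {l : V3}
    (hl : l ∈ openCell (sourceCons o o' f k)) :
    ∃ x ∈ (k.1 : Set (Chord P)), ∃ y ∈ (k.2 : Set (Chord P)), x.ray = l ∧
      y.ray = unitize (P.sideCovReflection (o' k.1).1 l) ∧ IsNext x y := by
  obtain ⟨h1, h2⟩ := pos_reflectedUnion_iff.1 hl.2
  obtain ⟨x, hx, rfl⟩ := H.exists_chord C ⟨hl.1, h1⟩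
  obtain ⟨y, hy, e⟩ := H.exists_chord C (unitize_mem_openCell
    (sideCovReflection_ne_zero hχ (o' k.1).1 (ne_zero_of_unit hl.1)) h2)
  exact ⟨x, hx, y, hy, rfl, e, (H.isNext_iff hχ hP C hx hy).2 ⟨hk, e⟩⟩

theorem exists_next_of_target (H : FaceChart P o o' f) (hχ : χ = 0 ∨ χ = 1 ∨ χ = -1)
    (hP : χ = 1 → P.Admissible) (C : ConePolygon P.vA P.vB P.coneK P.coneI c)
    {k : openFaces (Delta P) × openFaces (Delta P)} (hk : (o' k.1).1 = (o k.2).1) {l : V3}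
    (hl : l ∈ openCell (targetCons o o' f k)) :
    ∃ x ∈ (k.1 : Set (Chord P)), ∃ y ∈ (k.2 : Set (Chord P)), y.ray = l ∧ IsNext x y := by
  obtain ⟨h1, h2⟩ := pos_reflectedUnion_iff.1 hl.2
  obtain ⟨y, hy, rfl⟩ := H.exists_chord C ⟨hl.1, h1⟩
  obtain ⟨x, hx, e⟩ := H.exists_chord C (unitize_mem_openCell
    (sideCovReflection_ne_zero hχ (o' k.1).1 (ne_zero_of_unit hl.1)) h2)
  refine ⟨x, hx, y, hy, rfl, (H.isNext_iff hχ hP C hx hy).2 ⟨hk, ?_⟩⟩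
  rw [e, unitize_sideCovReflection_unitize hχ _ hl.1]

/-- Source and target cells impose the same two families of conditions, one on the line and one on
its reflection; the linear involution exchanges the two. -/
theorem linearMatching (hχ : χ = 0 ∨ χ = 1 ∨ χ = -1) :
    CellGluing.LinearMatching (fun k : Transition o o' f => sourceCons o o' f k.1)
      (fun k => targetCons o o' f k.1) (fun k => P.sideCovReflection (o' k.1.1).1)
      (fun k => P.sideCovReflection (o' k.1.1).1) where
  left_inv k v := sideCovReflection_involutive hχ _ v
  right_inv k v := sideCovReflection_involutive hχ _ v
  pos_iff k v := by
    rw [sourceCons, targetCons, pos_reflectedUnion_iff, pos_reflectedUnion_iff,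
      sideCovReflection_involutive hχ, and_comm]
  nonneg_iff k v := by
    rw [sourceCons, targetCons, nonneg_reflectedUnion_iff, nonneg_reflectedUnion_iff,
      sideCovReflection_involutive hχ, and_comm]

theorem finite_transition (hχ : χ = 0 ∨ χ = 1 ∨ χ = -1)
    (C : ConePolygon P.vA P.vB P.coneK P.coneI c) : Finite (Transition o o' f) := by
  have := (finite_openFaces_delta hχ C).to_subtype
  infer_instance

/-- The pieces of a face are disjoint because the next chord is unique, and they cover because the
lines with a next chord in Δ lie on finitely many circles. -/
theorem subdivision_source (H : FaceChart P o o' f) (hχ : χ = 0 ∨ χ = 1 ∨ χ = -1)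
    (hP : χ = 1 → P.Admissible) (C : ConePolygon P.vA P.vB P.coneK P.coneI c) :
    CellGluing.Subdivision (faceCons o o' f) P.arrangement
      (fun k : Transition o o' f => k.1.1) (fun k => sourceCons o o' f k.1) where
  finite_index := finite_transition hχ C
  superset k := subset_union_left
  subset k := reflectedUnion_subset (cons_subset _ _ _) (cons_subset _ _ _)
  nonempty k := k.2.2
  disjoint := by
    rintro ⟨⟨F, F₁⟩, hk, hn⟩ ⟨⟨F', F₂⟩, hk', hn'⟩ hne (rfl : F = F')
    refine Set.disjoint_left.2 fun l hl hl' => hne ?_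
    obtain ⟨x, hx, y, hy, e, -, h⟩ := H.exists_next_of_source hχ hP C hk hl
    obtain ⟨x', hx', y', hy', e', -, h'⟩ := H.exists_next_of_source hχ hP C hk' hl'
    obtain rfl := H.ray_inj C hx hx' (e.trans e'.symm)
    obtain rfl := next_unique hχ hP C h h'
    obtain rfl : F₁ = F₂ := face_unique hy hy'
    rfl
  cover F l hl := by
    have := finite_transition (o := o) (o' := o') (f := f) hχ C
    refine exists_mem_closedCell_of_generic (finite_cons _ _ _) (H.good F).salient_cons.nonempty
      (H.nonempty_faceCell F) ((finite_cornerSet (A := P.vA) (B := P.vB)).image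
        (P.sideReflection (o' F).1)) ?_ ?_ hl
    · rintro ⟨w, hw, e⟩
      exact sideReflection_ne_zero hχ _ (C.ne_zero (C.corner_mem hw)) e
    · intro m hm hg
      obtain ⟨x, hx, rfl⟩ := H.exists_chord C hm
      obtain ⟨F', y, hy, h⟩ := H.exists_next_mem hχ hP C hx
        fun w hw => hg _ (mem_image_of_mem _ hw)
      obtain ⟨h1, h2, -⟩ := H.ray_mem_of_isNext hχ hP C hx hy h
      exact ⟨⟨(F, F'), h1, _, h2⟩, rfl, h2⟩

/-- The mirror image of the source subdivision: disjointness comes from uniqueness of the previous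
chord, and covering from its existence for generic lines. -/
theorem subdivision_target (H : FaceChart P o o' f) (hχ : χ = 0 ∨ χ = 1 ∨ χ = -1)
    (hP : χ = 1 → P.Admissible) (C : ConePolygon P.vA P.vB P.coneK P.coneI c) :
    CellGluing.Subdivision (faceCons o o' f) P.arrangement
      (fun k : Transition o o' f => k.1.2) (fun k => targetCons o o' f k.1) where
  finite_index := finite_transition hχ C
  superset k := subset_union_left
  subset k := reflectedUnion_subset (cons_subset _ _ _) (cons_subset _ _ _)
  nonempty k := by
    obtain ⟨l, hl⟩ := k.2.2
    obtain ⟨x, hx, y, hy, -, -, h⟩ := H.exists_next_of_source hχ hP C k.2.1 hl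
    exact ⟨_, (H.ray_mem_of_isNext hχ hP C hx hy h).2.2⟩
  disjoint := by
    rintro ⟨⟨F₁, F⟩, hk, hn⟩ ⟨⟨F₂, F'⟩, hk', hn'⟩ hne (rfl : F = F')
    refine Set.disjoint_left.2 fun l hl hl' => hne ?_
    obtain ⟨x, hx, y, hy, e, h⟩ := H.exists_next_of_target hχ hP C hk hl
    obtain ⟨x', hx', y', hy', e', h'⟩ := H.exists_next_of_target hχ hP C hk' hl'
    obtain rfl := H.ray_inj C hy hy' (e.trans e'.symm)
    obtain rfl := prev_unique hχ hP C (H.notMem_delta C hx) (H.notMem_delta C hx')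
      (H.notMem_delta C hy) h h'
    obtain rfl : F₁ = F₂ := face_unique hx hx'
    rfl
  cover F l hl := by
    have := finite_transition (o := o) (o' := o') (f := f) hχ C
    refine exists_mem_closedCell_of_generic (finite_cons _ _ _) (H.good F).salient_cons.nonempty
      (H.nonempty_faceCell F) ((finite_cornerSet (A := P.vA) (B := P.vB)).image
        (P.sideReflection (o F).1)) ?_ ?_ hl
    · rintro ⟨w, hw, e⟩
      exact sideReflection_ne_zero hχ _ (C.ne_zero (C.corner_mem hw)) e
    · intro m hm hg
      obtain ⟨y, hy, rfl⟩ := H.exists_chord C hm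
      obtain ⟨F', x, hx, h⟩ := H.exists_prev_mem hχ hP C hy
        fun w hw => hg _ (mem_image_of_mem _ hw)
      obtain ⟨h1, h2, h3⟩ := H.ray_mem_of_isNext hχ hP C hx hy h
      exact ⟨⟨(F', F), h1, _, h2⟩, rfl, h3⟩

end FaceChart

end Chord

/-! ### The billiard map on the phase space -/

open ConePolygon

namespace PhaseSpace

open GeoPolygon Chord

variable {χ : ℝ} {P : GeoPolygon χ} {c : V3}
variable {o o' : openFaces (Delta P) → Fin P.n × Bool} {f : openFaces (Delta P) → V3}

theorem cellGluing (H : FaceChart P o o' f) (hχ : χ = 0 ∨ χ = 1 ∨ χ = -1)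
    (C : ConePolygon P.vA P.vB P.coneK P.coneI c) :
    CellGluing (faceCons o o' f)
      (fun F : openFaces (Delta P) => closure (ray '' (F : Set (Chord P)))) (Glued P) P.arrangement
      (line P) :=
  Chord.cellGluing hχ C H finite_arrangement (zero_notMem_arrangement hχ C)
    fun w hw => ⟨Or.inl (Or.inl hw), Or.inl (Or.inr (by rwa [neg_neg]))⟩

/-- The phase point of a ray in a closed face of `Δ`. -/
abbrev facePt (F : openFaces (Delta P)) (l : V3) (h : l ∈ closure (ray '' (F : Set (Chord P)))) :
    PhaseSpace P :=
  CellGluing.pt (D := fun F : openFaces (Delta P) => closure (ray '' (F : Set (Chord P))))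
    (Glued P) F l h

theorem ray_mem_closure {F : openFaces (Delta P)} {x : Chord P} (hx : x ∈ (F : Set (Chord P))) :
    x.ray ∈ closure (ray '' (F : Set (Chord P))) := subset_closure (mem_image_of_mem _ hx)

theorem ofChord_eq {F : openFaces (Delta P)} (x : {x : Chord P // x ∉ Delta P})
    (hx : x.1 ∈ (F : Set (Chord P))) : ofChord P x = facePt F x.1.ray (ray_mem_closure hx) :=
  CellGluing.pt_congr (Subtype.ext (FaceChart.eq_component hx)) rfl _ _

theorem ofChord_injective (H : FaceChart P o o' f) (hχ : χ = 0 ∨ χ = 1 ∨ χ = -1)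
    (C : ConePolygon P.vA P.vB P.coneK P.coneI c) : Function.Injective (ofChord P) := by
  intro x y h
  obtain ⟨F, hx⟩ := FaceChart.exists_mem x.2
  obtain ⟨F', hy⟩ := FaceChart.exists_mem y.2
  rw [ofChord_eq x hx, ofChord_eq y hy] at h
  have hr : x.1.ray = y.1.ray := congrArg (line P) h
  have hF : F = F' := (cellGluing H hχ C).eq_of_mem_openCell ((H.mem_iff C).1 hx).2
    (hj := hr ▸ ray_mem_closure hy) (h.trans (CellGluing.pt_congr rfl hr.symm _ _))
  subst hF
  exact Subtype.ext (H.ray_inj C hx hy hr)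

theorem continuous_ofChord (H : FaceChart P o o' f) (hχ : χ = 0 ∨ χ = 1 ∨ χ = -1)
    (C : ConePolygon P.vA P.vB P.coneK P.coneI c) : Continuous (ofChord P) := by
  refine continuous_iff_continuousAt.2 fun x U hU => ?_
  obtain ⟨F, hx⟩ := FaceChart.exists_mem x.2
  rw [ofChord_eq x hx] at hU
  have h := ((cellGluing H hχ C).mem_nhds_iff (ray_mem_closure hx)).1 hU F (ray_mem_closure hx) rfl
  have hF : IsOpen (F : Set (Chord P)) := by rw [H.eq_face F]; exact isOpen_face C (H.good F)
  have h1 : ∀ᶠ z : {x : Chord P // x ∉ Delta P} in 𝓝 x, z.1 ∈ (F : Set (Chord P)) :=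
    continuous_subtype_val.continuousAt.eventually (hF.mem_nhds hx)
  have h2 := ((continuous_ray C).comp continuous_subtype_val).continuousAt.eventually h
  refine Filter.mem_map.2 ?_
  filter_upwards [h1, h2] with z hz hz'
  show ofChord P z ∈ U
  rw [ofChord_eq z hz]
  exact hz' (ray_mem_closure hz)

/-- At an interior point of a face only that face contributes to neighbourhoods, and there `ofGood`
inverts the developing map continuously. -/
theorem isOpenMap_ofChord (H : FaceChart P o o' f) (hχ : χ = 0 ∨ χ = 1 ∨ χ = -1)
    (C : ConePolygon P.vA P.vB P.coneK P.coneI c) : IsOpenMap (ofChord P) := by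
  refine isOpenMap_iff_nhds_le.2 fun x U hU => ?_
  obtain ⟨F, hx⟩ := FaceChart.exists_mem x.2
  obtain ⟨hrun, hcell⟩ := (H.mem_iff C).1 hx
  rw [ofChord_eq x hx]
  refine ((cellGluing H hχ C).mem_nhds_iff (ray_mem_closure hx)).2 fun k hl hk => ?_
  obtain rfl := (cellGluing H hχ C).eq_of_mem_openCell hcell hk.symm
  have hgood : Good P.vA P.vB P.coneI (o F) (o' F) x.1.ray := (H.good F).of_pos_cons C hcell.2
  have hx0 : ofGood C (o F) (o' F) ⟨_, hgood⟩ = x.1 := by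
    have e : (ofGood C (o F) (o' F) ⟨_, hgood⟩).ray = x.1.ray :=
      (ray_ofGood C _).trans (unitize_of_unit hcell.1)
    obtain ⟨r, hr, e'⟩ := (unitize_eq_iff (cov_ne_zero C _) (cov_ne_zero C _)).1 e
    exact (runs_ofGood C _).eq hrun hr e'
  obtain ⟨U', hU', hsub⟩ := mem_nhds_subtype _ _ _ |>.1 hU
  have hev := (continuous_ofGood C (o F) (o' F)).continuousAt.eventually (hx0.symm ▸ hU')
  rw [← (isOpen_good C (o F) (o' F)).isOpenEmbedding_subtypeVal.map_nhds_eq ⟨_, hgood⟩,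
    Filter.eventually_map]
  have hpos := (continuous_subtype_val (p := fun g => Good P.vA P.vB P.coneI (o F) (o' F) g)
    |>.continuousAt (x := ⟨x.1.ray, hgood⟩)).eventually
    (eventually_pos (finite_cons (o F) (o' F) (f F)) x.1.ray)
  filter_upwards [hev, hpos] with m hm hm' hmD
  have hu : m.1 ⬝ᵥ m.1 = 1 := (cellGluing H hχ C).unit_of_mem hmD
  have hray : (ofGood C (o F) (o' F) m).ray = m.1 := (ray_ofGood C _).trans (unitize_of_unit hu)
  have hmF : ofGood C (o F) (o' F) m ∈ (F : Set (Chord P)) := (H.mem_iff C).2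
    ⟨runs_ofGood C m, hray.symm ▸ ⟨hu, fun s hs => hm' s hs (hcell.2 s hs)⟩⟩
  have h := hsub (a := ⟨_, H.notMem_delta C hmF⟩) hm
  rw [mem_preimage, ofChord_eq ⟨_, H.notMem_delta C hmF⟩ hmF] at h
  have e : facePt F _ (ray_mem_closure hmF) = facePt F m.1 hmD :=
    CellGluing.pt_congr rfl hray _ _
  show facePt F m.1 hmD ∈ U
  rwa [← e]

theorem isOpenEmbedding_ofChord (H : FaceChart P o o' f) (hχ : χ = 0 ∨ χ = 1 ∨ χ = -1)
    (C : ConePolygon P.vA P.vB P.coneK P.coneI c) : IsOpenEmbedding (ofChord P) :=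
  .of_continuous_injective_isOpenMap (continuous_ofChord H hχ C) (ofChord_injective H hχ C)
    (isOpenMap_ofChord H hχ C)

theorem denseRange_ofChord (H : FaceChart P o o' f) (hχ : χ = 0 ∨ χ = 1 ∨ χ = -1)
    (C : ConePolygon P.vA P.vB P.coneK P.coneI c) : DenseRange (ofChord P) := by
  intro ξ
  obtain ⟨F, l, hl, rfl⟩ := CellGluing.exists_pt ξ
  refine mem_closure_iff_nhds.2 fun U hU => ?_
  have h := ((cellGluing H hχ C).mem_nhds_iff hl).1 hU F hl rfl
  obtain ⟨_, hm, x, hx, rfl⟩ := mem_closure_iff_nhds.1 hl _ h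
  have hx' := H.notMem_delta C hx
  refine ⟨ofChord P ⟨x, hx'⟩, ?_, mem_range_self _⟩
  rw [ofChord_eq ⟨x, hx'⟩ hx]
  exact hm _

/-- A next chord never begins at a corner, so for chords outside Δ belonging to Γ means exactly that
the next chord is in Δ. Hence the complement of Γ consists of the chords that pass from one face of
Δ to another or the same face, which are the open source cells. -/
theorem gamma_eq_skeleton (H : FaceChart P o o' f) (hχ : χ = 0 ∨ χ = 1 ∨ χ = -1)
    (hP : χ = 1 → P.Admissible) (C : ConePolygon P.vA P.vB P.coneK P.coneI c) :
    Gamma P = CellGluing.skeleton (Glued P) (fun k : Transition o o' f => k.1.1)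
      (fun k => sourceCons o o' f k.1) := by
  ext ξ
  refine not_congr ?_
  refine Iff.trans ?_ mem_iUnion.symm
  constructor
  · rintro ⟨x, hxG, rfl⟩
    obtain ⟨F, hx⟩ := FaceChart.exists_mem x.2
    obtain ⟨y, hy, -⟩ := existsUnique_next hχ hP C fun h => x.2 (Or.inl (Or.inl h))
    have hyd : y ∉ Delta P := fun h => hxG (Or.inr ⟨y, hy, h, hy.notMem_deltaMinus⟩)
    obtain ⟨F', hF'⟩ := FaceChart.exists_mem hyd
    obtain ⟨h1, h2, -⟩ := H.ray_mem_of_isNext hχ hP C hx hF' hy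
    exact ⟨⟨(F, F'), h1, _, h2⟩, _, ray_mem_closure hx, h2, (ofChord_eq x hx).symm⟩
  · rintro ⟨k, l, hl, hlT, rfl⟩
    obtain ⟨x, hx, y, hy, rfl, -, h⟩ := H.exists_next_of_source hχ hP C k.2.1 hlT
    refine ⟨⟨x, H.notMem_delta C hx⟩, ?_, ofChord_eq _ hx⟩
    rintro (h' | ⟨y', h1, h2, -⟩)
    · exact H.notMem_delta C hx h'
    · exact H.notMem_delta C hy (next_unique hχ hP C h h1 ▸ h2)

open Classical in
/-- The billiard map on the phase space; the identity where it is not defined. -/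
def next (P : GeoPolygon χ) (ξ : PhaseSpace P) : PhaseSpace P :=
  if h : ∃ η, IsNext P ξ η then h.choose else ξ

theorem isNext_unique (H : FaceChart P o o' f) (hχ : χ = 0 ∨ χ = 1 ∨ χ = -1)
    (hP : χ = 1 → P.Admissible) (C : ConePolygon P.vA P.vB P.coneK P.coneI c)
    {ξ η η' : PhaseSpace P} (h : IsNext P ξ η) (h' : IsNext P ξ η') : η = η' := by
  obtain ⟨x, y, rfl, rfl, h⟩ := h
  obtain ⟨x', y', e, rfl, h'⟩ := h'
  obtain rfl := ofChord_injective H hχ C e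
  rw [Subtype.ext (next_unique hχ hP C h h')]

theorem eq_next (H : FaceChart P o o' f) (hχ : χ = 0 ∨ χ = 1 ∨ χ = -1)
    (hP : χ = 1 → P.Admissible) (C : ConePolygon P.vA P.vB P.coneK P.coneI c)
    {ξ η : PhaseSpace P} (h : IsNext P ξ η) : η = next P ξ := by
  have h' : ∃ η, IsNext P ξ η := ⟨η, h⟩
  rw [next, dif_pos h']
  exact isNext_unique H hχ hP C h h'.choose_spec

theorem isNext_next {ξ : PhaseSpace P} (h : ∃ η, IsNext P ξ η) : IsNext P ξ (next P ξ) := by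
  rw [next, dif_pos h]
  exact h.choose_spec

theorem exists_isNext (hχ : χ = 0 ∨ χ = 1 ∨ χ = -1) (hP : χ = 1 → P.Admissible)
    (C : ConePolygon P.vA P.vB P.coneK P.coneI c) {ξ : PhaseSpace P} (h : ξ ∉ Gamma P) :
    ∃ η, IsNext P ξ η := by
  obtain ⟨x, hxG, rfl⟩ := not_not.1 h
  obtain ⟨y, hy, -⟩ := existsUnique_next hχ hP C fun h => x.2 (Or.inl (Or.inl h))
  exact ⟨_, x, ⟨y, fun h => hxG (Or.inr ⟨y, hy, h, hy.notMem_deltaMinus⟩)⟩, rfl, rfl, hy⟩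

theorem next_facePt (H : FaceChart P o o' f) (hχ : χ = 0 ∨ χ = 1 ∨ χ = -1)
    (hP : χ = 1 → P.Admissible) (C : ConePolygon P.vA P.vB P.coneK P.coneI c)
    (k : Transition o o' f) (l : V3) (hl : l ∈ closure (ray '' (k.1.1 : Set (Chord P))))
    (h : l ∈ openCell (sourceCons o o' f k.1)) :
    ∃ h', next P (facePt k.1.1 l hl) =
      facePt k.1.2 (unitize (P.sideCovReflection (o' k.1.1).1 l)) h' := by
  obtain ⟨x, hx, y, hy, rfl, e, hxy⟩ := H.exists_next_of_source hχ hP C k.2.1 h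
  refine ⟨e ▸ ray_mem_closure hy, ?_⟩
  have hn : IsNext P (ofChord P ⟨x, H.notMem_delta C hx⟩) (ofChord P ⟨y, H.notMem_delta C hy⟩) :=
    ⟨_, _, rfl, rfl, hxy⟩
  have := eq_next H hχ hP C hn
  rw [ofChord_eq ⟨x, H.notMem_delta C hx⟩ hx, ofChord_eq ⟨y, H.notMem_delta C hy⟩ hy] at this
  rw [← this]
  exact CellGluing.pt_congr rfl e _ _

end PhaseSpace

end

theorem theorem1 (χ : ℝ) (hχ : χ = 0 ∨ χ = 1 ∨ χ = -1) (P : GeoPolygon χ)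
    (hP : χ = 1 → P.Admissible) :
    -- the billiard map is well defined off `Δ₊`
    (∀ x : Chord P, x ∉ Chord.DeltaPlus P → ∃! y : Chord P, Chord.IsNext x y) ∧
    -- `X` is a geodesic surface, containing the chords outside `Δ` as an open dense subspace
    IsGeodesicSurface (PhaseSpace.line P) ∧
    IsOpenEmbedding (PhaseSpace.ofChord P) ∧ DenseRange (PhaseSpace.ofChord P) ∧
    -- `Γ` is a convex geodesic graph
    IsConvexGeodesicGraph (PhaseSpace.line P) (PhaseSpace.Gamma P) ∧
    -- `Tb` is the billiard map on `X \ Γ`; it is continuous on the faces of `Γ`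
    ∃ Tb : PhaseSpace P → PhaseSpace P,
      (∀ ξ, ξ ∉ PhaseSpace.Gamma P → ∀ η, PhaseSpace.IsNext P ξ η ↔ η = Tb ξ) ∧
      (∀ F ∈ openFaces (PhaseSpace.Gamma P), ContinuousOn Tb F) ∧
      -- `T` is the extension by continuity of `Tb` from the open faces to the closed faces
      ∃ T : (F : openFaces (PhaseSpace.Gamma P)) → closure (F : Set (PhaseSpace P)) → PhaseSpace P,
        (∀ T' : (F : openFaces (PhaseSpace.Gamma P)) →
            closure (F : Set (PhaseSpace P)) → PhaseSpace P,
          (∀ F, Continuous (T' F) ∧ ∀ ξ : closure (F : Set (PhaseSpace P)),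
            (ξ : PhaseSpace P) ∈ (F : Set (PhaseSpace P)) → T' F ξ = Tb ξ) ↔ T' = T) ∧
        IsPiecewiseConvexTransformation (PhaseSpace.line P) (PhaseSpace.Gamma P) T ∧
        -- `T` and the billiard map coincide on `X \ Γ`
        ∀ (F : openFaces (PhaseSpace.Gamma P)) (ξ : closure (F : Set (PhaseSpace P))),
          (ξ : PhaseSpace P) ∉ PhaseSpace.Gamma P → T F ξ = Tb ξ := by
  obtain ⟨c, C⟩ := GeoPolygon.exists_conePolygon hχ P hP
  obtain ⟨o, o', f, H⟩ := Chord.exists_faceChart hχ C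
  have G := PhaseSpace.cellGluing H hχ C
  have hK := H.subdivision_source hχ hP C
  have hΓ := PhaseSpace.gamma_eq_skeleton H hχ hP C
  refine ⟨fun x hx => Chord.existsUnique_next hχ hP C hx, G.isGeodesicSurface,
    PhaseSpace.isOpenEmbedding_ofChord H hχ C, PhaseSpace.denseRange_ofChord H hχ C, ?_,
    PhaseSpace.next P, fun ξ hξ η => ⟨PhaseSpace.eq_next H hχ hP C, ?_⟩, ?_⟩
  · rw [hΓ]
    exact G.isConvexGeodesicGraph_skeleton hK
  · rintro rfl
    exact PhaseSpace.isNext_next (PhaseSpace.exists_isNext hχ hP C hξ)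
  · rw [hΓ]
    exact G.exists_piecewiseConvexTransformation hK (H.subdivision_target hχ hP C)
      (Chord.FaceChart.linearMatching hχ) (PhaseSpace.next P) (PhaseSpace.next_facePt H hχ hP C)
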